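/- All graphs are finite and simple, and "contains" means "contains as an induced subgraph". A *pyramid* consists of three pairwise adjacent vertices $b_1,b_2,b_3$, a vertex $a$ adjacent to at most one of them, and three chordless paths $P_i$ from $a$ to $b_i$ ($i=1,2,3$) such that, for $i<j$, $V(P_i)\cap V(P_j)=\{a\}$ and $b_ib_j$ is the only edge between $V(P_i)\setminus\{a\}$ and $V(P_j)\setminus\{a\}$. A subdivision of $K_4$ is *proper* if at least one edge of $K_4$ is replaced by a path of length at least two. Let $F$ be the line graph of a proper subdivision $R$ of $K_4$, where $K_4$ has vertices $a,b,c,d$. For $x\neq y$ in $\{a,b,c,d\}$ the edges of the path of $R$ that replaces the edge $xy$ form a path $R_{xy}=R_{yx}$ of $F$ (a *rung*); the *corner* $v_{xy}$ is the end of $R_{xy}$ whose corresponding edge of $R$ is incident to $x$. A *frame* of $F$ is an $18$-tuple consisting of the twelve corners $v_{xy}$ and of six vertices $m_{xy}=m_{yx}\in R_{xy}$ such that the distances along $R_{xy}$ from $m_{xy}$ to $v_{xy}$ and to $v_{yx}$ differ by at most one. For any $18$-tuple $t=(v_{ab},v_{ac},\dots,v_{dc},m_{ab},\dots,m_{cd})$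 of vertices of a graph $G$ and $x\ne y$, call a path of $G$ from $v_{xy}$ to $m_{xy}$ *admissible* for $t$ if its interior vertices are adjacent to none of the twelve vertices $v_{ij}$ other than $v_{xy}$. **Theorem.** 1. Let $G$ be a graph that contains no pyramid, let $F$ be an induced subgraph of $G$ that is the line graph of a proper subdivision of $K_4$ and has the smallest number of vertices with this property, and let $t$ be a frame of $F$. For $x\ne y$ in $\{a,b,c,d\}$ let $P$ be a shortest admissible path from $v_{xy}$ to $m_{xy}$. Then $(V(F)\setminus V(v_{xy}\text{-}R_{xy}\text{-}m_{xy}))\cup V(P)$, where $v_{xy}\text{-}R_{xy}\text{-}m_{xy}$ is the part of $R_{xy}$ between $v_{xy}$ and $m_{xy}$, induces the line graph of a proper subdivision of $K_4$ of smallest size. 2. For $G$, $F$, $t$ as in 1, for each of the twelve ordered pairs $xy$ there is a shortest admissible path from $v_{xy}$ to $m_{xy}$, and for every choice of such shortest paths $S_{xy}$ the set $\bigcup_{x\neq y}V(S_{xy})$ induces the line graph of a proper subdivision of $K_4$ of smallest size. 3. There is an algorithm which, given the adjacency matrix of an $n$-vertex graph $G$ that contains no pyramid, decides in time $O(n^{20})$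 whether $G$ contains the line graph of a proper subdivision of $K_4$. If it does, the algorithm returns the vertex set of such an induced subgraph, and this set is the union of twelve shortest admissible paths for some $18$-tuple of vertices of $G$. Time is the number of steps of a random access machine whose unit-cost instructions are reading and writing memory cells, reading an entry of the adjacency matrix, adding or subtracting one, and comparing two numbers. -/

import Mathlib

open SimpleGraph

section Subdivisions

/-- A presentation of the graph `R` as a subdivision of the graph `H`: every edge of `H` is
replaced by a path of `R` (of length at least one) between the branch vertices that stand for its
ends; these paths meet only in common ends, and together with the branch vertices they make up
all of `R`. An edge of `H` is traversed in its two directions by its two darts. -/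
structure Subdivision {U W : Type*} (H : SimpleGraph U) (R : SimpleGraph W) where
  /-- the branch vertices -/
  branch : U ↪ W
  /-- the path that replaces an edge -/
  path : ∀ d : H.Dart, R.Walk (branch d.fst) (branch d.snd)
  path_isPath : ∀ d, (path d).IsPath
  path_symm : ∀ d, path d.symm = (path d).reverse
  branch_mem : ∀ d u, branch u ∈ (path d).support → u = d.fst ∨ u = d.snd
  disjoint : ∀ d d' x, d.edge ≠ d'.edge → x ∈ (path d).support → x ∈ (path d').support →
    x ∈ Set.range branch
  vertex_cover : ∀ x, x ∈ Set.range branch ∨ ∃ d, x ∈ (path d).support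
  edge_cover : ∀ e ∈ R.edgeSet, ∃ d, e ∈ (path d).edges

/-- At least one edge is replaced by a path of length at least two. -/
def Subdivision.IsProper {U W : Type*} {H : SimpleGraph U} {R : SimpleGraph W}
    (σ : Subdivision H R) : Prop :=
  ∃ d, 2 ≤ (σ.path d).length

/-- The complete graph on the four vertices `a, b, c, d`. -/
abbrev K4 : SimpleGraph (Fin 4) := ⊤

/-- A way of seeing the subgraph of `G` induced by the vertex set `S` as the line graph of a
proper subdivision `root` of `K4`. -/
structure LineGraphModel {V : Type*} (G : SimpleGraph V) (S : Set V) where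
  order : ℕ
  root : SimpleGraph (Fin order)
  subdiv : Subdivision K4 root
  proper : subdiv.IsProper
  iso : root.lineGraph ≃g G.induce S

/-- `S` induces in `G` the line graph of a proper subdivision of `K4`. -/
def IsLGPSK4 {V : Type*} (G : SimpleGraph V) (S : Set V) : Prop :=
  Nonempty (LineGraphModel G S)

/-- `S` induces in `G` the line graph of a proper subdivision of `K4`, with as few vertices as
possible. -/
def IsSmallestLGPSK4 {V : Type*} (G : SimpleGraph V) (S : Set V) : Prop :=
  IsLGPSK4 G S ∧ ∀ T : Set V, IsLGPSK4 G T → S.ncard ≤ T.ncard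

/-- The `18`-tuples `(v_ab, v_ac, …, v_dc, m_ab, …, m_cd)` of vertices: twelve vertices `v_xy`,
one for each ordered pair `xy`, and six vertices `m_xy`, one for each unordered pair `xy`. -/
structure Tuple18 (V : Type*) where
  corner : K4.Dart → V
  middle : K4.edgeSet → V

/-- The vertex `m_xy`, for the ordered pair `d = xy`. -/
def Tuple18.mid {V : Type*} (t : Tuple18 V) (d : K4.Dart) : V :=
  t.middle ⟨d.edge, d.edge_mem⟩

namespace LineGraphModel

variable {V : Type*} {G : SimpleGraph V} {S : Set V}

/-- The rung `R_xy`, for `d = xy`: the list of the vertices of `G` that are the edges of the path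
of the subdivision that replaces `xy`, listed from `x` to `y`. -/
def rung (M : LineGraphModel G S) (d : K4.Dart) : List V :=
  (M.subdiv.path d).edges.pmap (fun e he => (M.iso ⟨e, he⟩ : V))
    (fun _ he => Walk.edges_subset_edgeSet _ he)

/-- `t` is a frame: `v_xy` is the first vertex of the rung `R_xy` (its end in the basic triangle
of `x`), and `m_xy` is a vertex of `R_xy` whose distances `α` and `β` along `R_xy` to the two ends
of `R_xy` differ by at most one. -/
structure IsFrame (M : LineGraphModel G S) (t : Tuple18 V) : Prop where
  corner : ∀ d, (M.rung d)[0]? = some (t.corner d)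
  middle : ∀ d, ∃ α β : ℕ, (M.rung d)[α]? = some (t.mid d) ∧ α + β + 1 = (M.rung d).length ∧
    α ≤ β + 1 ∧ β ≤ α + 1

/-- The vertices of the rung `R_xy`, for `d = xy`, from its end at `x` up to and including its
vertex `m`. -/
def initialSegment (M : LineGraphModel G S) (d : K4.Dart) (m : V) : Set V :=
  {x | ∃ i j : ℕ, i ≤ j ∧ (M.rung d)[i]? = some x ∧ (M.rung d)[j]? = some m}

end LineGraphModel

/-- `P` is a path from `v_xy` to `m_xy` (for `d = xy`) whose interior vertices are adjacent to no
corner other than `v_xy`. -/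
def IsAdmissible {V : Type*} {G : SimpleGraph V} (t : Tuple18 V) (d : K4.Dart)
    (P : G.Walk (t.corner d) (t.mid d)) : Prop :=
  P.IsPath ∧ ∀ x ∈ P.support, x ≠ t.corner d → x ≠ t.mid d →
    ∀ d', t.corner d' ≠ t.corner d → ¬ G.Adj x (t.corner d')

/-- `P` is a shortest path among those of `IsAdmissible`. -/
def IsShortestAdmissible {V : Type*} {G : SimpleGraph V} (t : Tuple18 V) (d : K4.Dart)
    (P : G.Walk (t.corner d) (t.mid d)) : Prop :=
  IsAdmissible t d P ∧
    ∀ Q : G.Walk (t.corner d) (t.mid d), IsAdmissible t d Q → P.length ≤ Q.length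

/-- The three paths `P 0`, `P 1`, `P 2` form in `G` an induced pyramid with apex `a` and triangle
`b 0`, `b 1`, `b 2`. -/
structure IsPyramid {V : Type*} (G : SimpleGraph V) (a : V) (b : Fin 3 → V)
    (P : ∀ i, G.Walk a (b i)) : Prop where
  triangle : ∀ i j, i ≠ j → G.Adj (b i) (b j)
  isPath : ∀ i, (P i).IsPath
  chordless : ∀ i, (P i).IsChordless
  inter : ∀ i j, i ≠ j → ∀ x, x ∈ (P i).support → x ∈ (P j).support → x = a
  only_edge : ∀ i j, i ≠ j → ∀ x ∈ (P i).support, ∀ y ∈ (P j).support, x ≠ a → y ≠ a →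
    G.Adj x y → x = b i ∧ y = b j
  apex : ∀ i j, G.Adj a (b i) → G.Adj a (b j) → i = j

/-- `G` contains a pyramid as an induced subgraph. -/
def ContainsPyramid {V : Type*} (G : SimpleGraph V) : Prop :=
  ∃ (a : V) (b : Fin 3 → V) (P : ∀ i, G.Walk a (b i)), IsPyramid G a b P

end Subdivisions

/-! ### A random access machine that reads the adjacency matrix of a graph

Memory cells hold natural numbers. There are the registers `reg x`, and the arrays `arr a`, whose
cells are addressed by the content of a register. The machine does no arithmetic beyond adding
and subtracting one, so that in `t` steps it produces only numbers of size `O(n + t)` and the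
charge of one unit per step is a fair one. -/

namespace RAM

/-- Right-hand sides of assignments. -/
inductive Expr where
  /-- a constant -/
  | const (k : ℕ)
  /-- the content of a register -/
  | var (x : ℕ)
  /-- the content of a register, plus one -/
  | succ (x : ℕ)
  /-- the content of a register, minus one (and `0` at `0`) -/
  | pred (x : ℕ)
  /-- the number of vertices of the input graph -/
  | order
  /-- the cell of the array `a` at the address held by the register `x` -/
  | load (a x : ℕ)
  /-- the entry of the adjacency matrix of the input graph at the row and column held by the
  registers `x` and `y` -/
  | adj (x y : ℕ)

/-- Comparisons of two registers. -/
inductive Test where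
  | lt (x y : ℕ)
  | eq (x y : ℕ)

/-- Programs. -/
inductive Prog where
  /-- `x := e` -/
  | assign (x : ℕ) (e : Expr)
  /-- `arr a [x] := y`, with address and value held by the registers `x` and `y` -/
  | store (a x y : ℕ)
  /-- `p; q` -/
  | seq (p q : Prog)
  /-- `if b then p else q` -/
  | ite (b : Test) (p q : Prog)
  /-- `while b do p` -/
  | while (b : Test) (p : Prog)

/-- The contents of the memory. -/
structure Memory where
  reg : ℕ → ℕ
  arr : ℕ → ℕ → ℕ

/-- The entry of the adjacency matrix of `G` in row `i` and column `j` (and `0` outside of the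
matrix). -/
noncomputable def adjEntry {n : ℕ} (G : SimpleGraph (Fin n)) (i j : ℕ) : ℕ :=
  open Classical in
  if ∃ (hi : i < n) (hj : j < n), G.Adj ⟨i, hi⟩ ⟨j, hj⟩ then 1 else 0

noncomputable def Expr.eval {n : ℕ} (G : SimpleGraph (Fin n)) (s : Memory) : Expr → ℕ
  | const k => k
  | var x => s.reg x
  | succ x => s.reg x + 1
  | pred x => s.reg x - 1
  | order => n
  | load a x => s.arr a (s.reg x)
  | adj x y => adjEntry G (s.reg x) (s.reg y)

def Test.holds (s : Memory) : Test → Bool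
  | lt x y => decide (s.reg x < s.reg y)
  | eq x y => decide (s.reg x = s.reg y)

/-- A configuration: the programs that are still to be run, in this order, and the memory. -/
structure Config where
  todo : List Prog
  mem : Memory

/-- One step of the machine on the input graph `G`. The machine has halted when nothing is left
to be run. -/
noncomputable def step {n : ℕ} (G : SimpleGraph (Fin n)) : Config → Config
  | ⟨[], s⟩ => ⟨[], s⟩
  | ⟨.assign x e :: k, s⟩ => ⟨k, ⟨Function.update s.reg x (e.eval G s), s.arr⟩⟩
  | ⟨.store a x y :: k, s⟩ =>
      ⟨k, ⟨s.reg, Function.update s.arr a (Function.update (s.arr a) (s.reg x) (s.reg y))⟩⟩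
  | ⟨.seq p q :: k, s⟩ => ⟨p :: q :: k, s⟩
  | ⟨.ite b p q :: k, s⟩ => ⟨cond (b.holds s) p q :: k, s⟩
  | ⟨.while b p :: k, s⟩ => ⟨cond (b.holds s) (p :: .while b p :: k) k, s⟩

/-- The configuration from which the program `p` is started: all memory cells hold `0`. -/
def start (p : Prog) : Config := ⟨[p], ⟨fun _ => 0, fun _ _ => 0⟩⟩

/-- On the input graph `G`, the program `p` halts within `T` steps, with final memory `s`. -/
def HaltsWithin {n : ℕ} (G : SimpleGraph (Fin n)) (p : Prog) (T : ℕ) (s : Memory) : Prop :=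
  ∃ t ≤ T, (step G)^[t] (start p) = ⟨[], s⟩

/-- The final memory `s` is a correct answer to the question whether `G` contains the line graph
of a proper subdivision of `K4`. Either register `0` holds `1`, and array `0` holds the
characteristic vector of the vertex set of an induced subgraph of that kind, which is the union of
twelve shortest paths that belong to some `18`-tuple; or register `0` holds `0`, and there is no
such subgraph. -/
def CorrectAnswer {n : ℕ} (G : SimpleGraph (Fin n)) (s : Memory) : Prop :=
  (s.reg 0 = 1 ∧ IsLGPSK4 G {v | s.arr 0 v = 1} ∧
    ∃ (t : Tuple18 (Fin n)) (P : ∀ d : K4.Dart, G.Walk (t.corner d) (t.mid d)),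
      (∀ d, IsShortestAdmissible t d (P d)) ∧
        {v : Fin n | s.arr 0 v = 1} = ⋃ d, {x | x ∈ (P d).support}) ∨
  (s.reg 0 = 0 ∧ ∀ S, ¬ IsLGPSK4 G S)

end RAM

/-! Let F be a smallest line graph of a proper subdivision of K4 in a graph without pyramids. Delete
a rung xy, and let z, w be the other two vertices of K4. What remains is a prism: the triangles at z
and w, joined by a path through x, a path through y, and the rung zw (`IsRungSystem.isPrism`). The
deleted rung was attached to the prism in two places only: where the rungs zx and xw join, and where
zy and yw join.

The engine is `IsHop.exists_isLGPSK4`. A hop is an induced path outside a prism such that only its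
first vertex sees one of the three paths and only its last vertex sees the other two; the ends of
the prism paths are suitably avoided. If the last vertex sees both of the other paths, it is the
apex of a pyramid. If an end of the hop has two neighbours on its path with a gap between them, that
end is the apex of a pyramid; if it has just one neighbour there, that neighbour is the apex. So
without pyramids both ends of the hop see exactly two consecutive vertices of one path each, and
then the prism and the hop together form the line graph of a proper subdivision of K4, with the hop
as a rung. By minimality of F, a hop over the prism has at least as many vertices as the deleted
rung (`IsStep.no_hop`).

Let the middle vertex m be at distance A from the corner of x and B from the corner of y, and let P
be a shortest admissible path, of length k. The half of the rung is itself admissible, because A ≤ B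
+ 1 keeps its interior away from the far corner; hence k ≤ A. Admissibility keeps the interior of P
away from the six ends of the prism paths, which is what the definition of a hop asks for. If P had
a neighbour on one of the two prism paths that avoid x, a subpath of P would be a hop that is too
short (`IsStep.not_adj_right`). If an inner vertex of P had a neighbour on the path through x, go
from the corner of y along the rung to m and back along P to the last such vertex: inside this walk
there is a hop with at most A + B - 1 edges, again too short (`IsStep.not_adj_left`). So P followed
by the rest of the rung is attached to the prism just as the rung was. Any shortest path inside
their union between the two corners is a possible new rung; minimality gives k = A and shows that
the union is itself an induced path (`IsStep.conclusion`).

The new subgraph has the same rung lengths, the same corners and the same middle vertices. The tuple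
is therefore a frame of it as well, and the twelve halves can be exchanged one after the other
(`IsRungFrame.replace_half`, `IsRungFrame.replace_all`).

The algorithm tries all tuples, computes shortest admissible paths and tests whether their union has
the required adjacencies. What passes the test is correct by construction (`Represents.isAnswer`);
that some tuple passes, if there is anything to find, is the exchange argument applied to a frame of
a smallest subgraph (`exists_isCandidate`). The vertices through which a search may continue depend
on the corners only, so the twelve search tables are computed once for each choice of corners.
Twelve loops for the corners, six for the middle vertices and two for comparing positions on two
rungs make twenty nested loops.

The graph theory is done with families `r x y i` that obey explicit equality and adjacency rules
(`IsRungSystem`); `exists_isRungSystem` and `IsRungSystem.isLGPSK4` translate from and to line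
graphs. The program is written with counted loops only (`LoopProg`), so that its effect is a
function of the memory and its running time is read off from the nesting depth
(`LoopProg.runs_compile`, `LoopProg.cost_le`). -/

namespace LGK4

/-! ### Shortest walks inside vertex sets, and pyramids obtained from connected sets. -/

section Paths

variable {V : Type*} {G : SimpleGraph V}

/-- The walk that visits `f 0, f 1, …, f n`. -/
def walkOfFn (f : ℕ → V) : ∀ n : ℕ, (∀ i < n, G.Adj (f i) (f (i + 1))) → G.Walk (f 0) (f n)
  | 0, _ => Walk.nil
  | n + 1, h => (walkOfFn f n fun i hi => h i (by omega)).concat (h n (by omega))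

theorem length_walkOfFn (f : ℕ → V) (n : ℕ) (h : ∀ i < n, G.Adj (f i) (f (i + 1))) :
    (walkOfFn f n h).length = n := by
  induction n with
  | zero => rfl
  | succ n ih => simp [walkOfFn, ih]

theorem support_walkOfFn (f : ℕ → V) (n : ℕ) (h : ∀ i < n, G.Adj (f i) (f (i + 1))) :
    (walkOfFn f n h).support = (List.range (n + 1)).map f := by
  induction n with
  | zero => rfl
  | succ n ih => simp [walkOfFn, Walk.support_concat, ih, List.range_succ (n := n + 1)]

theorem mem_support_walkOfFn (f : ℕ → V) (n : ℕ) (h : ∀ i < n, G.Adj (f i) (f (i + 1))) (x : V) :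
    x ∈ (walkOfFn f n h).support ↔ ∃ i ≤ n, f i = x := by
  simp [support_walkOfFn]

theorem getVert_walkOfFn (f : ℕ → V) (n : ℕ) (h : ∀ i < n, G.Adj (f i) (f (i + 1))) (i : ℕ)
    (hi : i ≤ n) : (walkOfFn f n h).getVert i = f i := by
  rw [Walk.getVert_eq_support_getElem _ (by rwa [length_walkOfFn])]
  simp [support_walkOfFn]

/-- The vertices `f 0, f 1, …, f n` are distinct, and only consecutive ones are adjacent. -/
structure IsInducedPath (G : SimpleGraph V) (f : ℕ → V) (n : ℕ) : Prop where
  inj : ∀ i ≤ n, ∀ j ≤ n, f i = f j → i = j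
  adj : ∀ i ≤ n, ∀ j ≤ n, (G.Adj (f i) (f j) ↔ i + 1 = j ∨ j + 1 = i)

/-- `p` is a walk inside of `X`, and as short as possible among those. -/
structure IsShortestIn (X : Set V) {u v : V} (p : G.Walk u v) : Prop where
  subset : ∀ x ∈ p.support, x ∈ X
  le : ∀ q : G.Walk u v, (∀ x ∈ q.support, x ∈ X) → p.length ≤ q.length

theorem exists_isShortestIn (X : Set V) {u v : V} (p : G.Walk u v) (hp : ∀ x ∈ p.support, x ∈ X) :
    ∃ q : G.Walk u v, IsShortestIn X q := by
  classical
  have h : ∃ n, ∃ q : G.Walk u v, (∀ x ∈ q.support, x ∈ X) ∧ q.length = n := ⟨_, p, hp, rfl⟩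
  obtain ⟨q, hq, hn⟩ := Nat.find_spec h
  exact ⟨q, hq, fun q' hq' => hn ▸ Nat.find_min' h ⟨q', hq', rfl⟩⟩

/-- Removing the closed detours of a walk only uses vertices of the walk, so the result stays inside
`X` and cannot be shorter. -/
theorem IsShortestIn.isPath {X : Set V} {u v : V} {p : G.Walk u v} (hp : IsShortestIn X p) :
    p.IsPath := by
  classical
  have h := hp.le p.bypass fun x hx => hp.subset x (p.support_bypass_subset_support hx)
  have : p.bypass = p := Walk.ext_support <|
    p.support_bypass_sublist_support.eq_of_length_le <| by simpa using h
  rw [← this]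
  exact p.bypass_isPath

theorem mem_support_take {u v : V} (p : G.Walk u v) (n : ℕ) {x : V}
    (hx : x ∈ (p.take n).support) : x ∈ p.support := by
  rw [Walk.support_take] at hx
  exact List.mem_of_mem_take hx

theorem mem_support_drop {u v : V} (p : G.Walk u v) (n : ℕ) {x : V}
    (hx : x ∈ (p.drop n).support) : x ∈ p.support := by
  rw [Walk.drop_support_eq_support_drop_min] at hx
  exact List.mem_of_mem_drop hx

/-- A chord between positions that are not consecutive would be a shortcut that uses no new
vertices. -/
theorem IsShortestIn.inducedPath {X : Set V} {u v : V} {p : G.Walk u v} (hp : IsShortestIn X p) :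
    IsInducedPath G p.getVert p.length := by
  have hinj : ∀ i ≤ p.length, ∀ j ≤ p.length, p.getVert i = p.getVert j → i = j :=
    fun i hi j hj h => hp.isPath.getVert_injOn hi hj h
  have key : ∀ i j, i < j → j ≤ p.length → G.Adj (p.getVert i) (p.getVert j) → i + 1 = j := by
    intro i j hij hj h
    have := hp.le ((p.take i).append (Walk.cons h (p.drop j))) (by
      intro x hx
      rw [Walk.mem_support_append_iff, Walk.support_cons, List.mem_cons] at hx
      rcases hx with hx | rfl | hx
      · exact hp.subset _ (mem_support_take p i hx)
      · exact hp.subset _ (p.getVert_mem_support i)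
      · exact hp.subset _ (mem_support_drop p j hx))
    simp only [Walk.length_append, Walk.length_cons, Walk.take_length, Walk.drop_length] at this
    omega
  refine ⟨hinj, fun i hi j hj => ⟨fun h => ?_, ?_⟩⟩
  · rcases lt_trichotomy i j with hij | hij | hij
    · exact Or.inl (key i j hij hj h)
    · subst hij; exact absurd h (G.irrefl)
    · exact Or.inr (key j i hij hi h.symm)
  · rintro (rfl | rfl)
    · exact p.adj_getVert_succ (by omega)
    · exact (p.adj_getVert_succ (by omega)).symm

theorem IsShortestIn.isChordless {X : Set V} {u v : V} {p : G.Walk u v} (hp : IsShortestIn X p) :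
    p.IsChordless := by
  rw [Walk.isChordless_iff_forall_mem_edges]
  intro x y hx hy hxy
  obtain ⟨i, rfl, hi⟩ := Walk.mem_support_iff_exists_getVert.mp hx
  obtain ⟨j, rfl, hj⟩ := Walk.mem_support_iff_exists_getVert.mp hy
  have key : ∀ i < p.length, s(p.getVert i, p.getVert (i + 1)) ∈ p.edges := by
    intro i hi
    have : p.edges[i]'(by simpa) = s(p.getVert i, p.getVert (i + 1)) := by
      simp [Walk.getElem_edges_eq_edge_getElem_darts, Walk.darts_getElem_eq_getVert]
    rw [← this]
    exact List.getElem_mem _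
  rcases (hp.inducedPath.adj i hi j hj).mp hxy with rfl | rfl
  · exact key _ (by omega)
  · rw [Sym2.eq_swap]; exact key _ (by omega)

/-- `u` and `v` are joined by a walk inside of `X`. -/
def ReachIn (G : SimpleGraph V) (X : Set V) (u v : V) : Prop :=
  ∃ p : G.Walk u v, ∀ x ∈ p.support, x ∈ X

theorem ReachIn.refl {X : Set V} {u : V} (hu : u ∈ X) : ReachIn G X u u :=
  ⟨Walk.nil, by simpa⟩

theorem ReachIn.symm {X : Set V} {u v : V} (h : ReachIn G X u v) : ReachIn G X v u := by
  obtain ⟨p, hp⟩ := h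
  exact ⟨p.reverse, by simpa using hp⟩

theorem ReachIn.trans {X : Set V} {u v w : V} (h : ReachIn G X u v) (h' : ReachIn G X v w) :
    ReachIn G X u w := by
  obtain ⟨p, hp⟩ := h
  obtain ⟨q, hq⟩ := h'
  refine ⟨p.append q, fun x hx => ?_⟩
  rw [Walk.mem_support_append_iff] at hx
  exact hx.elim (hp x) (hq x)

theorem ReachIn.adj {X : Set V} {u v : V} (h : G.Adj u v) (hu : u ∈ X) (hv : v ∈ X) :
    ReachIn G X u v :=
  ⟨h.toWalk, by simp [hu, hv]⟩

theorem ReachIn.of_fn {X : Set V} (f : ℕ → V) {i j : ℕ} (hij : i ≤ j)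
    (hadj : ∀ k, i ≤ k → k < j → G.Adj (f k) (f (k + 1))) (hX : ∀ k, i ≤ k → k ≤ j → f k ∈ X) :
    ReachIn G X (f i) (f j) := by
  induction j, hij using Nat.le_induction with
  | base => exact ReachIn.refl (hX _ le_rfl le_rfl)
  | succ j hij ih =>
    exact (ih (fun k h1 h2 => hadj k h1 (by omega)) (fun k h1 h2 => hX k h1 (by omega))).trans
      (ReachIn.adj (hadj j hij (by omega)) (hX _ hij (by omega)) (hX _ (by omega) le_rfl))

theorem IsInducedPath.reachIn {f : ℕ → V} {n : ℕ} (hf : IsInducedPath G f n) {X : Set V}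
    {i j : ℕ} (hij : i ≤ j) (hj : j ≤ n) (hX : ∀ k, i ≤ k → k ≤ j → f k ∈ X) :
    ReachIn G X (f i) (f j) :=
  ReachIn.of_fn f hij (fun k _ hk => (hf.adj k (by omega) (k + 1) (by omega)).mpr (Or.inl rfl)) hX

/-- A pyramid is found from three connected sets that hold the three paths without the apex. -/
theorem containsPyramid_of_sets (a b₀ b₁ b₂ : V) (X₀ X₁ X₂ : Set V)
    (htri : G.Adj b₀ b₁ ∧ G.Adj b₀ b₂ ∧ G.Adj b₁ b₂)
    (hapex : ¬ (G.Adj a b₀ ∧ G.Adj a b₁) ∧ ¬ (G.Adj a b₀ ∧ G.Adj a b₂) ∧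
      ¬ (G.Adj a b₁ ∧ G.Adj a b₂))
    (h₀ : ReachIn G (insert a X₀) a b₀) (h₁ : ReachIn G (insert a X₁) a b₁)
    (h₂ : ReachIn G (insert a X₂) a b₂)
    (h₀₁ : ∀ x ∈ X₀, ∀ y ∈ X₁, x ≠ y ∧ (G.Adj x y → x = b₀ ∧ y = b₁))
    (h₀₂ : ∀ x ∈ X₀, ∀ y ∈ X₂, x ≠ y ∧ (G.Adj x y → x = b₀ ∧ y = b₂))
    (h₁₂ : ∀ x ∈ X₁, ∀ y ∈ X₂, x ≠ y ∧ (G.Adj x y → x = b₁ ∧ y = b₂)) :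
    ContainsPyramid G := by
  let b : Fin 3 → V := ![b₀, b₁, b₂]
  let X : Fin 3 → Set V := ![X₀, X₁, X₂]
  have hreach : ∀ i, ReachIn G (insert a (X i)) a (b i) := by
    intro i; fin_cases i <;> assumption
  -- Shortest walks inside `insert a (X i)` are chordless paths. Hence only connectivity has to be
  -- supplied in applications: every vertex other than the apex lies in `X i`, where the cross
  -- conditions apply.
  have hsh : ∀ i, ∃ p : G.Walk a (b i), IsShortestIn (insert a (X i)) p := fun i => by
    obtain ⟨p, hp⟩ := hreach i
    exact exists_isShortestIn _ p hp
  choose P hP using hsh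
  have hcross : ∀ i j, i ≠ j → ∀ x ∈ X i, ∀ y ∈ X j, x ≠ y ∧ (G.Adj x y → x = b i ∧ y = b j) := by
    have sym : ∀ {Y Z : Set V} {c d : V},
        (∀ x ∈ Y, ∀ y ∈ Z, x ≠ y ∧ (G.Adj x y → x = c ∧ y = d)) →
        ∀ x ∈ Z, ∀ y ∈ Y, x ≠ y ∧ (G.Adj x y → x = d ∧ y = c) := fun h x hx y hy =>
      ⟨(h y hy x hx).1.symm, fun hxy => ((h y hy x hx).2 hxy.symm).symm⟩
    intro i j hij
    fin_cases i <;> fin_cases j <;>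
      first
        | exact absurd rfl hij
        | assumption
        | exact sym h₀₁
        | exact sym h₀₂
        | exact sym h₁₂
  have hmem : ∀ i, ∀ x ∈ (P i).support, x ≠ a → x ∈ X i := fun i x hx hxa =>
    ((hP i).subset x hx).resolve_left hxa
  refine ⟨a, b, P, ⟨?_, fun i => (hP i).isPath, fun i => (hP i).isChordless, ?_, ?_, ?_⟩⟩
  · obtain ⟨t1, t2, t3⟩ := htri
    intro i j hij
    fin_cases i <;> fin_cases j <;>
      first
        | exact absurd rfl hij
        | assumption
        | exact t1.symm
        | exact t2.symm
        | exact t3.symm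
  · intro i j hij x hi hj
    by_contra hxa
    exact (hcross i j hij x (hmem i x hi hxa) x (hmem j x hj hxa)).1 rfl
  · intro i j hij x hx y hy hxa hya hxy
    exact (hcross i j hij x (hmem i x hx hxa) y (hmem j y hy hya)).2 hxy
  · obtain ⟨t1, t2, t3⟩ := hapex
    intro i j hi hj
    fin_cases i <;> fin_cases j <;>
      first
        | rfl
        | exact (t1 ⟨hi, hj⟩).elim
        | exact (t1 ⟨hj, hi⟩).elim
        | exact (t2 ⟨hi, hj⟩).elim
        | exact (t2 ⟨hj, hi⟩).elim
        | exact (t3 ⟨hi, hj⟩).elim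
        | exact (t3 ⟨hj, hi⟩).elim

end Paths

end LGK4

/-! ### Positions on rungs, and the correspondence between subdivisions of K4 and rung systems. -/

namespace LGK4

/-- Two ordered pairs of distinct elements of `Fin 4` agree up to order, meet in one element,
or are disjoint. -/
theorem pair_cases (x y x' y' : Fin 4) (h : x ≠ y) (h' : x' ≠ y') :
    (x' = x ∧ y' = y) ∨ (x' = y ∧ y' = x) ∨ (x' = x ∧ y ≠ y') ∨ (x' = y ∧ x ≠ y') ∨
      (y' = x ∧ y ≠ x') ∨ (y' = y ∧ x ≠ x') ∨ (x ≠ x' ∧ x ≠ y' ∧ y ≠ x' ∧ y ≠ y') := by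
  revert x y x' y'; decide

/-- To prove a statement about pairs of positions on rungs, it suffices to do so for positions on
one rung, on two rungs that leave the same vertex, and on two disjoint rungs, provided that the
statement does not depend on the directions of the rungs. -/
theorem position_induction {len : Fin 4 → Fin 4 → ℕ} (hlen : ∀ x y, len y x = len x y)
    {Q : Fin 4 → Fin 4 → ℕ → Fin 4 → Fin 4 → ℕ → Prop}
    (flip₁ : ∀ x y i x' y' i', x ≠ y → x' ≠ y' → i < len x y → i' < len x' y' →
      Q x y (len x y - 1 - i) x' y' i' → Q y x i x' y' i')
    (flip₂ : ∀ x y i x' y' i', x ≠ y → x' ≠ y' → i < len x y → i' < len x' y' →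
      Q x y i x' y' (len x' y' - 1 - i') → Q x y i y' x' i')
    (same : ∀ x y i j, x ≠ y → i < len x y → j < len x y → Q x y i x y j)
    (meet : ∀ x y z i j, x ≠ y → x ≠ z → y ≠ z → i < len x y → j < len x z → Q x y i x z j)
    (opp : ∀ x y z w i j, x ≠ y → x ≠ z → x ≠ w → y ≠ z → y ≠ w → z ≠ w →
      i < len x y → j < len z w → Q x y i z w j)
    (x y : Fin 4) (i : ℕ) (x' y' : Fin 4) (i' : ℕ) (h : x ≠ y) (h' : x' ≠ y') (hi : i < len x y)
    (hi' : i' < len x' y') : Q x y i x' y' i' := by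
  have hr := hlen x y
  have hr' := hlen x' y'
  rcases pair_cases x y x' y' h h' with ⟨rfl, rfl⟩ | ⟨rfl, rfl⟩ | ⟨rfl, h1⟩ | ⟨rfl, h1⟩ | ⟨rfl, h1⟩ |
    ⟨rfl, h1⟩ | ⟨h1, h2, h3, h4⟩
  · exact same _ _ _ _ h hi hi'
  · exact flip₂ _ _ _ _ _ _ h h hi (by omega) (same _ _ _ _ h hi (by omega))
  · exact meet _ _ _ _ _ h h' h1 hi hi'
  · exact flip₁ _ _ _ _ _ _ h.symm h' (by omega) hi' (meet _ _ _ _ _ h.symm h' h1 (by omega) hi')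
  · exact flip₂ _ _ _ _ _ _ h h'.symm hi (by omega) (meet _ _ _ _ _ h h'.symm h1 hi (by omega))
  · exact flip₁ _ _ _ _ _ _ h.symm h' (by omega) hi' (flip₂ _ _ _ _ _ _ h.symm h'.symm (by omega)
      (by omega) (meet _ _ _ _ _ h.symm h'.symm h1 (by omega) (by omega)))
  · exact opp _ _ _ _ _ _ h h1 h2 h3 h4 h' hi hi'

section Systems

variable {V W : Type*}

/-- The points `q x y 0, …, q x y (len x y)` of the paths of a subdivision of `K4`. -/
structure IsPointSystem (len : Fin 4 → Fin 4 → ℕ) (q : Fin 4 → Fin 4 → ℕ → W) : Prop where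
  pos : ∀ x y, x ≠ y → 1 ≤ len x y
  len_symm : ∀ x y, len y x = len x y
  rev : ∀ x y i, x ≠ y → i ≤ len x y → q y x i = q x y (len x y - i)
  inj : ∀ x y i j, x ≠ y → i ≤ len x y → j ≤ len x y → q x y i = q x y j → i = j
  meet : ∀ x y z i j, x ≠ y → x ≠ z → y ≠ z → i ≤ len x y → j ≤ len x z →
    (q x y i = q x z j ↔ i = 0 ∧ j = 0)
  opp : ∀ x y z w i j, x ≠ y → x ≠ z → x ≠ w → y ≠ z → y ≠ w → z ≠ w →
    i ≤ len x y → j ≤ len z w → q x y i ≠ q z w j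

/-- The rungs `r x y 0, …, r x y (len x y - 1)` of an induced subgraph of `G` that is the line
graph of a proper subdivision of `K4`. -/
structure IsRungSystem (G : SimpleGraph V) (len : Fin 4 → Fin 4 → ℕ)
    (r : Fin 4 → Fin 4 → ℕ → V) : Prop where
  pos : ∀ x y, x ≠ y → 1 ≤ len x y
  len_symm : ∀ x y, len y x = len x y
  rev : ∀ x y i, x ≠ y → i < len x y → r y x i = r x y (len x y - 1 - i)
  inj : ∀ x y i j, x ≠ y → i < len x y → j < len x y → r x y i = r x y j → i = j
  adj : ∀ x y i j, x ≠ y → i < len x y → j < len x y →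
    (G.Adj (r x y i) (r x y j) ↔ i + 1 = j ∨ j + 1 = i)
  meet_ne : ∀ x y z i j, x ≠ y → x ≠ z → y ≠ z → i < len x y → j < len x z → r x y i ≠ r x z j
  meet_adj : ∀ x y z i j, x ≠ y → x ≠ z → y ≠ z → i < len x y → j < len x z →
    (G.Adj (r x y i) (r x z j) ↔ i = 0 ∧ j = 0)
  opp_ne : ∀ x y z w i j, x ≠ y → x ≠ z → x ≠ w → y ≠ z → y ≠ w → z ≠ w →
    i < len x y → j < len z w → r x y i ≠ r z w j
  opp_adj : ∀ x y z w i j, x ≠ y → x ≠ z → x ≠ w → y ≠ z → y ≠ w → z ≠ w →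
    i < len x y → j < len z w → ¬ G.Adj (r x y i) (r z w j)
  proper : ∃ x y, x ≠ y ∧ 2 ≤ len x y

/-- The vertices on the rungs. -/
def rungSet (len : Fin 4 → Fin 4 → ℕ) (r : Fin 4 → Fin 4 → ℕ → V) : Set V :=
  {v | ∃ x y i, x ≠ y ∧ i < len x y ∧ r x y i = v}

namespace IsPointSystem

variable {len : Fin 4 → Fin 4 → ℕ} {q : Fin 4 → Fin 4 → ℕ → W}

theorem edge_rev (h : IsPointSystem len q) {x y : Fin 4} {i : ℕ} (hxy : x ≠ y)
    (hi : i < len x y) :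
    s(q y x i, q y x (i + 1)) = s(q x y (len x y - 1 - i), q x y (len x y - 1 - i + 1)) := by
  rw [h.rev x y i hxy (by omega), h.rev x y (i + 1) hxy (by omega), Sym2.eq_swap,
    show len x y - (i + 1) = len x y - 1 - i by omega,
    show len x y - i = len x y - 1 - i + 1 by omega]

theorem edge_same (h : IsPointSystem len q) {x y : Fin 4} {i j : ℕ} (hxy : x ≠ y)
    (hi : i < len x y) (hj : j < len x y) :
    s(q x y i, q x y (i + 1)) = s(q x y j, q x y (j + 1)) ↔ i = j := by
  have h1 := h.inj x y
  constructor
  · intro he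
    rw [Sym2.eq_iff] at he
    rcases he with ⟨h2, h3⟩ | ⟨h2, h3⟩
    · exact h1 _ _ hxy (by omega) (by omega) h2
    · have := h1 _ _ hxy (by omega) (by omega) h2
      have := h1 _ _ hxy (by omega) (by omega) h3
      omega
  · rintro rfl; rfl

theorem share_same (h : IsPointSystem len q) {x y : Fin 4} {i j : ℕ} (hxy : x ≠ y)
    (hi : i < len x y) (hj : j < len x y) :
    (∃ w, w ∈ s(q x y i, q x y (i + 1)) ∧ w ∈ s(q x y j, q x y (j + 1))) ↔
      i = j ∨ i + 1 = j ∨ j + 1 = i := by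
  have h1 := h.inj x y
  constructor
  · rintro ⟨w, hw, hw'⟩
    rw [Sym2.mem_iff] at hw hw'
    rcases hw with rfl | rfl <;> rcases hw' with hw' | hw' <;>
      have := h1 _ _ hxy (by omega) (by omega) hw' <;> omega
  · rintro (rfl | rfl | rfl)
    · exact ⟨_, Sym2.mem_mk_left _ _, Sym2.mem_mk_left _ _⟩
    · exact ⟨_, Sym2.mem_mk_right _ _, Sym2.mem_mk_left _ _⟩
    · exact ⟨_, Sym2.mem_mk_left _ _, Sym2.mem_mk_right _ _⟩

/-- Two paths that leave a common branch vertex have only that vertex in common, and each of them is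
there at position 0 only; so a shared end forces both edges to be the first ones. -/
theorem share_meet (h : IsPointSystem len q) {x y z : Fin 4} {i j : ℕ} (hxy : x ≠ y) (hxz : x ≠ z)
    (hyz : y ≠ z) (hi : i < len x y) (hj : j < len x z) :
    (∃ w, w ∈ s(q x y i, q x y (i + 1)) ∧ w ∈ s(q x z j, q x z (j + 1))) ↔ i = 0 ∧ j = 0 := by
  have h1 := h.meet x y z
  constructor
  · rintro ⟨w, hw, hw'⟩
    rw [Sym2.mem_iff] at hw hw'
    rcases hw with rfl | rfl <;> rcases hw' with hw' | hw' <;>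
      have := (h1 _ _ hxy hxz hyz (by omega) (by omega)).mp hw' <;> omega
  · rintro ⟨rfl, rfl⟩
    refine ⟨_, Sym2.mem_mk_left _ _, ?_⟩
    rw [(h1 0 0 hxy hxz hyz (by omega) (by omega)).mpr ⟨rfl, rfl⟩]
    exact Sym2.mem_mk_left _ _

theorem edge_meet (h : IsPointSystem len q) {x y z : Fin 4} {i j : ℕ} (hxy : x ≠ y) (hxz : x ≠ z)
    (hyz : y ≠ z) (hi : i < len x y) (hj : j < len x z) :
    s(q x y i, q x y (i + 1)) ≠ s(q x z j, q x z (j + 1)) := by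
  have h1 := h.meet x y z
  intro he
  rw [Sym2.eq_iff] at he
  rcases he with ⟨h2, h3⟩ | ⟨h2, h3⟩ <;>
    have := (h1 _ _ hxy hxz hyz (by omega) (by omega)).mp h2 <;>
    have := (h1 _ _ hxy hxz hyz (by omega) (by omega)).mp h3 <;> omega

theorem share_opp (h : IsPointSystem len q) {x y z w : Fin 4} {i j : ℕ} (hxy : x ≠ y) (hxz : x ≠ z)
    (hxw : x ≠ w) (hyz : y ≠ z) (hyw : y ≠ w) (hzw : z ≠ w) (hi : i < len x y) (hj : j < len z w) :
    ¬ ∃ v, v ∈ s(q x y i, q x y (i + 1)) ∧ v ∈ s(q z w j, q z w (j + 1)) := by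
  have h1 := h.opp x y z w
  rintro ⟨w, hw, hw'⟩
  rw [Sym2.mem_iff] at hw hw'
  rcases hw with rfl | rfl <;> rcases hw' with hw' | hw' <;>
    exact h1 _ _ hxy hxz hxw hyz hyw hzw (by omega) (by omega) hw'

/-- If the edges of the subdivision correspond to vertices of `G`, and common ends to adjacency,
then there is a system of rungs. -/
theorem isRungSystem {G : SimpleGraph V} (h : IsPointSystem len q) {r : Fin 4 → Fin 4 → ℕ → V}
    (hr : ∀ x y i x' y' i', x ≠ y → x' ≠ y' → i < len x y → i' < len x' y' →
      (r x y i = r x' y' i' ↔ s(q x y i, q x y (i + 1)) = s(q x' y' i', q x' y' (i' + 1))) ∧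
      (G.Adj (r x y i) (r x' y' i') ↔
        s(q x y i, q x y (i + 1)) ≠ s(q x' y' i', q x' y' (i' + 1)) ∧
        ∃ w, w ∈ s(q x y i, q x y (i + 1)) ∧ w ∈ s(q x' y' i', q x' y' (i' + 1))))
    (hp : ∃ x y, x ≠ y ∧ 2 ≤ len x y) : IsRungSystem G len r where
  pos := h.pos
  len_symm := h.len_symm
  rev x y i hxy hi :=
    (hr y x i x y _ hxy.symm hxy (by rwa [h.len_symm]) (by omega)).1.mpr (h.edge_rev hxy hi)
  inj x y i j hxy hi hj he := (h.edge_same hxy hi hj).mp ((hr _ _ _ _ _ _ hxy hxy hi hj).1.mp he)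
  adj x y i j hxy hi hj := by
    rw [(hr _ _ _ _ _ _ hxy hxy hi hj).2, Ne, h.edge_same hxy hi hj, h.share_same hxy hi hj]
    omega
  meet_ne x y z i j hxy hxz hyz hi hj he :=
    h.edge_meet hxy hxz hyz hi hj ((hr _ _ _ _ _ _ hxy hxz hi hj).1.mp he)
  meet_adj x y z i j hxy hxz hyz hi hj := by
    rw [(hr _ _ _ _ _ _ hxy hxz hi hj).2, h.share_meet hxy hxz hyz hi hj]
    exact and_iff_right (h.edge_meet hxy hxz hyz hi hj)
  opp_ne x y z w i j hxy hxz hxw hyz hyw hzw hi hj he := by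
    refine h.share_opp hxy hxz hxw hyz hyw hzw hi hj ?_
    rw [(hr _ _ _ _ _ _ hxy hzw hi hj).1.mp he]
    exact ⟨_, Sym2.mem_mk_left _ _, Sym2.mem_mk_left _ _⟩
  opp_adj x y z w i j hxy hxz hxw hyz hyw hzw hi hj he :=
    h.share_opp hxy hxz hxw hyz hyw hzw hi hj ((hr _ _ _ _ _ _ hxy hzw hi hj).2.mp he).2
  proper := hp

end IsPointSystem

/-- The converse of `IsPointSystem.isRungSystem`. -/
theorem IsRungSystem.correspondence {G : SimpleGraph V} {len : Fin 4 → Fin 4 → ℕ}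
    {q : Fin 4 → Fin 4 → ℕ → W} {r : Fin 4 → Fin 4 → ℕ → V} (hR : IsRungSystem G len r)
    (h : IsPointSystem len q) (x y : Fin 4) (i : ℕ) (x' y' : Fin 4) (i' : ℕ) (hxy : x ≠ y)
    (hxy' : x' ≠ y') (hi : i < len x y) (hi' : i' < len x' y') :
    (r x y i = r x' y' i' ↔ s(q x y i, q x y (i + 1)) = s(q x' y' i', q x' y' (i' + 1))) ∧
    (G.Adj (r x y i) (r x' y' i') ↔
      s(q x y i, q x y (i + 1)) ≠ s(q x' y' i', q x' y' (i' + 1)) ∧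
      ∃ w, w ∈ s(q x y i, q x y (i + 1)) ∧ w ∈ s(q x' y' i', q x' y' (i' + 1))) := by
  refine position_induction hR.len_symm (Q := fun x y i x' y' i' =>
    (r x y i = r x' y' i' ↔ s(q x y i, q x y (i + 1)) = s(q x' y' i', q x' y' (i' + 1))) ∧
    (G.Adj (r x y i) (r x' y' i') ↔
      s(q x y i, q x y (i + 1)) ≠ s(q x' y' i', q x' y' (i' + 1)) ∧
      ∃ w, w ∈ s(q x y i, q x y (i + 1)) ∧ w ∈ s(q x' y' i', q x' y' (i' + 1))))
    ?_ ?_ ?_ ?_ ?_ x y i x' y' i' hxy hxy' hi hi'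
  · intro x y i x' y' i' hxy hxy' hi hi' hQ
    rwa [hR.rev x y i hxy hi, h.edge_rev hxy hi]
  · intro x y i x' y' i' hxy hxy' hi hi' hQ
    rwa [hR.rev x' y' i' hxy' hi', h.edge_rev hxy' hi']
  · intro x y i j hxy hi hj
    rw [Ne, h.edge_same hxy hi hj, h.share_same hxy hi hj, hR.adj x y i j hxy hi hj]
    refine ⟨⟨hR.inj x y i j hxy hi hj, ?_⟩, ?_⟩
    · rintro rfl; rfl
    · omega
  · intro x y z i j hxy hxz hyz hi hj
    rw [h.share_meet hxy hxz hyz hi hj, hR.meet_adj x y z i j hxy hxz hyz hi hj]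
    have := h.edge_meet hxy hxz hyz hi hj
    have := hR.meet_ne x y z i j hxy hxz hyz hi hj
    tauto
  · intro x y z w i j hxy hxz hxw hyz hyw hzw hi hj
    have h1 := h.share_opp hxy hxz hxw hyz hyw hzw hi hj
    refine ⟨⟨fun he => absurd he (hR.opp_ne x y z w i j hxy hxz hxw hyz hyw hzw hi hj), fun he => ?_⟩,
      ⟨fun he => absurd he (hR.opp_adj x y z w i j hxy hxz hxw hyz hyw hzw hi hj),
        fun he => absurd he.2 h1⟩⟩
    rw [he] at h1
    exact absurd ⟨_, Sym2.mem_mk_left _ _, Sym2.mem_mk_left _ _⟩ h1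

end Systems

end LGK4

/-! ### Construction of a subdivision of K4 with prescribed path lengths. -/

namespace LGK4

section PointSystemExists

/-- The `i`-th point of the path that replaces `xy` in the subdivision with path lengths `len`. -/
def point (len : Fin 4 → Fin 4 → ℕ) (x y : Fin 4) (i : ℕ) : Fin 4 × Fin 4 × ℕ :=
  -- A branch vertex is coded by two equal coordinates. An inner point is coded by the ends of its
  -- path in increasing order and its distance from the smaller one, so that both directions of a
  -- path yield the same points.
  if i = 0 then (x, x, 0) else if len x y ≤ i then (y, y, 0) else
    if x < y then (x, y, i) else (y, x, len x y - i)

theorem isPointSystem_point {len : Fin 4 → Fin 4 → ℕ} (pos : ∀ x y, x ≠ y → 1 ≤ len x y)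
    (len_symm : ∀ x y, len y x = len x y) : IsPointSystem len (point len) where
  pos := pos
  len_symm := len_symm
  rev x y i hxy hi := by
    have h1 := pos x y hxy
    have h2 := len_symm x y
    unfold point
    rcases lt_or_gt_of_ne hxy with h | h
    · simp only [h, not_lt.mpr h.le, if_true, if_false]
      split_ifs <;> first | rfl | omega | (simp only [Prod.mk.injEq, true_and]; omega)
    · simp only [h, not_lt.mpr h.le, if_true, if_false]
      split_ifs <;> first | rfl | omega | (simp only [Prod.mk.injEq, true_and]; omega)
  inj x y i j hxy hi hj he := by
    have h1 := pos x y hxy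
    unfold point at he
    split_ifs at he <;> simp only [Prod.mk.injEq] at he <;> omega
  meet x y z i j hxy hxz hyz hi hj := by
    have h1 := pos x y hxy
    have h2 := pos x z hxz
    constructor
    · intro he
      unfold point at he
      split_ifs at he <;> simp only [Prod.mk.injEq] at he <;> omega
    · rintro ⟨rfl, rfl⟩; rfl
  opp x y z w i j hxy hxz hxw hyz hyw hzw hi hj he := by
    unfold point at he
    split_ifs at he <;> simp only [Prod.mk.injEq] at he <;> omega

/-- `LineGraphModel` asks for a root on some `Fin n`, so the finitely many coded points are
numbered. Only points that occur are numbered, which makes the paths cover all vertices. -/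
theorem exists_isPointSystem {len : Fin 4 → Fin 4 → ℕ} (pos : ∀ x y, x ≠ y → 1 ≤ len x y)
    (len_symm : ∀ x y, len y x = len x y) :
    ∃ (n : ℕ) (q : Fin 4 → Fin 4 → ℕ → Fin n), IsPointSystem len q ∧
      ∀ w, ∃ x y i, x ≠ y ∧ i ≤ len x y ∧ q x y i = w := by
  classical
  have hP := isPointSystem_point pos len_symm
  let A : Set (Fin 4 × Fin 4 × ℕ) := {w | ∃ x y i, x ≠ y ∧ i ≤ len x y ∧ point len x y i = w}
  have hA : A.Finite := by
    refine Set.Finite.subset (Set.finite_iUnion fun x : Fin 4 => Set.finite_iUnion fun y : Fin 4 =>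
      (Set.finite_Iic (len x y)).image (point len x y)) ?_
    rintro w ⟨x, y, i, -, hi, rfl⟩
    exact Set.mem_iUnion.mpr ⟨x, Set.mem_iUnion.mpr ⟨y, i, hi, rfl⟩⟩
  have : Finite A := hA
  let e := Finite.equivFin A
  have hw₀ : point len 0 1 0 ∈ A := ⟨0, 1, 0, by decide, Nat.zero_le _, rfl⟩
  -- The value outside of `A` is arbitrary; only points in `A` occur in what follows.
  let f : Fin 4 × Fin 4 × ℕ → Fin (Nat.card A) := fun w => if h : w ∈ A then e ⟨w, h⟩ else e ⟨_, hw₀⟩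
  have hf : ∀ w ∈ A, ∀ w' ∈ A, f w = f w' ↔ w = w' := by
    intro w hw w' hw'
    simp only [f, hw, hw', dif_pos, e.injective.eq_iff, Subtype.mk.injEq]
  have hmem : ∀ x y i, x ≠ y → i ≤ len x y → point len x y i ∈ A :=
    fun x y i hxy hi => ⟨x, y, i, hxy, hi, rfl⟩
  refine ⟨_, fun x y i => f (point len x y i), ⟨pos, len_symm, ?_, ?_, ?_, ?_⟩, ?_⟩
  · intro x y i hxy hi
    exact congrArg f (hP.rev x y i hxy hi)
  · intro x y i j hxy hi hj he
    exact hP.inj x y i j hxy hi hj ((hf _ (hmem _ _ _ hxy hi) _ (hmem _ _ _ hxy hj)).mp he)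
  · intro x y z i j hxy hxz hyz hi hj
    rw [hf _ (hmem _ _ _ hxy hi) _ (hmem _ _ _ hxz hj)]
    exact hP.meet x y z i j hxy hxz hyz hi hj
  · intro x y z w i j hxy hxz hxw hyz hyw hzw hi hj
    rw [Ne, hf _ (hmem _ _ _ hxy hi) _ (hmem _ _ _ hzw hj)]
    exact hP.opp x y z w i j hxy hxz hxw hyz hyw hzw hi hj
  · intro w
    obtain ⟨⟨w', x, y, i, hxy, hi, rfl⟩, rfl⟩ := e.surjective w
    refine ⟨x, y, i, hxy, hi, ?_⟩
    simp only [f, dif_pos (hmem x y i hxy hi)]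

end PointSystemExists

section Root

variable {V W : Type*} {len : Fin 4 → Fin 4 → ℕ} {q : Fin 4 → Fin 4 → ℕ → W}

/-- The subdivision of `K4` with the given points. -/
def IsPointSystem.root (h : IsPointSystem len q) : SimpleGraph W where
  Adj u v := ∃ x y i, x ≠ y ∧ i < len x y ∧ u = q x y i ∧ v = q x y (i + 1)
  symm.symm u v := by
    rintro ⟨x, y, i, hxy, hi, rfl, rfl⟩
    have := h.len_symm x y
    refine ⟨y, x, len x y - 1 - i, hxy.symm, by omega, ?_, ?_⟩
    · rw [h.rev x y _ hxy (by omega)]; congr 1; omega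
    · rw [h.rev x y _ hxy (by omega)]; congr 1; omega
  loopless.irrefl u := by
    rintro ⟨x, y, i, hxy, hi, rfl, he⟩
    have := h.inj x y _ _ hxy (by omega) (by omega) he
    omega

theorem IsPointSystem.root_adj (h : IsPointSystem len q) {x y : Fin 4} {i : ℕ} (hxy : x ≠ y)
    (hi : i < len x y) : h.root.Adj (q x y i) (q x y (i + 1)) :=
  ⟨x, y, i, hxy, hi, rfl, rfl⟩

theorem IsPointSystem.start_eq (h : IsPointSystem len q) {x y z : Fin 4} (hxy : x ≠ y)
    (hxz : x ≠ z) : q x y 0 = q x z 0 := by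
  rcases eq_or_ne y z with rfl | hyz
  · rfl
  · exact (h.meet x y z 0 0 hxy hxz hyz (by omega) (by omega)).mpr ⟨rfl, rfl⟩

/-- The branch vertices of the subdivision with the given points. -/
def IsPointSystem.branch (h : IsPointSystem len q) : Fin 4 ↪ W where
  -- `x + 1` is merely some index other than `x`; by `start_eq` every other choice gives the same
  -- point.
  toFun x := q x (x + 1) 0
  inj' x y he := by
    by_contra hxy
    have h1 : ∀ x : Fin 4, x ≠ x + 1 := by decide
    simp only [h.start_eq (h1 x) hxy, h.start_eq (h1 y) (Ne.symm hxy), h.rev x y 0 hxy (by omega)] at he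
    have := h.inj x y _ _ hxy (by omega) (by omega) he
    have := h.pos x y hxy
    omega

theorem IsPointSystem.branch_eq (h : IsPointSystem len q) {x y : Fin 4} (hxy : x ≠ y) :
    h.branch x = q x y 0 :=
  h.start_eq ((by decide : ∀ x : Fin 4, x ≠ x + 1) x) hxy

theorem IsPointSystem.branch_eq' (h : IsPointSystem len q) {x y : Fin 4} (hxy : x ≠ y) :
    h.branch y = q x y (len x y) := by
  rw [h.branch_eq hxy.symm, h.rev x y 0 hxy (by omega), Nat.sub_zero]

theorem dart_ne (d : K4.Dart) : d.fst ≠ d.snd := d.adj.ne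

/-- The path of the subdivision that replaces an edge of `K4`. -/
def IsPointSystem.path (h : IsPointSystem len q) (d : K4.Dart) :
    h.root.Walk (h.branch d.fst) (h.branch d.snd) :=
  (walkOfFn (q d.fst d.snd) (len d.fst d.snd) fun _ hi => h.root_adj (dart_ne d) hi).copy (h.branch_eq (dart_ne d)).symm
      (h.branch_eq' (dart_ne d)).symm

theorem IsPointSystem.support_path (h : IsPointSystem len q) (d : K4.Dart) :
    (h.path d).support = (List.range (len d.fst d.snd + 1)).map (q d.fst d.snd) := by
  rw [path, Walk.support_copy, support_walkOfFn]

theorem IsPointSystem.length_path (h : IsPointSystem len q) (d : K4.Dart) :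
    (h.path d).length = len d.fst d.snd := by
  rw [path, Walk.length_copy, length_walkOfFn]

theorem IsPointSystem.getVert_path (h : IsPointSystem len q) (d : K4.Dart) (i : ℕ)
    (hi : i ≤ len d.fst d.snd) : (h.path d).getVert i = q d.fst d.snd i := by
  rw [path, Walk.getVert_copy, getVert_walkOfFn _ _ _ _ hi]

theorem IsPointSystem.mem_support_path (h : IsPointSystem len q) (d : K4.Dart) (w : W) :
    w ∈ (h.path d).support ↔ ∃ i ≤ len d.fst d.snd, q d.fst d.snd i = w := by
  rw [path, Walk.support_copy, mem_support_walkOfFn]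

theorem mem_edges_of_lt {G : SimpleGraph W} {u v : W} (p : G.Walk u v) {i : ℕ}
    (hi : i < p.length) : s(p.getVert i, p.getVert (i + 1)) ∈ p.edges := by
  have : p.edges[i]'(by simpa) = s(p.getVert i, p.getVert (i + 1)) := by
    simp [Walk.getElem_edges_eq_edge_getElem_darts, Walk.darts_getElem_eq_getVert]
  rw [← this]
  exact List.getElem_mem _

/-- A third branch vertex `u` is the far end of the path from `x` to `u`, and that path meets the
path from `x` to `y` at its start only. -/
theorem branch_of_mem {h : IsPointSystem len q} {x y u : Fin 4} {i : ℕ} (hxy : x ≠ y)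
    (hi : i ≤ len x y) (he : h.branch u = q x y i) : u = x ∨ u = y := by
  by_contra! hu
  obtain ⟨hux, huy⟩ := hu
  rw [h.branch_eq' hux.symm] at he
  have := (h.meet x u y _ i hux.symm hxy huy le_rfl hi).mp he
  have := h.pos x u hux.symm
  omega

/-- Two different paths of the subdivision either leave a common branch vertex, after reversal if
necessary, and meet nowhere else, or belong to disjoint edges of K4 and do not meet. -/
theorem mem_range_branch {h : IsPointSystem len q} {x y x' y' : Fin 4} {i i' : ℕ} (hxy : x ≠ y)
    (hxy' : x' ≠ y') (hi : i ≤ len x y) (hi' : i' ≤ len x' y') (h1 : ¬ (x' = x ∧ y' = y))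
    (h2 : ¬ (x' = y ∧ y' = x)) (he : q x y i = q x' y' i') : q x y i ∈ Set.range h.branch := by
  have key : ∀ {x y z : Fin 4} {i j : ℕ}, x ≠ y → x ≠ z → y ≠ z → i ≤ len x y → j ≤ len x z →
      q x y i = q x z j → q x y i ∈ Set.range h.branch := by
    intro x y z i j hxy hxz hyz hi hj he
    obtain ⟨rfl, rfl⟩ := (h.meet x y z i j hxy hxz hyz hi hj).mp he
    exact ⟨x, h.branch_eq hxy⟩
  have hs := h.len_symm x y
  have hs' := h.len_symm x' y'
  have e1 := h.rev y x i hxy.symm (by omega)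
  have e2 := h.rev y' x' i' hxy'.symm (by omega)
  rcases pair_cases x y x' y' hxy hxy' with ⟨rfl, rfl⟩ | ⟨rfl, rfl⟩ | ⟨rfl, h3⟩ | ⟨rfl, h3⟩ |
    ⟨rfl, h3⟩ | ⟨rfl, h3⟩ | ⟨h3, h4, h5, h6⟩
  · exact absurd ⟨rfl, rfl⟩ h1
  · exact absurd ⟨rfl, rfl⟩ h2
  · exact key hxy hxy' h3 hi hi' he
  · rw [e1] at he ⊢
    exact key hxy.symm hxy' h3 (by omega) hi' he
  · rw [e2] at he
    exact key hxy hxy'.symm h3 hi (by omega) he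
  · rw [e2, e1] at he
    rw [e1]
    exact key hxy.symm hxy'.symm h3 (by omega) (by omega) he
  · exact absurd he (h.opp _ _ _ _ _ _ hxy h3 h4 h5 h6 hxy' hi hi')

/-- The subdivision of `K4` with the given points. -/
def IsPointSystem.subdivision (h : IsPointSystem len q)
    (hcov : ∀ w, ∃ x y i, x ≠ y ∧ i ≤ len x y ∧ q x y i = w) : Subdivision K4 h.root where
  branch := h.branch
  path := h.path
  path_isPath d := by
    rw [Walk.isPath_def, h.support_path]
    refine (List.nodup_map_iff_inj_on List.nodup_range).mpr ?_
    intro i hi j hj he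
    rw [List.mem_range] at hi hj
    exact h.inj _ _ i j (dart_ne d) (by omega) (by omega) he
  path_symm d := by
    apply Walk.ext_support
    refine Eq.trans ?_ (Walk.support_reverse (h.path d)).symm
    rw [h.support_path, h.support_path]
    have h1 : d.symm.fst = d.snd := rfl
    have h2 : d.symm.snd = d.fst := rfl
    rw [h1, h2, h.len_symm]
    apply List.ext_getElem
    · simp
    · intro i hi hi'
      simp only [List.length_map, List.length_range] at hi
      simp only [List.getElem_map, List.getElem_range, List.getElem_reverse, List.length_map,
        List.length_range]
      rw [h.rev _ _ i (dart_ne d) (by omega)]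
      congr 1
  branch_mem d u hu := by
    obtain ⟨i, hi, he⟩ := (h.mem_support_path d _).mp hu
    exact branch_of_mem (dart_ne d) hi he.symm
  disjoint d d' x hdd' hx hx' := by
    obtain ⟨i, hi, rfl⟩ := (h.mem_support_path d _).mp hx
    obtain ⟨i', hi', he⟩ := (h.mem_support_path d' _).mp hx'
    refine mem_range_branch (dart_ne d) (dart_ne d') hi hi' ?_ ?_ he.symm
    · rintro ⟨h1, h2⟩
      exact hdd' (by rw [show d = d' from Dart.ext _ _ (Prod.ext h1.symm h2.symm)])
    · rintro ⟨h1, h2⟩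
      refine hdd' ?_
      rw [← d'.edge_symm, show d = d'.symm from Dart.ext _ _ (Prod.ext h2.symm h1.symm)]
  vertex_cover x := by
    obtain ⟨x, y, i, hxy, hi, rfl⟩ := hcov x
    exact Or.inr ⟨⟨(x, y), hxy⟩, (h.mem_support_path _ _).mpr ⟨i, hi, rfl⟩⟩
  edge_cover e he := by
    induction e using Sym2.ind with
    | _ u v =>
      obtain ⟨x, y, i, hxy, hi, rfl, rfl⟩ := he
      refine ⟨⟨(x, y), hxy⟩, ?_⟩
      have h1 := h.getVert_path ⟨(x, y), hxy⟩
      have h2 := mem_edges_of_lt (h.path ⟨(x, y), hxy⟩) (i := i) (by rwa [h.length_path])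
      rw [h1 i (by exact hi.le), h1 (i + 1) (by exact hi)] at h2
      exact h2

/-- A system of rungs induces the line graph of a proper subdivision of `K4`. -/
theorem IsRungSystem.isLGPSK4 {G : SimpleGraph V} {r : Fin 4 → Fin 4 → ℕ → V}
    (hR : IsRungSystem G len r) : IsLGPSK4 G (rungSet len r) := by
  obtain ⟨n, q, h, hcov⟩ := exists_isPointSystem hR.pos hR.len_symm
  have key := hR.correspondence h
  have hpos : ∀ e : h.root.edgeSet, ∃ x y i, x ≠ y ∧ i < len x y ∧
      (e : Sym2 (Fin n)) = s(q x y i, q x y (i + 1)) := by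
    rintro ⟨e, he⟩
    induction e using Sym2.ind with
    | _ u v =>
      obtain ⟨x, y, i, hxy, hi, hu, hv⟩ := he
      exact ⟨x, y, i, hxy, hi, congrArg₂ (fun a b => s(a, b)) hu hv⟩
  -- Each edge has a position in both directions of its path, and one of them is picked. By `key`
  -- the vertex of `G` at that position does not depend on the choice.
  choose X Y I hXY hI hE using hpos
  let f : h.root.edgeSet → rungSet len r := fun e =>
    ⟨r (X e) (Y e) (I e), X e, Y e, I e, hXY e, hI e, rfl⟩
  have hf : Function.Bijective f := by
    constructor
    · intro e e' hee'
      have := (key _ _ _ _ _ _ (hXY e) (hXY e') (hI e) (hI e')).1.mp (congrArg Subtype.val hee')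
      rw [← hE, ← hE] at this
      exact Subtype.ext this
    · rintro ⟨v, x, y, i, hxy, hi, rfl⟩
      let e : h.root.edgeSet := ⟨s(q x y i, q x y (i + 1)), x, y, i, hxy, hi, rfl, rfl⟩
      refine ⟨e, Subtype.ext ?_⟩
      refine (key _ _ _ _ _ _ (hXY e) hxy (hI e) hi).1.mpr ?_
      rw [← hE]
  refine ⟨⟨n, h.root, h.subdivision hcov, ?_, ⟨Equiv.ofBijective f hf, ?_⟩⟩⟩
  · obtain ⟨x, y, hxy, hlen⟩ := hR.proper
    exact ⟨⟨(x, y), hxy⟩, by simpa [IsPointSystem.subdivision, h.length_path] using hlen⟩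
  · intro e e'
    rw [lineGraph_adj_iff_exists]
    refine (key _ _ _ _ _ _ (hXY e) (hXY e') (hI e) (hI e')).2.trans ?_
    rw [← hE, ← hE, Ne, Ne, Subtype.ext_iff]

end Root

end LGK4

/-! ### From line graph models and frames to rung systems. -/

namespace LGK4

section Model

variable {V : Type*} {G : SimpleGraph V} {S : Set V}

/-- The dart of `K4` from `x` to `y`. -/
def dart {x y : Fin 4} (h : x ≠ y) : K4.Dart := ⟨(x, y), h⟩

theorem dart_fst_snd (d : K4.Dart) : dart (dart_ne d) = d := rfl

theorem dart_edge_ne {x y z w : Fin 4} (hxy : x ≠ y) (hzw : z ≠ w) (h1 : ¬ (x = z ∧ y = w))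
    (h2 : ¬ (x = w ∧ y = z)) : (dart hxy).edge ≠ (dart hzw).edge := by
  intro he
  have : s(x, y) = s(z, w) := he
  rw [Sym2.eq_iff] at this
  exact this.elim h1 h2

/-- The lengths of the paths of the subdivision. -/
def modelLen (M : LineGraphModel G S) (x y : Fin 4) : ℕ :=
  if h : x ≠ y then (M.subdiv.path (dart h)).length else 0

/-- The points of the paths of the subdivision. -/
def modelPoint (M : LineGraphModel G S) (x y : Fin 4) (i : ℕ) : Fin M.order :=
  if h : x ≠ y then (M.subdiv.path (dart h)).getVert i else M.subdiv.branch x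

theorem modelPoint_mem (M : LineGraphModel G S) {x y : Fin 4} (h : x ≠ y) (i : ℕ) :
    modelPoint M x y i ∈ (M.subdiv.path (dart h)).support := by
  rw [modelPoint, dif_pos h]
  exact Walk.getVert_mem_support _ _

theorem modelPoint_zero (M : LineGraphModel G S) {x y : Fin 4} (h : x ≠ y) :
    modelPoint M x y 0 = M.subdiv.branch x := by
  rw [modelPoint, dif_pos h, Walk.getVert_zero]; rfl

/-- Paths for different edges meet in branch vertices only, and a branch vertex on a path is one of
its ends. So a common vertex stands for a common end of the two edges of K4, and disjoint edges have
none. -/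
theorem isPointSystem_model (M : LineGraphModel G S) :
    IsPointSystem (modelLen M) (modelPoint M) where
  pos x y hxy := by
    rw [modelLen, dif_pos hxy, Nat.one_le_iff_ne_zero]
    exact fun h => hxy (M.subdiv.branch.injective (Walk.eq_of_length_eq_zero h))
  len_symm x y := by
    by_cases hxy : x = y
    · rw [hxy]
    · rw [modelLen, modelLen, dif_pos hxy, dif_pos (Ne.symm hxy)]
      have := M.subdiv.path_symm (dart hxy)
      refine (congrArg Walk.length this).trans (Walk.length_reverse _)
  rev x y i hxy hi := by
    rw [modelLen, dif_pos hxy] at *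
    rw [modelPoint, modelPoint, dif_pos hxy, dif_pos hxy.symm]
    have := M.subdiv.path_symm (dart hxy)
    refine (congrArg (fun p => Walk.getVert p i) this).trans (Walk.getVert_reverse _ _)
  inj x y i j hxy hi hj he := by
    rw [modelLen, dif_pos hxy] at hi hj
    simp only [modelPoint, dif_pos hxy] at he
    exact (M.subdiv.path_isPath (dart hxy)).getVert_injOn hi hj he
  meet x y z i j hxy hxz hyz hi hj := by
    constructor
    · intro he
      have h1 := modelPoint_mem M hxy i
      have h2 := modelPoint_mem M hxz j
      obtain ⟨u, hu⟩ := M.subdiv.disjoint (dart hxy) (dart hxz) _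
        (dart_edge_ne hxy hxz (fun h => hyz h.2) (fun h => hxz h.1)) h1 (he ▸ h2)
      rw [← hu] at h1
      rw [← he, ← hu] at h2
      have hux : u = x := by
        rcases M.subdiv.branch_mem _ _ h1 with h | h
        · exact h
        · exact (M.subdiv.branch_mem _ _ h2).elim id fun h' => absurd (h.symm.trans h') hyz
      subst hux
      rw [modelLen, dif_pos hxy] at hi
      rw [modelLen, dif_pos hxz] at hj
      rw [← modelPoint_zero M hxy] at hu
      have h3 : modelPoint M u z 0 = modelPoint M u z j := by
        rw [← he, ← hu, modelPoint_zero M hxz, modelPoint_zero M hxy]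
      simp only [modelPoint, dif_pos hxy, dif_pos hxz] at hu h3
      exact ⟨((M.subdiv.path_isPath (dart hxy)).getVert_injOn (Nat.zero_le _) hi hu).symm,
        ((M.subdiv.path_isPath (dart hxz)).getVert_injOn (Nat.zero_le _) hj h3).symm⟩
    · rintro ⟨rfl, rfl⟩
      rw [modelPoint_zero M hxy, modelPoint_zero M hxz]
  opp x y z w i j hxy hxz hxw hyz hyw hzw hi hj he := by
    have h1 := modelPoint_mem M hxy i
    have h2 := modelPoint_mem M hzw j
    obtain ⟨u, hu⟩ := M.subdiv.disjoint (dart hxy) (dart hzw) _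
      (dart_edge_ne hxy hzw (fun h => hxz h.1) (fun h => hxw h.1)) h1 (he ▸ h2)
    rw [← hu] at h1
    rw [← he, ← hu] at h2
    rcases M.subdiv.branch_mem _ _ h1 with h | h <;>
      rcases M.subdiv.branch_mem _ _ h2 with h' | h' <;> have := h.symm.trans h'
    · exact hxz this
    · exact hxw this
    · exact hyz this
    · exact hyw this

theorem modelEdge_mem (M : LineGraphModel G S) {x y : Fin 4} {i : ℕ} (hxy : x ≠ y)
    (hi : i < modelLen M x y) :
    s(modelPoint M x y i, modelPoint M x y (i + 1)) ∈ M.root.edgeSet := by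
  rw [modelLen, dif_pos hxy] at hi
  simp only [modelPoint, dif_pos hxy]
  exact Walk.edges_subset_edgeSet _ (mem_edges_of_lt _ hi)

/-- The rungs of a model form a system of rungs. -/
theorem exists_isRungSystem (M : LineGraphModel G S) :
    ∃ len r, IsRungSystem G len r ∧ rungSet len r = S ∧ ∀ x y (hxy : x ≠ y),
      (M.rung (dart hxy)).length = len x y ∧
      ∀ i < len x y, (M.rung (dart hxy))[i]? = some (r x y i) := by
  classical
  have hq := isPointSystem_model M
  have h01 : (0 : Fin 4) ≠ 1 := by decide
  -- A filler for `r` at arguments that are not positions on a rung.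
  let v₀ : V := M.iso ⟨_, modelEdge_mem M h01 (hq.pos 0 1 h01)⟩
  let r : Fin 4 → Fin 4 → ℕ → V := fun x y i =>
    if h : s(modelPoint M x y i, modelPoint M x y (i + 1)) ∈ M.root.edgeSet then M.iso ⟨_, h⟩ else v₀
  have hr : ∀ x y i (hxy : x ≠ y) (hi : i < modelLen M x y),
      r x y i = M.iso ⟨_, modelEdge_mem M hxy hi⟩ :=
    fun x y i hxy hi => dif_pos (modelEdge_mem M hxy hi)
  refine ⟨modelLen M, r, hq.isRungSystem ?_ ?_, ?_, ?_⟩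
  · intro x y i x' y' i' hxy hxy' hi hi'
    rw [hr x y i hxy hi, hr x' y' i' hxy' hi', Subtype.coe_inj, M.iso.injective.eq_iff,
      Subtype.mk.injEq]
    refine ⟨Iff.rfl, ?_⟩
    have := M.iso.map_adj_iff (v := ⟨_, modelEdge_mem M hxy hi⟩) (w := ⟨_, modelEdge_mem M hxy' hi'⟩)
    rw [lineGraph_adj_iff_exists, Ne, Subtype.mk.injEq] at this
    exact this
  · obtain ⟨d, hd⟩ := M.proper
    exact ⟨d.fst, d.snd, dart_ne d, by rw [modelLen, dif_pos (dart_ne d)]; exact hd⟩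
  · ext v
    constructor
    · rintro ⟨x, y, i, hxy, hi, rfl⟩
      rw [hr x y i hxy hi]
      exact Subtype.coe_prop _
    · intro hv
      obtain ⟨⟨e, he⟩, hev⟩ := M.iso.surjective ⟨v, hv⟩
      obtain ⟨d, hd⟩ := M.subdiv.edge_cover e he
      obtain ⟨i, hi, hie⟩ := List.getElem_of_mem hd
      rw [Walk.length_edges] at hi
      have hi' : i < modelLen M d.fst d.snd := by rwa [modelLen, dif_pos (dart_ne d)]
      refine ⟨d.fst, d.snd, i, dart_ne d, hi', ?_⟩
      rw [hr _ _ _ (dart_ne d) hi', show v = ((⟨v, hv⟩ : S) : V) from rfl, ← hev]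
      congr 3
      rw [← hie]
      simp only [modelPoint, dif_pos (dart_ne d)]
      simp [Walk.getElem_edges_eq_edge_getElem_darts, Walk.darts_getElem_eq_getVert, dart_fst_snd]
  · intro x y hxy
    have hl : (M.rung (dart hxy)).length = modelLen M x y := by
      rw [modelLen, dif_pos hxy, LineGraphModel.rung, List.length_pmap, Walk.length_edges]
    refine ⟨hl, fun i hi => ?_⟩
    rw [List.getElem?_eq_getElem (by omega), hr x y i hxy hi]
    simp only [LineGraphModel.rung, List.getElem_pmap]
    congr 4
    simp only [modelPoint, dif_pos hxy]
    simp [Walk.getElem_edges_eq_edge_getElem_darts, Walk.darts_getElem_eq_getVert]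

/-- The corners and the middle vertices of a system of rungs. -/
structure IsRungFrame (t : Tuple18 V) (len : Fin 4 → Fin 4 → ℕ) (r : Fin 4 → Fin 4 → ℕ → V)
    (α : Fin 4 → Fin 4 → ℕ) : Prop where
  corner : ∀ x y (h : x ≠ y), t.corner (dart h) = r x y 0
  mid : ∀ x y (h : x ≠ y), t.mid (dart h) = r x y (α x y)
  add : ∀ x y, x ≠ y → α x y + α y x + 1 = len x y
  le : ∀ x y, x ≠ y → α x y ≤ α y x + 1

theorem mid_symm (t : Tuple18 V) {x y : Fin 4} (h : x ≠ y) :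
    t.mid (dart h.symm) = t.mid (dart h) := by
  unfold Tuple18.mid
  congr 1
  exact Subtype.ext (Dart.edge_symm (dart h))

theorem exists_isRungFrame (M : LineGraphModel G S) {t : Tuple18 V} (ht : M.IsFrame t)
    {len r} (hR : IsRungSystem G len r) (hM : ∀ x y (hxy : x ≠ y),
      (M.rung (dart hxy)).length = len x y ∧
      ∀ i < len x y, (M.rung (dart hxy))[i]? = some (r x y i)) :
    ∃ α, IsRungFrame t len r α := by
  have h : ∀ x y, ∃ α β, ∀ h : x ≠ y, t.mid (dart h) = r x y α ∧ α + β + 1 = len x y ∧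
      α ≤ β + 1 ∧ β ≤ α + 1 := by
    intro x y
    by_cases hxy : x = y
    · exact ⟨0, 0, fun h => absurd hxy h⟩
    · obtain ⟨α, β, h1, h2, h3, h4⟩ := ht.middle (dart hxy)
      rw [(hM x y hxy).1] at h2
      rw [(hM x y hxy).2 α (by omega)] at h1
      exact ⟨α, β, fun _ => ⟨(Option.some.inj h1).symm, h2, h3, h4⟩⟩
  choose α β hα using h
  -- A frame speaks about the rung in each direction separately. Since `m_xy = m_yx` and the
  -- vertices of a rung are distinct, the two descriptions agree, and one function `α` suffices.
  have hβ : ∀ x y, x ≠ y → β x y = α y x := by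
    intro x y hxy
    obtain ⟨h1, h2, -, -⟩ := hα x y hxy
    obtain ⟨h3, h4, -, -⟩ := hα y x hxy.symm
    have hl := hR.len_symm x y
    rw [mid_symm t hxy, h1, hR.rev x y _ hxy (by omega)] at h3
    have := hR.inj x y _ _ hxy (by omega) (by omega) h3
    omega
  refine ⟨α, fun x y hxy => ?_, fun x y hxy => (hα x y hxy).1, fun x y hxy => ?_, fun x y hxy => ?_⟩
  · have := ht.corner (dart hxy)
    rw [(hM x y hxy).2 0 (hR.pos x y hxy)] at this
    exact (Option.some.inj this).symm
  · rw [← hβ x y hxy]; exact (hα x y hxy).2.1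
  · rw [← hβ x y hxy]; exact (hα x y hxy).2.2.1

/-- Every system of rungs has a frame. -/
theorem IsRungSystem.exists_frame {len r} (hR : IsRungSystem G len r) :
    ∃ t α, IsRungFrame t len r α := by
  classical
  -- Rounding down in one direction and taking the complement in the other makes the two halves add
  -- up to the rung, with lengths that differ by at most one.
  let α : Fin 4 → Fin 4 → ℕ := fun x y =>
    if x < y then (len x y - 1) / 2 else len x y - 1 - (len x y - 1) / 2
  have hα : ∀ x y, x ≠ y → α x y + α y x + 1 = len x y ∧ α x y ≤ α y x + 1 := by
    intro x y hxy
    have h1 := hR.len_symm x y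
    have h2 := hR.pos x y hxy
    rcases lt_or_gt_of_ne hxy with h | h
    · simp only [α, h, not_lt.mpr h.le, if_true, if_false]; omega
    · simp only [α, h, not_lt.mpr h.le, if_true, if_false]; omega
  -- The middle vertices are indexed by unoriented edges, so an arbitrary direction is picked for
  -- each; position `α x y` from `x` and `α y x` from `y` is the same vertex.
  let D : K4.edgeSet → K4.Dart := fun e => ⟨(e : Sym2 (Fin 4)).out, by
    have := e.2; rwa [← Quot.out_eq (e : Sym2 (Fin 4))] at this⟩
  have hD : ∀ e, (D e).edge = e := fun e => Quot.out_eq _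
  refine ⟨⟨fun d => r d.fst d.snd 0, fun e => r (D e).fst (D e).snd (α (D e).fst (D e).snd)⟩, α,
    fun _ _ _ => rfl, fun x y hxy => ?_, fun x y hxy => (hα x y hxy).1, fun x y hxy => (hα x y hxy).2⟩
  have h := hD ⟨(dart hxy).edge, (dart hxy).edge_mem⟩
  unfold Tuple18.mid
  dsimp only
  generalize D ⟨(dart hxy).edge, (dart hxy).edge_mem⟩ = d at h ⊢
  rcases dart_edge_eq_iff _ _ |>.mp h with rfl | rfl
  · rfl
  · have h1 := hα x y hxy
    change r y x (α y x) = r x y (α x y)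
    rw [hR.rev x y _ hxy (by omega)]
    congr 1; omega

end Model

end LGK4

/-! ### Rung systems given in one direction per rung. -/

namespace LGK4

section Orient

variable {V : Type*} {G : SimpleGraph V}

/-- Position `i` on the rung `xy` is its end at `z`. -/
def IsEnd (len : Fin 4 → Fin 4 → ℕ) (x y : Fin 4) (i : ℕ) (z : Fin 4) : Prop :=
  (z = x ∧ i = 0) ∨ (z = y ∧ i + 1 = len x y)

/-- A system of rungs in which every rung is given in one direction only. -/
structure IsHalfRungSystem (G : SimpleGraph V) (len : Fin 4 → Fin 4 → ℕ)
    (g : Fin 4 → Fin 4 → ℕ → V) : Prop where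
  pos : ∀ x y, x < y → 1 ≤ len x y
  inj : ∀ x y i j, x < y → i < len x y → j < len x y → g x y i = g x y j → i = j
  adj : ∀ x y i j, x < y → i < len x y → j < len x y →
    (G.Adj (g x y i) (g x y j) ↔ i + 1 = j ∨ j + 1 = i)
  cross : ∀ x y x' y' i j, x < y → x' < y' → x < x' ∨ x = x' ∧ y < y' → i < len x y →
    j < len x' y' → g x y i ≠ g x' y' j ∧
      (G.Adj (g x y i) (g x' y' j) ↔ ∃ z, IsEnd len x y i z ∧ IsEnd len x' y' j z)
  proper : ∃ x y, x < y ∧ 2 ≤ len x y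

theorem IsHalfRungSystem.cross' {len : Fin 4 → Fin 4 → ℕ} {g : Fin 4 → Fin 4 → ℕ → V}
    (h : IsHalfRungSystem G len g) (x y x' y' : Fin 4) (i j : ℕ) (hxy : x < y) (hxy' : x' < y')
    (hne : ¬ (x = x' ∧ y = y')) (hi : i < len x y) (hj : j < len x' y') :
    g x y i ≠ g x' y' j ∧
      (G.Adj (g x y i) (g x' y' j) ↔ ∃ z, IsEnd len x y i z ∧ IsEnd len x' y' j z) := by
  by_cases hlt : x < x' ∨ x = x' ∧ y < y'
  · exact h.cross x y x' y' i j hxy hxy' hlt hi hj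
  · have := h.cross x' y' x y j i hxy' hxy (by omega) hj hi
    refine ⟨this.1.symm, ?_⟩
    rw [G.adj_comm, this.2]
    exact exists_congr fun z => and_comm

/-- The lengths of the rungs in both directions. -/
def orientLen (len : Fin 4 → Fin 4 → ℕ) (x y : Fin 4) : ℕ :=
  if x < y then len x y else len y x

/-- The rungs in both directions. -/
def orientRung (len : Fin 4 → Fin 4 → ℕ) (g : Fin 4 → Fin 4 → ℕ → V) (x y : Fin 4) (i : ℕ) : V :=
  if x < y then g x y i else g y x (len y x - 1 - i)

/-- Every position has a counterpart on the increasing direction of its rung, with the same vertex.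
Being the end at `z` does not depend on the direction, so adjacency rules expressed by `IsEnd` carry
over. -/
theorem orientRung_normal (len : Fin 4 → Fin 4 → ℕ) (g : Fin 4 → Fin 4 → ℕ → V) {x y : Fin 4}
    {i : ℕ} (hxy : x ≠ y) (hi : i < orientLen len x y) :
    ∃ u v k, u < v ∧ k < len u v ∧ orientRung len g x y i = g u v k ∧
      ((x = u ∧ y = v) ∨ (x = v ∧ y = u)) ∧
      ∀ z, (IsEnd len u v k z ↔ IsEnd (orientLen len) x y i z) := by
  unfold orientLen at hi
  rcases lt_or_gt_of_ne hxy with h | h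
  · rw [if_pos h] at hi
    exact ⟨x, y, i, h, hi, by rw [orientRung, if_pos h], by tauto, fun z => by
      simp only [IsEnd, orientLen, if_pos h]⟩
  · rw [if_neg (not_lt.mpr h.le)] at hi
    refine ⟨y, x, len y x - 1 - i, h, by omega, by rw [orientRung, if_neg (not_lt.mpr h.le)],
      by tauto, fun z => ?_⟩
    simp only [IsEnd, orientLen, if_neg (not_lt.mpr h.le)]
    constructor
    · rintro (⟨h1, h2⟩ | ⟨h1, h2⟩)
      · exact Or.inr ⟨h1, by omega⟩
      · exact Or.inl ⟨h1, by omega⟩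
    · rintro (⟨h1, h2⟩ | ⟨h1, h2⟩)
      · exact Or.inr ⟨h1, by omega⟩
      · exact Or.inl ⟨h1, by omega⟩

theorem IsHalfRungSystem.isRungSystem {len : Fin 4 → Fin 4 → ℕ} {g : Fin 4 → Fin 4 → ℕ → V}
    (h : IsHalfRungSystem G len g) : IsRungSystem G (orientLen len) (orientRung len g) := by
  -- All rules for two different rungs are one rule: the vertices differ, and they are adjacent
  -- exactly when they are ends at a common vertex of K4. The rules for meeting and for disjoint
  -- rungs are special cases.
  have key : ∀ x y x' y' i j, x ≠ y → x' ≠ y' → ¬ (x = x' ∧ y = y') → ¬ (x = y' ∧ y = x') →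
      i < orientLen len x y → j < orientLen len x' y' →
      orientRung len g x y i ≠ orientRung len g x' y' j ∧
      (G.Adj (orientRung len g x y i) (orientRung len g x' y' j) ↔
        ∃ z, IsEnd (orientLen len) x y i z ∧ IsEnd (orientLen len) x' y' j z) := by
    intro x y x' y' i j hxy hxy' h1 h2 hi hj
    obtain ⟨u, v, k, huv, hk, he, hc, hz⟩ := orientRung_normal len g hxy hi
    obtain ⟨u', v', k', huv', hk', he', hc', hz'⟩ := orientRung_normal len g hxy' hj
    simp only [he, he', ← hz, ← hz']
    refine h.cross' u v u' v' k k' huv huv' ?_ hk hk'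
    rintro ⟨rfl, rfl⟩
    omega
  refine ⟨?_, ?_, ?_, ?_, ?_, ?_, ?_, ?_, ?_, ?_⟩
  · intro x y hxy
    unfold orientLen
    split_ifs with h1
    · exact h.pos x y h1
    · exact h.pos y x (by omega)
  · intro x y
    unfold orientLen
    rcases lt_trichotomy x y with h1 | rfl | h1
    · rw [if_pos h1, if_neg (not_lt.mpr h1.le)]
    · rfl
    · rw [if_pos h1, if_neg (not_lt.mpr h1.le)]
  · intro x y i hxy hi
    unfold orientLen at *
    unfold orientRung
    rcases lt_or_gt_of_ne hxy with h1 | h1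
    · simp only [if_pos h1, if_neg (not_lt.mpr h1.le)] at *
    · simp only [if_pos h1, if_neg (not_lt.mpr h1.le)] at *
      congr 1; omega
  · intro x y i j hxy hi hj he
    unfold orientLen at *
    unfold orientRung at he
    rcases lt_or_gt_of_ne hxy with h1 | h1
    · simp only [if_pos h1] at *
      exact h.inj x y i j h1 hi hj he
    · simp only [if_neg (not_lt.mpr h1.le)] at *
      have := h.inj y x _ _ h1 (by omega) (by omega) he
      omega
  · intro x y i j hxy hi hj
    unfold orientLen at *
    unfold orientRung
    rcases lt_or_gt_of_ne hxy with h1 | h1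
    · simp only [if_pos h1] at *
      exact h.adj x y i j h1 hi hj
    · simp only [if_neg (not_lt.mpr h1.le)] at *
      rw [h.adj y x _ _ h1 (by omega) (by omega)]
      omega
  · intro x y z i j hxy hxz hyz hi hj
    exact (key x y x z i j hxy hxz (fun h => hyz h.2) (fun h => hxz h.1) hi hj).1
  · intro x y z i j hxy hxz hyz hi hj
    rw [(key x y x z i j hxy hxz (fun h => hyz h.2) (fun h => hxz h.1) hi hj).2]
    unfold IsEnd
    constructor
    · rintro ⟨w, h1 | h1, h2 | h2⟩
      · exact ⟨h1.2, h2.2⟩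
      · exact absurd (h1.1.symm.trans h2.1) hxz
      · exact absurd (h2.1.symm.trans h1.1) hxy
      · exact absurd (h1.1.symm.trans h2.1) hyz
    · rintro ⟨rfl, rfl⟩
      exact ⟨x, Or.inl ⟨rfl, rfl⟩, Or.inl ⟨rfl, rfl⟩⟩
  · intro x y z w i j hxy hxz hxw hyz hyw hzw hi hj
    exact (key x y z w i j hxy hzw (fun h => hxz h.1) (fun h => hxw h.1) hi hj).1
  · intro x y z w i j hxy hxz hxw hyz hyw hzw hi hj
    rw [(key x y z w i j hxy hzw (fun h => hxz h.1) (fun h => hxw h.1) hi hj).2]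
    rintro ⟨v, h1 | h1, h2 | h2⟩
    · exact hxz (h1.1.symm.trans h2.1)
    · exact hxw (h1.1.symm.trans h2.1)
    · exact hyz (h1.1.symm.trans h2.1)
    · exact hyw (h1.1.symm.trans h2.1)
  · obtain ⟨x, y, hxy, hl⟩ := h.proper
    exact ⟨x, y, hxy.ne, by rwa [orientLen, if_pos hxy]⟩

theorem rungSet_orient (len : Fin 4 → Fin 4 → ℕ) (g : Fin 4 → Fin 4 → ℕ → V) :
    rungSet (orientLen len) (orientRung len g) = {v | ∃ x y i, x < y ∧ i < len x y ∧ g x y i = v} := by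
  ext v
  constructor
  · rintro ⟨x, y, i, hxy, hi, rfl⟩
    obtain ⟨u, v, k, huv, hk, he, -, -⟩ := orientRung_normal len g hxy hi
    exact ⟨u, v, k, huv, hk, he.symm⟩
  · rintro ⟨x, y, i, hxy, hi, rfl⟩
    exact ⟨x, y, i, hxy.ne, by rwa [orientLen, if_pos hxy], by rw [orientRung, if_pos hxy]⟩

/-- The converse of `IsHalfRungSystem.isRungSystem`. -/
theorem IsRungSystem.isHalfRungSystem {len : Fin 4 → Fin 4 → ℕ} {r : Fin 4 → Fin 4 → ℕ → V}
    (h : IsRungSystem G len r) : IsHalfRungSystem G len r where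
  pos x y hxy := h.pos x y hxy.ne
  inj x y i j hxy := h.inj x y i j hxy.ne
  adj x y i j hxy := h.adj x y i j hxy.ne
  cross := by
    intro x y x' y' i j hxy hxy' hlt hi hj
    have key := position_induction h.len_symm (Q := fun x y i x' y' j =>
      ¬ (x = x' ∧ y = y') → ¬ (x = y' ∧ y = x') → r x y i ≠ r x' y' j ∧
      (G.Adj (r x y i) (r x' y' j) ↔ ∃ z, IsEnd len x y i z ∧ IsEnd len x' y' j z))
      ?_ ?_ ?_ ?_ ?_ x y i x' y' j hxy.ne hxy'.ne hi hj
    · exact key (by omega) (by omega)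
    · intro x y i x' y' i' hxy hxy' hi hi' hQ h1 h2
      rw [h.rev x y i hxy hi]
      refine (hQ (fun h => h2 h.symm) (fun h => h1 h.symm)).imp_right fun h3 => h3.trans ?_
      refine exists_congr fun z => and_congr_left fun _ => ?_
      have := h.len_symm x y
      unfold IsEnd
      constructor <;> rintro (⟨h1, h2⟩ | ⟨h1, h2⟩) <;> [right; left; right; left] <;>
        exact ⟨h1, by omega⟩
    · intro x y i x' y' i' hxy hxy' hi hi' hQ h1 h2
      rw [h.rev x' y' i' hxy' hi']
      refine (hQ h2 h1).imp_right fun h3 => h3.trans ?_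
      refine exists_congr fun z => and_congr_right fun _ => ?_
      have := h.len_symm x' y'
      unfold IsEnd
      constructor <;> rintro (⟨h1, h2⟩ | ⟨h1, h2⟩) <;> [right; left; right; left] <;>
        exact ⟨h1, by omega⟩
    · intro x y i j hxy hi hj h1
      exact absurd ⟨rfl, rfl⟩ h1
    · intro x y z i j hxy hxz hyz hi hj _ _
      refine ⟨h.meet_ne x y z i j hxy hxz hyz hi hj, ?_⟩
      rw [h.meet_adj x y z i j hxy hxz hyz hi hj]
      unfold IsEnd
      constructor
      · rintro ⟨rfl, rfl⟩
        exact ⟨x, Or.inl ⟨rfl, rfl⟩, Or.inl ⟨rfl, rfl⟩⟩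
      · rintro ⟨w, h1 | h1, h2 | h2⟩
        · exact ⟨h1.2, h2.2⟩
        · exact absurd (h1.1.symm.trans h2.1) hxz
        · exact absurd (h2.1.symm.trans h1.1) hxy
        · exact absurd (h1.1.symm.trans h2.1) hyz
    · intro x y z w i j hxy hxz hxw hyz hyw hzw hi hj _ _
      refine ⟨h.opp_ne x y z w i j hxy hxz hxw hyz hyw hzw hi hj,
        fun h1 => absurd h1 (h.opp_adj x y z w i j hxy hxz hxw hyz hyw hzw hi hj), ?_⟩
      rintro ⟨v, h1 | h1, h2 | h2⟩
      · exact absurd (h1.1.symm.trans h2.1) hxz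
      · exact absurd (h1.1.symm.trans h2.1) hxw
      · exact absurd (h1.1.symm.trans h2.1) hyz
      · exact absurd (h1.1.symm.trans h2.1) hyw
  proper := by
    obtain ⟨x, y, hxy, hl⟩ := h.proper
    rcases lt_or_gt_of_ne hxy with h1 | h1
    · exact ⟨x, y, h1, hl⟩
    · exact ⟨y, x, h1, by rwa [h.len_symm]⟩

end Orient

end LGK4

/-! ### Prisms, hops, and the assembly of a subgraph from six rungs. -/

namespace LGK4

section Prism

variable {V : Type*} {G : SimpleGraph V}

/-- Three paths `f a 0, …, f a (l a)` between two triangles, with no other edges between them. -/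
structure IsPrism (G : SimpleGraph V) (f : Fin 3 → ℕ → V) (l : Fin 3 → ℕ) : Prop where
  path : ∀ a, IsInducedPath G (f a) (l a)
  ne : ∀ a b i j, a ≠ b → i ≤ l a → j ≤ l b → f a i ≠ f b j
  adj : ∀ a b i j, a ≠ b → i ≤ l a → j ≤ l b →
    (G.Adj (f a i) (f b j) ↔ (i = 0 ∧ j = 0) ∨ (i = l a ∧ j = l b))

/-- An induced path `q 0, …, q t` outside of a prism, only the first vertex of which has
neighbours on the path `f 0`, and only the last vertex of which has neighbours on the other two
paths of the prism. -/
structure IsHop (G : SimpleGraph V) (f : Fin 3 → ℕ → V) (l : Fin 3 → ℕ) (q : ℕ → V) (t : ℕ) :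
    Prop where
  path : IsInducedPath G q t
  notMem : ∀ a i s, i ≤ l a → s ≤ t → q s ≠ f a i
  left : ∀ s i, s ≤ t → s ≠ 0 → i ≤ l 0 → ¬ G.Adj (q s) (f 0 i)
  right : ∀ a s i, a ≠ 0 → s < t → i ≤ l a → ¬ G.Adj (q s) (f a i)
  inner : ∀ a i, a ≠ 0 → i ≤ l a → G.Adj (q t) (f a i) → 0 < i ∧ i < l a
  -- The second alternative serves hops that start at a corner of the deleted rung. Such a vertex
  -- sees the two vertices where two rungs join, and one of these may be an end of the prism path if
  -- a rung has a single vertex.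
  left_inner : (∀ i ≤ l 0, G.Adj (q 0) (f 0 i) → 0 < i ∧ i < l 0) ∨
    (0 < t ∧ ∃ i < l 0, ∀ j ≤ l 0, (G.Adj (q 0) (f 0 j) ↔ j = i ∨ j = i + 1))
  exists_left : ∃ i ≤ l 0, G.Adj (q 0) (f 0 i)
  exists_right : ∃ a i, a ≠ 0 ∧ i ≤ l a ∧ G.Adj (q t) (f a i)

/-- The rungs of a line graph of a subdivision of `K4`, given one by one. -/
theorem exists_isLGPSK4_of_rungs (L₀₁ L₀₂ L₀₃ L₁₂ L₁₃ L₂₃ : ℕ) (g₀₁ g₀₂ g₀₃ g₁₂ g₁₃ g₂₃ : ℕ → V)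
    (p₀₁ : IsInducedPath G g₀₁ L₀₁) (p₀₂ : IsInducedPath G g₀₂ L₀₂)
    (p₀₃ : IsInducedPath G g₀₃ L₀₃) (p₁₂ : IsInducedPath G g₁₂ L₁₂)
    (p₁₃ : IsInducedPath G g₁₃ L₁₃) (p₂₃ : IsInducedPath G g₂₃ L₂₃)
    (h₁ : ∀ i ≤ L₀₁, ∀ j ≤ L₀₂, g₀₁ i ≠ g₀₂ j ∧ (G.Adj (g₀₁ i) (g₀₂ j) ↔ i = 0 ∧ j = 0))
    (h₂ : ∀ i ≤ L₀₁, ∀ j ≤ L₀₃, g₀₁ i ≠ g₀₃ j ∧ (G.Adj (g₀₁ i) (g₀₃ j) ↔ i = 0 ∧ j = 0))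
    (h₃ : ∀ i ≤ L₀₁, ∀ j ≤ L₁₂, g₀₁ i ≠ g₁₂ j ∧ (G.Adj (g₀₁ i) (g₁₂ j) ↔ i = L₀₁ ∧ j = 0))
    (h₄ : ∀ i ≤ L₀₁, ∀ j ≤ L₁₃, g₀₁ i ≠ g₁₃ j ∧ (G.Adj (g₀₁ i) (g₁₃ j) ↔ i = L₀₁ ∧ j = 0))
    (h₅ : ∀ i ≤ L₀₁, ∀ j ≤ L₂₃, g₀₁ i ≠ g₂₃ j ∧ ¬ G.Adj (g₀₁ i) (g₂₃ j))
    (h₆ : ∀ i ≤ L₀₂, ∀ j ≤ L₀₃, g₀₂ i ≠ g₀₃ j ∧ (G.Adj (g₀₂ i) (g₀₃ j) ↔ i = 0 ∧ j = 0))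
    (h₇ : ∀ i ≤ L₀₂, ∀ j ≤ L₁₂, g₀₂ i ≠ g₁₂ j ∧ (G.Adj (g₀₂ i) (g₁₂ j) ↔ i = L₀₂ ∧ j = L₁₂))
    (h₈ : ∀ i ≤ L₀₂, ∀ j ≤ L₁₃, g₀₂ i ≠ g₁₃ j ∧ ¬ G.Adj (g₀₂ i) (g₁₃ j))
    (h₉ : ∀ i ≤ L₀₂, ∀ j ≤ L₂₃, g₀₂ i ≠ g₂₃ j ∧ (G.Adj (g₀₂ i) (g₂₃ j) ↔ i = L₀₂ ∧ j = 0))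
    (h₁₀ : ∀ i ≤ L₀₃, ∀ j ≤ L₁₂, g₀₃ i ≠ g₁₂ j ∧ ¬ G.Adj (g₀₃ i) (g₁₂ j))
    (h₁₁ : ∀ i ≤ L₀₃, ∀ j ≤ L₁₃, g₀₃ i ≠ g₁₃ j ∧ (G.Adj (g₀₃ i) (g₁₃ j) ↔ i = L₀₃ ∧ j = L₁₃))
    (h₁₂ : ∀ i ≤ L₀₃, ∀ j ≤ L₂₃, g₀₃ i ≠ g₂₃ j ∧ (G.Adj (g₀₃ i) (g₂₃ j) ↔ i = L₀₃ ∧ j = L₂₃))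
    (h₁₃ : ∀ i ≤ L₁₂, ∀ j ≤ L₁₃, g₁₂ i ≠ g₁₃ j ∧ (G.Adj (g₁₂ i) (g₁₃ j) ↔ i = 0 ∧ j = 0))
    (h₁₄ : ∀ i ≤ L₁₂, ∀ j ≤ L₂₃, g₁₂ i ≠ g₂₃ j ∧ (G.Adj (g₁₂ i) (g₂₃ j) ↔ i = L₁₂ ∧ j = 0))
    (h₁₅ : ∀ i ≤ L₁₃, ∀ j ≤ L₂₃, g₁₃ i ≠ g₂₃ j ∧ (G.Adj (g₁₃ i) (g₂₃ j) ↔ i = L₁₃ ∧ j = L₂₃))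
    (hp : 1 ≤ L₀₃) (T : Set V) (t₀₁ : ∀ i ≤ L₀₁, g₀₁ i ∈ T) (t₀₂ : ∀ i ≤ L₀₂, g₀₂ i ∈ T)
    (t₀₃ : ∀ i ≤ L₀₃, g₀₃ i ∈ T) (t₁₂ : ∀ i ≤ L₁₂, g₁₂ i ∈ T) (t₁₃ : ∀ i ≤ L₁₃, g₁₃ i ∈ T)
    (t₂₃ : ∀ i ≤ L₂₃, g₂₃ i ∈ T) : ∃ T' ⊆ T, IsLGPSK4 G T' := by
  -- Only the entries above the diagonal matter; the others are fillers.
  let len : Fin 4 → Fin 4 → ℕ := ![![0, L₀₁ + 1, L₀₂ + 1, L₀₃ + 1], ![0, 0, L₁₂ + 1, L₁₃ + 1],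
    ![0, 0, 0, L₂₃ + 1], ![0, 0, 0, 0]]
  let g : Fin 4 → Fin 4 → ℕ → V := ![![g₀₁, g₀₁, g₀₂, g₀₃], ![g₀₁, g₀₁, g₁₂, g₁₃],
    ![g₀₁, g₀₁, g₀₁, g₂₃], ![g₀₁, g₀₁, g₀₁, g₀₁]]
  have hlt : ∀ {P : Fin 4 → Fin 4 → Prop}, P 0 1 → P 0 2 → P 0 3 → P 1 2 → P 1 3 → P 2 3 →
      ∀ x y, x < y → P x y := by
    intro P _ _ _ _ _ _ x y hxy
    fin_cases x <;> fin_cases y <;> first | assumption | exact absurd hxy (by decide)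
  have hpath : ∀ x y, x < y → IsInducedPath G (g x y) (len x y - 1) :=
    hlt p₀₁ p₀₂ p₀₃ p₁₂ p₁₃ p₂₃
  have hpos : ∀ x y, x < y → 1 ≤ len x y := by
    apply hlt <;> simp [len]
  have hg : IsHalfRungSystem G len g := by
    refine ⟨hpos, ?_, ?_, ?_, 0, 3, by decide, by simpa [len] using hp⟩
    · intro x y i j hxy hi hj
      exact (hpath x y hxy).inj i (by omega) j (by omega)
    · intro x y i j hxy hi hj
      exact (hpath x y hxy).adj i (by omega) j (by omega)
    · intro x y x' y' i j hxy hxy' hlex hi hj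
      revert i j
      revert x y
      -- Two different edges of K4 have at most one common vertex, so the quantifier over common
      -- ends can be instantiated with it.
      have e : ∀ {x y x' y' : Fin 4} {i j : ℕ} (z : Fin 4),
        (∀ w, IsEnd len x y i w ∧ IsEnd len x' y' j w → w = z) →
        ((∃ w, IsEnd len x y i w ∧ IsEnd len x' y' j w) ↔
          IsEnd len x y i z ∧ IsEnd len x' y' j z) := by
        intro x y x' y' i j z h
        exact ⟨fun ⟨w, hw⟩ => h w hw ▸ hw, fun h => ⟨z, h⟩⟩
      have e' : ∀ {x y x' y' : Fin 4} {i j : ℕ},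
        x ≠ x' → x ≠ y' → y ≠ x' → y ≠ y' →
        ((∃ w, IsEnd len x y i w ∧ IsEnd len x' y' j w) ↔ False) := by
        intro x y x' y' i j _ _ _ _
        refine iff_false_intro ?_
        rintro ⟨v, h1 | h1, h2 | h2⟩ <;> have := h1.1.symm.trans h2.1 <;> contradiction
      have conv : ∀ {x y x' y' : Fin 4} {P : ℕ → ℕ → Prop},
        (∀ i j, (∃ w, IsEnd len x y i w ∧ IsEnd len x' y' j w) ↔ P i j) →
        (∀ i ≤ len x y - 1, ∀ j ≤ len x' y' - 1,
          g x y i ≠ g x' y' j ∧ (G.Adj (g x y i) (g x' y' j) ↔ P i j)) →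
        ∀ i j, i < len x y → j < len x' y' → g x y i ≠ g x' y' j ∧
          (G.Adj (g x y i) (g x' y' j) ↔ ∃ w, IsEnd len x y i w ∧ IsEnd len x' y' j w) := by
        intro x y x' y' P h1 h2 i j hi hj
        rw [h1]
        exact h2 i (by omega) j (by omega)
      have conv₀ : ∀ {x y x' y' : Fin 4}, x ≠ x' → x ≠ y' → y ≠ x' → y ≠ y' →
        (∀ i ≤ len x y - 1, ∀ j ≤ len x' y' - 1,
          g x y i ≠ g x' y' j ∧ ¬ G.Adj (g x y i) (g x' y' j)) →
        ∀ i j, i < len x y → j < len x' y' → g x y i ≠ g x' y' j ∧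
          (G.Adj (g x y i) (g x' y' j) ↔ ∃ w, IsEnd len x y i w ∧ IsEnd len x' y' j w) := by
        intro x y x' y' a b c d h2 i j hi hj
        rw [e' a b c d, iff_false]
        exact h2 i (by omega) j (by omega)
      have c := fun (x y x' y' z : Fin 4) i j => @e x y x' y' i j z
      intro x y hxy hlex
      fin_cases x <;> fin_cases y <;> first | exact absurd hxy (by decide) | skip
      all_goals fin_cases x' <;> fin_cases y' <;>
        first | exact absurd hxy' (by decide) | exact absurd hlex (by decide) | skip
      · refine conv (P := fun i j => i = 0 ∧ j = 0) (fun i j => ?_) h₁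
        rw [c _ _ _ _ 0] <;> simp [IsEnd]
        omega
      · refine conv (P := fun i j => i = 0 ∧ j = 0) (fun i j => ?_) h₂
        rw [c _ _ _ _ 0] <;> simp [IsEnd]
        omega
      · refine conv (P := fun i j => i = L₀₁ ∧ j = 0) (fun i j => ?_) h₃
        rw [c _ _ _ _ 1] <;> simp [IsEnd, len]
        omega
      · refine conv (P := fun i j => i = L₀₁ ∧ j = 0) (fun i j => ?_) h₄
        rw [c _ _ _ _ 1] <;> simp [IsEnd, len]
        omega
      · exact conv₀ (by decide) (by decide) (by decide) (by decide) h₅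
      · refine conv (P := fun i j => i = 0 ∧ j = 0) (fun i j => ?_) h₆
        rw [c _ _ _ _ 0] <;> simp [IsEnd]
        omega
      · refine conv (P := fun i j => i = L₀₂ ∧ j = L₁₂) (fun i j => ?_) h₇
        rw [c _ _ _ _ 2] <;> simp [IsEnd, len]
        omega
      · exact conv₀ (by decide) (by decide) (by decide) (by decide) h₈
      · refine conv (P := fun i j => i = L₀₂ ∧ j = 0) (fun i j => ?_) h₉
        rw [c _ _ _ _ 2] <;> simp [IsEnd, len]
        omega
      · exact conv₀ (by decide) (by decide) (by decide) (by decide) h₁₀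
      · refine conv (P := fun i j => i = L₀₃ ∧ j = L₁₃) (fun i j => ?_) h₁₁
        rw [c _ _ _ _ 3] <;> simp [IsEnd, len]
        omega
      · refine conv (P := fun i j => i = L₀₃ ∧ j = L₂₃) (fun i j => ?_) h₁₂
        rw [c _ _ _ _ 3] <;> simp [IsEnd, len]
        omega
      · refine conv (P := fun i j => i = 0 ∧ j = 0) (fun i j => ?_) h₁₃
        rw [c _ _ _ _ 1] <;> simp [IsEnd]
        omega
      · refine conv (P := fun i j => i = L₁₂ ∧ j = 0) (fun i j => ?_) h₁₄
        rw [c _ _ _ _ 2] <;> simp [IsEnd, len]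
        omega
      · refine conv (P := fun i j => i = L₁₃ ∧ j = L₂₃) (fun i j => ?_) h₁₅
        rw [c _ _ _ _ 3] <;> simp [IsEnd, len]
        omega
  refine ⟨_, ?_, hg.isRungSystem.isLGPSK4⟩
  rw [rungSet_orient]
  rintro v ⟨x, y, i, hxy, hi, rfl⟩
  revert i
  revert x y
  apply hlt <;> intro i hi
  · exact t₀₁ i (Nat.lt_succ_iff.mp hi)
  · exact t₀₂ i (Nat.lt_succ_iff.mp hi)
  · exact t₀₃ i (Nat.lt_succ_iff.mp hi)
  · exact t₁₂ i (Nat.lt_succ_iff.mp hi)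
  · exact t₁₃ i (Nat.lt_succ_iff.mp hi)
  · exact t₂₃ i (Nat.lt_succ_iff.mp hi)

end Prism

end LGK4

/-! ### A hop over a prism yields a pyramid or a line graph of a proper subdivision of K4. -/

namespace LGK4

section Hop

variable {V : Type*} {G : SimpleGraph V} {f : Fin 3 → ℕ → V} {l : Fin 3 → ℕ} {q : ℕ → V} {t : ℕ}

/-- The vertices `f i, …, f j`. -/
def seg (f : ℕ → V) (i j : ℕ) : Set V := {v | ∃ k, i ≤ k ∧ k ≤ j ∧ f k = v}

theorem mem_seg {f : ℕ → V} {i j k : ℕ} (h1 : i ≤ k) (h2 : k ≤ j) : f k ∈ seg f i j :=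
  ⟨k, h1, h2, rfl⟩

theorem IsPrism.reachIn (P : IsPrism G f l) (a : Fin 3) {X : Set V} {i j : ℕ} (hij : i ≤ j)
    (hj : j ≤ l a) (hX : ∀ k, i ≤ k → k ≤ j → f a k ∈ X) : ReachIn G X (f a i) (f a j) :=
  (P.path a).reachIn hij hj hX

/-- Away from the second triangle, the paths of a prism are joined at the first triangle only. -/
theorem IsPrism.cross (P : IsPrism G f l) {a b : Fin 3} {i j : ℕ} (hab : a ≠ b) (hi : i ≤ l a)
    (hj : j ≤ l b) (h : i < l a ∨ j < l b) :
    f a i ≠ f b j ∧ (G.Adj (f a i) (f b j) → f a i = f a 0 ∧ f b j = f b 0) := by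
  refine ⟨P.ne a b i j hab hi hj, fun hadj => ?_⟩
  rcases (P.adj a b i j hab hi hj).mp hadj with ⟨rfl, rfl⟩ | ⟨h1, h2⟩
  · exact ⟨rfl, rfl⟩
  · omega

/-- The two positions are neither both first nor both last, so the vertices are not adjacent and any
`C` follows; this is the form that `containsPyramid_of_sets` takes. -/
theorem IsPrism.cross_ne (P : IsPrism G f l) {a b : Fin 3} {i j : ℕ} (hab : a ≠ b) (hi : i ≤ l a)
    (hj : j ≤ l b) (h : i < l a ∨ j < l b) (h' : 0 < i ∨ 0 < j) (C : Prop) :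
    f a i ≠ f b j ∧ (G.Adj (f a i) (f b j) → C) := by
  refine ⟨P.ne a b i j hab hi hj, fun hadj => ?_⟩
  rcases (P.adj a b i j hab hi hj).mp hadj with ⟨h1, h2⟩ | ⟨h1, h2⟩ <;> omega

theorem IsPrism.gap (P : IsPrism G f l) {a : Fin 3} {i j : ℕ} (hij : i + 1 < j) (hj : j ≤ l a)
    (C : Prop) : f a i ≠ f a j ∧ (G.Adj (f a i) (f a j) → C) := by
  refine ⟨fun h => ?_, fun h => ?_⟩
  · have := (P.path a).inj i (by omega) j hj h
    omega
  · have := ((P.path a).adj i (by omega) j hj).mp h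
    omega

theorem IsPrism.triangle (P : IsPrism G f l) :
    G.Adj (f 0 0) (f 1 0) ∧ G.Adj (f 0 0) (f 2 0) ∧ G.Adj (f 1 0) (f 2 0) :=
  ⟨(P.adj 0 1 0 0 (by decide) (by omega) (by omega)).mpr (Or.inl ⟨rfl, rfl⟩),
    (P.adj 0 2 0 0 (by decide) (by omega) (by omega)).mpr (Or.inl ⟨rfl, rfl⟩),
    (P.adj 1 2 0 0 (by decide) (by omega) (by omega)).mpr (Or.inl ⟨rfl, rfl⟩)⟩

theorem IsHop.right_cross (H : IsHop G f l q t) {a : Fin 3} {s i : ℕ} (ha : a ≠ 0) (hs : s < t)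
    (hi : i ≤ l a) (C : Prop) : q s ≠ f a i ∧ (G.Adj (q s) (f a i) → C) :=
  ⟨H.notMem a i s hi hs.le, fun h => absurd h (H.right a s i ha hs hi)⟩

theorem IsHop.not_adj_start (H : IsHop G f l q t) {a : Fin 3} (ha : a ≠ 0) :
    ¬ G.Adj (q t) (f a 0) := fun h => by
  have := H.inner a 0 ha (Nat.zero_le _) h
  omega

theorem IsHop.not_adj_start_any (H : IsHop G f l q t) {a : Fin 3} {s : ℕ} (hs : s ≤ t)
    (ha : a ≠ 0) : ¬ G.Adj (q s) (f a 0) := by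
  rcases hs.lt_or_eq with h | rfl
  · exact H.right a s 0 ha h (Nat.zero_le _)
  · exact H.not_adj_start ha

/-- The part of a hop before its last vertex, extended along the first path of the prism to the
first triangle. -/
theorem IsHop.reach_left (P : IsPrism G f l) (H : IsHop G f l q t) {i : ℕ} (hi : i ≤ l 0)
    (hadj : G.Adj (q 0) (f 0 i)) :
    ReachIn G (insert (q t) ({v | ∃ s < t, q s = v} ∪ seg (f 0) 0 i)) (q t) (f 0 0) := by
  have hmem : ∀ k, 0 ≤ k → k ≤ t → q k ∈ insert (q t) ({v | ∃ s < t, q s = v} ∪ seg (f 0) 0 i) := by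
    intro k _ hk
    rcases hk.lt_or_eq with h | rfl
    · exact Or.inr (Or.inl ⟨k, h, rfl⟩)
    · exact Or.inl rfl
  refine ((H.path.reachIn (Nat.zero_le t) le_rfl hmem).symm.trans
    (ReachIn.adj hadj (hmem 0 le_rfl (Nat.zero_le _)) (Or.inr (Or.inr (mem_seg (Nat.zero_le _) le_rfl))))).trans ?_
  exact (P.reachIn 0 (Nat.zero_le i) hi fun k h1 h2 => Or.inr (Or.inr (mem_seg h1 h2))).symm

/-- The apex is the last vertex of the hop. Its three paths to the first triangle go back along the
hop and down `f 0`, down `f 1`, and down `f 2`. Its neighbours on `f 1` and `f 2` are inner, so the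
second triangle is not reached there. -/
theorem IsHop.pyramid_of_both (P : IsPrism G f l) (H : IsHop G f l q t) {j₁ j₂ : ℕ}
    (h₁ : j₁ ≤ l 1) (a₁ : G.Adj (q t) (f 1 j₁)) (h₂ : j₂ ≤ l 2) (a₂ : G.Adj (q t) (f 2 j₂)) :
    ContainsPyramid G := by
  obtain ⟨i, hi, ai⟩ := H.exists_left
  have i₁ := H.inner 1 j₁ (by decide) h₁ a₁
  have i₂ := H.inner 2 j₂ (by decide) h₂ a₂
  refine containsPyramid_of_sets (q t) (f 0 0) (f 1 0) (f 2 0) ({v | ∃ s < t, q s = v} ∪ seg (f 0) 0 i)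
    (seg (f 1) 0 j₁) (seg (f 2) 0 j₂) P.triangle ?_ (H.reach_left P hi ai) ?_ ?_ ?_ ?_ ?_
  · exact ⟨fun h => H.not_adj_start (by decide) h.2, fun h => H.not_adj_start (by decide) h.2,
      fun h => H.not_adj_start (by decide) h.2⟩
  · exact (ReachIn.adj a₁ (Or.inl rfl) (Or.inr (mem_seg (Nat.zero_le _) le_rfl))).trans
      (P.reachIn 1 (Nat.zero_le _) h₁ fun k h1 h2 => Or.inr (mem_seg h1 h2)).symm
  · exact (ReachIn.adj a₂ (Or.inl rfl) (Or.inr (mem_seg (Nat.zero_le _) le_rfl))).trans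
      (P.reachIn 2 (Nat.zero_le _) h₂ fun k h1 h2 => Or.inr (mem_seg h1 h2)).symm
  · rintro _ (⟨s, hs, rfl⟩ | ⟨k, -, hk, rfl⟩) _ ⟨j, -, hj, rfl⟩
    · exact H.right_cross (by decide) hs (by omega) _
    · exact P.cross (by decide) (by omega) (by omega) (by omega)
  · rintro _ (⟨s, hs, rfl⟩ | ⟨k, -, hk, rfl⟩) _ ⟨j, -, hj, rfl⟩
    · exact H.right_cross (by decide) hs (by omega) _
    · exact P.cross (by decide) (by omega) (by omega) (by omega)
  · rintro _ ⟨k, -, hk, rfl⟩ _ ⟨j, -, hj, rfl⟩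
    exact P.cross (by decide) (by omega) (by omega) (by omega)

/-- The whole hop, extended along the second path of the prism to the first triangle. -/
theorem IsHop.reach_right (P : IsPrism G f l) (H : IsHop G f l q t) {j : ℕ} (hj : j ≤ l 1)
    (hadj : G.Adj (q t) (f 1 j)) {X : Set V} (hX : ∀ s ≤ t, q s ∈ X)
    (hX' : ∀ k ≤ j, f 1 k ∈ X) : ReachIn G X (q 0) (f 1 0) :=
  ((H.path.reachIn (Nat.zero_le t) le_rfl fun k _ hk => hX k hk).trans
    (ReachIn.adj hadj (hX t le_rfl) (hX' j le_rfl))).trans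
    (P.reachIn 1 (Nat.zero_le _) hj fun k _ hk => hX' k hk).symm

/-- The last part of a path of the prism, and then backwards along the third path. -/
theorem IsPrism.reach_around (P : IsPrism G f l) {a : Fin 3} (ha : a ≠ 2) {i : ℕ} (hi : i ≤ l a)
    {X : Set V} (hX : ∀ k, i ≤ k → k ≤ l a → f a k ∈ X) (hX' : ∀ k ≤ l 2, f 2 k ∈ X) :
    ReachIn G X (f a i) (f 2 0) :=
  ((P.reachIn a hi le_rfl hX).trans (ReachIn.adj
    ((P.adj a 2 _ _ ha le_rfl le_rfl).mpr (Or.inr ⟨rfl, rfl⟩)) (hX _ hi le_rfl) (hX' _ le_rfl))).trans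
    (P.reachIn 2 (Nat.zero_le _) le_rfl fun k _ hk => hX' k hk).symm

/-- The apex is the first vertex of the hop. From the lower neighbour a path goes down `f 0`; a
second one follows the hop and then `f 1` down; from the upper neighbour the third goes up `f 0`,
crosses the second triangle and returns along `f 2`. The gap separates the two pieces of `f 0`. -/
theorem IsHop.pyramid_of_left_gap (P : IsPrism G f l) (H : IsHop G f l q t)
    (h₂ : ∀ j ≤ l 2, ¬ G.Adj (q t) (f 2 j)) {i i' j : ℕ} (hii' : i + 1 < i') (hi' : i' ≤ l 0)
    (ai : G.Adj (q 0) (f 0 i)) (ai' : G.Adj (q 0) (f 0 i')) (hj : j ≤ l 1)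
    (aj : G.Adj (q t) (f 1 j)) : ContainsPyramid G := by
  have hjl := H.inner 1 j (by decide) hj aj
  have hQ₂ : ∀ s ≤ t, ∀ k ≤ l 2, ¬ G.Adj (q s) (f 2 k) := by
    intro s hs k hk
    rcases hs.lt_or_eq with h | rfl
    · exact H.right 2 s k (by decide) h hk
    · exact h₂ k hk
  refine containsPyramid_of_sets (q 0) (f 0 0) (f 1 0) (f 2 0) (seg (f 0) 0 i)
    (seg q 1 t ∪ seg (f 1) 0 j) (seg (f 0) i' (l 0) ∪ seg (f 2) 0 (l 2)) P.triangle ?_ ?_ ?_ ?_ ?_ ?_ ?_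
  · have n : ∀ a, a ≠ 0 → ¬ G.Adj (q 0) (f a 0) := fun a => H.not_adj_start_any (Nat.zero_le _)
    exact ⟨fun h => n 1 (by decide) h.2, fun h => n 2 (by decide) h.2, fun h => n 2 (by decide) h.2⟩
  · exact (ReachIn.adj ai (Or.inl rfl) (Or.inr (mem_seg (Nat.zero_le _) le_rfl))).trans
      (P.reachIn 0 (Nat.zero_le _) (by omega) fun k h1 h2 => Or.inr (mem_seg h1 h2)).symm
  · refine H.reach_right P hj aj (fun s hs => ?_) fun k hk => Or.inr (Or.inr (mem_seg (Nat.zero_le _) hk))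
    rcases Nat.eq_zero_or_pos s with rfl | h
    · exact Or.inl rfl
    · exact Or.inr (Or.inl (mem_seg h hs))
  · exact (ReachIn.adj ai' (Or.inl rfl) (Or.inr (Or.inl (mem_seg le_rfl hi')))).trans
      (P.reach_around (by decide) hi' (fun k h1 h2 => Or.inr (Or.inl (mem_seg h1 h2)))
        fun k hk => Or.inr (Or.inr (mem_seg (Nat.zero_le _) hk)))
  · rintro _ ⟨k, -, hk, rfl⟩ _ (⟨s, hs, hs', rfl⟩ | ⟨m, -, hm, rfl⟩)
    · exact ⟨(H.notMem 0 k s (by omega) hs').symm,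
        fun h => absurd h.symm (H.left s k hs' (by omega) (by omega))⟩
    · exact P.cross (by decide) (by omega) (by omega) (by omega)
  · rintro _ ⟨k, -, hk, rfl⟩ _ (⟨m, hm, hm', rfl⟩ | ⟨m, -, hm, rfl⟩)
    · exact P.gap (by omega) hm' _
    · exact P.cross (by decide) (by omega) (by omega) (by omega)
  · rintro _ (⟨s, hs, hs', rfl⟩ | ⟨k, -, hk, rfl⟩) _ (⟨m, hm, hm', rfl⟩ | ⟨m, -, hm, rfl⟩)
    · exact ⟨H.notMem 0 m s hm' hs', fun h => absurd h (H.left s m hs' (by omega) hm')⟩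
    · exact ⟨H.notMem 2 m s hm hs', fun h => absurd h (hQ₂ s hs' m hm)⟩
    · exact P.cross_ne (by decide) (by omega) hm' (by omega) (by omega) _
    · exact P.cross (by decide) (by omega) (by omega) (by omega)

/-- The apex is the only neighbour of the hop on `f 0`: one path goes down `f 0`, one enters the hop
and continues down `f 1`, and one goes up `f 0` and returns along `f 2`. The apex is inner, so it is
not adjacent to `f 1 0` or `f 2 0`. -/
theorem IsHop.pyramid_of_left_single (P : IsPrism G f l) (H : IsHop G f l q t)
    (h₂ : ∀ j ≤ l 2, ¬ G.Adj (q t) (f 2 j)) {i j : ℕ} (hi : 0 < i) (hi' : i < l 0)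
    (ai : G.Adj (q 0) (f 0 i)) (huniq : ∀ k ≤ l 0, G.Adj (q 0) (f 0 k) → k = i) (hj : j ≤ l 1)
    (aj : G.Adj (q t) (f 1 j)) : ContainsPyramid G := by
  have hjl := H.inner 1 j (by decide) hj aj
  have hQ₂ : ∀ s ≤ t, ∀ k ≤ l 2, ¬ G.Adj (q s) (f 2 k) := by
    intro s hs k hk
    rcases hs.lt_or_eq with h | rfl
    · exact H.right 2 s k (by decide) h hk
    · exact h₂ k hk
  have hQ₀ : ∀ s ≤ t, ∀ k ≤ l 0, k ≠ i → ¬ G.Adj (q s) (f 0 k) := by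
    intro s hs k hk hki h
    rcases Nat.eq_zero_or_pos s with rfl | h0
    · exact hki (huniq k hk h)
    · exact H.left s k hs (by omega) hk h
  refine containsPyramid_of_sets (f 0 i) (f 0 0) (f 1 0) (f 2 0) (seg (f 0) 0 (i - 1))
    (seg q 0 t ∪ seg (f 1) 0 j) (seg (f 0) (i + 1) (l 0) ∪ seg (f 2) 0 (l 2)) P.triangle ?_ ?_ ?_ ?_ ?_ ?_ ?_
  · have n : ∀ a, a ≠ 0 → ¬ G.Adj (f 0 i) (f a 0) := fun a ha h => by
      have := (P.adj 0 a i 0 ha.symm hi'.le (Nat.zero_le _)).mp h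
      omega
    exact ⟨fun h => n 1 (by decide) h.2, fun h => n 2 (by decide) h.2, fun h => n 2 (by decide) h.2⟩
  · refine (P.reachIn 0 (Nat.zero_le _) hi'.le fun k h1 h2 => ?_).symm
    rcases h2.lt_or_eq with h | rfl
    · exact Or.inr (mem_seg h1 (by omega))
    · exact Or.inl rfl
  · refine (ReachIn.adj ai.symm (Or.inl rfl) (Or.inr (Or.inl (mem_seg le_rfl (Nat.zero_le _))))).trans
      (H.reach_right P hj aj (fun s hs => Or.inr (Or.inl (mem_seg (Nat.zero_le _) hs)))
        fun k hk => Or.inr (Or.inr (mem_seg (Nat.zero_le _) hk)))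
  · refine P.reach_around (by decide) hi'.le (fun k h1 h2 => ?_)
      fun k hk => Or.inr (Or.inr (mem_seg (Nat.zero_le _) hk))
    rcases h1.lt_or_eq with h | rfl
    · exact Or.inr (Or.inl (mem_seg h h2))
    · exact Or.inl rfl
  · rintro _ ⟨k, -, hk, rfl⟩ _ (⟨s, hs, hs', rfl⟩ | ⟨m, -, hm, rfl⟩)
    · exact ⟨(H.notMem 0 k s (by omega) hs').symm,
        fun h => absurd h.symm (hQ₀ s hs' k (by omega) (by omega))⟩
    · exact P.cross (by decide) (by omega) (by omega) (by omega)
  · rintro _ ⟨k, -, hk, rfl⟩ _ (⟨m, hm, hm', rfl⟩ | ⟨m, -, hm, rfl⟩)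
    · exact P.gap (by omega) hm' _
    · exact P.cross (by decide) (by omega) (by omega) (by omega)
  · rintro _ (⟨s, hs, hs', rfl⟩ | ⟨k, -, hk, rfl⟩) _ (⟨m, hm, hm', rfl⟩ | ⟨m, -, hm, rfl⟩)
    · exact ⟨H.notMem 0 m s hm' hs', fun h => absurd h (hQ₀ s hs' m hm' (by omega))⟩
    · exact ⟨H.notMem 2 m s hm hs', fun h => absurd h (hQ₂ s hs' m hm)⟩
    · exact P.cross_ne (by decide) (by omega) hm' (by omega) (by omega) _
    · exact P.cross (by decide) (by omega) (by omega) (by omega)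

/-- The apex is the last vertex of the hop, and it is now `f 1` that is split by a gap. The upper
piece reaches the second triangle and continues along `f 2`, so the neighbour on `f 0` must not be
the last vertex of that path. -/
theorem IsHop.pyramid_of_right_gap (P : IsPrism G f l) (H : IsHop G f l q t)
    {i j j' : ℕ} (hi : i < l 0) (ai : G.Adj (q 0) (f 0 i)) (hjj' : j + 1 < j') (hj' : j' ≤ l 1)
    (aj : G.Adj (q t) (f 1 j)) (aj' : G.Adj (q t) (f 1 j')) : ContainsPyramid G := by
  refine containsPyramid_of_sets (q t) (f 0 0) (f 1 0) (f 2 0) ({v | ∃ s < t, q s = v} ∪ seg (f 0) 0 i)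
    (seg (f 1) 0 j) (seg (f 1) j' (l 1) ∪ seg (f 2) 0 (l 2)) P.triangle ?_
    (H.reach_left P hi.le ai) ?_ ?_ ?_ ?_ ?_
  · exact ⟨fun h => H.not_adj_start (by decide) h.2, fun h => H.not_adj_start (by decide) h.2,
      fun h => H.not_adj_start (by decide) h.2⟩
  · exact (ReachIn.adj aj (Or.inl rfl) (Or.inr (mem_seg (Nat.zero_le _) le_rfl))).trans
      (P.reachIn 1 (Nat.zero_le _) (by omega) fun k h1 h2 => Or.inr (mem_seg h1 h2)).symm
  · exact (ReachIn.adj aj' (Or.inl rfl) (Or.inr (Or.inl (mem_seg le_rfl hj')))).trans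
      (P.reach_around (by decide) hj' (fun k h1 h2 => Or.inr (Or.inl (mem_seg h1 h2)))
        fun k hk => Or.inr (Or.inr (mem_seg (Nat.zero_le _) hk)))
  · rintro _ (⟨s, hs, rfl⟩ | ⟨k, -, hk, rfl⟩) _ ⟨m, -, hm, rfl⟩
    · exact H.right_cross (by decide) hs (by omega) _
    · exact P.cross (by decide) (by omega) (by omega) (by omega)
  · rintro _ (⟨s, hs, rfl⟩ | ⟨k, -, hk, rfl⟩) _ (⟨m, hm, hm', rfl⟩ | ⟨m, -, hm, rfl⟩)
    · exact H.right_cross (by decide) hs (by omega) _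
    · exact H.right_cross (by decide) hs (by omega) _
    · exact P.cross_ne (by decide) (by omega) hm' (by omega) (by omega) _
    · exact P.cross (by decide) (by omega) (by omega) (by omega)
  · rintro _ ⟨k, -, hk, rfl⟩ _ (⟨m, hm, hm', rfl⟩ | ⟨m, -, hm, rfl⟩)
    · exact P.gap (by omega) hm' _
    · exact P.cross (by decide) (by omega) (by omega) (by omega)

/-- The apex is the only neighbour of the hop on `f 1`. One path runs back through the hop and down
`f 0`, one down `f 1`, and one up `f 1` and back along `f 2`; again `i < l 0` keeps the first away
from the second triangle. -/
theorem IsHop.pyramid_of_right_single (P : IsPrism G f l) (H : IsHop G f l q t)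
    (h₂ : ∀ j ≤ l 2, ¬ G.Adj (q t) (f 2 j)) {i j : ℕ} (hi : i < l 0) (ai : G.Adj (q 0) (f 0 i))
    (hj : j ≤ l 1) (aj : G.Adj (q t) (f 1 j))
    (huniq : ∀ k ≤ l 1, G.Adj (q t) (f 1 k) → k = j) : ContainsPyramid G := by
  have hjl := H.inner 1 j (by decide) hj aj
  have hQ₂ : ∀ s ≤ t, ∀ k ≤ l 2, ¬ G.Adj (q s) (f 2 k) := by
    intro s hs k hk
    rcases hs.lt_or_eq with h | rfl
    · exact H.right 2 s k (by decide) h hk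
    · exact h₂ k hk
  have hQ₁ : ∀ s ≤ t, ∀ k ≤ l 1, k ≠ j → ¬ G.Adj (q s) (f 1 k) := by
    intro s hs k hk hkj
    rcases hs.lt_or_eq with h | rfl
    · exact H.right 1 s k (by decide) h hk
    · exact fun h => hkj (huniq k hk h)
  refine containsPyramid_of_sets (f 1 j) (f 0 0) (f 1 0) (f 2 0) (seg q 0 t ∪ seg (f 0) 0 i)
    (seg (f 1) 0 (j - 1)) (seg (f 1) (j + 1) (l 1) ∪ seg (f 2) 0 (l 2)) P.triangle ?_ ?_ ?_ ?_ ?_ ?_ ?_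
  · have n : ∀ a, a ≠ 1 → ¬ G.Adj (f 1 j) (f a 0) := fun a ha h => by
      have := (P.adj 1 a j 0 ha.symm hj (Nat.zero_le _)).mp h
      omega
    exact ⟨fun h => n 0 (by decide) h.1, fun h => n 2 (by decide) h.2, fun h => n 2 (by decide) h.2⟩
  · refine (ReachIn.adj aj.symm (Or.inl rfl) (Or.inr (Or.inl (mem_seg (Nat.zero_le _) le_rfl)))).trans
      (((H.path.reachIn (Nat.zero_le t) le_rfl fun k h1 h2 => Or.inr (Or.inl (mem_seg h1 h2))).symm.trans
      (ReachIn.adj ai (Or.inr (Or.inl (mem_seg le_rfl (Nat.zero_le _))))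
        (Or.inr (Or.inr (mem_seg (Nat.zero_le _) le_rfl))))).trans
      (P.reachIn 0 (Nat.zero_le i) hi.le fun k h1 h2 => Or.inr (Or.inr (mem_seg h1 h2))).symm)
  · refine (P.reachIn 1 (Nat.zero_le _) hj fun k h1 h2 => ?_).symm
    rcases h2.lt_or_eq with h | rfl
    · exact Or.inr (mem_seg h1 (by omega))
    · exact Or.inl rfl
  · refine P.reach_around (by decide) hj (fun k h1 h2 => ?_)
      fun k hk => Or.inr (Or.inr (mem_seg (Nat.zero_le _) hk))
    rcases h1.lt_or_eq with h | rfl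
    · exact Or.inr (Or.inl (mem_seg h h2))
    · exact Or.inl rfl
  · rintro _ (⟨s, hs, hs', rfl⟩ | ⟨k, -, hk, rfl⟩) _ ⟨m, -, hm, rfl⟩
    · exact ⟨H.notMem 1 m s (by omega) hs', fun h => absurd h (hQ₁ s hs' m (by omega) (by omega))⟩
    · exact P.cross (by decide) (by omega) (by omega) (by omega)
  · rintro _ (⟨s, hs, hs', rfl⟩ | ⟨k, -, hk, rfl⟩) _ (⟨m, hm, hm', rfl⟩ | ⟨m, -, hm, rfl⟩)
    · exact ⟨H.notMem 1 m s (by omega) hs', fun h => absurd h (hQ₁ s hs' m (by omega) (by omega))⟩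
    · exact ⟨H.notMem 2 m s hm hs', fun h => absurd h (hQ₂ s hs' m hm)⟩
    · exact P.cross_ne (by decide) (by omega) hm' (by omega) (by omega) _
    · exact P.cross (by decide) (by omega) (by omega) (by omega)
  · rintro _ ⟨k, -, hk, rfl⟩ _ (⟨m, hm, hm', rfl⟩ | ⟨m, -, hm, rfl⟩)
    · exact P.gap (by omega) hm' _
    · exact P.cross (by decide) (by omega) (by omega) (by omega)

theorem IsInducedPath.sub {g : ℕ → V} {n : ℕ} (h : IsInducedPath G g n) {i m : ℕ}
    (him : i + m ≤ n) : IsInducedPath G (fun k => g (i + k)) m where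
  inj a ha b hb he := by
    have := h.inj _ (by omega) _ (by omega) he
    omega
  adj a ha b hb := by
    rw [h.adj _ (by omega) _ (by omega)]
    omega

theorem IsInducedPath.reverse {g : ℕ → V} {n : ℕ} (h : IsInducedPath G g n) {m : ℕ}
    (hm : m ≤ n) : IsInducedPath G (fun k => g (n - k)) m where
  inj a ha b hb he := by
    have := h.inj _ (by omega) _ (by omega) he
    omega
  adj a ha b hb := by
    rw [h.adj _ (by omega) _ (by omega)]
    omega

/-- A nonempty set of positions on a path, at least two of which are present and no two of which
have a gap between them, is a pair of consecutive positions. -/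
theorem exists_consecutive {A : ℕ → Prop} {n i : ℕ} (hi : i ≤ n) (ai : A i)
    (hgap : ∀ i j, i + 1 < j → j ≤ n → A i → A j → False)
    (hsing : ∀ i ≤ n, A i → ¬ ∀ k ≤ n, A k → k = i) :
    ∃ i < n, ∀ j ≤ n, (A j ↔ j = i ∨ j = i + 1) := by
  have h := hsing i hi ai
  push Not at h
  obtain ⟨k, hk, ak, hki⟩ := h
  rcases lt_or_gt_of_ne hki with hlt | hlt
  · have e : i = k + 1 := by
      by_contra hne
      exact hgap k i (by omega) hi ak ai
    subst e
    refine ⟨k, by omega, fun j hj => ⟨fun aj => ?_, ?_⟩⟩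
    · by_contra hne
      rcases lt_or_ge j k with h1 | h1
      · exact hgap j (k + 1) (by omega) hi aj ai
      · exact hgap k j (by omega) hj ak aj
    · rintro (rfl | rfl) <;> assumption
  · have e : k = i + 1 := by
      by_contra hne
      exact hgap i k (by omega) hk ai ak
    subst e
    refine ⟨i, by omega, fun j hj => ⟨fun aj => ?_, ?_⟩⟩
    · by_contra hne
      rcases lt_or_ge j i with h1 | h1
      · exact hgap j (i + 1) (by omega) hk aj ak
      · exact hgap i j (by omega) hj ai aj
    · rintro (rfl | rfl) <;> assumption

/-- The four triangles are the two of the prism and, at each end of the hop, the end with its two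
consecutive neighbours. The rungs are `f 2`, the two pieces of `f 0`, the two pieces of `f 1`, and
the hop. Since `0 < j`, the lower piece of `f 1` has at least two vertices, so the subdivision is
proper. -/
theorem IsHop.exists_of_pairs (P : IsPrism G f l) (H : IsHop G f l q t)
    (h₂ : ∀ j ≤ l 2, ¬ G.Adj (q t) (f 2 j)) {i j : ℕ} (hi : i < l 0)
    (ai : ∀ k ≤ l 0, (G.Adj (q 0) (f 0 k) ↔ k = i ∨ k = i + 1)) (hj : 0 < j) (hj' : j + 1 < l 1)
    (aj : ∀ k ≤ l 1, (G.Adj (q t) (f 1 k) ↔ k = j ∨ k = j + 1)) :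
    ∃ T ⊆ {v | ∃ a i, i ≤ l a ∧ f a i = v} ∪ seg q 0 t, IsLGPSK4 G T := by
  have hQ₂ : ∀ s ≤ t, ∀ k ≤ l 2, ¬ G.Adj (q s) (f 2 k) := by
    intro s hs k hk
    rcases hs.lt_or_eq with h | rfl
    · exact H.right 2 s k (by decide) h hk
    · exact h₂ k hk
  have hQ₀ : ∀ s ≤ t, ∀ k ≤ l 0, (G.Adj (q s) (f 0 k) ↔ s = 0 ∧ (k = i ∨ k = i + 1)) := by
    intro s hs k hk
    rcases Nat.eq_zero_or_pos s with rfl | h0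
    · rw [ai k hk]; simp
    · exact ⟨fun h => absurd h (H.left s k hs (by omega) hk), fun h => by omega⟩
  have hQ₁ : ∀ s ≤ t, ∀ k ≤ l 1, (G.Adj (q s) (f 1 k) ↔ s = t ∧ (k = j ∨ k = j + 1)) := by
    intro s hs k hk
    rcases hs.lt_or_eq with h | rfl
    · exact ⟨fun h' => absurd h' (H.right 1 s k (by decide) h hk), fun h' => by omega⟩
    · rw [aj k hk]; simp
  have inj := fun a => (P.path a).inj
  have adj := fun a => (P.path a).adj
  refine exists_isLGPSK4_of_rungs (l 2) i j (l 0 - (i + 1)) (l 1 - (j + 1)) t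
    (f 2) (f 0) (f 1) (fun k => f 0 (l 0 - k)) (fun k => f 1 (l 1 - k)) q
    (P.path 2) (by simpa using (P.path 0).sub (i := 0) (m := i) (by omega))
    (by simpa using (P.path 1).sub (i := 0) (m := j) (by omega))
    ((P.path 0).reverse (by omega)) ((P.path 1).reverse (by omega)) H.path
    ?_ ?_ ?_ ?_ ?_ ?_ ?_ ?_ ?_ ?_ ?_ ?_ ?_ ?_ ?_ hj _ ?_ ?_ ?_ ?_ ?_ ?_
  · intro a ha b hb
    refine ⟨P.ne _ _ _ _ (by decide) ha (by omega), ?_⟩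
    rw [P.adj _ _ _ _ (by decide) ha (by omega)]; omega
  · intro a ha b hb
    refine ⟨P.ne _ _ _ _ (by decide) ha (by omega), ?_⟩
    rw [P.adj _ _ _ _ (by decide) ha (by omega)]; omega
  · intro a ha b hb
    refine ⟨P.ne _ _ _ _ (by decide) ha (by omega), ?_⟩
    rw [P.adj _ _ _ _ (by decide) ha (by omega)]; omega
  · intro a ha b hb
    refine ⟨P.ne _ _ _ _ (by decide) ha (by omega), ?_⟩
    rw [P.adj _ _ _ _ (by decide) ha (by omega)]; omega
  · intro a ha b hb
    exact ⟨(H.notMem 2 a b ha hb).symm, fun h => hQ₂ b hb a ha h.symm⟩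
  · intro a ha b hb
    refine ⟨P.ne _ _ _ _ (by decide) (by omega) (by omega), ?_⟩
    rw [P.adj _ _ _ _ (by decide) (by omega) (by omega)]; omega
  · intro a ha b hb
    refine ⟨fun h => ?_, ?_⟩
    · have := inj 0 _ (by omega) _ (by omega) h
      omega
    · rw [adj 0 _ (by omega) _ (by omega)]; omega
  · intro a ha b hb
    refine ⟨P.ne _ _ _ _ (by decide) (by omega) (by omega), ?_⟩
    rw [P.adj _ _ _ _ (by decide) (by omega) (by omega)]; omega
  · intro a ha b hb
    refine ⟨(H.notMem 0 a b (by omega) hb).symm, ?_⟩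
    rw [G.adj_comm, hQ₀ b hb a (by omega)]; omega
  · intro a ha b hb
    refine ⟨P.ne _ _ _ _ (by decide) (by omega) (by omega), ?_⟩
    rw [P.adj _ _ _ _ (by decide) (by omega) (by omega)]; omega
  · intro a ha b hb
    refine ⟨fun h => ?_, ?_⟩
    · have := inj 1 _ (by omega) _ (by omega) h
      omega
    · rw [adj 1 _ (by omega) _ (by omega)]; omega
  · intro a ha b hb
    refine ⟨(H.notMem 1 a b (by omega) hb).symm, ?_⟩
    rw [G.adj_comm, hQ₁ b hb a (by omega)]; omega
  · intro a ha b hb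
    refine ⟨P.ne _ _ _ _ (by decide) (by omega) (by omega), ?_⟩
    rw [P.adj _ _ _ _ (by decide) (by omega) (by omega)]; omega
  · intro a ha b hb
    refine ⟨(H.notMem 0 _ b (by omega) hb).symm, ?_⟩
    rw [G.adj_comm, hQ₀ b hb _ (by omega)]; omega
  · intro a ha b hb
    refine ⟨(H.notMem 1 _ b (by omega) hb).symm, ?_⟩
    rw [G.adj_comm, hQ₁ b hb _ (by omega)]; omega
  · exact fun k hk => Or.inl ⟨2, k, hk, rfl⟩
  · exact fun k hk => Or.inl ⟨0, k, by omega, rfl⟩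
  · exact fun k hk => Or.inl ⟨1, k, by omega, rfl⟩
  · exact fun k hk => Or.inl ⟨0, _, by omega, rfl⟩
  · exact fun k hk => Or.inl ⟨1, _, by omega, rfl⟩
  · exact fun k hk => Or.inr (mem_seg (Nat.zero_le _) hk)

/-- The left end is settled first: once it sees exactly `i` and `i + 1`, there is a neighbour below
the end of `f 0`, and this is what the pyramids for the right end need. -/
theorem IsHop.exists_of_one (hG : ¬ ContainsPyramid G) (P : IsPrism G f l) (H : IsHop G f l q t)
    (h₂ : ∀ j ≤ l 2, ¬ G.Adj (q t) (f 2 j)) :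
    ∃ T ⊆ {v | ∃ a i, i ≤ l a ∧ f a i = v} ∪ seg q 0 t, IsLGPSK4 G T := by
  obtain ⟨i, hi, ai⟩ := H.exists_left
  obtain ⟨j, hj, aj⟩ : ∃ j ≤ l 1, G.Adj (q t) (f 1 j) := by
    obtain ⟨a, j, ha, hj, aj⟩ := H.exists_right
    fin_cases a
    · exact absurd rfl ha
    · exact ⟨j, hj, aj⟩
    · exact absurd aj (h₂ j hj)
  obtain ⟨i, hi, ai⟩ : ∃ i < l 0, ∀ j ≤ l 0, (G.Adj (q 0) (f 0 j) ↔ j = i ∨ j = i + 1) := by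
    rcases H.left_inner with h | ⟨-, h⟩
    · exact exists_consecutive hi ai (fun i i' h1 h2 h3 h4 =>
        hG (H.pyramid_of_left_gap P h₂ h1 h2 h3 h4 hj aj)) fun i hi ai huniq =>
        hG (H.pyramid_of_left_single P h₂ (h i hi ai).1 (h i hi ai).2 ai huniq hj aj)
    · exact h
  have ai' := (ai i hi.le).mpr (Or.inl rfl)
  obtain ⟨j, hj, aj⟩ := exists_consecutive (A := fun j => G.Adj (q t) (f 1 j)) hj aj
    (fun j j' h1 h2 h3 h4 => hG (H.pyramid_of_right_gap P hi ai' h1 h2 h3 h4)) fun j hj aj huniq =>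
      hG (H.pyramid_of_right_single P h₂ hi ai' hj aj huniq)
  exact H.exists_of_pairs P h₂ hi ai (H.inner 1 j (by decide) hj.le ((aj j hj.le).mpr (Or.inl rfl))).1
    (H.inner 1 (j + 1) (by decide) hj ((aj (j + 1) hj).mpr (Or.inr rfl))).2 aj

/-- A prism with a hop contains a pyramid or the line graph of a proper subdivision of `K4`. -/
theorem IsHop.exists_isLGPSK4 (hG : ¬ ContainsPyramid G) (P : IsPrism G f l)
    (H : IsHop G f l q t) :
    ∃ T ⊆ {v | ∃ a i, i ≤ l a ∧ f a i = v} ∪ seg q 0 t, IsLGPSK4 G T := by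
  by_cases h₂ : ∀ j ≤ l 2, ¬ G.Adj (q t) (f 2 j)
  · exact H.exists_of_one hG P h₂
  push Not at h₂
  obtain ⟨j₂, hj₂, a₂⟩ := h₂
  have h₁ : ∀ j ≤ l 1, ¬ G.Adj (q t) (f 1 j) := fun j₁ hj₁ a₁ =>
    hG (H.pyramid_of_both P hj₁ a₁ hj₂ a₂)
  -- The last vertex sees `f 2` and therefore not `f 1`; exchanging these two paths gives the case
  -- already treated.
  let σ : Equiv.Perm (Fin 3) := Equiv.swap 1 2
  have σ0 : σ 0 = 0 := by decide
  have σ2 : σ 2 = 1 := by decide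
  have hσ : ∀ a, a ≠ 0 → σ a ≠ 0 := fun a ha h => ha (σ.injective (h.trans σ0.symm))
  have P' : IsPrism G (f ∘ σ) (l ∘ σ) :=
    ⟨fun a => P.path _, fun a b i j hab => P.ne _ _ i j (σ.injective.ne hab),
      fun a b i j hab => P.adj _ _ i j (σ.injective.ne hab)⟩
  have H' : IsHop G (f ∘ σ) (l ∘ σ) q t := by
    refine ⟨H.path, fun a => H.notMem _, ?_, fun a s i ha => H.right _ s i (hσ a ha),
      fun a i ha => H.inner _ i (hσ a ha), ?_, ?_, ?_⟩
    · simpa only [Function.comp, σ0] using H.left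
    · simpa only [Function.comp, σ0] using H.left_inner
    · simpa only [Function.comp, σ0] using H.exists_left
    · exact ⟨1, j₂, by decide, hj₂, a₂⟩
  obtain ⟨T, hT, hT'⟩ := H'.exists_of_one hG P' (by simpa only [Function.comp, σ2] using h₁)
  refine ⟨T, hT.trans (Set.union_subset_union_left _ ?_), hT'⟩
  rintro v ⟨a, i, hi, rfl⟩
  exact ⟨σ a, i, hi, rfl⟩

end Hop

end LGK4

/-! ### The prism that is left when a rung is deleted. -/

namespace LGK4

section PrismOfRungs

variable {V : Type*} {G : SimpleGraph V} {len : Fin 4 → Fin 4 → ℕ} {r : Fin 4 → Fin 4 → ℕ → V}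

theorem IsRungSystem.out_in (R : IsRungSystem G len r) {z x w : Fin 4} {i j : ℕ} (hzx : z ≠ x)
    (hxw : x ≠ w) (hzw : z ≠ w) (hi : i < len z x) (hj : j < len x w) :
    r z x i ≠ r x w j ∧ (G.Adj (r z x i) (r x w j) ↔ i + 1 = len z x ∧ j = 0) := by
  have hl := R.len_symm z x
  rw [R.rev x z i hzx.symm (by omega)]
  refine ⟨R.meet_ne x z w _ j hzx.symm hxw hzw (by omega) hj, ?_⟩
  rw [R.meet_adj x z w _ j hzx.symm hxw hzw (by omega) hj]
  omega

theorem IsRungSystem.in_in (R : IsRungSystem G len r) {x y w : Fin 4} {i j : ℕ} (hxy : x ≠ y)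
    (hxw : x ≠ w) (hyw : y ≠ w) (hi : i < len x w) (hj : j < len y w) :
    r x w i ≠ r y w j ∧ (G.Adj (r x w i) (r y w j) ↔ i + 1 = len x w ∧ j + 1 = len y w) := by
  have hl := R.len_symm y w
  rw [R.rev w y j hyw.symm (by omega)]
  have := R.out_in hxw hyw.symm hxy hi (show len w y - 1 - j < len w y by omega)
  refine ⟨this.1, this.2.trans ?_⟩
  omega

/-- The rung from `z` to `x` followed by the rung from `x` to `w`. -/
def through (len : Fin 4 → Fin 4 → ℕ) (r : Fin 4 → Fin 4 → ℕ → V) (z x w : Fin 4) (i : ℕ) : V :=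
  if i < len z x then r z x i else r x w (i - len z x)

theorem through_left {z x w : Fin 4} {i : ℕ} (h : i < len z x) :
    through len r z x w i = r z x i := if_pos h

theorem through_right {z x w : Fin 4} {i : ℕ} (h : len z x ≤ i) :
    through len r z x w i = r x w (i - len z x) := if_neg (not_lt.mpr h)

theorem IsRungSystem.through_path (R : IsRungSystem G len r) {z x w : Fin 4} (hzx : z ≠ x)
    (hxw : x ≠ w) (hzw : z ≠ w) :
    IsInducedPath G (through len r z x w) (len z x + len x w - 1) := by
  have p₁ := R.pos z x hzx
  have p₂ := R.pos x w hxw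
  constructor
  · intro i hi j hj he
    rcases lt_or_ge i (len z x) with h1 | h1 <;> rcases lt_or_ge j (len z x) with h2 | h2
    · rw [through_left h1, through_left h2] at he
      exact R.inj z x i j hzx h1 h2 he
    · rw [through_left h1, through_right h2] at he
      exact absurd he (R.out_in hzx hxw hzw h1 (by omega)).1
    · rw [through_right h1, through_left h2] at he
      exact absurd he.symm (R.out_in hzx hxw hzw h2 (by omega)).1
    · rw [through_right h1, through_right h2] at he
      have := R.inj x w _ _ hxw (by omega) (by omega) he
      omega
  · intro i hi j hj
    rcases lt_or_ge i (len z x) with h1 | h1 <;> rcases lt_or_ge j (len z x) with h2 | h2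
    · rw [through_left h1, through_left h2]
      exact R.adj z x i j hzx h1 h2
    · rw [through_left h1, through_right h2, (R.out_in hzx hxw hzw h1 (by omega)).2]
      omega
    · rw [through_right h1, through_left h2, G.adj_comm, (R.out_in hzx hxw hzw h2 (by omega)).2]
      omega
    · rw [through_right h1, through_right h2, R.adj x w _ _ hxw (by omega) (by omega)]
      omega

/-- `x, y, z, w` are the four elements of `Fin 4`. -/
structure Distinct (x y z w : Fin 4) : Prop where
  xy : x ≠ y
  xz : x ≠ z
  xw : x ≠ w
  yz : y ≠ z
  yw : y ≠ w
  zw : z ≠ w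

theorem Distinct.swap {x y z w : Fin 4} (h : Distinct x y z w) : Distinct y x z w :=
  ⟨h.xy.symm, h.yz, h.yw, h.xz, h.xw, h.zw⟩

theorem Distinct.cover {x y z w : Fin 4} (h : Distinct x y z w) (u : Fin 4) :
    u = x ∨ u = y ∨ u = z ∨ u = w := by
  obtain ⟨h1, h2, h3, h4, h5, h6⟩ := h
  revert x y z w u; decide

theorem exists_distinct {x y : Fin 4} (h : x ≠ y) : ∃ z w, Distinct x y z w := by
  have : ∃ z w, x ≠ z ∧ x ≠ w ∧ y ≠ z ∧ y ≠ w ∧ z ≠ w := by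
    revert x y; decide
  obtain ⟨z, w, h1, h2, h3, h4, h5⟩ := this
  exact ⟨z, w, h, h1, h2, h3, h4, h5⟩

variable {x y z w : Fin 4}

/-- The first parts meet at `z`, the last parts meet at `w`, and a first part and the other path's
last part lie on disjoint edges of K4. -/
theorem IsRungSystem.through_through (R : IsRungSystem G len r) (D : Distinct x y z w) {i j : ℕ}
    (hi : i ≤ len z x + len x w - 1) (hj : j ≤ len z y + len y w - 1) :
    through len r z x w i ≠ through len r z y w j ∧
      (G.Adj (through len r z x w i) (through len r z y w j) ↔
        (i = 0 ∧ j = 0) ∨ (i = len z x + len x w - 1 ∧ j = len z y + len y w - 1)) := by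
  have p₁ := R.pos z x D.xz.symm
  have p₂ := R.pos x w D.xw
  have p₃ := R.pos z y D.yz.symm
  have p₄ := R.pos y w D.yw
  rcases lt_or_ge i (len z x) with h1 | h1 <;> rcases lt_or_ge j (len z y) with h2 | h2
  · rw [through_left h1, through_left h2]
    refine ⟨R.meet_ne z x y i j D.xz.symm D.yz.symm D.xy h1 h2, ?_⟩
    rw [R.meet_adj z x y i j D.xz.symm D.yz.symm D.xy h1 h2]
    omega
  · rw [through_left h1, through_right h2]
    refine ⟨R.opp_ne z x y w _ _ D.xz.symm D.yz.symm D.zw D.xy D.xw D.yw h1 (by omega),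
      fun h => absurd h (R.opp_adj z x y w _ _ D.xz.symm D.yz.symm D.zw D.xy D.xw D.yw h1
        (by omega)), fun h => by omega⟩
  · rw [through_right h1, through_left h2]
    refine ⟨R.opp_ne x w z y _ _ D.xw D.xz D.xy D.zw.symm D.yw.symm D.yz.symm (by omega) h2,
      fun h => absurd h (R.opp_adj x w z y _ _ D.xw D.xz D.xy D.zw.symm D.yw.symm D.yz.symm
        (by omega) h2), fun h => by omega⟩
  · rw [through_right h1, through_right h2]
    have := R.in_in D.xy D.xw D.yw (show i - len z x < len x w by omega)
      (show j - len z y < len y w by omega)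
    refine ⟨this.1, this.2.trans ?_⟩
    omega

theorem IsRungSystem.through_direct (R : IsRungSystem G len r) (D : Distinct x y z w) {i j : ℕ}
    (hi : i ≤ len z x + len x w - 1) (hj : j ≤ len z w - 1) :
    through len r z x w i ≠ r z w j ∧
      (G.Adj (through len r z x w i) (r z w j) ↔
        (i = 0 ∧ j = 0) ∨ (i = len z x + len x w - 1 ∧ j = len z w - 1)) := by
  have p₁ := R.pos z x D.xz.symm
  have p₂ := R.pos x w D.xw
  have p₃ := R.pos z w D.zw
  rcases lt_or_ge i (len z x) with h1 | h1
  · rw [through_left h1]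
    refine ⟨R.meet_ne z x w i j D.xz.symm D.zw D.xw h1 (by omega), ?_⟩
    rw [R.meet_adj z x w i j D.xz.symm D.zw D.xw h1 (by omega)]
    omega
  · rw [through_right h1]
    have := R.in_in D.xz D.xw D.zw (show i - len z x < len x w by omega)
      (show j < len z w by omega)
    refine ⟨this.1, this.2.trans ?_⟩
    omega

/-- The paths of the prism that is left when the rung `xy` is removed. -/
def prismPath (len : Fin 4 → Fin 4 → ℕ) (r : Fin 4 → Fin 4 → ℕ → V) (x y z w : Fin 4) :
    Fin 3 → ℕ → V :=
  ![through len r z x w, through len r z y w, r z w]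

/-- The lengths of the paths of the prism that is left when the rung `xy` is removed. -/
def prismLen (len : Fin 4 → Fin 4 → ℕ) (x y z w : Fin 4) : Fin 3 → ℕ :=
  ![len z x + len x w - 1, len z y + len y w - 1, len z w - 1]

/-- Without the rung `xy`, only the triangles at `z` and `w` survive. At `x` and at `y` just two
rungs are left, and they join to form one path each. -/
theorem IsRungSystem.isPrism (R : IsRungSystem G len r) (D : Distinct x y z w) :
    IsPrism G (prismPath len r x y z w) (prismLen len x y z w) := by
  have key : ∀ a b i j, a ≠ b → i ≤ prismLen len x y z w a → j ≤ prismLen len x y z w b →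
      prismPath len r x y z w a i ≠ prismPath len r x y z w b j ∧
      (G.Adj (prismPath len r x y z w a i) (prismPath len r x y z w b j) ↔
        (i = 0 ∧ j = 0) ∨ (i = prismLen len x y z w a ∧ j = prismLen len x y z w b)) := by
    have flip : ∀ {u v : V} {P Q P' Q' : Prop}, (u ≠ v ∧ (G.Adj u v ↔ (P ∧ Q) ∨ (P' ∧ Q'))) →
        v ≠ u ∧ (G.Adj v u ↔ (Q ∧ P) ∨ (Q' ∧ P')) := fun h =>
      ⟨h.1.symm, by rw [G.adj_comm, h.2]; tauto⟩
    intro a b i j hab hi hj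
    fin_cases a <;> fin_cases b
    · exact absurd rfl hab
    · exact R.through_through D hi hj
    · exact R.through_direct D hi hj
    · exact flip (R.through_through D hj hi)
    · exact absurd rfl hab
    · exact R.through_direct D.swap hi hj
    · exact flip (R.through_direct D hj hi)
    · exact flip (R.through_direct D.swap hj hi)
    · exact absurd rfl hab
  refine ⟨fun a => ?_, fun a b i j hab hi hj => (key a b i j hab hi hj).1,
    fun a b i j hab hi hj => (key a b i j hab hi hj).2⟩
  fin_cases a
  · exact R.through_path D.xz.symm D.xw D.zw
  · exact R.through_path D.yz.symm D.yw D.zw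
  · have h := R.pos z w D.zw
    exact ⟨fun i hi j hj => R.inj z w i j D.zw (by simp [prismLen] at hi; omega)
        (by simp [prismLen] at hj; omega),
      fun i hi j hj => R.adj z w i j D.zw (by simp [prismLen] at hi; omega)
        (by simp [prismLen] at hj; omega)⟩

/-- Each vertex on the path through `x` lies on a rung that leaves `x`. -/
theorem IsRungSystem.through_eq (R : IsRungSystem G len r) (hzx : z ≠ x) (hxw : x ≠ w) {i : ℕ}
    (hi : i ≤ len z x + len x w - 1) :
    ∃ u j, (u = z ∨ u = w) ∧ j < len x u ∧ through len r z x w i = r x u j := by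
  have hl := R.len_symm z x
  have p₁ := R.pos z x hzx
  have p₂ := R.pos x w hxw
  rcases lt_or_ge i (len z x) with h1 | h1
  · exact ⟨z, len z x - 1 - i, Or.inl rfl, by omega, by
      rw [through_left h1, R.rev x z i hzx.symm (by omega), hl]⟩
  · exact ⟨w, i - len z x, Or.inr rfl, by omega, through_right h1⟩

theorem IsRungSystem.eq_through (R : IsRungSystem G len r) (hzx : z ≠ x) (hxw : x ≠ w) {u : Fin 4}
    {j : ℕ} (hu : u = z ∨ u = w) (hj : j < len x u) :
    ∃ i ≤ len z x + len x w - 1, through len r z x w i = r x u j := by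
  have hl := R.len_symm z x
  have p₁ := R.pos z x hzx
  have p₂ := R.pos x w hxw
  rcases hu with rfl | rfl
  · refine ⟨len u x - 1 - j, by omega, ?_⟩
    rw [through_left (by omega), R.rev x u _ hzx.symm (by omega)]
    congr 1; omega
  · refine ⟨len z x + j, by omega, ?_⟩
    rw [through_right (by omega)]
    congr 1; omega

theorem IsRungSystem.through_zero (R : IsRungSystem G len r) (hzx : z ≠ x) :
    through len r z x w 0 = r z x 0 := through_left (R.pos z x hzx)

theorem IsRungSystem.through_last (R : IsRungSystem G len r) (hxw : x ≠ w) :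
    through len r z x w (len z x + len x w - 1) = r w x 0 := by
  have p₂ := R.pos x w hxw
  have hl := R.len_symm x w
  rw [through_right (by omega), R.rev x w 0 hxw (by omega)]
  congr 1; omega

/-- The triangle at `x` consists of the first vertex of the rung `xy` and of the two vertices at
which the rungs `zx` and `xw` join, at positions `len z x - 1` and `len z x` of the prism path. -/
theorem IsRungSystem.adj_through_start (R : IsRungSystem G len r) (D : Distinct x y z w)
    {i j : ℕ} (hi : i < len x y) (hj : j ≤ len z x + len x w - 1) :
    r x y i ≠ through len r z x w j ∧
    (G.Adj (r x y i) (through len r z x w j) ↔ i = 0 ∧ (j = len z x - 1 ∨ j = len z x - 1 + 1)) := by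
  have hl := R.len_symm z x
  have p₁ := R.pos z x D.xz.symm
  have p₂ := R.pos x w D.xw
  rcases lt_or_ge j (len z x) with h1 | h1
  · rw [through_left h1]
    have := R.out_in D.xz.symm D.xy D.yz.symm h1 hi
    refine ⟨this.1.symm, ?_⟩
    rw [G.adj_comm, this.2]
    omega
  · rw [through_right h1]
    refine ⟨R.meet_ne x y w i _ D.xy D.xw D.yw hi (by omega), ?_⟩
    rw [R.meet_adj x y w i _ D.xy D.xw D.yw hi (by omega)]
    omega

theorem IsRungSystem.adj_through_end (R : IsRungSystem G len r) (D : Distinct x y z w)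
    {i j : ℕ} (hi : i < len x y) (hj : j ≤ len z y + len y w - 1) :
    r x y i ≠ through len r z y w j ∧ (G.Adj (r x y i) (through len r z y w j) ↔
      i + 1 = len x y ∧ (j = len z y - 1 ∨ j = len z y - 1 + 1)) := by
  have hl := R.len_symm x y
  rw [R.rev y x i D.xy.symm (by omega)]
  have := R.adj_through_start D.swap (show len y x - 1 - i < len y x by omega) hj
  refine ⟨this.1, this.2.trans ?_⟩
  omega

end PrismOfRungs

/-! ### Exchanging a whole rung. -/

section Replace

variable {V : Type*} {G : SimpleGraph V} {len : Fin 4 → Fin 4 → ℕ} {r : Fin 4 → Fin 4 → ℕ → V}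

/-- The lengths of the rungs after the rung `xy` has been replaced by a path of length `n`. -/
def replaceLen (len : Fin 4 → Fin 4 → ℕ) (x y : Fin 4) (n : ℕ) (u v : Fin 4) : ℕ :=
  if (u = x ∧ v = y) ∨ (u = y ∧ v = x) then n + 1 else len u v

/-- The rungs after the rung `xy` has been replaced by the path `g 0, …, g n`. -/
def replaceRung (r : Fin 4 → Fin 4 → ℕ → V) (x y : Fin 4) (g : ℕ → V) (n : ℕ) (u v : Fin 4)
    (i : ℕ) : V :=
  if u = x ∧ v = y then g i else if u = y ∧ v = x then g (n - i) else r u v i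

theorem replaceLen_self (x y : Fin 4) (n : ℕ) : replaceLen len x y n x y = n + 1 := by
  simp [replaceLen]

theorem replaceLen_rev (x y : Fin 4) (n : ℕ) : replaceLen len x y n y x = n + 1 := by
  simp [replaceLen]

theorem replaceLen_other {x y : Fin 4} (n : ℕ) {u v : Fin 4} (h1 : ¬ (u = x ∧ v = y))
    (h2 : ¬ (u = y ∧ v = x)) : replaceLen len x y n u v = len u v := by
  simp [replaceLen, h1, h2]

theorem replaceRung_self (x y : Fin 4) (g : ℕ → V) (n i : ℕ) :
    replaceRung r x y g n x y i = g i := by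
  simp [replaceRung]

theorem replaceRung_rev {x y : Fin 4} (hxy : x ≠ y) (g : ℕ → V) (n i : ℕ) :
    replaceRung r x y g n y x i = g (n - i) := by
  simp [replaceRung, hxy.symm]

theorem replaceRung_other {x y : Fin 4} (g : ℕ → V) (n i : ℕ) {u v : Fin 4}
    (h1 : ¬ (u = x ∧ v = y)) (h2 : ¬ (u = y ∧ v = x)) : replaceRung r x y g n u v i = r u v i := by
  simp [replaceRung, h1, h2]

/-- Rules that do not involve the rung `xy` are inherited. The others concern the new path and a
rung that leaves `x`, a rung that leaves `y`, or the disjoint rung, and each is one of the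
hypotheses up to reversal. -/
theorem IsRungSystem.replace (R : IsRungSystem G len r) {x y : Fin 4} (hxy : x ≠ y) {g : ℕ → V}
    {n : ℕ} (hg : IsInducedPath G g n)
    (hx : ∀ u i j, x ≠ u → y ≠ u → i ≤ n → j < len x u →
      g i ≠ r x u j ∧ (G.Adj (g i) (r x u j) ↔ i = 0 ∧ j = 0))
    (hy : ∀ u i j, x ≠ u → y ≠ u → i ≤ n → j < len y u →
      g i ≠ r y u j ∧ (G.Adj (g i) (r y u j) ↔ i = n ∧ j = 0))
    (ho : ∀ z w i j, Distinct x y z w → i ≤ n → j < len z w →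
      g i ≠ r z w j ∧ ¬ G.Adj (g i) (r z w j))
    (hp : ∃ u v, u ≠ v ∧ 2 ≤ replaceLen len x y n u v) :
    IsRungSystem G (replaceLen len x y n) (replaceRung r x y g n) := by
  have cases : ∀ u v : Fin 4, (u = x ∧ v = y) ∨ (u = y ∧ v = x) ∨
      (¬ (u = x ∧ v = y) ∧ ¬ (u = y ∧ v = x)) := fun u v => by tauto
  have meet : ∀ a b c i j, a ≠ b → a ≠ c → b ≠ c → i < replaceLen len x y n a b →
      j < replaceLen len x y n a c →
      replaceRung r x y g n a b i ≠ replaceRung r x y g n a c j ∧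
      (G.Adj (replaceRung r x y g n a b i) (replaceRung r x y g n a c j) ↔ i = 0 ∧ j = 0) := by
    intro a b c i j hab hac hbc hi hj
    have flip : ∀ {u v : V} {P Q : Prop}, (u ≠ v ∧ (G.Adj u v ↔ P ∧ Q)) →
        v ≠ u ∧ (G.Adj v u ↔ Q ∧ P) := fun h =>
      ⟨h.1.symm, by rw [G.adj_comm, h.2]; tauto⟩
    rcases cases a b with ⟨rfl, rfl⟩ | ⟨rfl, rfl⟩ | ⟨h1, h2⟩
    · rw [replaceLen_self] at hi
      have h3 : ¬ (a = a ∧ c = b) := fun h => hbc h.2.symm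
      have h4 : ¬ (a = b ∧ c = a) := fun h => hxy h.1
      rw [replaceLen_other _ h3 h4] at hj
      rw [replaceRung_self, replaceRung_other _ _ _ h3 h4]
      exact hx c i j hac hbc (by omega) hj
    · rw [replaceLen_rev] at hi
      have h3 : ¬ (a = b ∧ c = a) := fun h => hxy h.1.symm
      have h4 : ¬ (a = a ∧ c = b) := fun h => hbc h.2.symm
      rw [replaceLen_other _ h3 h4] at hj
      rw [replaceRung_rev hxy, replaceRung_other _ _ _ h3 h4]
      have := hy c (n - i) j hbc hac (by omega) hj
      refine ⟨this.1, this.2.trans ?_⟩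
      omega
    · rw [replaceLen_other _ h1 h2] at hi
      rw [replaceRung_other _ _ _ h1 h2]
      rcases cases a c with ⟨rfl, rfl⟩ | ⟨rfl, rfl⟩ | ⟨h3, h4⟩
      · rw [replaceLen_self] at hj
        rw [replaceRung_self]
        exact flip (hx b j i hab hbc.symm (by omega) hi)
      · rw [replaceLen_rev] at hj
        rw [replaceRung_rev hxy]
        refine flip ?_
        have := hy b (n - j) i hbc.symm hab (by omega) hi
        refine ⟨this.1, this.2.trans ?_⟩
        omega
      · rw [replaceLen_other _ h3 h4] at hj
        rw [replaceRung_other _ _ _ h3 h4]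
        exact ⟨R.meet_ne a b c i j hab hac hbc hi hj, R.meet_adj a b c i j hab hac hbc hi hj⟩
  have opp : ∀ a b c d i j, a ≠ b → a ≠ c → a ≠ d → b ≠ c → b ≠ d → c ≠ d →
      i < replaceLen len x y n a b → j < replaceLen len x y n c d →
      replaceRung r x y g n a b i ≠ replaceRung r x y g n c d j ∧
      ¬ G.Adj (replaceRung r x y g n a b i) (replaceRung r x y g n c d j) := by
    intro a b c d i j hab hac had hbc hbd hcd hi hj
    have flip : ∀ {u v : V}, (u ≠ v ∧ ¬ G.Adj u v) → v ≠ u ∧ ¬ G.Adj v u := fun h =>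
      ⟨h.1.symm, fun h' => h.2 h'.symm⟩
    rcases cases a b with ⟨rfl, rfl⟩ | ⟨rfl, rfl⟩ | ⟨h1, h2⟩
    · rw [replaceLen_self] at hi
      have h3 : ¬ (c = a ∧ d = b) := fun h => hac h.1.symm
      have h4 : ¬ (c = b ∧ d = a) := fun h => hbc h.1.symm
      rw [replaceLen_other _ h3 h4] at hj
      rw [replaceRung_self, replaceRung_other _ _ _ h3 h4]
      exact ho c d i j ⟨hab, hac, had, hbc, hbd, hcd⟩ (by omega) hj
    · rw [replaceLen_rev] at hi
      have h3 : ¬ (c = b ∧ d = a) := fun h => hbc h.1.symm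
      have h4 : ¬ (c = a ∧ d = b) := fun h => hac h.1.symm
      rw [replaceLen_other _ h3 h4] at hj
      rw [replaceRung_rev hxy, replaceRung_other _ _ _ h3 h4]
      exact ho c d (n - i) j ⟨hxy, hbc, hbd, hac, had, hcd⟩ (by omega) hj
    · rw [replaceLen_other _ h1 h2] at hi
      rw [replaceRung_other _ _ _ h1 h2]
      rcases cases c d with ⟨rfl, rfl⟩ | ⟨rfl, rfl⟩ | ⟨h3, h4⟩
      · rw [replaceLen_self] at hj
        rw [replaceRung_self]
        exact flip (ho a b j i ⟨hcd, hac.symm, hbc.symm, had.symm, hbd.symm, hab⟩ (by omega) hi)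
      · rw [replaceLen_rev] at hj
        rw [replaceRung_rev hxy]
        exact flip (ho a b (n - j) i ⟨hxy, had.symm, hbd.symm, hac.symm, hbc.symm, hab⟩ (by omega) hi)
      · rw [replaceLen_other _ h3 h4] at hj
        rw [replaceRung_other _ _ _ h3 h4]
        exact ⟨R.opp_ne a b c d i j hab hac had hbc hbd hcd hi hj,
          R.opp_adj a b c d i j hab hac had hbc hbd hcd hi hj⟩
  refine ⟨?_, ?_, ?_, ?_, ?_, fun a b c i j h1 h2 h3 h4 h5 => (meet a b c i j h1 h2 h3 h4 h5).1,
    fun a b c i j h1 h2 h3 h4 h5 => (meet a b c i j h1 h2 h3 h4 h5).2,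
    fun a b c d i j h1 h2 h3 h4 h5 h6 h7 h8 => (opp a b c d i j h1 h2 h3 h4 h5 h6 h7 h8).1,
    fun a b c d i j h1 h2 h3 h4 h5 h6 h7 h8 => (opp a b c d i j h1 h2 h3 h4 h5 h6 h7 h8).2, hp⟩
  · intro u v huv
    unfold replaceLen
    split_ifs
    · omega
    · exact R.pos u v huv
  · intro u v
    unfold replaceLen
    rw [R.len_symm u v]
    congr 1
    simp only [eq_iff_iff]; tauto
  · intro u v i huv hi
    rcases cases u v with ⟨rfl, rfl⟩ | ⟨rfl, rfl⟩ | ⟨h1, h2⟩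
    · rw [replaceRung_rev hxy, replaceRung_self, replaceLen_self, Nat.add_sub_cancel]
    · rw [replaceLen_rev] at hi
      rw [replaceRung_rev hxy, replaceRung_self, replaceLen_rev]
      congr 1; omega
    · rw [replaceLen_other _ h1 h2] at hi
      rw [replaceRung_other _ _ _ h1 h2, replaceLen_other _ h1 h2,
        replaceRung_other _ _ _ (fun h => h2 h.symm) (fun h => h1 h.symm), R.rev u v i huv hi]
  · intro u v i j huv hi hj he
    rcases cases u v with ⟨rfl, rfl⟩ | ⟨rfl, rfl⟩ | ⟨h1, h2⟩
    · rw [replaceLen_self] at hi hj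
      rw [replaceRung_self, replaceRung_self] at he
      exact hg.inj i (by omega) j (by omega) he
    · rw [replaceLen_rev] at hi hj
      rw [replaceRung_rev hxy, replaceRung_rev hxy] at he
      have := hg.inj _ (by omega) _ (by omega) he
      omega
    · rw [replaceLen_other _ h1 h2] at hi hj
      rw [replaceRung_other _ _ _ h1 h2, replaceRung_other _ _ _ h1 h2] at he
      exact R.inj u v i j huv hi hj he
  · intro u v i j huv hi hj
    rcases cases u v with ⟨rfl, rfl⟩ | ⟨rfl, rfl⟩ | ⟨h1, h2⟩
    · rw [replaceLen_self] at hi hj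
      rw [replaceRung_self, replaceRung_self]
      exact hg.adj i (by omega) j (by omega)
    · rw [replaceLen_rev] at hi hj
      rw [replaceRung_rev hxy, replaceRung_rev hxy, hg.adj _ (by omega) _ (by omega)]
      omega
    · rw [replaceLen_other _ h1 h2] at hi hj
      rw [replaceRung_other _ _ _ h1 h2, replaceRung_other _ _ _ h1 h2]
      exact R.adj u v i j huv hi hj

/-- The vertices on the rungs other than `xy`. -/
def otherSet (len : Fin 4 → Fin 4 → ℕ) (r : Fin 4 → Fin 4 → ℕ → V) (x y : Fin 4) : Set V :=
  {v | ∃ a b i, a ≠ b ∧ ¬ (a = x ∧ b = y) ∧ ¬ (a = y ∧ b = x) ∧ i < len a b ∧ r a b i = v}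

theorem rungSet_replace {x y : Fin 4} (hxy : x ≠ y) (g : ℕ → V) (n : ℕ) :
    rungSet (replaceLen len x y n) (replaceRung r x y g n) = otherSet len r x y ∪ seg g 0 n := by
  ext v
  constructor
  · rintro ⟨a, b, i, hab, hi, rfl⟩
    by_cases h1 : a = x ∧ b = y
    · obtain ⟨rfl, rfl⟩ := h1
      rw [replaceLen_self] at hi
      rw [replaceRung_self]
      exact Or.inr ⟨i, Nat.zero_le _, by omega, rfl⟩
    · by_cases h2 : a = y ∧ b = x
      · obtain ⟨rfl, rfl⟩ := h2
        rw [replaceRung_rev hxy]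
        exact Or.inr ⟨n - i, Nat.zero_le _, by omega, rfl⟩
      · rw [replaceLen_other _ h1 h2] at hi
        rw [replaceRung_other _ _ _ h1 h2]
        exact Or.inl ⟨a, b, i, hab, h1, h2, hi, rfl⟩
  · rintro (⟨a, b, i, hab, h1, h2, hi, rfl⟩ | ⟨i, -, hi, rfl⟩)
    · exact ⟨a, b, i, hab, by rwa [replaceLen_other _ h1 h2], replaceRung_other _ _ _ h1 h2⟩
    · exact ⟨x, y, i, hxy, by rw [replaceLen_self]; omega, replaceRung_self _ _ _ _ _⟩

end Replace

end LGK4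

/-! ### How an admissible path may be attached to the prism. -/

namespace LGK4

section Step

variable {V : Type*} {G : SimpleGraph V} {len : Fin 4 → Fin 4 → ℕ} {r : Fin 4 → Fin 4 → ℕ → V}
  {x y z w : Fin 4}

theorem seg_eq_image (f : ℕ → V) (n : ℕ) : seg f 0 n = f '' Set.Iic n := by
  ext v
  simp [seg]

theorem ncard_Iic (n : ℕ) : (Set.Iic n).ncard = n + 1 := by
  rw [Set.ncard_eq_toFinset_card']; simp

theorem ncard_seg_le (f : ℕ → V) (n : ℕ) : (seg f 0 n).ncard ≤ n + 1 := by
  rw [seg_eq_image, ← ncard_Iic n]; exact Set.ncard_image_le (Set.finite_Iic n)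

theorem ncard_seg {f : ℕ → V} {n : ℕ} (hf : IsInducedPath G f n) : (seg f 0 n).ncard = n + 1 := by
  rw [seg_eq_image, ← ncard_Iic n]
  exact Set.InjOn.ncard_image fun i hi j hj he => hf.inj i hi j hj he

theorem IsRungSystem.inducedPath (R : IsRungSystem G len r) (hxy : x ≠ y) :
    IsInducedPath G (r x y) (len x y - 1) where
  inj i hi j hj := by
    have := R.pos x y hxy
    exact R.inj x y i j hxy (by omega) (by omega)
  adj i hi j hj := by
    have := R.pos x y hxy
    exact R.adj x y i j hxy (by omega) (by omega)

theorem IsRungSystem.notMem_otherSet (R : IsRungSystem G len r) (hxy : x ≠ y) {i : ℕ}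
    (hi : i < len x y) : r x y i ∉ otherSet len r x y := by
  rintro ⟨a, b, j, hab, h1, h2, hj, he⟩
  have := position_induction R.len_symm (Q := fun x y i a b j =>
    ¬ (a = x ∧ b = y) → ¬ (a = y ∧ b = x) → r a b j ≠ r x y i) ?_ ?_ ?_ ?_ ?_ x y i a b j hxy hab hi hj
  · exact this h1 h2 he
  · intro x y i a b j hxy hab hi hj h h1 h2
    rw [R.rev x y i hxy hi]; exact h h2 h1
  · intro x y i a b j hxy hab hi hj h h1 h2
    rw [R.rev a b j hab hj]; exact h (fun h => h2 h.symm) (fun h => h1 h.symm)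
  · intro x y i j _ _ _ h
    exact absurd ⟨rfl, rfl⟩ h
  · intro x y z i j h1 h2 h3 h4 h5 _ _
    exact (R.meet_ne x y z i j h1 h2 h3 h4 h5).symm
  · intro x y z w i j h1 h2 h3 h4 h5 h6 h7 h8 _ _
    exact (R.opp_ne x y z w i j h1 h2 h3 h4 h5 h6 h7 h8).symm

theorem IsRungSystem.rungSet_eq (R : IsRungSystem G len r) (hxy : x ≠ y) :
    rungSet len r = otherSet len r x y ∪ seg (r x y) 0 (len x y - 1) := by
  have hpos := R.pos x y hxy
  have hl := R.len_symm x y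
  ext v
  constructor
  · rintro ⟨a, b, i, hab, hi, rfl⟩
    by_cases h1 : a = x ∧ b = y
    · obtain ⟨rfl, rfl⟩ := h1
      exact Or.inr (mem_seg (Nat.zero_le _) (by omega))
    · by_cases h2 : a = y ∧ b = x
      · obtain ⟨rfl, rfl⟩ := h2
        rw [R.rev b a i hxy (by omega)]
        exact Or.inr (mem_seg (Nat.zero_le _) (by omega))
      · exact Or.inl ⟨a, b, i, hab, h1, h2, hi, rfl⟩
  · rintro (⟨a, b, i, hab, -, -, hi, rfl⟩ | ⟨i, -, hi, rfl⟩)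
    · exact ⟨a, b, i, hab, hi, rfl⟩
    · exact ⟨x, y, i, hxy, by omega, rfl⟩

/-- The vertex set of a system of rungs is as small as possible. -/
def IsMinimal (G : SimpleGraph V) (len : Fin 4 → Fin 4 → ℕ) (r : Fin 4 → Fin 4 → ℕ → V) : Prop :=
  ∀ T : Set V, IsLGPSK4 G T → (rungSet len r).ncard ≤ T.ncard

theorem IsRungSystem.ncard_rungSet [Finite V] (R : IsRungSystem G len r) (hxy : x ≠ y) :
    (rungSet len r).ncard = (otherSet len r x y).ncard + len x y := by
  have hpos := R.pos x y hxy
  rw [R.rungSet_eq hxy, Set.ncard_union_eq, ncard_seg (R.inducedPath hxy)]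
  · omega
  · rw [Set.disjoint_right]
    rintro _ ⟨i, -, hi, rfl⟩
    exact R.notMem_otherSet hxy (by omega)

/-- A rung of a smallest subgraph cannot be exchanged for fewer vertices. -/
theorem IsRungSystem.len_le [Finite V] (R : IsRungSystem G len r) (hmin : IsMinimal G len r)
    (hxy : x ≠ y) {q : ℕ → V} {t : ℕ} {T : Set V} (hT : T ⊆ otherSet len r x y ∪ seg q 0 t)
    (hT' : IsLGPSK4 G T) : len x y ≤ t + 1 := by
  have h1 := hmin T hT'
  rw [R.ncard_rungSet hxy] at h1
  have h2 := Set.ncard_le_ncard hT (Set.toFinite _)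
  have h3 := Set.ncard_union_le (otherSet len r x y) (seg q 0 t)
  have h4 := ncard_seg_le q t
  omega

theorem IsRungSystem.prism_subset (R : IsRungSystem G len r) (D : Distinct x y z w) {a : Fin 3}
    {i : ℕ} (hi : i ≤ prismLen len x y z w a) :
    prismPath len r x y z w a i ∈ otherSet len r x y := by
  fin_cases a
  · obtain ⟨u, j, hu, hj, he⟩ := R.through_eq D.xz.symm D.xw hi
    refine ⟨x, u, j, ?_, ?_, ?_, hj, he.symm⟩
    · rcases hu with rfl | rfl
      exacts [D.xz, D.xw]
    · rintro ⟨-, rfl⟩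
      exact hu.elim D.yz D.yw
    · exact fun h => D.xy h.1
  · obtain ⟨u, j, hu, hj, he⟩ := R.through_eq D.yz.symm D.yw hi
    refine ⟨y, u, j, ?_, ?_, ?_, hj, he.symm⟩
    · rcases hu with rfl | rfl
      exacts [D.yz, D.yw]
    · exact fun h => D.xy h.1.symm
    · rintro ⟨-, rfl⟩
      exact hu.elim D.xz D.xw
  · have := R.pos z w D.zw
    exact ⟨z, w, i, D.zw, fun h => D.xz h.1.symm, fun h => D.yz h.1.symm,
      by simp [prismLen] at hi; omega, rfl⟩

/-- A path `P 0, …, P k` that is to replace the first part, of length `A`, of the rung `xy`, of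
length `A + B`, in a smallest subgraph. -/
structure IsStep (G : SimpleGraph V) (len : Fin 4 → Fin 4 → ℕ) (r : Fin 4 → Fin 4 → ℕ → V)
    (x y z w : Fin 4) (A B k : ℕ) (P : ℕ → V) : Prop where
  noPyramid : ¬ ContainsPyramid G
  R : IsRungSystem G len r
  minimal : IsMinimal G len r
  D : Distinct x y z w
  len_eq : len x y = A + B + 1
  two_le : 2 ≤ A
  le_succ : A ≤ B + 1
  k_le : k ≤ A
  path : IsInducedPath G P k
  P_zero : P 0 = r x y 0
  P_last : P k = r x y A
  corner : ∀ i, 0 < i → i < k → ∀ u v, u ≠ v → r u v 0 ≠ r x y 0 → ¬ G.Adj (P i) (r u v 0)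

variable {A B k : ℕ} {P : ℕ → V}

namespace IsStep

theorem rung_adj_zero (S : IsStep G len r x y z w A B k P) {i j : ℕ} (hi : i ≤ A + B)
    (hj : j ≤ prismLen len x y z w 0) :
    r x y i ≠ prismPath len r x y z w 0 j ∧ (G.Adj (r x y i) (prismPath len r x y z w 0 j) ↔
      i = 0 ∧ (j = len z x - 1 ∨ j = len z x - 1 + 1)) :=
  S.R.adj_through_start S.D (by have := S.len_eq; omega) hj

theorem rung_adj_one (S : IsStep G len r x y z w A B k P) {i j : ℕ} (hi : i ≤ A + B)
    (hj : j ≤ prismLen len x y z w 1) :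
    r x y i ≠ prismPath len r x y z w 1 j ∧ (G.Adj (r x y i) (prismPath len r x y z w 1 j) ↔
      i = A + B ∧ (j = len z y - 1 ∨ j = len z y - 1 + 1)) := by
  have h := S.len_eq
  have := S.R.adj_through_end S.D (show i < len x y by omega) hj
  refine ⟨this.1, this.2.trans ?_⟩
  omega

theorem rung_adj_two (S : IsStep G len r x y z w A B k P) {i j : ℕ} (hi : i ≤ A + B)
    (hj : j ≤ prismLen len x y z w 2) :
    r x y i ≠ prismPath len r x y z w 2 j ∧ ¬ G.Adj (r x y i) (prismPath len r x y z w 2 j) := by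
  have h := S.len_eq
  obtain ⟨h1, h2, h3, h4, h5, h6⟩ := S.D
  have hp := S.R.pos z w h6
  have hj' : j < len z w := by simp [prismLen] at hj; omega
  exact ⟨S.R.opp_ne x y z w i j h1 h2 h3 h4 h5 h6 (by omega) hj',
    S.R.opp_adj x y z w i j h1 h2 h3 h4 h5 h6 (by omega) hj'⟩

theorem rung_ne (S : IsStep G len r x y z w A B k P) {i j : ℕ} (hi : i ≤ A + B) {a : Fin 3}
    (hj : j ≤ prismLen len x y z w a) : r x y i ≠ prismPath len r x y z w a j := by
  fin_cases a
  · exact (S.rung_adj_zero hi hj).1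
  · exact (S.rung_adj_one hi hj).1
  · exact (S.rung_adj_two hi hj).1

/-- The path starts at the corner of `x`, which differs from the corner of `y` as `2 ≤ A`; so it is
attached to the prism path through `x` only. -/
theorem zero_adj (S : IsStep G len r x y z w A B k P) {a : Fin 3} (ha : a ≠ 0) {j : ℕ}
    (hj : j ≤ prismLen len x y z w a) : ¬ G.Adj (P 0) (prismPath len r x y z w a j) := by
  have := S.two_le
  rw [S.P_zero]
  fin_cases a
  · exact absurd rfl ha
  · exact fun h => by have := ((S.rung_adj_one (Nat.zero_le _) hj).2.mp h).1; omega
  · exact (S.rung_adj_two (Nat.zero_le _) hj).2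

/-- The inner vertices of the path have no neighbours in the triangles of the prism. -/
theorem inner (S : IsStep G len r x y z w A B k P) {s : ℕ} (hs : 0 < s) (hsk : s < k) {a : Fin 3}
    {j : ℕ} (hj : j ≤ prismLen len x y z w a)
    (hadj : G.Adj (P s) (prismPath len r x y z w a j)) : 0 < j ∧ j < prismLen len x y z w a := by
  have hD := S.D
  -- Different rungs are disjoint, so the ends of the other rungs differ from the corner at which
  -- the path starts, and the condition on corners applies to them.
  have hne : ∀ u v, u ≠ v → ¬ (u = x ∧ v = y) → ¬ (u = y ∧ v = x) → r u v 0 ≠ r x y 0 := by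
    intro u v huv h1 h2 he
    refine S.R.notMem_otherSet hD.xy (S.R.pos x y hD.xy) ?_
    rw [← he]
    exact ⟨u, v, 0, huv, h1, h2, S.R.pos u v huv, rfl⟩
  have hc := S.corner s hs hsk
  -- The six ends of the prism paths are the corners at `z` and at `w`.
  have hzx := hc z x hD.xz.symm (hne _ _ hD.xz.symm (fun h => hD.xz h.1.symm) fun h => hD.yz h.1.symm)
  have hzy := hc z y hD.yz.symm (hne _ _ hD.yz.symm (fun h => hD.xz h.1.symm) fun h => hD.yz h.1.symm)
  have hzw := hc z w hD.zw (hne _ _ hD.zw (fun h => hD.xz h.1.symm) fun h => hD.yz h.1.symm)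
  have hwx := hc w x hD.xw.symm (hne _ _ hD.xw.symm (fun h => hD.xw h.1.symm) fun h => hD.yw h.1.symm)
  have hwy := hc w y hD.yw.symm (hne _ _ hD.yw.symm (fun h => hD.xw h.1.symm) fun h => hD.yw h.1.symm)
  have hwz := hc w z hD.zw.symm (hne _ _ hD.zw.symm (fun h => hD.xw h.1.symm) fun h => hD.yw h.1.symm)
  have h0 : j ≠ 0 := by
    rintro rfl
    fin_cases a
    · exact hzx (by rw [← S.R.through_zero (w := w) hD.xz.symm]; exact hadj)
    · exact hzy (by rw [← S.R.through_zero (w := w) hD.yz.symm]; exact hadj)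
    · exact hzw hadj
  have hl : j ≠ prismLen len x y z w a := by
    rintro rfl
    fin_cases a
    · exact hwx (by rw [← S.R.through_last (z := z) hD.xw]; exact hadj)
    · exact hwy (by rw [← S.R.through_last (z := z) hD.yw]; exact hadj)
    · refine hwz ?_
      rw [S.R.rev z w 0 hD.zw (S.R.pos z w hD.zw)]
      exact hadj
  omega

theorem prism (S : IsStep G len r x y z w A B k P) :
    IsPrism G (prismPath len r x y z w) (prismLen len x y z w) := S.R.isPrism S.D

/-- No hop over the prism is shorter than the rung. -/
theorem no_hop [Finite V] (S : IsStep G len r x y z w A B k P) (σ : Equiv.Perm (Fin 3)) {q : ℕ → V}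
    {t : ℕ} (ht : t < A + B)
    (H : IsHop G (prismPath len r x y z w ∘ σ) (prismLen len x y z w ∘ σ) q t) : False := by
  have P' : IsPrism G (prismPath len r x y z w ∘ σ) (prismLen len x y z w ∘ σ) :=
    ⟨fun a => S.prism.path _, fun a b i j hab => S.prism.ne _ _ i j (σ.injective.ne hab),
      fun a b i j hab => S.prism.adj _ _ i j (σ.injective.ne hab)⟩
  obtain ⟨T, hT, hT'⟩ := H.exists_isLGPSK4 S.noPyramid P'
  have := S.R.len_le S.minimal S.D.xy (q := q) (t := t) (hT.trans (Set.union_subset_union_left _ ?_)) hT'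
  · have := S.len_eq
    omega
  · rintro _ ⟨a, i, hi, rfl⟩
    exact S.R.prism_subset S.D hi

/-- The path has no neighbours on the paths of the prism that avoid `x`. -/
theorem not_adj_right [Finite V] (S : IsStep G len r x y z w A B k P) {s : ℕ} (hs : s < k)
    {a : Fin 3} (ha : a ≠ 0) {j : ℕ} (hj : j ≤ prismLen len x y z w a) :
    ¬ G.Adj (P s) (prismPath len r x y z w a j) := by
  classical
  intro hadj
  set f := prismPath len r x y z w with hf
  set l := prismLen len x y z w with hl
  have hex : ∃ s, s < k ∧ ∃ a j, a ≠ 0 ∧ j ≤ l a ∧ G.Adj (P s) (f a j) := ⟨s, hs, a, j, ha, hj, hadj⟩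
  obtain ⟨hrk, a', j', ha', hj', hadj'⟩ := Nat.find_spec hex
  have hmin : ∀ s, s < Nat.find hex → ∀ a j, a ≠ 0 → j ≤ l a → ¬ G.Adj (P s) (f a j) :=
    fun s h a j ha hj h' => Nat.find_min hex h ⟨by omega, a, j, ha, hj, h'⟩
  -- `e` is the first vertex of the path that sees a prism path avoiding `x`; the hop is to end
  -- there.
  set e := Nat.find hex with he
  have he0 : e ≠ 0 := fun h => S.zero_adj ha' hj' (h ▸ hadj')
  have hlz := S.R.len_symm z x
  have hlx := S.R.pos z x S.D.xz.symm
  have hlw := S.R.pos x w S.D.xw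
  have l0 : l 0 = len z x + len x w - 1 := rfl
  have hP0 : ∀ j ≤ l 0, (G.Adj (P 0) (f 0 j) ↔ j = len z x - 1 ∨ j = len z x - 1 + 1) := by
    intro j hj
    rw [S.P_zero, (S.rung_adj_zero (Nat.zero_le _) hj).2]
    simp
  let B' : ℕ → Prop := fun s => ∃ i ≤ l 0, G.Adj (P s) (f 0 i)
  have hB0 : B' 0 := ⟨len z x - 1, by omega, (hP0 _ (by omega)).mpr (Or.inl rfl)⟩
  -- `b` is the last vertex up to `e` that sees the prism path through `x`; the vertex at 0 does,
  -- being a corner of `x`. Between `b` and `e` there are no other attachments, and `e - b` is less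
  -- than `A + B`.
  set b := Nat.findGreatest B' e with hb
  have hbe : b ≤ e := Nat.findGreatest_le e
  have hBb : B' b := Nat.findGreatest_spec (P := B') (Nat.zero_le e) hB0
  have hmax : ∀ s, b < s → s ≤ e → ∀ i ≤ l 0, ¬ G.Adj (P s) (f 0 i) := fun s h1 h2 i hi h =>
    Nat.findGreatest_is_greatest h1 h2 ⟨i, hi, h⟩
  have hk := S.k_le
  refine S.no_hop (Equiv.refl _) (q := fun i => P (b + i)) (t := e - b) (by omega) ?_
  -- If `P s` were on the prism path through `x`, its successor would contradict the choice of `b`,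
  -- or, if `s = e`, an adjacency between two prism paths would have to be in a triangle. On another
  -- prism path, its predecessor would contradict the choice of `e`.
  have hnot : ∀ a i s, i ≤ l a → b ≤ s → s ≤ e → P s ≠ f a i := by
    intro a i s hi hbs hse heq
    rcases Nat.eq_zero_or_pos s with rfl | hs0
    · rw [S.P_zero] at heq
      exact S.rung_ne (Nat.zero_le _) hi heq
    · by_cases ha0 : a = 0
      · subst ha0
        rcases hse.lt_or_eq with h | rfl
        · refine hmax (s + 1) (by omega) (by omega) i hi ?_
          rw [← heq]
          exact (S.path.adj _ (by omega) _ (by omega)).mpr (Or.inr rfl)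
        · rw [heq] at hadj'
          have h1 := (S.prism.adj 0 a' i j' (Ne.symm ha') hi hj').mp hadj'
          rw [← heq] at hadj'
          have := S.inner (by omega) hrk hj' hadj'
          omega
      · refine hmin (s - 1) (by omega) a i ha0 hi ?_
        rw [← heq]
        exact (S.path.adj _ (by omega) _ (by omega)).mpr (Or.inl (by omega))
  refine ⟨S.path.sub (by omega), ?_, ?_, ?_, ?_, ?_, ?_, ?_⟩
  · exact fun a i s hi hs => hnot a i (b + s) hi (by omega) (by omega)
  · exact fun s i hs hs0 hi => hmax (b + s) (by omega) (by omega) i hi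
  · exact fun a s i ha hs hi => hmin (b + s) (by omega) a i ha hi
  · intro a i ha hi h
    rw [show b + (e - b) = e by omega] at h
    exact S.inner (by omega) hrk hi h
  -- If the hop starts at the corner of `x`, its neighbours are the two consecutive vertices where
  -- the rungs `zx` and `xw` join; otherwise it starts at an inner vertex of the path, which sees no
  -- end of a prism path.
  · rcases Nat.eq_zero_or_pos b with hb0 | hb0
    · refine Or.inr ⟨by omega, len z x - 1, ?_, ?_⟩
      · change len z x - 1 < l 0
        omega
      · intro j hj
        rw [hb0]
        exact hP0 j hj
    · exact Or.inl fun i hi h => S.inner hb0 (by omega) hi h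
  · exact hBb
  · refine ⟨a', j', ha', hj', ?_⟩
    rw [show b + (e - b) = e by omega]
    exact hadj'

/-- The path has no neighbours on the path of the prism through `x`. -/
theorem not_adj_left [Finite V] (S : IsStep G len r x y z w A B k P) {s : ℕ} (hs0 : 0 < s)
    (hs : s < k) {j : ℕ} (hj : j ≤ prismLen len x y z w 0) :
    ¬ G.Adj (P s) (prismPath len r x y z w 0 j) := by
  classical
  intro hadj
  set f := prismPath len r x y z w with hf
  set l := prismLen len x y z w with hl
  have hk := S.k_le
  have h2 := S.two_le
  let B' : ℕ → Prop := fun s => ∃ i ≤ l 0, G.Adj (P s) (f 0 i)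
  set b := Nat.findGreatest B' (k - 1) with hb
  have hbk : b ≤ k - 1 := Nat.findGreatest_le _
  have hsb : s ≤ b := Nat.le_findGreatest (by omega) ⟨j, hj, hadj⟩
  have hBb : B' b := Nat.findGreatest_spec (P := B') (show s ≤ k - 1 by omega) ⟨j, hj, hadj⟩
  have hmax : ∀ s, b < s → s < k → ∀ i ≤ l 0, ¬ G.Adj (P s) (f 0 i) := fun s h1 h2 i hi h =>
    Nat.findGreatest_is_greatest h1 (by omega) ⟨i, hi, h⟩
  -- The part of the path from its last attachment `b` onwards, together with the untouched part of
  -- the rung. In this set only `P b` sees the prism path through `x`, and only the corner of `y`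
  -- sees the one through `y`.
  let Y : Set V := {v | (∃ i, b ≤ i ∧ i < k ∧ P i = v) ∨ ∃ i, A ≤ i ∧ i ≤ A + B ∧ r x y i = v}
  have hY0 : ∀ v ∈ Y, ∀ i ≤ l 0, G.Adj v (f 0 i) → v = P b := by
    rintro v (⟨m, hm, hmk, rfl⟩ | ⟨m, hm, hm', rfl⟩) i hi h
    · rcases hm.lt_or_eq with h' | rfl
      · exact absurd h (hmax m h' hmk i hi)
      · rfl
    · have := ((S.rung_adj_zero hm' hi).2.mp h).1
      omega
  have hY1 : ∀ v ∈ Y, ∀ i ≤ l 1, G.Adj v (f 1 i) → v = r x y (A + B) := by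
    rintro v (⟨m, hm, hmk, rfl⟩ | ⟨m, hm, hm', rfl⟩) i hi h
    · exact absurd h (S.not_adj_right hmk (by decide) hi)
    · rw [((S.rung_adj_one hm' hi).2.mp h).1]
  have hY2 : ∀ v ∈ Y, ∀ i ≤ l 2, ¬ G.Adj v (f 2 i) := by
    rintro v (⟨m, hm, hmk, rfl⟩ | ⟨m, hm, hm', rfl⟩) i hi h
    · exact S.not_adj_right hmk (by decide) hi h
    · exact (S.rung_adj_two hm' hi).2 h
  have hYn : ∀ v ∈ Y, ∀ a i, i ≤ l a → v ≠ f a i := by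
    rintro v (⟨m, hm, hmk, rfl⟩ | ⟨m, hm, hm', rfl⟩) a i hi heq
    · by_cases ha0 : a = 0
      · subst ha0
        have hadj' : G.Adj (P (m + 1)) (f 0 i) := by
          rw [← heq]
          exact (S.path.adj _ (by omega) _ (by omega)).mpr (Or.inr rfl)
        rcases (show m + 1 ≤ k by omega).lt_or_eq with h | h
        · exact hmax (m + 1) (by omega) h i hi hadj'
        · rw [h, S.P_last] at hadj'
          have := ((S.rung_adj_zero (by omega) hi).2.mp hadj').1
          omega
      · refine S.not_adj_right (s := m - 1) (by omega) ha0 hi ?_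
        rw [← hf, ← heq]
        exact (S.path.adj _ (by omega) _ (by omega)).mpr (Or.inl (by omega))
    · exact S.rung_ne hm' hi heq
  -- From the corner of `y` down the rung to the middle vertex, in `B` steps, and then backwards
  -- along `P` to `P b`. Since `b` is positive and `k ≤ A`, the length `B + (k - b)` is less than `A
  -- + B`.
  let u : ℕ → V := fun i => if i ≤ B then r x y (A + B - i) else P (k - (i - B))
  have hu : ∀ i < B + (k - b), G.Adj (u i) (u (i + 1)) := by
    intro i hi
    have hl := S.len_eq
    by_cases h1 : i + 1 ≤ B
    · simp only [u, h1, show i ≤ B by omega, if_true]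
      exact (S.R.adj x y _ _ S.D.xy (by omega) (by omega)).mpr (Or.inr (by omega))
    · by_cases h3 : i ≤ B
      · simp only [u, h1, h3, if_true, if_false]
        rw [show A + B - i = A by omega, ← S.P_last, show k - (i + 1 - B) = k - 1 by omega]
        exact (S.path.adj _ (by omega) _ (by omega)).mpr (Or.inr (by omega))
      · simp only [u, h1, h3, if_false]
        exact (S.path.adj _ (by omega) _ (by omega)).mpr (Or.inr (by omega))
  have huY : ∀ i ≤ B + (k - b), u i ∈ Y := by
    intro i hi
    by_cases h3 : i ≤ B
    · simp only [u, h3, if_true]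
      exact Or.inr ⟨_, by omega, by omega, rfl⟩
    · simp only [u, h3, if_false]
      exact Or.inl ⟨_, by omega, by omega, rfl⟩
  have hub : u (B + (k - b)) = P b := by
    simp only [u, show ¬ (B + (k - b) ≤ B) by omega, if_false]
    congr 1; omega
  have hu0 : u 0 = r x y (A + B) := by simp [u]
  obtain ⟨p, hp⟩ := exists_isShortestIn Y (walkOfFn u _ hu) (by
    intro v hv
    obtain ⟨i, hi, rfl⟩ := (mem_support_walkOfFn _ _ _ _).mp hv
    exact huY i hi)
  have hpl : p.length ≤ B + (k - b) := by
    have := hp.le (walkOfFn u _ hu) (by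
      intro v hv
      obtain ⟨i, hi, rfl⟩ := (mem_support_walkOfFn _ _ _ _).mp hv
      exact huY i hi)
    rwa [length_walkOfFn] at this
  have hpY : ∀ i, p.getVert i ∈ Y := fun i => hp.subset _ (p.getVert_mem_support i)
  have hp0 : p.getVert 0 = r x y (A + B) := by rw [Walk.getVert_zero, hu0]
  have hpt : p.getVert p.length = P b := by rw [Walk.getVert_length, hub]
  have hip := hp.inducedPath
  have ht0 : 0 < p.length := by
    by_contra h
    rw [show p.length = 0 by omega, hp0] at hpt
    obtain ⟨i, hi, h'⟩ := hBb
    rw [← hpt] at h'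
    have := ((S.rung_adj_zero le_rfl hi).2.mp h').1
    omega
  have hlz := S.R.pos z y S.D.yz.symm
  have hly := S.R.pos y w S.D.yw
  have l1 : l 1 = len z y + len y w - 1 := rfl
  have hQ1 : ∀ j ≤ l 1, (G.Adj (p.getVert 0) (f 1 j) ↔ j = len z y - 1 ∨ j = len z y - 1 + 1) := by
    intro j hj
    rw [hp0, (S.rung_adj_one le_rfl hj).2]
    simp
  -- The hop starts at the corner of `y`, so the prism path through `y` takes the role of the first
  -- path.
  refine S.no_hop (Equiv.swap 0 1) (q := p.getVert) (t := p.length) (by omega) ?_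
  have e0 : (Equiv.swap (0 : Fin 3) 1) 0 = 1 := by decide
  have e1 : (Equiv.swap (0 : Fin 3) 1) 1 = 0 := by decide
  have e2 : (Equiv.swap (0 : Fin 3) 1) 2 = 2 := by decide
  refine ⟨hip, fun a i s hi hs => hYn _ (hpY s) _ i hi, ?_, ?_, ?_, ?_, ?_, ?_⟩
  · intro s i hs hs0 hi h
    simp only [Function.comp, e0] at hi h
    have := hip.inj s hs 0 (Nat.zero_le _) ((hY1 _ (hpY s) i hi h).trans hp0.symm)
    omega
  · intro a s i ha hs hi h
    fin_cases a
    · exact absurd rfl ha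
    · have := hip.inj s hs.le _ le_rfl ((hY0 _ (hpY s) i hi h).trans hpt.symm)
      omega
    · exact hY2 _ (hpY s) i hi h
  · intro a i ha hi h
    rw [hpt] at h
    exact S.inner (by omega) (by omega) hi h
  · refine Or.inr ⟨ht0, len z y - 1, ?_, hQ1⟩
    change len z y - 1 < l 1
    omega
  · exact ⟨len z y - 1, show len z y - 1 ≤ l 1 by omega, (hQ1 _ (by omega)).mpr (Or.inl rfl)⟩
  · obtain ⟨i, hi, h⟩ := hBb
    exact ⟨1, i, by decide, hi, by rw [hpt]; exact h⟩

end IsStep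

end Step

end LGK4

/-! ### Replacing a part of a rung of a smallest subgraph. -/

namespace LGK4

section Replacement

variable {V : Type*} {G : SimpleGraph V} {len : Fin 4 → Fin 4 → ℕ} {r : Fin 4 → Fin 4 → ℕ → V}
  {x y z w : Fin 4} {A B k : ℕ} {P : ℕ → V}

namespace IsStep

/-- A vertex of the path on the prism would make a neighbouring vertex of the path see the prism,
which is excluded by `not_adj_left`, `not_adj_right` and the attachments of the rung. -/
theorem path_ne [Finite V] (S : IsStep G len r x y z w A B k P) {m : ℕ} (hm : m ≤ k) {a : Fin 3}
    {j : ℕ} (hj : j ≤ prismLen len x y z w a) : P m ≠ prismPath len r x y z w a j := by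
  have h2 := S.two_le
  intro heq
  rcases hm.lt_or_eq with hm | rfl
  · rcases Nat.eq_zero_or_pos m with rfl | h0
    · rw [S.P_zero] at heq
      exact S.rung_ne (Nat.zero_le _) hj heq
    · by_cases ha0 : a = 0
      · subst ha0
        have hadj' : G.Adj (P (m + 1)) (prismPath len r x y z w 0 j) := by
          rw [← heq]
          exact (S.path.adj _ (by omega) _ (by omega)).mpr (Or.inr rfl)
        rcases (show m + 1 ≤ k by omega).lt_or_eq with h | h
        · exact S.not_adj_left (by omega) h hj hadj'
        · rw [h, S.P_last] at hadj'
          have := ((S.rung_adj_zero (by omega) hj).2.mp hadj').1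
          omega
      · refine S.not_adj_right (s := m - 1) (by omega) ha0 hj ?_
        rw [← heq]
        exact (S.path.adj _ (by omega) _ (by omega)).mpr (Or.inl (by omega))
  · rw [S.P_last] at heq
    exact S.rung_ne (by omega) hj heq

/-- The vertices that may be used instead of those of the rung. -/
def newSet (r : Fin 4 → Fin 4 → ℕ → V) (x y : Fin 4) (A B k : ℕ) (P : ℕ → V) : Set V :=
  {v | (∃ i ≤ k, P i = v) ∨ ∃ i, A ≤ i ∧ i ≤ A + B ∧ r x y i = v}

/-- The path and the rest of the rung together have no attachments to the prism other than those of
the two corners of the rung. At the middle vertex, where they meet, the statement is that for the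
rung. -/
theorem newSet_spec [Finite V] (S : IsStep G len r x y z w A B k P) {v : V}
    (hv : v ∈ newSet r x y A B k P) :
    (v ≠ r x y 0 → ∀ j ≤ prismLen len x y z w 0, ¬ G.Adj v (prismPath len r x y z w 0 j)) ∧
    (v ≠ r x y (A + B) → ∀ j ≤ prismLen len x y z w 1, ¬ G.Adj v (prismPath len r x y z w 1 j)) ∧
    (∀ j ≤ prismLen len x y z w 2, ¬ G.Adj v (prismPath len r x y z w 2 j)) ∧
    ∀ a, ∀ j ≤ prismLen len x y z w a, v ≠ prismPath len r x y z w a j := by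
  have h2 := S.two_le
  have hr : ∀ i, A ≤ i → i ≤ A + B →
    (r x y i ≠ r x y 0 → ∀ j ≤ prismLen len x y z w 0,
      ¬ G.Adj (r x y i) (prismPath len r x y z w 0 j)) ∧
    (r x y i ≠ r x y (A + B) → ∀ j ≤ prismLen len x y z w 1,
      ¬ G.Adj (r x y i) (prismPath len r x y z w 1 j)) ∧
    (∀ j ≤ prismLen len x y z w 2, ¬ G.Adj (r x y i) (prismPath len r x y z w 2 j)) ∧
    ∀ a, ∀ j ≤ prismLen len x y z w a, r x y i ≠ prismPath len r x y z w a j := by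
    intro i hi hi'
    refine ⟨fun _ j hj h => ?_, fun hne j hj h => ?_, fun j hj => (S.rung_adj_two hi' hj).2,
      fun a j hj => S.rung_ne hi' hj⟩
    · have := ((S.rung_adj_zero hi' hj).2.mp h).1
      omega
    · exact hne (by rw [((S.rung_adj_one hi' hj).2.mp h).1])
  rcases hv with ⟨i, hi, rfl⟩ | ⟨i, hi, hi', rfl⟩
  · rcases hi.lt_or_eq with hi | rfl
    · refine ⟨fun hne j hj => ?_, fun _ j hj => S.not_adj_right hi (by decide) hj,
        fun j hj => S.not_adj_right hi (by decide) hj, fun a j hj => S.path_ne hi.le hj⟩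
      refine S.not_adj_left (Nat.pos_of_ne_zero ?_) hi hj
      rintro rfl
      exact hne S.P_zero
    · rw [S.P_last]
      exact hr A le_rfl (by omega)
  · exact hr i hi hi'

/-- By `newSet_spec` only the ends of the new path see the prism. These ends are the two corners of
the old rung, so their adjacencies are known. -/
theorem isRungSystem_replace [Finite V] (S : IsStep G len r x y z w A B k P) {g : ℕ → V} {n : ℕ}
    (hg : IsInducedPath G g n) (hg0 : g 0 = r x y 0) (hgn : g n = r x y (A + B))
    (hgZ : ∀ i ≤ n, g i ∈ newSet r x y A B k P) :
    IsRungSystem G (replaceLen len x y n) (replaceRung r x y g n) := by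
  have hl := S.len_eq
  have h2 := S.two_le
  obtain ⟨h1, h3, h4, h5, h6, h7⟩ := S.D
  have hzw : ∀ u, x ≠ u → y ≠ u → u = z ∨ u = w := by
    intro u hxu hyu
    rcases S.D.cover u with h | h | h | h
    · exact absurd h.symm hxu
    · exact absurd h.symm hyu
    · exact Or.inl h
    · exact Or.inr h
  have hn : n ≠ 0 := by
    rintro rfl
    have := S.R.inj x y 0 (A + B) h1 (by omega) (by omega) (hg0.symm.trans hgn)
    omega
  refine S.R.replace h1 hg ?_ ?_ ?_ ⟨x, y, h1, by rw [replaceLen_self]; omega⟩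
  · intro u i j hxu hyu hi hj
    obtain ⟨j', hj', he⟩ := S.R.eq_through h3.symm h4 (hzw u hxu hyu) hj
    have hsp := S.newSet_spec (hgZ i hi)
    refine ⟨he ▸ hsp.2.2.2 0 j' hj', ?_⟩
    by_cases hi0 : i = 0
    · subst hi0
      rw [hg0, S.R.meet_adj x y u 0 j h1 hxu hyu (by omega) hj]
    · refine ⟨fun h => absurd h ?_, fun h => absurd h.1 hi0⟩
      rw [← he]
      exact hsp.1 (fun h => hi0 (hg.inj i hi 0 (Nat.zero_le _) (h.trans hg0.symm))) j' hj'
  · intro u i j hxu hyu hi hj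
    obtain ⟨j', hj', he⟩ := S.R.eq_through h5.symm h6 (hzw u hxu hyu) hj
    have hsp := S.newSet_spec (hgZ i hi)
    refine ⟨he ▸ hsp.2.2.2 1 j' hj', ?_⟩
    by_cases hin : i = n
    · subst hin
      have hls := S.R.len_symm x y
      rw [hgn, S.R.rev y x (A + B) h1.symm (by omega),
        S.R.meet_adj y x u _ j h1.symm hyu hxu (by omega) hj]
      omega
    · refine ⟨fun h => absurd h ?_, fun h => absurd h.1 hin⟩
      rw [← he]
      exact hsp.2.1 (fun h => hin (hg.inj i hi n le_rfl (h.trans hgn.symm))) j' hj'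
  · have key : ∀ i j, i ≤ n → j < len z w → g i ≠ r z w j ∧ ¬ G.Adj (g i) (r z w j) := by
      intro i j hi hj
      have hsp := S.newSet_spec (hgZ i hi)
      have hj' : j ≤ prismLen len x y z w 2 := by simp [prismLen]; omega
      exact ⟨hsp.2.2.2 2 j hj', hsp.2.2.1 j hj'⟩
    intro z' w' i j D' hi hj
    rcases hzw z' D'.xz D'.yz with rfl | rfl
    · rcases hzw w' D'.xw D'.yw with rfl | rfl
      · exact absurd rfl D'.zw
      · exact key i j hi hj
    · rcases hzw w' D'.xw D'.yw with rfl | rfl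
      · have hls := S.R.len_symm w' z'
        rw [S.R.rev w' z' j h7 (by omega)]
        exact key i _ hi (by omega)
      · exact absurd rfl D'.zw

/-- The path has the same length as the part of the rung that it replaces, and it may replace it. -/
theorem conclusion [Finite V] (S : IsStep G len r x y z w A B k P) :
    k = A ∧ IsRungSystem G (replaceLen len x y (A + B))
      (replaceRung r x y (fun i => if i ≤ A then P i else r x y i) (A + B)) := by
  have hl := S.len_eq
  have h2 := S.two_le
  have hkA := S.k_le
  let Z := newSet r x y A B k P
  let u : ℕ → V := fun i => if i ≤ k then P i else r x y (A + (i - k))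
  have hu : ∀ i < k + B, G.Adj (u i) (u (i + 1)) := by
    intro i hi
    by_cases h1 : i + 1 ≤ k
    · simp only [u, h1, show i ≤ k by omega, if_true]
      exact (S.path.adj _ (by omega) _ (by omega)).mpr (Or.inl rfl)
    · have hu' : u i = r x y (A + (i - k)) := by
        by_cases h3 : i ≤ k
        · have : i = k := by omega
          subst this
          simp [u, S.P_last]
        · simp only [u, h3, if_false]
      rw [hu']
      simp only [u, h1, if_false]
      exact (S.R.adj x y _ _ S.D.xy (by omega) (by omega)).mpr (Or.inl (by omega))
  have huZ : ∀ i ≤ k + B, u i ∈ Z := by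
    intro i hi
    by_cases h3 : i ≤ k
    · simp only [u, h3, if_true]
      exact Or.inl ⟨_, h3, rfl⟩
    · simp only [u, h3, if_false]
      exact Or.inr ⟨_, by omega, by omega, rfl⟩
  have hu0 : u 0 = r x y 0 := by simp [u, S.P_zero]
  have hun : u (k + B) = r x y (A + B) := by
    by_cases h : B = 0
    · subst h; simp [u, S.P_last]
    · simp only [u, show ¬ (k + B ≤ k) by omega, if_false]
      congr 1; omega
  have hwZ : ∀ v ∈ (walkOfFn u _ hu).support, v ∈ Z := by
    intro v hv
    obtain ⟨i, hi, rfl⟩ := (mem_support_walkOfFn _ _ _ _).mp hv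
    exact huZ i hi
  -- Any shortest path between the two corners inside `Z` could serve as a rung, so by minimality of
  -- the subgraph it has at least `A + B` edges.
  have hmin : ∀ p : G.Walk (u 0) (u (k + B)), IsShortestIn Z p → A + B ≤ p.length := by
    intro p hp
    have hR := S.isRungSystem_replace hp.inducedPath (by rw [Walk.getVert_zero, hu0])
      (by rw [Walk.getVert_length, hun]) fun i _ => hp.subset _ (p.getVert_mem_support i)
    have := S.R.len_le S.minimal S.D.xy (rungSet_replace S.D.xy _ _).le hR.isLGPSK4
    omega
  obtain ⟨p, hp⟩ := exists_isShortestIn Z _ hwZ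
  have h3 := hmin p hp
  have h4 := hp.le _ hwZ
  rw [length_walkOfFn] at h4
  have hk : k = A := by omega
  refine ⟨hk, ?_⟩
  -- The concatenation has `k + B = A + B` edges and hence is itself shortest inside `Z`; in
  -- particular it is an induced path.
  have hsw : IsShortestIn Z (walkOfFn u _ hu) := by
    refine ⟨hwZ, fun q hq => ?_⟩
    rw [length_walkOfFn]
    have := hp.le q hq
    omega
  have hi := hsw.inducedPath
  rw [length_walkOfFn] at hi
  have hg : ∀ i ≤ A + B, (walkOfFn u _ hu).getVert i = if i ≤ A then P i else r x y i := by
    intro i hi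
    rw [getVert_walkOfFn _ _ _ _ (by omega)]
    simp only [u, hk]
    split_ifs
    · rfl
    · congr 1; omega
  have hg' : IsInducedPath G (fun i => if i ≤ A then P i else r x y i) (A + B) := by
    refine ⟨fun i hiA j hj he => hi.inj i (by omega) j (by omega) ?_, fun i hiA j hj => ?_⟩
    · rw [hg i hiA, hg j hj]; exact he
    · have := hi.adj i (by omega) j (by omega)
      rwa [hg i hiA, hg j hj] at this
  refine S.isRungSystem_replace hg' (by simp [S.P_zero]) ?_ ?_
  · by_cases h : B = 0
    · subst h; simp [← S.P_last, hk]
    · simp [h]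
  · intro i hi
    by_cases h : i ≤ A
    · simp only [h, if_true]
      exact Or.inl ⟨i, by omega, rfl⟩
    · simp only [h, if_false]
      exact Or.inr ⟨i, by omega, hi, rfl⟩

end IsStep

end Replacement

/-! ### Shortest admissible paths, and exchanging the halves of the rungs. -/

section Admissible

variable {V : Type*} {G : SimpleGraph V}

/-- The vertices that may be used by an admissible path. -/
def admissibleSet (G : SimpleGraph V) (t : Tuple18 V) (d : K4.Dart) : Set V :=
  {v | v = t.corner d ∨ v = t.mid d ∨ ∀ d', t.corner d' ≠ t.corner d → ¬ G.Adj v (t.corner d')}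

theorem isAdmissible_iff {t : Tuple18 V} {d : K4.Dart} {P : G.Walk (t.corner d) (t.mid d)} :
    IsAdmissible t d P ↔ P.IsPath ∧ ∀ v ∈ P.support, v ∈ admissibleSet G t d := by
  refine and_congr_right fun _ => forall₂_congr fun v _ => ?_
  simp only [admissibleSet, Set.mem_ofPred_eq]
  tauto

/-- Minimizing over paths and over walks is the same, since the bypass of a walk is no longer and
has no new vertices. -/
theorem isShortestAdmissible_iff {t : Tuple18 V} {d : K4.Dart}
    {P : G.Walk (t.corner d) (t.mid d)} :
    IsShortestAdmissible t d P ↔ IsShortestIn (admissibleSet G t d) P := by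
  classical
  constructor
  · rintro ⟨h1, h2⟩
    refine ⟨(isAdmissible_iff.mp h1).2, fun q hq => ?_⟩
    exact (h2 q.bypass (isAdmissible_iff.mpr ⟨q.bypass_isPath, fun v hv =>
      hq v (q.support_bypass_subset_support hv)⟩)).trans q.length_bypass_le_length
  · intro h
    exact ⟨isAdmissible_iff.mpr ⟨h.isPath, h.subset⟩, fun q hq => h.le q (isAdmissible_iff.mp hq).2⟩

variable {len : Fin 4 → Fin 4 → ℕ} {r : Fin 4 → Fin 4 → ℕ → V} {α : Fin 4 → Fin 4 → ℕ}
  {t : Tuple18 V} {x y : Fin 4}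

/-- An inner vertex of a rung has no neighbours on other rungs. On its own rung the corners are at
the two ends, so the far one is adjacent from the last but one position only. -/
theorem IsRungSystem.adj_corner (R : IsRungSystem G len r) (hxy : x ≠ y) {i : ℕ} (hi : 0 < i)
    (hi' : i + 1 < len x y) {u v : Fin 4} (huv : u ≠ v) (h : G.Adj (r x y i) (r u v 0)) :
    r u v 0 = r x y 0 ∨ i + 2 = len x y := by
  have hl := R.len_symm x y
  have hl' := R.len_symm u v
  have hp := R.pos u v huv
  have hend : r u v 0 = r v u (len v u - 1) := by
    rw [R.rev v u 0 huv.symm (by omega)]; rfl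
  rcases pair_cases x y u v hxy huv with ⟨rfl, rfl⟩ | ⟨rfl, rfl⟩ | ⟨rfl, h1⟩ | ⟨rfl, h1⟩ | ⟨rfl, h1⟩ |
    ⟨rfl, h1⟩ | ⟨h1, h2, h3, h4⟩
  · exact Or.inl rfl
  · rw [hend, R.adj _ _ _ _ hxy (by omega) (by omega)] at h
    omega
  · rw [R.meet_adj _ _ _ _ _ hxy huv h1 (by omega) hp] at h
    omega
  · rw [(R.out_in hxy huv h1 (by omega) hp).2] at h
    omega
  · rw [hend, R.meet_adj _ _ _ _ _ hxy huv.symm h1 (by omega) (by omega)] at h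
    omega
  · rw [hend, (R.out_in hxy huv.symm h1 (by omega) (by omega)).2] at h
    omega
  · exact absurd h (R.opp_adj _ _ _ _ _ _ hxy h1 h2 h3 h4 huv (by omega) hp)

/-- The part of a rung from its corner to its middle is admissible. -/
theorem IsRungFrame.mem_admissibleSet (F : IsRungFrame t len r α) (R : IsRungSystem G len r)
    (hxy : x ≠ y) {i : ℕ} (hi : i ≤ α x y) : r x y i ∈ admissibleSet G t (dart hxy) := by
  have h1 := F.add x y hxy
  have h2 := F.le x y hxy
  rcases Nat.eq_zero_or_pos i with rfl | h0
  · exact Or.inl (F.corner x y hxy).symm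
  · rcases hi.lt_or_eq with hi | rfl
    · refine Or.inr (Or.inr fun d hd hadj => ?_)
      rw [F.corner x y hxy, ← dart_fst_snd d, F.corner _ _ (dart_ne d)] at hd
      rw [← dart_fst_snd d, F.corner _ _ (dart_ne d)] at hadj
      -- Being next to the far corner with `0 < i < α x y` would force `α y x = 0` and `2 ≤ α x y`,
      -- against `α x y ≤ α y x + 1`.
      rcases R.adj_corner hxy h0 (by omega) (dart_ne d) hadj with h | h
      · exact hd h
      · omega
    · exact Or.inr (Or.inl (F.mid x y hxy).symm)

theorem IsRungFrame.exists_walk (F : IsRungFrame t len r α) (R : IsRungSystem G len r)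
    (hxy : x ≠ y) : ∃ p : G.Walk (t.corner (dart hxy)) (t.mid (dart hxy)),
      p.length = α x y ∧ ∀ v ∈ p.support, v ∈ admissibleSet G t (dart hxy) := by
  have h1 := F.add x y hxy
  refine ⟨(walkOfFn (G := G) (r x y) (α x y) fun i hi =>
    (R.adj x y _ _ hxy (by omega) (by omega)).mpr (Or.inl rfl)).copy (F.corner x y hxy).symm
      (F.mid x y hxy).symm, ?_, ?_⟩
  · rw [Walk.length_copy, length_walkOfFn]
  · intro v hv
    rw [Walk.support_copy, mem_support_walkOfFn] at hv
    obtain ⟨i, hi, rfl⟩ := hv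
    exact F.mem_admissibleSet R hxy hi

theorem IsRungFrame.exists_isShortestAdmissible (F : IsRungFrame t len r α)
    (R : IsRungSystem G len r) (hxy : x ≠ y) :
    ∃ p : G.Walk (t.corner (dart hxy)) (t.mid (dart hxy)), IsShortestAdmissible t (dart hxy) p := by
  obtain ⟨p, -, hp⟩ := F.exists_walk R hxy
  obtain ⟨q, hq⟩ := exists_isShortestIn _ p hp
  exact ⟨q, isShortestAdmissible_iff.mpr hq⟩

/-- Half of a rung of a smallest subgraph may be replaced by a shortest admissible path. -/
theorem IsRungFrame.replace_half [Finite V] (hG : ¬ ContainsPyramid G)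
    (F : IsRungFrame t len r α) (R : IsRungSystem G len r) (hmin : IsMinimal G len r) (hxy : x ≠ y)
    {p : G.Walk (t.corner (dart hxy)) (t.mid (dart hxy))}
    (hp : IsShortestAdmissible t (dart hxy) p) :
    p.length = α x y ∧ ∃ r', IsRungSystem G len r' ∧ IsRungFrame t len r' α ∧
      IsMinimal G len r' ∧ (∀ i ≤ α x y, r' x y i = p.getVert i) ∧
      (∀ i, α x y ≤ i → i < len x y → r' x y i = r x y i) ∧
      ∀ u v i, ¬ (u = x ∧ v = y) → ¬ (u = y ∧ v = x) → r' u v i = r u v i := by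
  have hadd := F.add x y hxy
  have hle := F.le x y hxy
  have hc := F.corner x y hxy
  have hm := F.mid x y hxy
  rw [isShortestAdmissible_iff] at hp
  obtain ⟨q, hq, hq'⟩ := F.exists_walk R hxy
  have hpα : p.length ≤ α x y := hq ▸ hp.le q hq'
  -- A half of length at most one has no interior, and the path cannot be shorter unless the corner
  -- is the middle vertex; so there is nothing to exchange.
  rcases Nat.lt_or_ge (α x y) 2 with hα | hα
  · have hlen : p.length = α x y := by
      by_contra hne
      have h0 : p.length = 0 := by omega
      have h1 := Walk.eq_of_length_eq_zero h0
      rw [hc, hm] at h1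
      have := R.inj x y _ _ hxy (by omega) (by omega) h1
      omega
    refine ⟨hlen, r, R, F, hmin, fun i hi => ?_, fun _ _ _ => rfl, fun _ _ _ _ _ => rfl⟩
    rcases (show i = 0 ∨ i = α x y by omega) with rfl | rfl
    · rw [Walk.getVert_zero, hc]
    · rw [← hlen, Walk.getVert_length, hlen, hm]
  · obtain ⟨z, w, D⟩ := exists_distinct hxy
    have S : IsStep G len r x y z w (α x y) (α y x) p.length p.getVert := by
      refine ⟨hG, R, hmin, D, hadd.symm, hα, hle, hpα, hp.inducedPath, by rw [Walk.getVert_zero, hc],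
        by rw [Walk.getVert_length, hm], fun i hi hik u v huv hne hadj => ?_⟩
      rcases hp.subset _ (p.getVert_mem_support i) with h | h | h
      · have := hp.inducedPath.inj i hik.le 0 (Nat.zero_le _) (h.trans p.getVert_zero.symm)
        omega
      · have := hp.inducedPath.inj i hik.le _ le_rfl (h.trans p.getVert_length.symm)
        omega
      · refine h (dart huv) ?_ ?_
        · rwa [F.corner u v huv, hc]
        · rwa [F.corner u v huv]
    obtain ⟨hk, hR⟩ := S.conclusion
    set g : ℕ → V := fun i => if i ≤ α x y then p.getVert i else r x y i with hg
    -- The new rung has as many vertices as the old one, so the lengths are unchanged and `α` stays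
    -- valid.
    have hlenEq : replaceLen len x y (α x y + α y x) = len := by
      funext u v
      have := R.len_symm x y
      unfold replaceLen
      split_ifs with h
      · rcases h with ⟨rfl, rfl⟩ | ⟨rfl, rfl⟩ <;> omega
      · rfl
    rw [hlenEq] at hR
    have hr1 : ∀ i ≤ α x y, replaceRung r x y g (α x y + α y x) x y i = p.getVert i := by
      intro i hi
      rw [replaceRung_self]
      simp [hg, hi]
    have hr2 : ∀ i, α x y ≤ i → i < len x y →
        replaceRung r x y g (α x y + α y x) x y i = r x y i := by
      intro i hi hi'
      rw [replaceRung_self]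
      by_cases h : i ≤ α x y
      · have : i = α x y := by omega
        simp only [hg, h, if_true]
        rw [this, ← hm, ← hk, Walk.getVert_length]
      · simp [hg, h]
    refine ⟨hk, _, hR, ⟨fun u v huv => ?_, fun u v huv => ?_, F.add, F.le⟩, ?_, hr1, hr2,
      fun u v i h1 h2 => replaceRung_other _ _ _ h1 h2⟩
    · by_cases h1 : u = x ∧ v = y
      · obtain ⟨rfl, rfl⟩ := h1
        rw [hr1 0 (Nat.zero_le _), Walk.getVert_zero]
      · by_cases h2 : u = y ∧ v = x
        · obtain ⟨rfl, rfl⟩ := h2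
          rw [hR.rev v u 0 hxy (by omega), hr2 _ (by omega) (by omega), F.corner u v huv,
            R.rev v u 0 hxy (by omega)]
        · rw [replaceRung_other _ _ _ h1 h2, F.corner u v huv]
    · by_cases h1 : u = x ∧ v = y
      · obtain ⟨rfl, rfl⟩ := h1
        rw [hr1 _ le_rfl, ← hk, Walk.getVert_length]
      · by_cases h2 : u = y ∧ v = x
        · obtain ⟨rfl, rfl⟩ := h2
          rw [hR.rev v u _ hxy (by omega), hr2 _ (by omega) (by omega), F.mid u v huv,
            R.rev v u _ hxy (by omega)]
        · rw [replaceRung_other _ _ _ h1 h2, F.mid u v huv]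
    -- The new rung adds at most `len x y` vertices to those of the other rungs, so the new vertex
    -- set is not larger than the old one.
    · intro T hT
      refine le_trans ?_ (hmin T hT)
      have := rungSet_replace (len := len) (r := r) hxy g (α x y + α y x)
      rw [hlenEq] at this
      rw [this, R.ncard_rungSet hxy]
      refine (Set.ncard_union_le _ _).trans ?_
      have := ncard_seg_le g (α x y + α y x)
      omega

/-- All halves of rungs of a smallest subgraph may be replaced by shortest admissible paths at the
same time. -/
theorem IsRungFrame.replace_all [Finite V] (hG : ¬ ContainsPyramid G)
    (F : IsRungFrame t len r α) (R : IsRungSystem G len r) (hmin : IsMinimal G len r)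
    {P : ∀ d : K4.Dart, G.Walk (t.corner d) (t.mid d)} (hP : ∀ d, IsShortestAdmissible t d (P d)) :
    (∀ d : K4.Dart, (P d).length = α d.fst d.snd) ∧ ∃ r', IsRungSystem G len r' ∧
      IsRungFrame t len r' α ∧ IsMinimal G len r' ∧
      ∀ (d : K4.Dart), ∀ i ≤ α d.fst d.snd, r' d.fst d.snd i = (P d).getVert i := by
  classical
  refine ⟨fun d => (F.replace_half hG R hmin (dart_ne d) (hP d)).1, ?_⟩
  -- The tuple remains a frame, with the same `α`, after each exchange, and admissibility refers to
  -- the tuple only. So the exchanges can be done one by one.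
  have key : ∀ l : List K4.Dart, ∃ r', IsRungSystem G len r' ∧ IsRungFrame t len r' α ∧
      IsMinimal G len r' ∧
      ∀ d ∈ l, ∀ i ≤ α d.fst d.snd, r' d.fst d.snd i = (P d).getVert i := by
    intro l
    induction l with
    | nil => exact ⟨r, R, F, hmin, by simp⟩
    | cons d l ih =>
      obtain ⟨r₁, R₁, F₁, m₁, h₁⟩ := ih
      obtain ⟨-, r₂, R₂, F₂, m₂, h₂, h₃, h₄⟩ := F₁.replace_half hG R₁ m₁ (dart_ne d) (hP d)
      refine ⟨r₂, R₂, F₂, m₂, fun e he i hi => ?_⟩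
      by_cases h5 : e.fst = d.fst ∧ e.snd = d.snd
      · have : e = d := Dart.ext _ _ (Prod.ext h5.1 h5.2)
        subst this
        exact h₂ i hi
      · have he' : e ∈ l := by
          refine (List.mem_cons.mp he).resolve_left ?_
          rintro rfl
          exact h5 ⟨rfl, rfl⟩
        rw [← h₁ e he' i hi]
        -- The half of `e` may lie on the rung that is being changed. It is then on the other side
        -- of the middle vertex, where the new rung agrees with the previous one.
        by_cases h6 : e.fst = d.snd ∧ e.snd = d.fst
        · have a1 := F.add d.fst d.snd (dart_ne d)
          rw [h6.1, h6.2] at hi ⊢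
          rw [R₂.rev _ _ i (dart_ne d) (by omega), R₁.rev _ _ i (dart_ne d) (by omega)]
          exact h₃ _ (by omega) (by omega)
        · exact h₄ _ _ i h5 h6
  obtain ⟨r', R', F', m', h'⟩ := key (Finset.univ : Finset K4.Dart).toList
  exact ⟨r', R', F', m', fun d => h' d (by simp)⟩

/-- If the halves of all rungs are the given paths, then the rungs are made up of these paths. -/
theorem IsRungFrame.rungSet_eq (F : IsRungFrame t len r α) (R : IsRungSystem G len r)
    {P : ∀ d : K4.Dart, G.Walk (t.corner d) (t.mid d)}
    (hl : ∀ d : K4.Dart, (P d).length = α d.fst d.snd)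
    (hP : ∀ (d : K4.Dart), ∀ i ≤ α d.fst d.snd, r d.fst d.snd i = (P d).getVert i) :
    rungSet len r = ⋃ d, {v | v ∈ (P d).support} := by
  have key : ∀ (d : K4.Dart) v, v ∈ (P d).support ↔ ∃ i ≤ α d.fst d.snd, r d.fst d.snd i = v := by
    intro d v
    rw [Walk.mem_support_iff_exists_getVert, hl d]
    constructor
    · rintro ⟨i, rfl, hi⟩
      exact ⟨i, hi, hP d i hi⟩
    · rintro ⟨i, hi, rfl⟩
      exact ⟨i, (hP d i hi).symm, hi⟩
  ext v
  rw [Set.mem_iUnion]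
  constructor
  · rintro ⟨x, y, i, hxy, hi, rfl⟩
    rcases le_or_gt i (α x y) with h | h
    · exact ⟨dart hxy, (key _ _).mpr ⟨i, h, rfl⟩⟩
    · have h1 := F.add x y hxy
      have h2 := R.len_symm x y
      refine ⟨dart hxy.symm, (key _ _).mpr ⟨len x y - 1 - i, ?_, ?_⟩⟩
      · change _ ≤ α y x
        omega
      · change r y x _ = _
        rw [R.rev x y _ hxy (by omega)]
        congr 1; omega
  · rintro ⟨d, hd⟩
    obtain ⟨i, hi, rfl⟩ := (key _ _).mp hd
    have h1 := F.add _ _ (dart_ne d)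
    exact ⟨d.fst, d.snd, i, dart_ne d, by omega, rfl⟩

end Admissible

/-! ### The two exchange statements for line graph models. -/

section Parts

variable {V : Type*} {G : SimpleGraph V} {S : Set V}

theorem exists_isMinimal (hS : IsSmallestLGPSK4 G S) (M : LineGraphModel G S) {t : Tuple18 V}
    (ht : M.IsFrame t) : ∃ len r α, IsRungSystem G len r ∧ rungSet len r = S ∧ IsMinimal G len r ∧
      IsRungFrame t len r α ∧ ∀ x y (hxy : x ≠ y), (M.rung (dart hxy)).length = len x y ∧
      ∀ i < len x y, (M.rung (dart hxy))[i]? = some (r x y i) := by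
  obtain ⟨len, r, R, rfl, hM⟩ := exists_isRungSystem M
  obtain ⟨α, F⟩ := exists_isRungFrame M ht R hM
  exact ⟨len, r, α, R, rfl, hS.2, F, hM⟩

theorem isSmallest_of_minimal {len r} (R : IsRungSystem G len r) (hmin : IsMinimal G len r) :
    IsSmallestLGPSK4 G (rungSet len r) := ⟨R.isLGPSK4, hmin⟩

theorem isSmallest_replace_half [Finite V] (hG : ¬ ContainsPyramid G) (hS : IsSmallestLGPSK4 G S)
    (M : LineGraphModel G S) {t : Tuple18 V} (ht : M.IsFrame t) (d : K4.Dart)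
    (P : G.Walk (t.corner d) (t.mid d)) (hP : IsShortestAdmissible t d P) :
    IsSmallestLGPSK4 G ((S \ M.initialSegment d (t.mid d)) ∪ {x | x ∈ P.support}) := by
  obtain ⟨len, r, α, R, rfl, hmin, F, hM⟩ := exists_isMinimal hS M ht
  have hxy := dart_ne d
  obtain ⟨hl, r', R', F', hmin', h1, h2, h3⟩ := F.replace_half hG R hmin hxy hP
  have hadd := F.add _ _ hxy
  have hother : otherSet len r' d.fst d.snd = otherSet len r d.fst d.snd := by
    ext v
    constructor
    · rintro ⟨a, b, i, hab, g1, g2, hi, rfl⟩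
      exact ⟨a, b, i, hab, g1, g2, hi, (h3 a b i g1 g2).symm⟩
    · rintro ⟨a, b, i, hab, g1, g2, hi, rfl⟩
      exact ⟨a, b, i, hab, g1, g2, hi, h3 a b i g1 g2⟩
  have hinit : M.initialSegment d (t.mid d) =
      {v | ∃ i ≤ α d.fst d.snd, r d.fst d.snd i = v} := by
    have hMd := hM _ _ hxy
    rw [dart_fst_snd] at hMd
    have hmid : t.mid d = r d.fst d.snd (α d.fst d.snd) := F.mid _ _ hxy
    ext v
    constructor
    · rintro ⟨i, j, hij, hi, hj⟩
      have hj' : j < len d.fst d.snd := by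
        by_contra h
        rw [List.getElem?_eq_none (by omega)] at hj
        cases hj
      rw [hMd.2 j hj', hmid] at hj
      rw [hMd.2 i (by omega)] at hi
      have := R.inj _ _ _ _ hxy hj' (by omega) (Option.some.inj hj)
      exact ⟨i, by omega, Option.some.inj hi⟩
    · rintro ⟨i, hi, rfl⟩
      refine ⟨i, α d.fst d.snd, hi, hMd.2 i (by omega), ?_⟩
      rw [hMd.2 _ (by omega), hmid]
  -- The removed segment includes the middle vertex, which returns as the last vertex of `P`. A
  -- removed vertex lies on no other rung.
  have hset : (rungSet len r \ M.initialSegment d (t.mid d)) ∪ {x | x ∈ P.support} =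
      rungSet len r' := by
    rw [hinit, R'.rungSet_eq hxy, hother, R.rungSet_eq hxy]
    ext v
    simp only [Set.mem_union, Set.mem_sdiff, Set.mem_ofPred_eq, seg]
    constructor
    · rintro (⟨hv | ⟨i, -, hi, rfl⟩, hnot⟩ | hv)
      · exact Or.inl hv
      · refine Or.inr ⟨i, Nat.zero_le _, hi, h2 i ?_ (by omega)⟩
        by_contra h
        exact hnot ⟨i, by omega, rfl⟩
      · obtain ⟨i, rfl, hi⟩ := Walk.mem_support_iff_exists_getVert.mp hv
        have hi' : i ≤ α d.fst d.snd := hi.trans_eq hl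
        exact Or.inr ⟨i, Nat.zero_le _, by omega, h1 i hi'⟩
    · rintro (hv | ⟨i, -, hi, rfl⟩)
      · refine Or.inl ⟨Or.inl hv, ?_⟩
        rintro ⟨i, hi, rfl⟩
        exact R.notMem_otherSet hxy (by omega) hv
      · rcases le_or_gt i (α d.fst d.snd) with h | h
        · exact Or.inr (by rw [h1 i h]; exact P.getVert_mem_support i)
        · rw [h2 i h.le (by omega)]
          refine Or.inl ⟨Or.inr ⟨i, Nat.zero_le _, hi, rfl⟩, ?_⟩
          rintro ⟨j, hj, he⟩
          have := R.inj _ _ _ _ hxy (by omega) (by omega) he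
          omega
  rw [hset]
  exact isSmallest_of_minimal R' hmin'

theorem isSmallest_iUnion [Finite V] (hG : ¬ ContainsPyramid G) (hS : IsSmallestLGPSK4 G S)
    (M : LineGraphModel G S) {t : Tuple18 V} (ht : M.IsFrame t) :
    (∀ d : K4.Dart, ∃ P : G.Walk (t.corner d) (t.mid d), IsShortestAdmissible t d P) ∧
    ∀ P : ∀ d : K4.Dart, G.Walk (t.corner d) (t.mid d),
      (∀ d, IsShortestAdmissible t d (P d)) →
      IsSmallestLGPSK4 G (⋃ d, {x | x ∈ (P d).support}) := by
  obtain ⟨len, r, α, R, rfl, hmin, F, hM⟩ := exists_isMinimal hS M ht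
  refine ⟨fun d => F.exists_isShortestAdmissible R (dart_ne d), fun P hP => ?_⟩
  obtain ⟨hl, r', R', F', hmin', h⟩ := F.replace_all hG R hmin hP
  rw [← F'.rungSet_eq R' hl h]
  exact isSmallest_of_minimal R' hmin'

end Parts

end LGK4

/-! ### Programs with counted loops, their effect and their running time. -/

namespace LGK4

open RAM

section Machine

/-- Programs whose only loops run a register through all vertices of the input graph. -/
inductive LoopProg where
  /-- `x := e` -/
  | set (x : ℕ) (e : Expr)
  /-- `arr a [x] := y` -/
  | store (a x y : ℕ)
  /-- `p; q` -/
  | seq (p q : LoopProg)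
  /-- `if b then p else q` -/
  | ite (b : Test) (p q : LoopProg)
  /-- `for x < n do p` -/
  | loop (x : ℕ) (p : LoopProg)

/-- The memory after writing `v` to register `x`. -/
def setReg (s : Memory) (x v : ℕ) : Memory := ⟨Function.update s.reg x v, s.arr⟩

/-- The memory after writing `v` to the cell `i` of array `a`. -/
def setArr (s : Memory) (a i v : ℕ) : Memory :=
  ⟨s.reg, Function.update s.arr a (Function.update (s.arr a) i v)⟩

@[simp] theorem setReg_reg (s : Memory) (x v y : ℕ) :
    (setReg s x v).reg y = if y = x then v else s.reg y := Function.update_apply ..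

@[simp] theorem setReg_arr (s : Memory) (x v : ℕ) : (setReg s x v).arr = s.arr := rfl

@[simp] theorem setArr_reg (s : Memory) (a i v : ℕ) : (setArr s a i v).reg = s.reg := rfl

theorem setArr_arr (s : Memory) (a i v b j : ℕ) :
    (setArr s a i v).arr b j = if b = a ∧ j = i then v else s.arr b j := by
  by_cases h : b = a <;> by_cases h' : j = i <;> simp [setArr, h, h']

theorem setArr_arr_self (s : Memory) (a i v : ℕ) :
    (setArr s a i v).arr a = Function.update (s.arr a) i v := Function.update_self ..

theorem setArr_arr_of_ne (s : Memory) (a i v : ℕ) {b : ℕ} (h : b ≠ a) :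
    (setArr s a i v).arr b = s.arr b := Function.update_of_ne h ..

namespace LoopProg

/-- The program for the machine; register `1` holds the number of vertices. -/
def compile : LoopProg → Prog
  | set x e => .assign x e
  | store a x y => .store a x y
  | seq p q => .seq p.compile q.compile
  | ite b p q => .ite b p.compile q.compile
  | loop x p => .seq (.assign x (.const 0)) (.while (.lt x 1) (.seq p.compile (.assign x (.succ x))))

/-- The effect of a program. -/
noncomputable def run {n : ℕ} (G : SimpleGraph (Fin n)) : LoopProg → Memory → Memory
  | set x e, s => setReg s x (e.eval G s)
  | store a x y, s => setArr s a (s.reg x) (s.reg y)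
  | seq p q, s => q.run G (p.run G s)
  | ite b p q, s => if b.holds s then p.run G s else q.run G s
  | loop x p, s => (fun s' => setReg (p.run G s') x ((p.run G s').reg x + 1))^[n] (setReg s x 0)

/-- The registers that a program writes. -/
def regs : LoopProg → List ℕ
  | set x _ => [x]
  | store _ _ _ => []
  | seq p q => p.regs ++ q.regs
  | ite _ p q => p.regs ++ q.regs
  | loop x p => x :: p.regs

/-- The arrays that a program writes. -/
def arrs : LoopProg → List ℕ
  | set _ _ => []
  | store a _ _ => [a]
  | seq p q => p.arrs ++ q.arrs
  | ite _ p q => p.arrs ++ q.arrs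
  | loop _ p => p.arrs

/-- No loop writes its own counter. -/
def wf : LoopProg → Bool
  | set _ _ => true
  | store _ _ _ => true
  | seq p q => p.wf && q.wf
  | ite _ p q => p.wf && q.wf
  | loop x p => p.wf && !(p.regs.contains x)

/-- The nesting depth of the loops. -/
def depth : LoopProg → ℕ
  | set _ _ => 0
  | store _ _ _ => 0
  | seq p q => max p.depth q.depth
  | ite _ p q => max p.depth q.depth
  | loop _ p => p.depth + 1

/-- A bound for the number of steps on graphs with `n` vertices. -/
def cost (n : ℕ) : LoopProg → ℕ
  | set _ _ => 1
  | store _ _ _ => 1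
  | seq p q => p.cost n + q.cost n + 1
  | ite _ p q => p.cost n + q.cost n + 1
  | loop _ p => n * (p.cost n + 3) + 3

/-- The factor in the bound for the number of steps. -/
def size : LoopProg → ℕ
  | set _ _ => 1
  | store _ _ _ => 1
  | seq p q => p.size + q.size + 1
  | ite _ p q => p.size + q.size + 1
  | loop _ p => p.size + 3

/-- Each loop multiplies the cost by at most `n + 1`, and the constant overheads are absorbed by
`size`. -/
theorem cost_le (n : ℕ) (p : LoopProg) : p.cost n ≤ p.size * (n + 1) ^ p.depth := by
  have key : ∀ a b c d : ℕ, a * (n + 1) ^ c + b * (n + 1) ^ d + 1 ≤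
      (a + b + 1) * (n + 1) ^ max c d := by
    intro a b c d
    have h1 : (n + 1) ^ c ≤ (n + 1) ^ max c d := Nat.pow_le_pow_right (by omega) (le_max_left ..)
    have h2 : (n + 1) ^ d ≤ (n + 1) ^ max c d := Nat.pow_le_pow_right (by omega) (le_max_right ..)
    have h3 : 1 ≤ (n + 1) ^ max c d := Nat.one_le_pow _ _ (by omega)
    have h4 := Nat.mul_le_mul_left a h1
    have h5 := Nat.mul_le_mul_left b h2
    rw [add_mul, add_mul]
    omega
  induction p with
  | set | store => simp [cost, size, depth]
  | seq p q hp hq | ite _ p q hp hq =>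
    have := key p.size q.size p.depth q.depth
    simp only [cost, size, depth]
    omega
  | loop x p hp =>
    have h1 : n + 1 ≤ (n + 1) ^ (p.depth + 1) := Nat.le_self_pow (by omega) _
    have h2 := Nat.mul_le_mul_left (n + 1) hp
    simp only [cost, size, depth]
    calc n * (p.cost n + 3) + 3 ≤ (n + 1) * p.cost n + 3 * (n + 1) := by
          rw [mul_add, add_mul]; omega
      _ ≤ (n + 1) * (p.size * (n + 1) ^ p.depth) + 3 * (n + 1) ^ (p.depth + 1) := by omega
      _ = (p.size + 3) * (n + 1) ^ (p.depth + 1) := by ring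

variable {n : ℕ} {G : SimpleGraph (Fin n)}

/-- The counter is incremented from whatever the body leaves in it, so the body has to preserve it.
This is assumed as a property of the effect rather than of the text, for bodies that contain an
arbitrary subprogram; `run_loop_inv` is the syntactic version. -/
theorem run_loop_induction (G : SimpleGraph (Fin n)) (x : ℕ) (p : LoopProg)
    (hx : ∀ s, (p.run G s).reg x = s.reg x) (I : ℕ → Memory → Prop)
    {s : Memory} (h0 : I 0 (setReg s x 0))
    (hs : ∀ i < n, ∀ s, s.reg x = i → I i s → I (i + 1) (setReg (p.run G s) x (i + 1))) :
    I n ((loop x p).run G s) := by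
  have key : ∀ m ≤ n, ((fun s' => setReg (p.run G s') x ((p.run G s').reg x + 1))^[m]
      (setReg s x 0)).reg x = m ∧ I m ((fun s' => setReg (p.run G s') x
        ((p.run G s').reg x + 1))^[m] (setReg s x 0)) := by
    intro m
    induction m with
    | zero => intro _; exact ⟨by simp, h0⟩
    | succ m ih =>
      intro hm
      obtain ⟨h1, h2⟩ := ih (by omega)
      rw [Function.iterate_succ_apply']
      generalize (fun s' => setReg (p.run G s') x ((p.run G s').reg x + 1))^[m]
        (setReg s x 0) = s' at h1 h2 ⊢
      rw [hx, h1]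
      exact ⟨by simp, hs m (by omega) _ h1 h2⟩
  exact (key n le_rfl).2

theorem run_reg {p : LoopProg} {y : ℕ} (hy : y ∉ p.regs) (s : Memory) :
    (p.run G s).reg y = s.reg y := by
  induction p generalizing s with
  | set x e => simp only [regs, List.mem_singleton] at hy; simp [run, hy]
  | store => simp [run]
  | seq p q hp hq =>
    simp only [regs, List.mem_append, not_or] at hy
    rw [run, hq hy.2, hp hy.1]
  | ite b p q hp hq =>
    simp only [regs, List.mem_append, not_or] at hy
    rw [run]
    split_ifs
    exacts [hp hy.1 s, hq hy.2 s]
  | loop x p hp =>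
    simp only [regs, List.mem_cons, not_or] at hy
    rw [run]
    have : ∀ m, ((fun s' => setReg (p.run G s') x ((p.run G s').reg x + 1))^[m]
        (setReg s x 0)).reg y = s.reg y := by
      intro m
      induction m with
      | zero => simp [hy.1]
      | succ m ih => rw [Function.iterate_succ_apply', setReg_reg, if_neg hy.1, hp hy.2, ih]
    exact this n

theorem run_arr {p : LoopProg} {a : ℕ} (ha : a ∉ p.arrs) (s : Memory) :
    (p.run G s).arr a = s.arr a := by
  induction p generalizing s with
  | set x e => simp [run]
  | store b =>
    simp only [arrs, List.mem_singleton] at ha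
    exact setArr_arr_of_ne _ _ _ _ ha
  | seq p q hp hq =>
    simp only [arrs, List.mem_append, not_or] at ha
    rw [run, hq ha.2, hp ha.1]
  | ite b p q hp hq =>
    simp only [arrs, List.mem_append, not_or] at ha
    rw [run]
    split_ifs
    exacts [hp ha.1 s, hq ha.2 s]
  | loop x p hp =>
    rw [run]
    have : ∀ m, ((fun s' => setReg (p.run G s') x ((p.run G s').reg x + 1))^[m]
        (setReg s x 0)).arr a = s.arr a := by
      intro m
      induction m with
      | zero => simp
      | succ m ih => rw [Function.iterate_succ_apply', setReg_arr, hp ha, ih]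
    exact this n

theorem run_loop_inv {x : ℕ} {p : LoopProg} (hx : x ∉ p.regs) (I : ℕ → Memory → Prop)
    {s : Memory} (h0 : I 0 (setReg s x 0))
    (hs : ∀ i < n, ∀ s, s.reg x = i → I i s → I (i + 1) (setReg (p.run G s) x (i + 1))) :
    I n ((loop x p).run G s) :=
  run_loop_induction G x p (fun s => run_reg hx s) I h0 hs

end LoopProg

variable {n : ℕ} {G : SimpleGraph (Fin n)}

/-- Within `T` steps, the program `p` turns the memory `s` into `s'`. -/
def Runs (G : SimpleGraph (Fin n)) (p : Prog) (T : ℕ) (s s' : Memory) : Prop :=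
  ∃ t ≤ T, ∀ k, (step G)^[t] ⟨p :: k, s⟩ = ⟨k, s'⟩

theorem Runs.seq {p q : Prog} {T U : ℕ} {s s' s'' : Memory} (h : Runs G p T s s')
    (h' : Runs G q U s' s'') : Runs G (.seq p q) (T + U + 1) s s'' := by
  obtain ⟨t, ht, h⟩ := h
  obtain ⟨u, hu, h'⟩ := h'
  refine ⟨u + t + 1, by omega, fun k => ?_⟩
  rw [Function.iterate_succ_apply, Function.iterate_add_apply]
  exact (congrArg _ (h _)).trans (h' k)

theorem Runs.mono {p : Prog} {T U : ℕ} {s s' : Memory} (h : Runs G p T s s') (hTU : T ≤ U) :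
    Runs G p U s s' := by
  obtain ⟨t, ht, h⟩ := h
  exact ⟨t, ht.trans hTU, h⟩

theorem Runs.while_true {b : Test} {p : Prog} {T U : ℕ} {s s' s'' : Memory} (hb : b.holds s = true)
    (h : Runs G p T s s') (h' : Runs G (.while b p) U s' s'') :
    Runs G (.while b p) (T + U + 1) s s'' := by
  obtain ⟨t, ht, h⟩ := h
  obtain ⟨u, hu, h'⟩ := h'
  refine ⟨u + t + 1, by omega, fun k => ?_⟩
  rw [Function.iterate_succ_apply, Function.iterate_add_apply, step, hb]
  exact (congrArg _ (h _)).trans (h' k)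

theorem Runs.while_false {b : Test} {p : Prog} {s : Memory} (hb : b.holds s = false) :
    Runs G (.while b p) 1 s s :=
  ⟨1, le_rfl, fun k => by simp [step, hb]⟩

namespace LoopProg

theorem runs_compile {p : LoopProg} (hp : p.wf = true) (h1 : 1 ∉ p.regs) {s : Memory}
    (hs : s.reg 1 = n) : Runs G p.compile (p.cost n) s (p.run G s) := by
  induction p generalizing s with
  | set x e => exact ⟨1, le_rfl, fun k => rfl⟩
  | store a x y => exact ⟨1, le_rfl, fun k => rfl⟩
  | seq p q ihp ihq =>
    simp only [wf, Bool.and_eq_true] at hp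
    simp only [regs, List.mem_append, not_or] at h1
    exact (ihp hp.1 h1.1 hs).seq (ihq hp.2 h1.2 (by rw [run_reg h1.1, hs]))
  | ite b p q ihp ihq =>
    simp only [wf, Bool.and_eq_true] at hp
    simp only [regs, List.mem_append, not_or] at h1
    rw [run]
    cases hb : b.holds s with
    | true =>
      obtain ⟨t, ht, h⟩ := ihp hp.1 h1.1 hs
      refine ⟨t + 1, by simp only [cost]; omega, fun k => ?_⟩
      rw [Function.iterate_succ_apply, compile, step, hb, if_pos rfl]
      exact h k
    | false =>
      obtain ⟨t, ht, h⟩ := ihq hp.2 h1.2 hs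
      refine ⟨t + 1, by simp only [cost]; omega, fun k => ?_⟩
      rw [Function.iterate_succ_apply, compile, step, hb, if_neg (by simp)]
      exact h k
  | loop x p ih =>
    simp only [wf, Bool.and_eq_true, Bool.not_eq_true', List.contains_eq_mem,
      decide_eq_false_iff_not] at hp
    simp only [regs, List.mem_cons, not_or] at h1
    -- Induction on the number `m` of rounds that are still to be made; the counter is then `n - m`.
    have key : ∀ m ≤ n, ∀ s : Memory, s.reg 1 = n → s.reg x = n - m →
        Runs G (.while (.lt x 1) (.seq p.compile (.assign x (.succ x)))) (m * (p.cost n + 3) + 1) s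
          ((fun s' => setReg (p.run G s') x ((p.run G s').reg x + 1))^[m] s) := by
      intro m
      induction m with
      | zero =>
        intro _ s h2 h3
        exact (Runs.while_false (by simp [Test.holds, h2, h3])).mono (by omega)
      | succ m ihm =>
        intro hm s h2 h3
        have h4 : Runs G (.assign x (.succ x)) 1 (p.run G s)
            (setReg (p.run G s) x ((p.run G s).reg x + 1)) := ⟨1, le_rfl, fun k => rfl⟩
        have h5 := (ih hp.1 h1.2 h2).seq h4
        have h6 := ihm (by omega) (setReg (p.run G s) x ((p.run G s).reg x + 1))
          (by rw [setReg_reg, if_neg h1.1, run_reg h1.2, h2])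
          (by rw [setReg_reg, if_pos rfl, run_reg hp.2, h3]; omega)
        rw [Function.iterate_succ_apply]
        refine (h5.while_true (by simp [Test.holds, h2, h3]; omega) h6).mono ?_
        rw [Nat.succ_mul]; omega
    have h2 : Runs G (.assign x (.const 0)) 1 s (setReg s x 0) := ⟨1, le_rfl, fun k => rfl⟩
    exact (h2.seq (key n le_rfl (setReg s x 0) (by simpa [h1.1] using hs) (by simp))).mono
      (by simp only [cost]; omega)

/-- A program with at most twenty nested loops runs in time `O(n ^ 20)`. -/
theorem exists_haltsWithin {p : LoopProg} (hp : p.wf = true) (h1 : 1 ∉ p.regs)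
    (hd : p.depth ≤ 20) : ∃ (q : Prog) (C : ℕ), ∀ (n : ℕ) (G : SimpleGraph (Fin n)),
      HaltsWithin G q (C * n ^ 20 + C) (p.run G (setReg ⟨fun _ => 0, fun _ _ => 0⟩ 1 n)) := by
  -- The factor comes from `(n + 1) ^ 20 ≤ 2 ^ 20 * (n ^ 20 + 1)`; the two extra steps load the
  -- number of vertices and unfold the sequence.
  refine ⟨.seq (.assign 1 .order) p.compile, p.size * 2 ^ 20 + 2, fun n G => ?_⟩
  have h2 : Runs G (.assign 1 .order) 1 ⟨fun _ => 0, fun _ _ => 0⟩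
      (setReg ⟨fun _ => 0, fun _ _ => 0⟩ 1 n) := ⟨1, le_rfl, fun k => rfl⟩
  obtain ⟨t, ht, h⟩ := h2.seq (runs_compile (G := G) hp h1 (by simp))
  refine ⟨t, ht.trans ?_, h []⟩
  have h3 : (n + 1) ^ p.depth ≤ 2 ^ 20 * (n ^ 20 + 1) := by
    calc (n + 1) ^ p.depth ≤ (n + 1) ^ 20 := Nat.pow_le_pow_right (by omega) hd
      _ ≤ 2 ^ 20 * (n ^ 20 + 1) := by
        rcases Nat.eq_zero_or_pos n with rfl | hn
        · norm_num
        · calc (n + 1) ^ 20 ≤ (2 * n) ^ 20 := Nat.pow_le_pow_left (by omega) _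
            _ = 2 ^ 20 * n ^ 20 := mul_pow ..
            _ ≤ 2 ^ 20 * (n ^ 20 + 1) := Nat.mul_le_mul_left _ (by omega)
  have h4 := (p.cost_le n).trans (Nat.mul_le_mul_left p.size h3)
  calc 1 + p.cost n + 1 ≤ p.size * (2 ^ 20 * (n ^ 20 + 1)) + 2 := by omega
    _ ≤ (p.size * 2 ^ 20 + 2) * n ^ 20 + (p.size * 2 ^ 20 + 2) := by
      have : p.size * (2 ^ 20 * (n ^ 20 + 1)) = p.size * 2 ^ 20 * n ^ 20 + p.size * 2 ^ 20 := by ring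
      rw [this, add_mul]; omega

end LoopProg

end Machine

end LGK4

/-! ### Exhaustive search by nested loops. -/

namespace LGK4

open RAM

section Search

variable {n : ℕ} {G : SimpleGraph (Fin n)}

/-- The memories `s` and `s'` differ only in the registers `W` and in the arrays `A`. -/
def AgreeOff (W A : Set ℕ) (s s' : Memory) : Prop :=
  (∀ y ∉ W, s'.reg y = s.reg y) ∧ ∀ a ∉ A, s'.arr a = s.arr a

theorem AgreeOff.symm {W A : Set ℕ} {s s' : Memory} (h : AgreeOff W A s s') : AgreeOff W A s' s :=
  ⟨fun y hy => (h.1 y hy).symm, fun a ha => (h.2 a ha).symm⟩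

theorem AgreeOff.trans {W A : Set ℕ} {s s' s'' : Memory} (h : AgreeOff W A s s')
    (h' : AgreeOff W A s' s'') : AgreeOff W A s s'' :=
  ⟨fun y hy => (h'.1 y hy).trans (h.1 y hy), fun a ha => (h'.2 a ha).trans (h.2 a ha)⟩

theorem AgreeOff.mono {W A W' A' : Set ℕ} {s s' : Memory} (h : AgreeOff W A s s') (hW : W ⊆ W')
    (hA : A ⊆ A') : AgreeOff W' A' s s' :=
  ⟨fun y hy => h.1 y fun h' => hy (hW h'), fun a ha => h.2 a fun h' => ha (hA h')⟩

theorem AgreeOff.setReg {W A : Set ℕ} {x : ℕ} (hx : x ∈ W) (s : Memory) (v : ℕ) :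
    AgreeOff W A s (setReg s x v) := by
  refine ⟨fun y hy => ?_, fun _ _ => rfl⟩
  rw [setReg_reg, if_neg]
  rintro rfl
  exact hy hx

theorem AgreeOff.run {W A : Set ℕ} {p : LoopProg} (hW : ∀ y ∈ p.regs, y ∈ W)
    (hA : ∀ a ∈ p.arrs, a ∈ A) (s : Memory) : AgreeOff W A s (p.run G s) :=
  ⟨fun _ hy => p.run_reg (fun h => hy (hW _ h)) s, fun _ ha => p.run_arr (fun h => ha (hA _ h)) s⟩

/-- A successful answer has been written. -/
def Hit (Ans : (ℕ → ℕ) → Prop) (s : Memory) : Prop := s.reg 0 = 1 ∧ Ans (s.arr 0)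

/-- No answer has been written yet. -/
def Fresh (s : Memory) : Prop := s.reg 0 = 0 ∧ ∀ v, s.arr 0 v = 0

/-- Started from a memory with the property `Pre`, the program `p` keeps a successful answer, and
finds one if the memory has the property `Ψ`. -/
def IsSearch (G : SimpleGraph (Fin n)) (Ans : (ℕ → ℕ) → Prop) (Pre : Memory → Prop) (p : LoopProg)
    (Ψ : Memory → Prop) : Prop :=
  ∀ s, Pre s → (Hit Ans s → Hit Ans (p.run G s)) ∧
    (Fresh s → Hit Ans (p.run G s) ∨ (Fresh (p.run G s) ∧ ¬ Ψ s))

namespace LoopProg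

/-- Do nothing. -/
def skip : LoopProg := .set 4 (.const 0)

/-- One program after the other. -/
def seqList (l : List LoopProg) : LoopProg := l.foldr .seq skip

/-- Run the registers of the list `l` through all vertices. -/
def nest (l : List ℕ) (p : LoopProg) : LoopProg := l.foldr .loop p

theorem mem_regs_nest (l : List ℕ) (p : LoopProg) (y : ℕ) :
    y ∈ (nest l p).regs ↔ y ∈ l ∨ y ∈ p.regs := by
  induction l with
  | nil => simp [nest]
  | cons x l ih =>
    change y ∈ x :: (nest l p).regs ↔ _
    simp [ih, or_assoc]

theorem arrs_nest (l : List ℕ) (p : LoopProg) : (nest l p).arrs = p.arrs := by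
  induction l with
  | nil => rfl
  | cons x l ih => exact ih

end LoopProg

theorem Hit.setReg {Ans : (ℕ → ℕ) → Prop} {s : Memory} (h : Hit Ans s) {x : ℕ} (hx : x ≠ 0)
    (v : ℕ) : Hit Ans (setReg s x v) := by
  rw [Hit, setReg_reg, if_neg hx.symm]; exact h

theorem Fresh.setReg {s : Memory} (h : Fresh s) {x : ℕ} (hx : x ≠ 0) (v : ℕ) :
    Fresh (setReg s x v) := by
  rw [Fresh, setReg_reg, if_neg hx.symm]; exact h

/-- The property `Ψ` does not depend on the memory `W`, `A` that the body writes. So if some values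
of the loop registers make `Ψ` true, it is true when the loops come to these values, and the body
then finds an answer unless there is one already. -/
theorem IsSearch.nest {Ans : (ℕ → ℕ) → Prop} {l : List ℕ} {p : LoopProg} {W A : Set ℕ}
    {Ψ : Memory → Prop} (hl : l.Nodup) (h0 : 0 ∉ l) (hlW : ∀ x ∈ l, x ∉ W)
    (hW : ∀ y ∈ p.regs, y ∈ W) (hA : ∀ a ∈ p.arrs, a ∈ A)
    (hΨ : ∀ s s', AgreeOff W A s s' → Ψ s → Ψ s') {Pre : Memory → Prop}
    (hPre : ∀ s s', AgreeOff (W ∪ {y | y ∈ l}) A s s' → Pre s → Pre s')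
    (hp : IsSearch G Ans (fun s => Pre s ∧ ∀ y ∈ l, s.reg y < n) p Ψ) :
    IsSearch G Ans Pre (LoopProg.nest l p) fun s =>
      ∃ s', AgreeOff (W ∪ {y | y ∈ l}) A s s' ∧ (∀ y ∈ l, s'.reg y < n) ∧ Ψ s' := by
  induction l generalizing Pre with
  | nil =>
    intro s hs
    obtain ⟨h1, h2⟩ := hp s ⟨hs, by simp⟩
    refine ⟨h1, fun h => (h2 h).imp_right fun h3 => ⟨h3.1, ?_⟩⟩
    rintro ⟨s', h4, -, h5⟩
    exact h3.2 (hΨ _ _ (h4.symm.mono (by simp) subset_rfl) h5)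
  | cons x l ih =>
    simp only [List.mem_cons, not_or] at h0
    obtain ⟨hxl, hl⟩ := List.nodup_cons.mp hl
    have hxW := hlW x List.mem_cons_self
    have hsub : W ∪ {y | y ∈ l} ⊆ W ∪ {y | y ∈ x :: l} :=
      Set.union_subset_union_right _ fun y hy => List.mem_cons_of_mem _ hy
    have hin : x ∈ W ∪ {y | y ∈ x :: l} := Or.inr List.mem_cons_self
    have hstep := ih hl h0.2 (fun y hy => hlW y (List.mem_cons_of_mem _ hy))
      (Pre := fun s => Pre s ∧ s.reg x < n)
      (fun s s' h hs => ⟨hPre s s' (h.mono hsub subset_rfl) hs.1, by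
        rw [h.1 x (by simp [hxW, hxl])]; exact hs.2⟩)
      (fun s hs => hp s ⟨hs.1.1, fun y hy => (List.mem_cons.mp hy).elim
        (fun h => h ▸ hs.1.2) (hs.2 y)⟩)
    have hxr : x ∉ (LoopProg.nest l p).regs := by
      rw [LoopProg.mem_regs_nest, not_or]
      exact ⟨hxl, fun h => hxW (hW x h)⟩
    intro s hs
    -- As long as no answer is written, every assignment with `Ψ` has a value of `x` that is still
    -- to come.
    have key := LoopProg.run_loop_inv (G := G) hxr (s := s) (fun i s' =>
      AgreeOff (W ∪ {y | y ∈ x :: l}) A s s' ∧ (Hit Ans s → Hit Ans s') ∧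
      (Fresh s → Hit Ans s' ∨ (Fresh s' ∧ ∀ s₁, AgreeOff (W ∪ {y | y ∈ x :: l}) A s s₁ →
        (∀ y ∈ x :: l, s₁.reg y < n) → Ψ s₁ → ¬ s₁.reg x < i)))
      ⟨AgreeOff.setReg hin s 0, fun h => h.setReg (Ne.symm h0.1) 0,
        fun h => Or.inr ⟨h.setReg (Ne.symm h0.1) 0, fun s₁ _ _ _ => by omega⟩⟩ ?_
    · refine ⟨key.2.1, fun h => (key.2.2 h).imp_right fun h3 => ⟨h3.1, ?_⟩⟩
      rintro ⟨s₁, h4, h5, h6⟩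
      exact h3.2 s₁ h4 h5 h6 (h5 x List.mem_cons_self)
    · rintro i hi s' hx ⟨h1, h2, h3⟩
      obtain ⟨h4, h5⟩ := hstep s' ⟨hPre _ _ h1 hs, by rwa [hx]⟩
      refine ⟨(h1.trans ((AgreeOff.run (fun y hy => ?_) (fun a ha => ?_) s'))).trans
        (AgreeOff.setReg hin _ _), fun h => (h4 (h2 h)).setReg (Ne.symm h0.1) _, fun h => ?_⟩
      · rw [LoopProg.mem_regs_nest] at hy
        exact hy.elim (fun h => Or.inr (List.mem_cons_of_mem _ h)) fun h => Or.inl (hW y h)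
      · rw [LoopProg.arrs_nest] at ha
        exact hA a ha
      rcases h3 h with h6 | ⟨h6, h7⟩
      · exact Or.inl ((h4 h6).setReg (Ne.symm h0.1) _)
      rcases h5 h6 with h8 | ⟨h8, h9⟩
      · exact Or.inl (h8.setReg (Ne.symm h0.1) _)
      refine Or.inr ⟨h8.setReg (Ne.symm h0.1) _, fun s₁ g1 g2 g3 hlt => ?_⟩
      have hne := h7 s₁ g1 g2 g3
      have hxi : s₁.reg x = i := by omega
      -- The memory `s₁` has the current value `i` in register `x`, so it differs from the current
      -- memory only where the inner loops and the body may write.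
      refine h9 ⟨s₁, ⟨fun y hy => ?_, (h1.symm.trans g1).2⟩,
        fun y hy => g2 y (List.mem_cons_of_mem _ hy), g3⟩
      by_cases hyx : y = x
      · rw [hyx, hxi, hx]
      · refine (h1.symm.trans g1).1 y ?_
        rintro (h' | h')
        · exact hy (Or.inl h')
        · exact (List.mem_cons.mp h').elim hyx fun h'' => hy (Or.inr h'')

end Search

end LGK4

/-! ### Breadth-first search tables. -/

namespace LGK4

open RAM

section Distances

variable {n : ℕ} {G : SimpleGraph (Fin n)}

/-- The table of the distances, increased by one, from `src` through the vertices `X`, where `0`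
stands for unreachable vertices, and the table of the predecessors. -/
structure IsTable (G : SimpleGraph (Fin n)) (X : Set ℕ) (src : ℕ) (dist par : ℕ → ℕ) : Prop where
  source : dist src = 1
  back : ∀ v < n, dist v ≠ 0 → v = src ∨ (par v < n ∧ par v ∈ X ∧ adjEntry G (par v) v = 1 ∧
    dist (par v) ≠ 0 ∧ dist v = dist (par v) + 1)
  closed : ∀ u < n, ∀ v < n, dist u ≠ 0 → u ∈ X → adjEntry G u v = 1 →
    dist v ≠ 0 ∧ dist v ≤ dist u + 1
  le : ∀ v < n, dist v ≤ n

/-- The tables during round `r` of the computation, when the pairs `(b, a)` that come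
lexicographically before `(v, u)` have been treated. -/
structure IsLayer (G : SimpleGraph (Fin n)) (X : Set ℕ) (src r v u : ℕ) (dist par : ℕ → ℕ) :
    Prop where
  source : dist src = 1
  back : ∀ v < n, dist v ≠ 0 → v = src ∨ (par v < n ∧ par v ∈ X ∧ adjEntry G (par v) v = 1 ∧
    dist (par v) ≠ 0 ∧ dist v = dist (par v) + 1)
  le : ∀ v < n, dist v ≤ r + 2
  closed : ∀ a < n, ∀ b < n, dist a ≠ 0 → dist a ≤ r → a ∈ X → adjEntry G a b = 1 →
    dist b ≠ 0 ∧ dist b ≤ dist a + 1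
  progress : ∀ a < n, ∀ b < n, b < v ∨ b = v ∧ a < u → dist a = r + 1 → a ∈ X →
    adjEntry G a b = 1 → dist b ≠ 0

variable {X : Set ℕ} {src r v u : ℕ} {dist par : ℕ → ℕ}

theorem IsLayer.start (hs : dist src = 1) (h : ∀ v < n, v ≠ src → dist v = 0) :
    IsLayer G X src 0 0 0 dist par where
  source := hs
  back v hv h0 := by
    by_contra h'
    exact h0 (h v hv fun h'' => h' (Or.inl h''))
  le v hv := by
    by_cases h' : v = src
    · rw [h', hs]; omega
    · rw [h v hv h']; omega
  closed a _ b _ h1 h2 := by omega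
  progress a _ b _ h1 := by omega

theorem IsLayer.next_row (h : IsLayer G X src r v n dist par) :
    IsLayer G X src r (v + 1) 0 dist par where
  source := h.source
  back := h.back
  le := h.le
  closed := h.closed
  progress a ha b hb h1 := h.progress a ha b hb (by omega)

/-- When all pairs have been treated, every vertex of `X` with label `r + 1` has passed labels on to
its neighbours, and these are at most `r + 2`; so `closed` extends by one level. -/
theorem IsLayer.next_round (h : IsLayer G X src r n 0 dist par) :
    IsLayer G X src (r + 1) 0 0 dist par where
  source := h.source
  back := h.back
  le v hv := (h.le v hv).trans (by omega)
  closed a ha b hb h1 h2 h3 h4 := by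
    rcases Nat.lt_or_ge r (dist a) with h5 | h5
    · have h6 : dist a = r + 1 := by omega
      refine ⟨h.progress a ha b hb (Or.inl hb) h6 h3 h4, ?_⟩
      rw [h6]
      exact h.le b hb
    · exact h.closed a ha b hb h1 h5 h3 h4
  progress a _ b _ h1 := by omega

theorem IsLayer.relax_neg (h : IsLayer G X src r v u dist par)
    (hc : ¬ (dist v = 0 ∧ dist u = r + 1 ∧ u ∈ X ∧ adjEntry G u v = 1)) :
    IsLayer G X src r v (u + 1) dist par where
  source := h.source
  back := h.back
  le := h.le
  closed := h.closed
  progress a ha b hb h1 h2 h3 h4 h5 := by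
    by_cases h6 : b = v ∧ a = u
    · obtain ⟨rfl, rfl⟩ := h6
      exact hc ⟨h5, h2, h3, h4⟩
    · exact h.progress a ha b hb (by omega) h2 h3 h4 h5

/-- Labelled vertices differ from `v`, so their labels and predecessors stay. The new label `r + 2`
exceeds the levels of which `closed` and `progress` speak. -/
theorem IsLayer.relax_pos (h : IsLayer G X src r v u dist par) (hu : u < n)
    (hv : dist v = 0) (hd : dist u = r + 1) (hX : u ∈ X) (hadj : adjEntry G u v = 1) :
    IsLayer G X src r v (u + 1) (Function.update dist v (r + 2)) (Function.update par v u) := by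
  have hne : ∀ w, dist w ≠ 0 → w ≠ v := fun w hw hwv => hw (hwv ▸ hv)
  have hof : ∀ w, dist w ≠ 0 → Function.update dist v (r + 2) w = dist w := fun w hw =>
    Function.update_of_ne (hne w hw) _ _
  have hnz : ∀ w, dist w ≠ 0 → Function.update dist v (r + 2) w ≠ 0 := fun w hw => by
    rwa [hof w hw]
  have hval : ∀ w, w ≠ v → Function.update dist v (r + 2) w = dist w := fun w hw =>
    Function.update_of_ne hw _ _
  constructor
  · rw [hof src (by rw [h.source]; omega), h.source]
  · intro w hw h0
    by_cases hwv : w = v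
    · subst hwv
      right
      rw [Function.update_self, Function.update_self, hof u (by omega)]
      exact ⟨hu, hX, hadj, by omega, by omega⟩
    · rw [hval w hwv] at h0 ⊢
      rw [Function.update_of_ne hwv]
      refine (h.back w hw h0).imp_right fun ⟨h1, h2, h3, h4, h5⟩ => ?_
      rw [hof _ h4]
      exact ⟨h1, h2, h3, h4, h5⟩
  · intro w hw
    by_cases hwv : w = v
    · subst hwv
      rw [Function.update_self]
    · rw [hval w hwv]
      exact h.le w hw
  · intro a ha b hb h1 h2 h3 h4
    have hav : a ≠ v := by
      rintro rfl
      rw [Function.update_self] at h2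
      omega
    rw [hval a hav] at h1 h2 ⊢
    obtain ⟨h5, h6⟩ := h.closed a ha b hb h1 h2 h3 h4
    rw [hof b h5]
    exact ⟨h5, h6⟩
  · intro a ha b hb h1 h2 h3 h4
    by_cases hbv : b = v
    · rw [hbv, Function.update_self]; omega
    have hav : a ≠ v := by
      rintro rfl
      rw [Function.update_self] at h2
      omega
    rw [hval a hav] at h2
    exact hnz b (h.progress a ha b hb (by omega) h2 h3 h4)

/-- Going back along predecessors lowers the label by one, so every value from 1 to a given label
occurs. Hence labels are at most `n`, and after `n` rounds `closed` covers all of them. -/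
theorem IsLayer.isTable (h : IsLayer G X src n 0 0 dist par) : IsTable G X src dist par := by
  have hlev : ∀ m, ∀ v < n, dist v = m → ∀ j, 1 ≤ j → j ≤ m → ∃ u < n, dist u = j := by
    intro m
    induction m with
    | zero => intro v _ _ j h1 h2; omega
    | succ m ih =>
      intro v hv hd j h1 h2
      rcases Nat.lt_or_ge m j with h3 | h3
      · exact ⟨v, hv, by omega⟩
      · rcases h.back v hv (by omega) with rfl | ⟨h4, -, -, -, h5⟩
        · rw [h.source] at hd; omega
        · exact ih _ h4 (by omega) j h1 h3
  have hle : ∀ v < n, dist v ≤ n := by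
    intro v hv
    have hsub : Finset.Icc 1 (dist v) ⊆ (Finset.range n).image dist := by
      intro j hj
      rw [Finset.mem_Icc] at hj
      obtain ⟨u, hu, hd⟩ := hlev _ v hv rfl j hj.1 hj.2
      exact Finset.mem_image.mpr ⟨u, Finset.mem_range.mpr hu, hd⟩
    have := (Finset.card_le_card hsub).trans Finset.card_image_le
    simpa using this
  exact ⟨h.source, h.back, fun u hu v hv h1 => h.closed u hu v hv h1 (hle u hu), hle⟩

namespace LoopProg

/-- If the entry `[u, v]` allows it, append `v` to the tables in round `r`. -/
def relax (k : ℕ) : LoopProg :=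
  .seq (.set 2 (.const 0)) <| .seq (.set 3 (.const 1)) <|
  .seq (.set 10 (.load (20 + k) 8)) <| .ite (.eq 10 2)
    (.seq (.set 11 (.load (20 + k) 9)) <| .seq (.set 12 (.succ 7)) <| .ite (.eq 11 12)
      (.seq (.set 13 (.load (60 + k) 9)) <| .ite (.eq 13 3)
        (.seq (.set 14 (.adj 9 8)) <| .ite (.eq 14 3)
          (.seq (.set 12 (.succ 12)) <| .seq (.store (20 + k) 8 12) <| .store (40 + k) 8 9)
          skip) skip) skip) skip

/-- Compute the tables `20 + k` and `40 + k` of distances and predecessors, from the vertex in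
the register `20 + k` through the vertices marked in the array `60 + k`. -/
def distances (k : ℕ) : LoopProg :=
  .seq (.loop 6 (.seq (.set 2 (.const 0)) (.store (20 + k) 6 2))) <|
  .seq (.set 3 (.const 1)) <| .seq (.store (20 + k) (20 + k) 3) <|
  .loop 7 (.loop 8 (.loop 9 (relax k)))

theorem run_relax (k : ℕ) (s : Memory) :
    ((relax k).run G s).arr (20 + k) = (if s.arr (20 + k) (s.reg 8) = 0 ∧
        s.arr (20 + k) (s.reg 9) = s.reg 7 + 1 ∧ s.arr (60 + k) (s.reg 9) = 1 ∧
        adjEntry G (s.reg 9) (s.reg 8) = 1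
      then Function.update (s.arr (20 + k)) (s.reg 8) (s.reg 7 + 2) else s.arr (20 + k)) ∧
    ((relax k).run G s).arr (40 + k) = (if s.arr (20 + k) (s.reg 8) = 0 ∧
        s.arr (20 + k) (s.reg 9) = s.reg 7 + 1 ∧ s.arr (60 + k) (s.reg 9) = 1 ∧
        adjEntry G (s.reg 9) (s.reg 8) = 1
      then Function.update (s.arr (40 + k)) (s.reg 8) (s.reg 9) else s.arr (40 + k)) := by
  have h1 : 20 + k ≠ 40 + k := by omega
  by_cases c1 : s.arr (20 + k) (s.reg 8) = 0
  · by_cases c2 : s.arr (20 + k) (s.reg 9) = s.reg 7 + 1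
    · by_cases c3 : s.arr (60 + k) (s.reg 9) = 1
      · by_cases c4 : adjEntry G (s.reg 9) (s.reg 8) = 1
        · simp [relax, run, Expr.eval, Test.holds, c1, c2, c3, c4, setArr_arr_self,
            setArr_arr_of_ne _ _ _ _ h1, setArr_arr_of_ne _ _ _ _ h1.symm]
        · simp [relax, run, Expr.eval, Test.holds, c1, c2, c3, c4, skip]
      · simp [relax, run, Expr.eval, Test.holds, c1, c2, c3, skip]
    · simp [relax, run, Expr.eval, Test.holds, c1, c2, skip]
  · simp [relax, run, Expr.eval, Test.holds, c1, skip]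

theorem regs_relax (k : ℕ) : (relax k).regs = [2, 3, 10, 11, 12, 13, 14, 12, 4, 4, 4, 4] := rfl

theorem arrs_relax (k : ℕ) : (relax k).arrs = [20 + k, 40 + k] := rfl

/-- Registers 7, 8 and 9 hold the round and the pair in `IsLayer`, which the three loops advance
lexicographically. The array of marks is not written, so `X` stays fixed. -/
theorem isTable_distances (k : ℕ) (s : Memory) :
    IsTable G {u | s.arr (60 + k) u = 1} (s.reg (20 + k))
      (((distances k).run G s).arr (20 + k)) (((distances k).run G s).arr (40 + k)) := by
  have hE : ∀ s, ((relax k).run G s).arr (60 + k) = s.arr (60 + k) := fun s =>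
    run_arr (by rw [arrs_relax]; simp) s
  set s₁ := (loop 6 (.seq (.set 2 (.const 0)) (.store (20 + k) 6 2))).run G s with hs₁
  have h1 : (s₁.arr (60 + k) = s.arr (60 + k) ∧ s₁.reg (20 + k) = s.reg (20 + k)) ∧
      ∀ v < n, s₁.arr (20 + k) v = 0 := by
    refine ⟨⟨run_arr (by simp [arrs]) s, run_reg (by simp [regs]; omega) s⟩, ?_⟩
    refine run_loop_inv (by simp [regs]) (fun i s' => ∀ v < i, s'.arr (20 + k) v = 0) (by simp) ?_
    intro i _ s' hi h v hv
    simp only [run, setReg_arr, setArr_arr, Expr.eval, setReg_reg, hi]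
    by_cases hvi : v = i
    · simp [hvi]
    · simp [hvi, h v (by omega)]
  set s₂ := setArr (setReg s₁ 3 1) (20 + k) (s.reg (20 + k)) 1 with hs₂
  have hrun : (distances k).run G s = (loop 7 (.loop 8 (.loop 9 (relax k)))).run G s₂ := by
    have h3 : 20 + k ≠ 3 := by omega
    change (loop 7 (.loop 8 (.loop 9 (relax k)))).run G (setArr (setReg s₁ 3 1) (20 + k)
      ((setReg s₁ 3 1).reg (20 + k)) ((setReg s₁ 3 1).reg 3)) = _
    rw [setReg_reg, setReg_reg, if_neg h3, if_pos rfl, h1.1.2]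
  have h2 : s₂.arr (60 + k) = s.arr (60 + k) := by
    rw [hs₂, setArr_arr_of_ne _ _ _ _ (by omega), setReg_arr, h1.1.1]
  have h3 : IsLayer G {u | s.arr (60 + k) u = 1} (s.reg (20 + k)) 0 0 0 (s₂.arr (20 + k))
      (s₂.arr (40 + k)) := by
    apply IsLayer.start
    · simp [hs₂, setArr_arr]
    · intro v hv hne
      simp [hs₂, setArr_arr, hne, h1.2 v hv]
  rw [hrun]
  refine IsLayer.isTable (And.right (a := ((loop 7 (.loop 8 (.loop 9 (relax k)))).run G s₂).arr
    (60 + k) = s.arr (60 + k)) ?_)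
  refine run_loop_inv (by simp [regs, regs_relax]) (fun r s' => s'.arr (60 + k) = s.arr (60 + k) ∧
    IsLayer G {u | s.arr (60 + k) u = 1} (s.reg (20 + k)) r 0 0 (s'.arr (20 + k))
      (s'.arr (40 + k))) ⟨h2, h3⟩ ?_
  intro r _ s' hr h
  have key : ((loop 8 (.loop 9 (relax k))).run G s').reg 7 = r ∧
      ((loop 8 (.loop 9 (relax k))).run G s').arr (60 + k) = s.arr (60 + k) ∧
      IsLayer G {u | s.arr (60 + k) u = 1} (s.reg (20 + k)) r n 0
        (((loop 8 (.loop 9 (relax k))).run G s').arr (20 + k))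
        (((loop 8 (.loop 9 (relax k))).run G s').arr (40 + k)) := by
    refine run_loop_inv (by simp [regs, regs_relax]) (fun v s' => s'.reg 7 = r ∧
      s'.arr (60 + k) = s.arr (60 + k) ∧
      IsLayer G {u | s.arr (60 + k) u = 1} (s.reg (20 + k)) r v 0 (s'.arr (20 + k))
        (s'.arr (40 + k))) ⟨by simp [hr], h⟩ ?_
    intro v _ s' hv h
    have key : ((loop 9 (relax k)).run G s').reg 8 = v ∧ ((loop 9 (relax k)).run G s').reg 7 = r ∧
        ((loop 9 (relax k)).run G s').arr (60 + k) = s.arr (60 + k) ∧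
        IsLayer G {u | s.arr (60 + k) u = 1} (s.reg (20 + k)) r v n
          (((loop 9 (relax k)).run G s').arr (20 + k))
          (((loop 9 (relax k)).run G s').arr (40 + k)) := by
      refine run_loop_inv (by simp [regs_relax]) (fun u s' => s'.reg 8 = v ∧ s'.reg 7 = r ∧
        s'.arr (60 + k) = s.arr (60 + k) ∧
        IsLayer G {u | s.arr (60 + k) u = 1} (s.reg (20 + k)) r v u (s'.arr (20 + k))
          (s'.arr (40 + k))) ⟨by simp [hv], by simpa using h⟩ ?_
      rintro u hu s' h9 ⟨h8, h7, hX, h⟩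
      refine ⟨?_, ?_, ?_, ?_⟩
      · simpa [run_reg (G := G) (p := relax k) (y := 8) (by simp [regs_relax])] using h8
      · simpa [run_reg (G := G) (p := relax k) (y := 7) (by simp [regs_relax])] using h7
      · rw [setReg_arr, hE, hX]
      · rw [setReg_arr, (run_relax k s').1, (run_relax k s').2, h7, h8, h9, hX]
        split_ifs with hc
        · exact h.relax_pos hu hc.1 hc.2.1 hc.2.2.1 hc.2.2.2
        · exact h.relax_neg hc
    exact ⟨by simp [key.2.1], key.2.2.1, key.2.2.2.next_row⟩
  exact ⟨key.2.1, key.2.2.next_round⟩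

end LoopProg

end Distances

end LGK4

/-! ### Shortest admissible paths read from the tables. -/

namespace LGK4

open RAM

section Tables

variable {n : ℕ} {G : SimpleGraph (Fin n)}

theorem adjEntry_fin (u v : Fin n) : adjEntry G u v = 1 ↔ G.Adj u v := by
  unfold adjEntry
  split_ifs with h
  · simpa using h
  · simpa using h

theorem adjEntry_eq_zero_or_one (i j : ℕ) : adjEntry G i j = 0 ∨ adjEntry G i j = 1 := by
  unfold adjEntry
  split_ifs
  exacts [Or.inr rfl, Or.inl rfl]

variable {X : Set ℕ} {src : ℕ} {dist par : ℕ → ℕ}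

theorem IsTable.congr {Y : Set ℕ} (T : IsTable G X src dist par) (h : ∀ u < n, (u ∈ X ↔ u ∈ Y)) :
    IsTable G Y src dist par where
  source := T.source
  back v hv h0 := (T.back v hv h0).imp_right fun ⟨h1, h2, h3⟩ => ⟨h1, (h _ h1).mp h2, h3⟩
  closed u hu v hv h1 h2 := T.closed u hu v hv h1 ((h u hu).mpr h2)
  le := T.le

/-- The label falls by one with each step to the predecessor, so the source, which has label 1, is
not left before `D` steps are made. -/
theorem IsTable.chain (T : IsTable G X src dist par) {m : ℕ} (hm : m < n) {D : ℕ}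
    (hD : dist m = D + 1) : ∀ j ≤ D, par^[j] m < n ∧ dist (par^[j] m) = D + 1 - j ∧
      (0 < j → par^[j] m ∈ X ∧ adjEntry G (par^[j] m) (par^[j - 1] m) = 1) := by
  intro j
  induction j with
  | zero => intro _; exact ⟨hm, hD, by omega⟩
  | succ j ih =>
    intro hj
    obtain ⟨h1, h2, -⟩ := ih (by omega)
    rw [Function.iterate_succ_apply']
    rcases T.back _ h1 (by omega) with h3 | ⟨h3, h4, h5, h6, h7⟩
    · rw [h3, T.source] at h2; omega
    · exact ⟨h3, by omega, fun _ => ⟨h4, h5⟩⟩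

theorem IsTable.chain_end (T : IsTable G X src dist par) {m : ℕ} (hm : m < n) {D : ℕ}
    (hD : dist m = D + 1) : par^[D] m = src := by
  obtain ⟨h1, h2, -⟩ := T.chain hm hD D le_rfl
  rcases T.back _ h1 (by omega) with h3 | ⟨-, -, -, h6, h7⟩
  · exact h3
  · omega

/-- Labels grow by at most one along the walk as long as it stays in `X`. The target need not be in
`X`; if the walk meets it early, the bound already holds at that point. -/
theorem IsTable.le_length {u m : Fin n} (T : IsTable G X u dist par) (P : G.Walk u m)
    (hP : ∀ v ∈ P.support, v = m ∨ (v : ℕ) ∈ X) : dist m ≠ 0 ∧ dist m ≤ P.length + 1 := by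
  have key : ∀ i ≤ P.length, (dist (P.getVert i) ≠ 0 ∧ dist (P.getVert i) ≤ i + 1) ∨
      (dist m ≠ 0 ∧ dist m ≤ P.length + 1) := by
    intro i
    induction i with
    | zero => intro _; left; simp [T.source]
    | succ i ih =>
      intro hi
      rcases ih (by omega) with ⟨h1, h2⟩ | h
      · rcases hP _ (P.getVert_mem_support i) with h3 | h3
        · rw [h3] at h1 h2
          exact Or.inr ⟨h1, by omega⟩
        · obtain ⟨h4, h5⟩ := T.closed _ (P.getVert i).2 _ (P.getVert (i + 1)).2 h1 h3
            ((adjEntry_fin _ _).mpr (P.adj_getVert_succ (by omega)))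
          exact Or.inl ⟨h4, by omega⟩
      · exact Or.inr h
  rcases key _ le_rfl with h | h
  · rwa [P.getVert_length] at h
  · exact h

/-- The path is the chain of predecessors of `m`, read backwards; by `le_length` no walk of this
kind is shorter. -/
theorem IsTable.exists_isShortestIn {u m : Fin n} (T : IsTable G X u dist par)
    (hm : dist m ≠ 0) : ∃ P : G.Walk u m, P.length + 1 = dist m ∧
      (∀ i ≤ P.length, (P.getVert i : ℕ) = par^[P.length - i] m) ∧
      IsShortestIn {v | v = m ∨ (v : ℕ) ∈ X} P := by
  obtain ⟨D, hD⟩ := Nat.exists_eq_succ_of_ne_zero hm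
  have hc := T.chain m.2 hD
  let f : ℕ → Fin n := fun i => ⟨par^[D - i] m, (hc (D - i) (by omega)).1⟩
  have hf : ∀ i < D, G.Adj (f i) (f (i + 1)) := by
    intro i hi
    rw [← adjEntry_fin]
    have := ((hc (D - i) (by omega)).2.2 (by omega)).2
    rwa [show D - i - 1 = D - (i + 1) by omega] at this
  have h0 : f 0 = u := Fin.ext (T.chain_end m.2 hD)
  have h1 : f D = m := by simp [f]
  refine ⟨(walkOfFn f D hf).copy h0 h1, ?_, ?_, ?_, ?_⟩
  · rw [Walk.length_copy, length_walkOfFn, hD]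
  · intro i hi
    rw [Walk.length_copy, length_walkOfFn] at *
    rw [Walk.getVert_copy, getVert_walkOfFn f D hf i hi]
  · intro v hv
    rw [Walk.support_copy, mem_support_walkOfFn] at hv
    obtain ⟨i, hi, rfl⟩ := hv
    rcases Nat.eq_or_lt_of_le hi with rfl | hi
    · exact Or.inl h1
    · exact Or.inr ((hc (D - i) (by omega)).2.2 (by omega)).1
  · intro q hq
    rw [Walk.length_copy, length_walkOfFn]
    have := (T.le_length q hq).2
    omega

/-- The number of the ordered pair `xy`. -/
def idx (x y : Fin 4) : ℕ := 4 * x + y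

theorem idx_inj {x y x' y' : Fin 4} : idx x y = idx x' y' ↔ x = x' ∧ y = y' := by
  unfold idx; omega

theorem idx_lt (x y : Fin 4) : idx x y < 16 := by unfold idx; omega

/-- The ordered pairs. -/
def dartList : List (Fin 4 × Fin 4) :=
  [(0, 1), (0, 2), (0, 3), (1, 0), (1, 2), (1, 3), (2, 0), (2, 1), (2, 3), (3, 0), (3, 1), (3, 2)]

theorem mem_dartList : ∀ e : Fin 4 × Fin 4, e ∈ dartList ↔ e.1 ≠ e.2 := by decide

/-- The vertices that can be inner vertices of the path for `xy`, or its first vertex, when `c`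
lists the corners. -/
def expandSet (G : SimpleGraph (Fin n)) (c : ℕ → ℕ) (x y : Fin 4) : Set ℕ :=
  {u | u = c (idx x y) ∨ ∀ x' y' : Fin 4, x' ≠ y' → c (idx x' y') ≠ c (idx x y) →
    adjEntry G u (c (idx x' y')) ≠ 1}

namespace LoopProg

/-- Unmark the vertex in register `6` in the array `60 + k` if the vertex in register `20 + k'` is
an adjacent corner. -/
def unmark (k k' : ℕ) : LoopProg :=
  .ite (.eq (20 + k') (20 + k)) skip <| .seq (.set 10 (.adj 6 (20 + k'))) <|
  .seq (.set 3 (.const 1)) <| .ite (.eq 10 3) (.seq (.set 2 (.const 0)) (.store (60 + k) 6 2)) skip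

/-- Mark the vertices of `expandSet` in the array `60 + k`. -/
def expand (k : ℕ) : LoopProg :=
  .seq (.loop 6 (.seq (.set 3 (.const 1)) <| .seq (.store (60 + k) 6 3) <|
    seqList (dartList.map fun e => unmark k (idx e.1 e.2)))) <|
  -- The corner itself is marked at the end, since it loses its mark in the loop when it is adjacent
  -- to a different corner.
  .seq (.set 3 (.const 1)) (.store (60 + k) (20 + k) 3)

theorem regs_unmark (k k' : ℕ) : (unmark k k').regs = [4, 10, 3, 2, 4] := rfl

theorem arrs_unmark (k k' : ℕ) : (unmark k k').arrs = [60 + k] := rfl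

theorem run_unmark (k k' : ℕ) (s : Memory) (v : ℕ) :
    ((unmark k k').run G s).arr (60 + k) v = if v = s.reg 6 ∧ s.reg (20 + k') ≠ s.reg (20 + k) ∧
      adjEntry G (s.reg 6) (s.reg (20 + k')) = 1 then 0 else s.arr (60 + k) v := by
  have h : 20 + k' ≠ 10 := by omega
  by_cases c1 : s.reg (20 + k') = s.reg (20 + k)
  · simp [unmark, run, Expr.eval, Test.holds, c1, skip]
  · by_cases c2 : adjEntry G (s.reg 6) (s.reg (20 + k')) = 1
    · simp [unmark, run, Expr.eval, Test.holds, c1, c2, setArr_arr]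
    · simp [unmark, run, Expr.eval, Test.holds, c1, c2, skip]

theorem run_unmark_list (k : ℕ) (l : List (Fin 4 × Fin 4)) (s : Memory) :
    AgreeOff {2, 3, 4, 10} {60 + k} s ((seqList (l.map fun e => unmark k (idx e.1 e.2))).run G s) ∧
    ∀ v, ((seqList (l.map fun e => unmark k (idx e.1 e.2))).run G s).arr (60 + k) v =
      if v = s.reg 6 ∧ ∃ e ∈ l, s.reg (20 + idx e.1 e.2) ≠ s.reg (20 + k) ∧
        adjEntry G (s.reg 6) (s.reg (20 + idx e.1 e.2)) = 1 then 0 else s.arr (60 + k) v := by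
  induction l generalizing s with
  | nil => exact ⟨AgreeOff.setReg (by simp) _ _, by simp [seqList, skip, run]⟩
  | cons e l ih =>
    have h1 : AgreeOff {2, 3, 4, 10} {60 + k} s ((unmark k (idx e.1 e.2)).run G s) :=
      AgreeOff.run (by simp [regs_unmark]) (by simp [arrs_unmark]) s
    obtain ⟨h2, h3⟩ := ih ((unmark k (idx e.1 e.2)).run G s)
    refine ⟨h1.trans h2, fun v => ?_⟩
    have hreg : ∀ k', ((unmark k (idx e.1 e.2)).run G s).reg (20 + k') = s.reg (20 + k') :=
      fun k' => h1.1 _ (by simp; omega)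
    change ((seqList (l.map fun e => unmark k (idx e.1 e.2))).run G
      ((unmark k (idx e.1 e.2)).run G s)).arr (60 + k) v = _
    rw [h3, h1.1 6 (by simp), run_unmark]
    simp only [hreg, List.exists_mem_cons_iff]
    by_cases c1 : v = s.reg 6
    · by_cases c2 : s.reg (20 + idx e.1 e.2) ≠ s.reg (20 + k) ∧
        adjEntry G (s.reg 6) (s.reg (20 + idx e.1 e.2)) = 1
      · simp [c1, c2]
      · simp only [c1, c2, true_and, and_false, if_false, false_or]
    · simp [c1]

theorem run_mark (k : ℕ) (q : LoopProg) (s : Memory) :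
    (LoopProg.seq (.set 3 (.const 1)) (.seq (.store (60 + k) 6 3) q)).run G s =
      q.run G (setArr (setReg s 3 1) (60 + k) (s.reg 6) 1) := by
  simp [run, Expr.eval]

theorem run_expand (x y : Fin 4) (s : Memory) :
    ∀ u < n, (((expand (idx x y)).run G s).arr (60 + idx x y) u = 1 ↔
      u ∈ expandSet G (fun k => s.reg (20 + k)) x y) := by
  set p : LoopProg := .seq (.set 3 (.const 1)) <| .seq (.store (60 + idx x y) 6 3) <|
    seqList (dartList.map fun e => unmark (idx x y) (idx e.1 e.2)) with hp
  set c : ℕ → ℕ := fun k => s.reg (20 + k) with hc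
  have hpr : ∀ s', AgreeOff {2, 3, 4, 10} {60 + idx x y} s' (p.run G s') ∧
      ∀ v, (p.run G s').arr (60 + idx x y) v = if v = s'.reg 6 then
        (if ∃ e ∈ dartList, s'.reg (20 + idx e.1 e.2) ≠ s'.reg (20 + idx x y) ∧
          adjEntry G (s'.reg 6) (s'.reg (20 + idx e.1 e.2)) = 1 then 0 else 1)
        else s'.arr (60 + idx x y) v := by
    intro s'
    have h1 : AgreeOff {2, 3, 4, 10} {60 + idx x y} s' (setReg s' 3 1) :=
      AgreeOff.setReg (by simp) _ _
    have h2 : AgreeOff {2, 3, 4, 10} {60 + idx x y} (setReg s' 3 1)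
        (setArr (setReg s' 3 1) (60 + idx x y) (s'.reg 6) 1) :=
      ⟨fun _ _ => rfl, fun a ha => setArr_arr_of_ne _ _ _ _ ha⟩
    obtain ⟨h3, h4⟩ := run_unmark_list (G := G) (idx x y) dartList
      (setArr (setReg s' 3 1) (60 + idx x y) (s'.reg 6) 1)
    rw [hp, run_mark]
    refine ⟨(h1.trans h2).trans h3, fun v => (h4 v).trans ?_⟩
    have hreg : ∀ k', (setReg s' 3 1).reg (20 + k') = s'.reg (20 + k') := fun k' => by
      rw [setReg_reg, if_neg (by omega)]
    have h6 : (setReg s' 3 1).reg 6 = s'.reg 6 := by simp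
    rw [setArr_arr, setArr_reg]
    simp only [hreg, h6, setReg_arr, true_and]
    by_cases c1 : v = s'.reg 6
    · simp only [c1, true_and, if_true]
    · simp only [c1, false_and, if_false]
  have h6 : 6 ∉ p.regs := by
    rw [hp]
    have : ∀ l : List (Fin 4 × Fin 4),
        6 ∉ (seqList (l.map fun e => unmark (idx x y) (idx e.1 e.2))).regs := by
      intro l
      induction l with
      | nil => simp [seqList, skip, regs]
      | cons e l ih =>
        change 6 ∉ (unmark _ _).regs ++ (seqList (l.map fun e => unmark (idx x y)
          (idx e.1 e.2))).regs
        simp [regs_unmark, ih]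
    simp [regs, this]
  have key := run_loop_inv (G := G) h6 (s := s) (fun i s' => (∀ k, s'.reg (20 + k) = c k) ∧
    ∀ u < i, s'.arr (60 + idx x y) u =
      if ∃ e ∈ dartList, c (idx e.1 e.2) ≠ c (idx x y) ∧ adjEntry G u (c (idx e.1 e.2)) = 1
      then 0 else 1) ⟨fun k => by rw [setReg_reg, if_neg (by omega)], by simp⟩ (by
    rintro i hi s' h1 ⟨h2, h3⟩
    obtain ⟨h4, h5⟩ := hpr s'
    refine ⟨fun k => ?_, fun u hu => ?_⟩
    · rw [setReg_reg, if_neg (by omega), h4.1 _ (by simp; omega), h2]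
    · rw [setReg_arr, h5]
      simp only [h1, h2]
      by_cases c1 : u = i
      · simp only [c1, if_true]
      · rw [if_neg c1]
        exact h3 u (by omega))
  intro u hu
  change (setArr (setReg ((loop 6 p).run G s) 3 1) _
    ((setReg ((loop 6 p).run G s) 3 1).reg (20 + idx x y))
    ((setReg ((loop 6 p).run G s) 3 1).reg 3)).arr _ u = 1 ↔ _
  rw [setReg_reg, if_neg (by omega), setReg_reg, if_pos rfl, key.1, setArr_arr, setReg_arr,
    key.2 u hu]
  simp only [expandSet, Set.mem_ofPred_eq, true_and]
  by_cases c1 : u = c (idx x y)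
  · simp [c1]
  · simp only [c1, if_false, false_or]
    rw [ite_eq_right_iff]
    simp only [zero_ne_one, imp_false, not_exists, not_and, Prod.forall, mem_dartList]

end LoopProg

end Tables

end LGK4

/-! ### Copying the rungs from the tables into arrays. -/

namespace LGK4

open RAM

section Build

variable {n : ℕ} {G : SimpleGraph (Fin n)}

/-- The unordered pairs, each with its smaller member first. -/
def rungList : List (Fin 4 × Fin 4) := [(0, 1), (0, 2), (0, 3), (1, 2), (1, 3), (2, 3)]

theorem mem_rungList : ∀ e : Fin 4 × Fin 4, e ∈ rungList ↔ e.1 < e.2 := by decide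

/-- The length of the half of the rung `xy` next to `x`, read from the tables. -/
def halfLen (s : Memory) (x y : Fin 4) (m : ℕ) : ℕ := s.arr (20 + idx x y) m - 1

/-- The number of vertices of the rung `xy`, read from the tables. -/
def tableLen (s : Memory) (x y : Fin 4) : ℕ :=
  halfLen s x y (s.reg (40 + idx x y)) + halfLen s y x (s.reg (40 + idx x y)) + 1

/-- The rung `xy`, read from the tables. -/
def tableRung (s : Memory) (x y : Fin 4) (i : ℕ) : ℕ :=
  -- Predecessors for `xy` lead from the middle vertex to the corner of `x`, hence the reversed
  -- exponent; those for `yx` lead from the middle vertex onwards to the corner of `y`.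
  if i ≤ halfLen s x y (s.reg (40 + idx x y)) then
    (s.arr (40 + idx x y))^[halfLen s x y (s.reg (40 + idx x y)) - i] (s.reg (40 + idx x y))
  else (s.arr (40 + idx y x))^[i - halfLen s x y (s.reg (40 + idx x y))] (s.reg (40 + idx x y))

/-- The tables are the right ones for the corners in the registers. -/
def TablesCorrect (G : SimpleGraph (Fin n)) (s : Memory) : Prop :=
  ∀ x y : Fin 4, x ≠ y → IsTable G (expandSet G (fun k => s.reg (20 + k)) x y)
    (s.reg (20 + idx x y)) (s.arr (20 + idx x y)) (s.arr (40 + idx x y))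

/-- The tables provide two paths that end in the middle vertex of `xy`, and are not too long. -/
def IsReached (n : ℕ) (s : Memory) (x y : Fin 4) : Prop :=
  s.arr (20 + idx x y) (s.reg (40 + idx x y)) ≠ 0 ∧ s.arr (20 + idx y x) (s.reg (40 + idx x y)) ≠ 0 ∧
    tableLen s x y ≤ n

/-- The rung `xy` has been copied from the tables to the array `80 + idx x y`. -/
def IsBuilt (s : Memory) (x y : Fin 4) : Prop :=
  s.reg (60 + idx x y) = tableLen s x y ∧
    ∀ i < tableLen s x y, s.arr (80 + idx x y) i = tableRung s x y i

/-- The registers that are written after the middle vertices have been chosen. -/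
def workRegs : Set ℕ := {y | y < 20 ∨ 60 ≤ y}

/-- The arrays that are written after the tables have been computed. -/
def workArrs : Set ℕ := {a | a < 20 ∨ 80 ≤ a}

theorem AgreeOff.work_reg {s s' : Memory} (h : AgreeOff workRegs workArrs s s') {y : ℕ}
    (hy : 20 ≤ y) (hy' : y < 60) : s'.reg y = s.reg y :=
  h.1 _ (by simp [workRegs]; omega)

theorem AgreeOff.work_arr {s s' : Memory} (h : AgreeOff workRegs workArrs s s') {a : ℕ}
    (ha : 20 ≤ a) (ha' : a < 80) : s'.arr a = s.arr a :=
  h.2 _ (by simp [workArrs]; omega)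

section Agree

variable {s s' : Memory}

theorem AgreeOff.halfLen_eq (h : AgreeOff workRegs workArrs s s') (x y : Fin 4) (m : ℕ) :
    halfLen s' x y m = halfLen s x y m := by
  have := idx_lt x y
  rw [halfLen, halfLen, h.work_arr (by omega) (by omega)]

theorem AgreeOff.mid_eq (h : AgreeOff workRegs workArrs s s') (x y : Fin 4) :
    s'.reg (40 + idx x y) = s.reg (40 + idx x y) := by
  have := idx_lt x y
  exact h.work_reg (by omega) (by omega)

theorem AgreeOff.corner_eq (h : AgreeOff workRegs workArrs s s') (x y : Fin 4) :
    s'.reg (20 + idx x y) = s.reg (20 + idx x y) := by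
  have := idx_lt x y
  exact h.work_reg (by omega) (by omega)

theorem AgreeOff.dist_eq (h : AgreeOff workRegs workArrs s s') (x y : Fin 4) :
    s'.arr (20 + idx x y) = s.arr (20 + idx x y) := by
  have := idx_lt x y
  exact h.work_arr (by omega) (by omega)

theorem AgreeOff.par_eq (h : AgreeOff workRegs workArrs s s') (x y : Fin 4) :
    s'.arr (40 + idx x y) = s.arr (40 + idx x y) := by
  have := idx_lt x y
  exact h.work_arr (by omega) (by omega)

theorem AgreeOff.tableLen_eq (h : AgreeOff workRegs workArrs s s') (x y : Fin 4) :
    tableLen s' x y = tableLen s x y := by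
  simp only [tableLen, h.halfLen_eq, h.mid_eq]

theorem AgreeOff.tableRung_eq (h : AgreeOff workRegs workArrs s s') (x y : Fin 4) (i : ℕ) :
    tableRung s' x y i = tableRung s x y i := by
  simp only [tableRung, h.halfLen_eq, h.mid_eq, h.par_eq]

theorem AgreeOff.isReached_iff (h : AgreeOff workRegs workArrs s s') (x y : Fin 4) :
    IsReached n s' x y ↔ IsReached n s x y := by
  simp only [IsReached, h.tableLen_eq, h.mid_eq, h.dist_eq]

theorem expandSet_congr {c c' : ℕ → ℕ} (h : ∀ x y : Fin 4, c (idx x y) = c' (idx x y))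
    (x y : Fin 4) : expandSet G c x y = expandSet G c' x y := by
  simp only [expandSet, h]

theorem TablesCorrect.agree (hT : TablesCorrect G s) (h : AgreeOff workRegs workArrs s s') :
    TablesCorrect G s' := by
  intro x y hxy
  rw [h.corner_eq, h.dist_eq, h.par_eq, expandSet_congr (c' := fun k => s.reg (20 + k))
    (fun x y => h.corner_eq x y)]
  exact hT x y hxy

end Agree

namespace LoopProg

/-- Register `5` is set when the chosen vertices turn out to be useless. -/
def fail : LoopProg := .set 5 (.const 1)

/-- Prepare for copying the rung `k`; the ordered pair `k'` is the reverse of `k`. -/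
def measure (k k' : ℕ) : LoopProg :=
  .seq (.set 2 (.const 0)) <| .seq (.set 10 (.load (20 + k) (40 + k))) <|
  .seq (.ite (.eq 10 2) fail skip) <| .seq (.set 13 (.load (20 + k') (40 + k))) <|
  .seq (.ite (.eq 13 2) fail skip) <| .seq (.set 13 (.pred 13)) <| .seq (.set 11 (.pred 10))
  (.set 12 (.var (40 + k)))

/-- Copy one vertex of the first half. -/
def backStep (k : ℕ) : LoopProg :=
  .seq (.store (80 + k) 11 12) <| .seq (.set 12 (.load (40 + k) 12)) (.set 11 (.pred 11))

/-- Copy one vertex of the second half, and count it. -/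
def forthStep (k k' : ℕ) : LoopProg :=
  .seq (.store (80 + k) 11 12) <| .seq (.set 12 (.load (40 + k') 12)) <|
  .seq (.set 11 (.succ 11)) (.ite (.lt 6 13) (.set (60 + k) (.succ (60 + k))) skip)

/-- Copy the rung `k` from the tables to the array `80 + k`, and its number of vertices to the
register `60 + k`. -/
def build (k k' : ℕ) : LoopProg :=
  -- Loops always make `n` rounds. When register 11 has come down to 0, the copying keeps
  -- overwriting cell 0, so the corner is stored there afterwards.
  .seq (measure k k') <| .seq (.loop 6 (backStep k)) <| .seq (.store (80 + k) 2 (20 + k)) <|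
  -- Register 10 holds the label of the middle vertex, which is the number of vertices of the first
  -- half including the middle; the vertices of the second half are then counted on top of it.
  .seq (.seq (.set 11 (.pred 10)) <| .seq (.set 12 (.var (40 + k))) (.set (60 + k) (.var 10))) <|
  -- A rung with more than `n` vertices cannot be correct, and later loops only visit positions
  -- below `n`.
  .seq (.loop 6 (forthStep k k')) <| .seq (.set 14 .order) (.ite (.lt 14 (60 + k)) fail skip)

theorem run_measure (k k' : ℕ) (s : Memory) :
    AgreeOff {2, 4, 5, 10, 11, 12, 13} ∅ s ((measure k k').run G s) ∧
    (((measure k k').run G s).reg 5 = 0 ↔ s.reg 5 = 0 ∧ s.arr (20 + k) (s.reg (40 + k)) ≠ 0 ∧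
      s.arr (20 + k') (s.reg (40 + k)) ≠ 0) ∧
    ((measure k k').run G s).reg 2 = 0 ∧
    ((measure k k').run G s).reg 10 = s.arr (20 + k) (s.reg (40 + k)) ∧
    ((measure k k').run G s).reg 11 = s.arr (20 + k) (s.reg (40 + k)) - 1 ∧
    ((measure k k').run G s).reg 12 = s.reg (40 + k) ∧
    ((measure k k').run G s).reg 13 = s.arr (20 + k') (s.reg (40 + k)) - 1 := by
  refine ⟨AgreeOff.run (by simp [measure, regs, fail, skip]) (by simp [measure, arrs, fail, skip]) s,
    ?_⟩
  have h (j : ℕ) (hj : j < 40) : 40 + k ≠ j := by omega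
  by_cases c1 : s.arr (20 + k) (s.reg (40 + k)) = 0
  · by_cases c2 : s.arr (20 + k') (s.reg (40 + k)) = 0
    · simp [measure, run, Expr.eval, Test.holds, fail, skip, h, c1, c2]
    · simp [measure, run, Expr.eval, Test.holds, fail, skip, h, c1, c2]
  · by_cases c2 : s.arr (20 + k') (s.reg (40 + k)) = 0
    · simp [measure, run, Expr.eval, Test.holds, fail, skip, h, c1, c2]
    · simp [measure, run, Expr.eval, Test.holds, fail, skip, h, c1, c2]

theorem run_back (k : ℕ) (s : Memory) :
    AgreeOff {6, 11, 12} {80 + k} s ((loop 6 (backStep k)).run G s) ∧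
    ∀ j < n, j < s.reg 11 → ((loop 6 (backStep k)).run G s).arr (80 + k) (s.reg 11 - j) =
      (s.arr (40 + k))^[j] (s.reg 12) := by
  refine ⟨AgreeOff.run (by simp [backStep, regs]) (by simp [backStep, arrs]) s, ?_⟩
  refine (run_loop_inv (by simp [backStep, regs]) (fun i s' => s'.arr (40 + k) = s.arr (40 + k) ∧
    s'.reg 11 = s.reg 11 - i ∧ s'.reg 12 = (s.arr (40 + k))^[i] (s.reg 12) ∧
    ∀ j < i, j < s.reg 11 → s'.arr (80 + k) (s.reg 11 - j) = (s.arr (40 + k))^[j] (s.reg 12))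
    (by simp) ?_).2.2.2
  rintro i hi s' h6 ⟨h1, h2, h3, h4⟩
  have h5 : 40 + k ≠ 80 + k := by omega
  refine ⟨?_, ?_, ?_, fun j hj hj' => ?_⟩
  · simp [backStep, run, setArr_arr_of_ne _ _ _ _ h5, h1]
  · simp [backStep, run, Expr.eval, h2, Nat.sub_sub]
  · simp [backStep, run, Expr.eval, setArr_arr_of_ne _ _ _ _ h5, h1, h3,
      Function.iterate_succ_apply']
  · simp only [backStep, run, setReg_arr, setArr_arr, true_and]
    by_cases c : j = i
    · rw [if_pos (by omega), h3, c]
    · rw [if_neg (by omega), h4 j (by omega) hj']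

theorem run_forth {k k' : ℕ} (hk : k' < 40) (s : Memory) :
    AgreeOff {4, 6, 11, 12, 60 + k} {80 + k} s ((loop 6 (forthStep k k')).run G s) ∧
    ((loop 6 (forthStep k k')).run G s).reg (60 + k) = s.reg (60 + k) + min n (s.reg 13) ∧
    ∀ i, ((loop 6 (forthStep k k')).run G s).arr (80 + k) i =
      if s.reg 11 ≤ i ∧ i < s.reg 11 + n then (s.arr (40 + k'))^[i - s.reg 11] (s.reg 12)
      else s.arr (80 + k) i := by
  refine ⟨AgreeOff.run (by simp [forthStep, regs, skip]) (by simp [forthStep, arrs, skip]) s, ?_⟩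
  refine (run_loop_inv (by simp [forthStep, regs, skip]; omega) (fun i s' =>
    (s'.arr (40 + k') = s.arr (40 + k') ∧ s'.reg 13 = s.reg 13 ∧
      s'.reg 11 = s.reg 11 + i ∧ s'.reg 12 = (s.arr (40 + k'))^[i] (s.reg 12)) ∧
    s'.reg (60 + k) = s.reg (60 + k) + min i (s.reg 13) ∧
    ∀ j, s'.arr (80 + k) j = if s.reg 11 ≤ j ∧ j < s.reg 11 + i then
      (s.arr (40 + k'))^[j - s.reg 11] (s.reg 12) else s.arr (80 + k) j) ?_ ?_).2
  · have h6 : 60 + k ≠ 6 := by omega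
    simp [h6]
  rintro i hi s' h6 ⟨⟨h1, h2, h3, h4⟩, h5, h7⟩
  have h8 : 40 + k' ≠ 80 + k := by omega
  have h9 : ∀ j < 60, 60 + k ≠ j := by omega
  have h10 : ∀ j < 60, j ≠ 60 + k := by omega
  have key : ((forthStep k k').run G s').arr = (setArr s' (80 + k) (s'.reg 11) (s'.reg 12)).arr ∧
      ((forthStep k k').run G s').reg 13 = s'.reg 13 ∧
      ((forthStep k k').run G s').reg 11 = s'.reg 11 + 1 ∧
      ((forthStep k k').run G s').reg 12 = s'.arr (40 + k') (s'.reg 12) ∧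
      ((forthStep k k').run G s').reg (60 + k) =
        if i < s'.reg 13 then s'.reg (60 + k) + 1 else s'.reg (60 + k) := by
    by_cases c : i < s'.reg 13
    · simp [forthStep, run, Expr.eval, Test.holds, h6, c, setArr_arr_of_ne _ _ _ _ h8, h9, h10]
    · simp [forthStep, run, Expr.eval, Test.holds, h6, c, setArr_arr_of_ne _ _ _ _ h8, h9, skip]
  obtain ⟨k1, k2, k3, k4, k5⟩ := key
  simp only [setReg_arr, setReg_reg, k1, k2, k3, k4, k5, setArr_arr_of_ne _ _ _ _ h8, h1, h2, h3,
    h4, h5, if_neg (h9 6 (by omega)), Function.iterate_succ_apply']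
  refine ⟨⟨trivial, by simp, by simp; omega, by simp⟩, ?_, fun j => ?_⟩
  · split_ifs <;> omega
  · rw [setArr_arr, h7]
    by_cases c : j = s.reg 11 + i
    · rw [if_pos ⟨rfl, c⟩, if_pos (by omega), c, Nat.add_sub_cancel_left]
    · rw [if_neg (by tauto)]
      congr 1
      simp only [eq_iff_iff]
      omega

theorem regs_build (k k' : ℕ) : (build k k').regs =
    [2, 10, 5, 4, 13, 5, 4, 13, 11, 12, 6, 12, 11, 11, 12, 60 + k, 6, 12, 11, 60 + k, 4, 14, 5, 4] :=
  rfl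

theorem arrs_build (k k' : ℕ) : (build k k').arrs = [80 + k, 80 + k, 80 + k] := rfl

theorem run_build {x y : Fin 4} (hxy : x ≠ y) {s : Memory} (hT : TablesCorrect G s)
    (hm : s.reg (40 + idx x y) < n) :
    (((build (idx x y) (idx y x)).run G s).reg 5 = 0 ↔ s.reg 5 = 0 ∧ IsReached n s x y) ∧
    (IsReached n s x y → IsBuilt ((build (idx x y) (idx y x)).run G s) x y) := by
  have hk := idx_lt x y
  have hk' := idx_lt y x
  have hagree : AgreeOff workRegs workArrs s ((build (idx x y) (idx y x)).run G s) := by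
    refine AgreeOff.run ?_ ?_ s
    · simp [regs_build, workRegs]
    · simp [arrs_build, workArrs]
  set k := idx x y with hkd
  set k' := idx y x with hkd'
  set m := s.reg (40 + k) with hmd
  have hrun : ∃ s₁ s₂ s₃ s₄ s₅, s₁ = (measure k k').run G s ∧
      s₂ = (loop 6 (backStep k)).run G s₁ ∧
      s₃ = setArr s₂ (80 + k) (s₂.reg 2) (s₂.reg (20 + k)) ∧
      s₄ = (seq (.set 11 (.pred 10)) (.seq (.set 12 (.var (40 + k))) (.set (60 + k) (.var 10)))).run
        G s₃ ∧
      s₅ = (loop 6 (forthStep k k')).run G s₄ ∧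
      (build k k').run G s = (seq (.set 14 .order) (.ite (.lt 14 (60 + k)) fail skip)).run G s₅ :=
    ⟨_, _, _, _, _, rfl, rfl, rfl, rfl, rfl, rfl⟩
  obtain ⟨s₁, s₂, s₃, s₄, s₅, e₁, e₂, e₃, e₄, e₅, e₆⟩ := hrun
  obtain ⟨a1, m1, m2, m3, m4, m5, m6⟩ := run_measure (G := G) k k' s
  rw [← e₁] at a1 m1 m2 m3 m4 m5 m6
  obtain ⟨b1, b2⟩ := run_back (G := G) k s₁
  rw [← e₂] at b1 b2
  have hs₄ : (∀ j < 60, j ≠ 11 → j ≠ 12 → s₄.reg j = s₃.reg j) ∧ s₄.arr = s₃.arr ∧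
      s₄.reg 11 = s₃.reg 10 - 1 ∧ s₄.reg 12 = s₃.reg (40 + k) ∧
      s₄.reg (60 + k) = s₃.reg 10 := by
    have h11 : 11 ≠ 60 + k := by omega
    have h12 : 12 ≠ 60 + k := by omega
    have h40 : 40 + k ≠ 11 := by omega
    rw [e₄]
    refine ⟨fun j hj h1 h2 => ?_, rfl, ?_, ?_, ?_⟩
    · have : j ≠ 60 + k := by omega
      simp [run, this, h1, h2]
    · simp [run, Expr.eval, h11]
    · simp [run, Expr.eval, h12, h40]
    · simp [run, Expr.eval]
  obtain ⟨f1, f2, f3⟩ := run_forth (G := G) (k := k) (k' := k') (by omega) s₄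
  rw [← e₅] at f1 f2 f3
  set D := s.arr (20 + k) m - 1 with hD
  set D' := s.arr (20 + k') m - 1 with hD'
  have r3 : ∀ j, s₃.reg j = s₂.reg j := fun j => by rw [e₃, setArr_reg]
  have r10 : s₃.reg 10 = s.arr (20 + k) m := by rw [r3, b1.1 10 (by simp), m3]
  have r11 : s₄.reg 11 = D := by rw [hs₄.2.2.1, r10]
  have r12 : s₄.reg 12 = m := by
    rw [hs₄.2.2.2.1, r3, b1.1 _ (by simp; omega), a1.1 _ (by simp; omega)]
  have r13 : s₄.reg 13 = D' := by
    rw [hs₄.1 13 (by omega) (by omega) (by omega), r3, b1.1 13 (by simp), m6]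
  have r5 : s₅.reg 5 = 0 ↔ s.reg 5 = 0 ∧ s.arr (20 + k) m ≠ 0 ∧ s.arr (20 + k') m ≠ 0 := by
    rw [f1.1 5 (by simp; omega), hs₄.1 5 (by omega) (by omega) (by omega), r3, b1.1 5 (by simp), m1]
  have hTL : tableLen s x y = D + D' + 1 := rfl
  have hD'n : D' ≤ n := (Nat.sub_le _ _).trans ((hT y x hxy.symm).le m hm)
  have hlen : s.arr (20 + k) m ≠ 0 → s₅.reg (60 + k) = tableLen s x y := by
    intro h
    rw [f2, r13, hs₄.2.2.2.2, r10, min_eq_right hD'n, hTL]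
    omega
  have hlast : ((build k k').run G s).reg (60 + k) = s₅.reg (60 + k) ∧
      ((build k k').run G s).arr = s₅.arr ∧
      (((build k k').run G s).reg 5 = 0 ↔ s₅.reg 5 = 0 ∧ s₅.reg (60 + k) ≤ n) := by
    rw [e₆]
    have h14 : 60 + k ≠ 14 := by omega
    have h5 : 60 + k ≠ 5 := by omega
    have h4 : 60 + k ≠ 4 := by omega
    by_cases c : n < s₅.reg (60 + k)
    · simp [run, Expr.eval, Test.holds, h14, c, fail, h5]
    · simp [run, Expr.eval, Test.holds, h14, c, skip, h4]
      intro; omega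
  constructor
  · rw [hlast.2.2, r5, IsReached]
    constructor
    · rintro ⟨⟨h1, h2, h3⟩, h4⟩
      exact ⟨h1, h2, h3, hlen h2 ▸ h4⟩
    · rintro ⟨h1, h2, h3, h4⟩
      exact ⟨⟨h1, h2, h3⟩, (hlen h2).symm ▸ h4⟩
  · rintro ⟨h2, h3, h4⟩
    refine ⟨by rw [hlast.1, hlen h2, hagree.tableLen_eq], fun i hi => ?_⟩
    rw [hagree.tableLen_eq] at hi
    rw [hagree.tableRung_eq, hlast.2.1, f3, r11, r12]
    have hDn := (hT x y hxy).le m hm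
    have hDn' := (hT y x hxy.symm).le m hm
    have hi' : i < D + D' + 1 := hi
    have par1 : s₄.arr (40 + k') = s.arr (40 + k') := by
      rw [hs₄.2.1, e₃, setArr_arr_of_ne _ _ _ _ (by omega), b1.2 _ (by simp; omega),
        a1.2 _ (by simp)]
    have par2 : s₁.arr (40 + k) = s.arr (40 + k) := a1.2 _ (by simp)
    change _ = if i ≤ D then (s.arr (40 + k))^[D - i] m else (s.arr (40 + k'))^[i - D] m
    by_cases c : D ≤ i
    · rw [if_pos (by omega), par1]
      by_cases c' : i ≤ D
      · rw [if_pos c', show i = D by omega, Nat.sub_self]; rfl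
      · rw [if_neg c']
    · rw [if_neg (by omega), if_pos (by omega), hs₄.2.1, e₃, setArr_arr]
      have r2 : s₂.reg 2 = 0 := by rw [b1.1 2 (by simp), m2]
      have rsrc : s₂.reg (20 + k) = s.reg (20 + k) := by
        rw [b1.1 _ (by simp; omega), a1.1 _ (by simp; omega)]
      rw [r2, rsrc]
      by_cases c' : i = 0
      · rw [if_pos ⟨rfl, c'⟩, c', Nat.sub_zero]
        have h2' : s.arr (20 + k) m = D + 1 := by
          have : s.arr (20 + k) m ≠ 0 := h2
          omega
        exact ((hT x y hxy).chain_end hm h2').symm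
      · rw [if_neg (by tauto)]
        have := b2 (D - i) (by omega) (by rw [m4]; omega)
        rw [m4, m5, par2] at this
        rw [← this]
        congr 1; omega

end LoopProg

end Build

end LGK4

/-! ### Testing the adjacencies between two rungs. -/

namespace LGK4

open RAM

section Checks

variable {n : ℕ} {G : SimpleGraph (Fin n)}

/-- The registers for temporary results. -/
def tempRegs : Set ℕ := {y | 2 ≤ y ∧ y < 20}

/-- The program `p` sets register `5` unless the memory has the property `Φ`, and has no other
lasting effect. -/
def IsCheck (G : SimpleGraph (Fin n)) (p : LoopProg) (Φ : Memory → Prop) : Prop :=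
  ∀ s, AgreeOff tempRegs ∅ s (p.run G s) ∧ ((p.run G s).reg 5 = 0 ↔ s.reg 5 = 0 ∧ Φ s)

/-- On the positions in the registers `6` and `7` of the rungs whose lengths are in the registers
`60 + k` and `60 + k'`, the program `T` computes whether the vertices there should be adjacent,
and whether they should be equal. -/
structure IsPattern (G : SimpleGraph (Fin n)) (k k' : ℕ) (T : LoopProg)
    (A B : ℕ → ℕ → ℕ → ℕ → Prop) : Prop where
  agree : ∀ s, AgreeOff {2, 3, 4, 8, 9, 14, 15} ∅ s (T.run G s)
  bool : ∀ s, ((T.run G s).reg 14 = 0 ∨ (T.run G s).reg 14 = 1) ∧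
    ((T.run G s).reg 15 = 0 ∨ (T.run G s).reg 15 = 1)
  adj : ∀ s, 1 ≤ s.reg (60 + k) → 1 ≤ s.reg (60 + k') → ((T.run G s).reg 14 = 1 ↔
    A (s.reg 6) (s.reg 7) (s.reg (60 + k)) (s.reg (60 + k')))
  eq : ∀ s, (T.run G s).reg 15 = 1 ↔ B (s.reg 6) (s.reg 7) (s.reg (60 + k)) (s.reg (60 + k'))

/-- The vertices at the positions `i` and `j` are adjacent and equal if and only if they should be,
when there are such vertices. -/
def Fits (G : SimpleGraph (Fin n)) (k k' : ℕ) (A B : ℕ → ℕ → ℕ → ℕ → Prop) (s : Memory)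
    (i j : ℕ) : Prop :=
  i < s.reg (60 + k) → j < s.reg (60 + k') →
    (adjEntry G (s.arr (80 + k) i) (s.arr (80 + k') j) = 1 ↔
      A i j (s.reg (60 + k)) (s.reg (60 + k'))) ∧
    (s.arr (80 + k) i = s.arr (80 + k') j ↔ B i j (s.reg (60 + k)) (s.reg (60 + k')))

theorem AgreeOff.fits_iff {k k' : ℕ} {A B : ℕ → ℕ → ℕ → ℕ → Prop} {s s' : Memory}
    (h : AgreeOff tempRegs ∅ s s') (i j : ℕ) : Fits G k k' A B s' i j ↔ Fits G k k' A B s i j := by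
  have h1 : ∀ k, s'.reg (60 + k) = s.reg (60 + k) := fun k => h.1 _ (by simp [tempRegs]; omega)
  have h2 : ∀ a, s'.arr a = s.arr a := fun a => h.2 a (by simp)
  simp only [Fits, h1, h2]

/-- Position `i` on the rung `e` with `L` vertices is its end at `z`. -/
def IsEndOf (e : Fin 4 × Fin 4) (i L : ℕ) (z : Fin 4) : Prop :=
  (z = e.1 ∧ i = 0) ∨ (z = e.2 ∧ i + 1 = L)

namespace LoopProg

theorem run_seqList_cons (p : LoopProg) (l : List LoopProg) (s : Memory) :
    (seqList (p :: l)).run G s = (seqList l).run G (p.run G s) := rfl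

/-- Test the pair of vertices at the positions in the registers `6` and `7`. -/
def pairStep (k k' : ℕ) (T : LoopProg) : LoopProg :=
  .seq T <| .seq (.set 10 (.load (80 + k) 6)) <| .seq (.set 11 (.load (80 + k') 7)) <|
  .seq (.set 12 (.adj 10 11)) <| .seq (.set 13 (.const 0)) <|
  .seq (.ite (.eq 10 11) (.set 13 (.const 1)) skip) <|
  .seq (.ite (.eq 12 14) skip fail) (.ite (.eq 13 15) skip fail)

/-- Test all pairs of vertices of two rungs. -/
def pairCheck (k k' : ℕ) (T : LoopProg) : LoopProg :=
  .loop 6 <| .loop 7 <| .ite (.lt 6 (60 + k)) (.ite (.lt 7 (60 + k')) (pairStep k k' T) skip) skip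

theorem run_pairStep {k k' : ℕ} {T : LoopProg} {A B : ℕ → ℕ → ℕ → ℕ → Prop}
    (hT : IsPattern G k k' T A B) (s : Memory) :
    AgreeOff {2, 3, 4, 5, 8, 9, 10, 11, 12, 13, 14, 15} ∅ s ((pairStep k k' T).run G s) ∧
    (s.reg 6 < s.reg (60 + k) → s.reg 7 < s.reg (60 + k') →
      (((pairStep k k' T).run G s).reg 5 = 0 ↔
        s.reg 5 = 0 ∧ Fits G k k' A B s (s.reg 6) (s.reg 7))) := by
  have h0 := hT.agree s
  constructor
  · refine (h0.mono (by intro y; simp; tauto) subset_rfl).trans ?_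
    change AgreeOff _ _ _ ((LoopProg.seq (.set 10 (.load (80 + k) 6)) <|
      .seq (.set 11 (.load (80 + k') 7)) <|
      .seq (.set 12 (.adj 10 11)) <| .seq (.set 13 (.const 0)) <|
      .seq (.ite (.eq 10 11) (.set 13 (.const 1)) skip) <|
      .seq (.ite (.eq 12 14) skip fail) (.ite (.eq 13 15) skip fail)).run G (T.run G s))
    exact AgreeOff.run (by simp [regs, skip, fail]) (by simp [arrs, skip, fail]) _
  intro hi hj
  have h1 := hT.adj s (by omega) (by omega)
  have h2 := hT.eq s
  obtain ⟨h3, h4⟩ := hT.bool s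
  have h5 : (T.run G s).reg 5 = s.reg 5 := h0.1 5 (by simp)
  have h6 : (T.run G s).reg 6 = s.reg 6 := h0.1 6 (by simp)
  have h7 : (T.run G s).reg 7 = s.reg 7 := h0.1 7 (by simp)
  have h8 : ∀ a, (T.run G s).arr a = s.arr a := fun a => h0.2 a (by simp)
  rw [pairStep, run]
  rw [Fits, ← h1, ← h2]
  simp only [hi, hj, forall_const]
  generalize T.run G s = s' at *
  have h9 := adjEntry_eq_zero_or_one (G := G) (s.arr (80 + k) (s.reg 6)) (s.arr (80 + k') (s.reg 7))
  by_cases c1 : s.arr (80 + k) (s.reg 6) = s.arr (80 + k') (s.reg 7)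
  · rcases h9 with h9 | h9 <;> rcases h3 with h3 | h3 <;> rcases h4 with h4 | h4 <;>
      rw [c1] at h9 <;>
      simp [run, Expr.eval, Test.holds, skip, fail, h3, h4, h5, h6, h7, h8, c1, h9]
  · rcases h9 with h9 | h9 <;> rcases h3 with h3 | h3 <;> rcases h4 with h4 | h4 <;>
      simp [run, Expr.eval, Test.holds, skip, fail, h3, h4, h5, h6, h7, h8, c1, h9]

/-- The tests never clear register 5, so it is 0 at the end if and only if it was 0 before and no
pair failed. The subprogram `T` is known only through its effect, so the loops are treated by
`run_loop_induction`. -/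
theorem isCheck_pairCheck {k k' : ℕ} {T : LoopProg} {A B : ℕ → ℕ → ℕ → ℕ → Prop}
    (hT : IsPattern G k k' T A B) :
    IsCheck G (pairCheck k k' T) fun s => ∀ i < n, ∀ j < n, Fits G k k' A B s i j := by
  intro s
  set q : LoopProg := .ite (.lt 6 (60 + k)) (.ite (.lt 7 (60 + k')) (pairStep k k' T) skip) skip
    with hq
  have hqs : ∀ s, AgreeOff {2, 3, 4, 5, 8, 9, 10, 11, 12, 13, 14, 15} ∅ s (q.run G s) ∧
      ((q.run G s).reg 5 = 0 ↔ s.reg 5 = 0 ∧ Fits G k k' A B s (s.reg 6) (s.reg 7)) := by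
    intro s
    have hs : AgreeOff {2, 3, 4, 5, 8, 9, 10, 11, 12, 13, 14, 15} ∅ s (skip.run G s) :=
      AgreeOff.setReg (by simp) _ _
    have hs5 : (skip.run G s).reg 5 = s.reg 5 := by simp [skip, run]
    by_cases c1 : s.reg 6 < s.reg (60 + k)
    · by_cases c2 : s.reg 7 < s.reg (60 + k')
      · have h : q.run G s = (pairStep k k' T).run G s := by simp [hq, run, Test.holds, c1, c2]
        rw [h]
        exact ⟨(run_pairStep hT s).1, (run_pairStep hT s).2 c1 c2⟩
      · have h : q.run G s = skip.run G s := by simp [hq, run, Test.holds, c1, c2]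
        rw [h, hs5]
        exact ⟨hs, by simp [Fits, c2]⟩
    · have h : q.run G s = skip.run G s := by simp [hq, run, Test.holds, c1]
      rw [h, hs5]
      exact ⟨hs, by simp [Fits, c1]⟩
  have hsub : ({2, 3, 4, 5, 8, 9, 10, 11, 12, 13, 14, 15} : Set ℕ) ⊆ tempRegs := by
    intro y hy
    simp only [Set.mem_insert_iff, Set.mem_singleton_iff] at hy
    simp only [tempRegs, Set.mem_ofPred_eq]
    omega
  have h6 : (6 : ℕ) ∈ tempRegs := by simp [tempRegs]
  have h7 : (7 : ℕ) ∈ tempRegs := by simp [tempRegs]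
  refine run_loop_induction G 6 (.loop 7 q) ?_ (fun i s' => AgreeOff tempRegs ∅ s s' ∧
    (s'.reg 5 = 0 ↔ s.reg 5 = 0 ∧ ∀ i' < i, ∀ j < n, Fits G k k' A B s i' j)) ?_ ?_ |>.imp_right ?_
  · intro s
    refine run_loop_induction G 7 q (fun s => (hqs s).1.1 7 (by simp))
      (fun _ s' => s'.reg 6 = s.reg 6) (by simp) ?_
    intro i _ s' _ h
    rw [setReg_reg, if_neg (by omega), (hqs s').1.1 6 (by simp), h]
  · exact ⟨AgreeOff.setReg h6 _ _, by simp⟩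
  · rintro i hi s' hs' ⟨h1, h2⟩
    have key := run_loop_induction G 7 q (fun s => (hqs s).1.1 7 (by simp)) (s := s')
      (fun j s'' => AgreeOff tempRegs ∅ s s'' ∧ s''.reg 6 = i ∧ (s''.reg 5 = 0 ↔
        (s.reg 5 = 0 ∧ ∀ i' < i, ∀ j < n, Fits G k k' A B s i' j) ∧
          ∀ j' < j, Fits G k k' A B s i j'))
      ⟨h1.trans (AgreeOff.setReg h7 _ _), by simp [hs'], by simp [h2]⟩ (by
        rintro j hj s'' hs'' ⟨g1, g2, g3⟩
        obtain ⟨g4, g5⟩ := hqs s''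
        refine ⟨(g1.trans (g4.mono hsub subset_rfl)).trans (AgreeOff.setReg h7 _ _), ?_, ?_⟩
        · rw [setReg_reg, if_neg (by omega), g4.1 6 (by simp), g2]
        · rw [setReg_reg, if_neg (by omega), g5, g3, g1.fits_iff, g2, hs'', and_assoc,
            Nat.forall_lt_succ_right])
    refine ⟨key.1.trans (AgreeOff.setReg h6 _ _), ?_⟩
    rw [setReg_reg, if_neg (by omega), key.2.2, and_assoc, Nat.forall_lt_succ_right]
  · exact id

theorem isCheck_seqList {ι : Type*} {l : List ι} {f : ι → LoopProg} {Φ : ι → Memory → Prop}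
    (h : ∀ a ∈ l, IsCheck G (f a) (Φ a))
    (hΦ : ∀ a s s', AgreeOff tempRegs ∅ s s' → (Φ a s' ↔ Φ a s)) :
    IsCheck G (seqList (l.map f)) fun s => ∀ a ∈ l, Φ a s := by
  induction l with
  | nil => exact fun s => ⟨AgreeOff.setReg (by simp [tempRegs]) _ _, by simp [seqList, skip, run]⟩
  | cons a l ih =>
    intro s
    obtain ⟨h1, h2⟩ := h a List.mem_cons_self s
    obtain ⟨h3, h4⟩ := ih (fun a ha => h a (List.mem_cons_of_mem _ ha)) ((f a).run G s)
    rw [List.map_cons, run_seqList_cons]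
    refine ⟨h1.trans h3, ?_⟩
    simp only [h4, h2, List.forall_mem_cons, hΦ _ _ _ h1, and_assoc]

/-- The pattern for two vertices of the same rung. -/
def samePattern : LoopProg :=
  .seq (.set 14 (.const 0)) <| .seq (.set 15 (.const 0)) <|
  .seq (.ite (.eq 6 7) (.set 15 (.const 1)) skip) <| .seq (.set 8 (.succ 6)) <|
  .seq (.ite (.eq 8 7) (.set 14 (.const 1)) skip) <| .seq (.set 9 (.succ 7))
  (.ite (.eq 9 6) (.set 14 (.const 1)) skip)

theorem isPattern_same (k : ℕ) : IsPattern G k k samePattern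
    (fun i j _ _ => i + 1 = j ∨ j + 1 = i) (fun i j _ _ => i = j) := by
  have hag : ∀ s, AgreeOff {2, 3, 4, 8, 9, 14, 15} ∅ s (samePattern.run G s) :=
    fun s => AgreeOff.run (by simp [samePattern, regs, skip]) (by simp [samePattern, arrs, skip]) s
  have key : ∀ s : Memory, (samePattern.run G s).reg 14 =
      (if s.reg 6 + 1 = s.reg 7 ∨ s.reg 7 + 1 = s.reg 6 then 1 else 0) ∧
      (samePattern.run G s).reg 15 = if s.reg 6 = s.reg 7 then 1 else 0 := by
    intro s
    by_cases c1 : s.reg 6 = s.reg 7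
    · simp [samePattern, run, Expr.eval, Test.holds, skip, c1]
    · by_cases c2 : s.reg 6 + 1 = s.reg 7
      · have c3 : ¬ s.reg 7 + 1 = s.reg 6 := by omega
        simp [samePattern, run, Expr.eval, Test.holds, skip, c1, c2, c3]
      · by_cases c3 : s.reg 7 + 1 = s.reg 6 <;>
          simp [samePattern, run, Expr.eval, Test.holds, skip, c1, c2, c3]
  refine ⟨hag, fun s => ?_, fun s _ _ => ?_, fun s => ?_⟩
  · rw [(key s).1, (key s).2]
    split_ifs <;> simp
  · rw [(key s).1, ite_eq_left_iff]
    simp only [zero_ne_one, imp_false, not_not]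
  · rw [(key s).2]; simp

/-- Adjacency at the common end `z = z'` of two rungs, where the positions of the ends are held by
the registers `a` and `b`. -/
def touchAt (z z' : Fin 4) (a b : ℕ) : LoopProg :=
  if z = z' then .ite (.eq 6 a) (.ite (.eq 7 b) (.set 14 (.const 1)) skip) skip else skip

/-- The pattern for vertices of two rungs. -/
def crossPattern (e e' : Fin 4 × Fin 4) : LoopProg :=
  .seq (.seq (.set 14 (.const 0)) <| .seq (.set 15 (.const 0)) <| .seq (.set 2 (.const 0)) <|
    .seq (.set 8 (.pred (60 + idx e.1 e.2))) (.set 9 (.pred (60 + idx e'.1 e'.2)))) <|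
  .seq (touchAt e.1 e'.1 2 2) <| .seq (touchAt e.1 e'.2 2 9) <|
  .seq (touchAt e.2 e'.1 8 2) (touchAt e.2 e'.2 8 9)

theorem run_touchAt (z z' : Fin 4) (a b : ℕ) (s : Memory) :
    AgreeOff {4, 14} ∅ s ((touchAt z z' a b).run G s) ∧
    ((touchAt z z' a b).run G s).reg 14 =
      if z = z' ∧ s.reg 6 = s.reg a ∧ s.reg 7 = s.reg b then 1 else s.reg 14 := by
  by_cases c : z = z'
  · simp only [touchAt, c, if_true, true_and]
    refine ⟨AgreeOff.run (by simp [regs, skip]) (by simp [arrs, skip]) s, ?_⟩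
    by_cases c1 : s.reg 6 = s.reg a
    · by_cases c2 : s.reg 7 = s.reg b <;> simp [run, Test.holds, Expr.eval, skip, c1, c2]
    · simp [run, Test.holds, skip, c1]
  · simp only [touchAt, c, if_false, false_and]
    exact ⟨AgreeOff.setReg (by simp) _ _, by simp [skip, run]⟩

theorem nested_ite (a b c d : Prop) [Decidable a] [Decidable b] [Decidable c] [Decidable d]
    [Decidable (a ∨ b ∨ c ∨ d)] :
    (if d then 1 else if c then 1 else if b then 1 else if a then 1 else 0) =
      if a ∨ b ∨ c ∨ d then 1 else 0 := by
  by_cases ha : a <;> by_cases hb : b <;> by_cases hc : c <;> by_cases hd : d <;>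
    simp [ha, hb, hc, hd]

theorem isPattern_cross (e e' : Fin 4 × Fin 4) :
    IsPattern G (idx e.1 e.2) (idx e'.1 e'.2) (crossPattern e e')
      (fun i j L L' => ∃ z, IsEndOf e i L z ∧ IsEndOf e' j L' z) (fun _ _ _ _ => False) := by
  have key : ∀ s : Memory, AgreeOff {2, 3, 4, 8, 9, 14, 15} ∅ s ((crossPattern e e').run G s) ∧
      (((crossPattern e e').run G s).reg 14 = if
        (e.1 = e'.1 ∧ s.reg 6 = 0 ∧ s.reg 7 = 0) ∨
        (e.1 = e'.2 ∧ s.reg 6 = 0 ∧ s.reg 7 = s.reg (60 + idx e'.1 e'.2) - 1) ∨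
        (e.2 = e'.1 ∧ s.reg 6 = s.reg (60 + idx e.1 e.2) - 1 ∧ s.reg 7 = 0) ∨
        (e.2 = e'.2 ∧ s.reg 6 = s.reg (60 + idx e.1 e.2) - 1 ∧
          s.reg 7 = s.reg (60 + idx e'.1 e'.2) - 1) then 1 else 0) ∧
      ((crossPattern e e').run G s).reg 15 = 0 := by
    intro s
    set s₁ := (LoopProg.seq (.set 14 (.const 0)) <| .seq (.set 15 (.const 0)) <|
      .seq (.set 2 (.const 0)) <| .seq (.set 8 (.pred (60 + idx e.1 e.2)))
        (.set 9 (.pred (60 + idx e'.1 e'.2)))).run G s with hs₁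
    have hk : ∀ k j : ℕ, j < 60 → 60 + k ≠ j := by omega
    have a1 : AgreeOff {2, 3, 4, 8, 9, 14, 15} ∅ s s₁ :=
      AgreeOff.run (by simp [regs]) (by simp [arrs]) s
    have v14 : s₁.reg 14 = 0 := by simp [hs₁, run, Expr.eval]
    have v15 : s₁.reg 15 = 0 := by simp [hs₁, run, Expr.eval]
    have v2 : s₁.reg 2 = 0 := by simp [hs₁, run, Expr.eval]
    have v8 : s₁.reg 8 = s.reg (60 + idx e.1 e.2) - 1 := by simp [hs₁, run, Expr.eval, hk]
    have v9 : s₁.reg 9 = s.reg (60 + idx e'.1 e'.2) - 1 := by simp [hs₁, run, Expr.eval, hk]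
    have v6 : s₁.reg 6 = s.reg 6 := a1.1 6 (by simp)
    have v7 : s₁.reg 7 = s.reg 7 := a1.1 7 (by simp)
    have hrun : (crossPattern e e').run G s = (touchAt e.2 e'.2 8 9).run G
      ((touchAt e.2 e'.1 8 2).run G ((touchAt e.1 e'.2 2 9).run G
        ((touchAt e.1 e'.1 2 2).run G s₁))) := rfl
    obtain ⟨b1, c1⟩ := run_touchAt (G := G) e.1 e'.1 2 2 s₁
    set s₂ := (touchAt e.1 e'.1 2 2).run G s₁
    obtain ⟨b2, c2⟩ := run_touchAt (G := G) e.1 e'.2 2 9 s₂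
    set s₃ := (touchAt e.1 e'.2 2 9).run G s₂
    obtain ⟨b3, c3⟩ := run_touchAt (G := G) e.2 e'.1 8 2 s₃
    set s₄ := (touchAt e.2 e'.1 8 2).run G s₃
    obtain ⟨b4, c4⟩ := run_touchAt (G := G) e.2 e'.2 8 9 s₄
    set s₅ := (touchAt e.2 e'.2 8 9).run G s₄
    have hb2 := b1.trans b2
    have hb3 := hb2.trans b3
    have hb4 := hb3.trans b4
    rw [hrun]
    refine ⟨a1.trans (hb4.mono (by intro y; simp; tauto) subset_rfl), ?_, ?_⟩
    · rw [c4, c3, c2, c1, hb3.1 6 (by simp), hb3.1 7 (by simp), hb3.1 8 (by simp),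
        hb3.1 9 (by simp), hb2.1 6 (by simp), hb2.1 7 (by simp), hb2.1 8 (by simp),
        hb2.1 2 (by simp), b1.1 6 (by simp), b1.1 7 (by simp), b1.1 9 (by simp), b1.1 2 (by simp),
        v14, v2, v6, v7, v8, v9]
      exact nested_ite _ _ _ _
    · rw [hb4.1 15 (by simp), v15]
  refine ⟨fun s => (key s).1, fun s => ?_, fun s h h' => ?_, fun s => ?_⟩
  · rw [(key s).2.1, (key s).2.2]
    split_ifs <;> simp
  · rw [(key s).2.1, ite_eq_left_iff]
    -- The machine computes a truncated predecessor of the length, which is the last position only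
    -- if the rung is nonempty.
    have h1 : ∀ i L, 1 ≤ L → (i + 1 = L ↔ i = L - 1) := by intros; omega
    simp only [IsEndOf, h1 _ _ h, h1 _ _ h', zero_ne_one, imp_false, not_not]
    constructor
    · rintro (⟨g1, g2, g3⟩ | ⟨g1, g2, g3⟩ | ⟨g1, g2, g3⟩ | ⟨g1, g2, g3⟩)
      · exact ⟨e.1, Or.inl ⟨rfl, g2⟩, Or.inl ⟨g1, g3⟩⟩
      · exact ⟨e.1, Or.inl ⟨rfl, g2⟩, Or.inr ⟨g1, g3⟩⟩
      · exact ⟨e.2, Or.inr ⟨rfl, g2⟩, Or.inl ⟨g1, g3⟩⟩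
      · exact ⟨e.2, Or.inr ⟨rfl, g2⟩, Or.inr ⟨g1, g3⟩⟩
    · rintro ⟨z, ⟨rfl, g2⟩ | ⟨rfl, g2⟩, ⟨g3, g4⟩ | ⟨g3, g4⟩⟩
      · exact Or.inl ⟨g3, g2, g4⟩
      · exact Or.inr (Or.inl ⟨g3, g2, g4⟩)
      · exact Or.inr (Or.inr (Or.inl ⟨g3, g2, g4⟩))
      · exact Or.inr (Or.inr (Or.inr ⟨g3, g2, g4⟩))
  · rw [(key s).2.2]; simp

end LoopProg

end Checks

end LGK4

/-! ### Testing one choice of corners and middle vertices, and writing the answer. -/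

namespace LGK4

open RAM

section Candidate

variable {n : ℕ} {G : SimpleGraph (Fin n)}

/-- The condition for adjacency of the vertices at the positions `i` and `j` of two rungs. -/
def RungAdj (e e' : Fin 4 × Fin 4) (i j L L' : ℕ) : Prop :=
  if e = e' then i + 1 = j ∨ j + 1 = i else ∃ z, IsEndOf e i L z ∧ IsEndOf e' j L' z

/-- The rungs that are read from the tables make up the line graph of a proper subdivision. -/
structure IsCandidate (G : SimpleGraph (Fin n)) (s : Memory) : Prop where
  reached : ∀ e ∈ rungList, IsReached n s e.1 e.2
  fits : ∀ e ∈ rungList, ∀ e' ∈ rungList, ∀ i < tableLen s e.1 e.2, ∀ j < tableLen s e'.1 e'.2,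
    (adjEntry G (tableRung s e.1 e.2 i) (tableRung s e'.1 e'.2 j) = 1 ↔
      RungAdj e e' i j (tableLen s e.1 e.2) (tableLen s e'.1 e'.2)) ∧
    (tableRung s e.1 e.2 i = tableRung s e'.1 e'.2 j ↔ e = e' ∧ i = j)
  proper : ∃ e ∈ rungList, 1 < tableLen s e.1 e.2

theorem IsCandidate.agree {s s' : Memory} (hs : IsCandidate G s)
    (h : AgreeOff workRegs workArrs s s') : IsCandidate G s' where
  reached e he := (h.isReached_iff _ _).mpr (hs.reached e he)
  fits e he e' he' := by
    simp only [h.tableLen_eq, h.tableRung_eq]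
    exact hs.fits e he e' he'
  proper := by
    simp only [h.tableLen_eq]
    exact hs.proper

theorem tempRegs_subset : tempRegs ⊆ workRegs := fun _ hy => Or.inl hy.2

namespace LoopProg

/-- Copy all rungs of the list from the tables. -/
def buildAll (l : List (Fin 4 × Fin 4)) : LoopProg :=
  seqList (l.map fun e => build (idx e.1 e.2) (idx e.2 e.1))

theorem agree_build (x y : Fin 4) (k' : ℕ) (s : Memory) :
    AgreeOff workRegs workArrs s ((build (idx x y) k').run G s) :=
  AgreeOff.run (by simp [regs_build, workRegs]) (by simp [arrs_build, workArrs]) s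

/-- Each rung has an array and a length register of its own. The clause about pairs outside of `l`
says that finished rungs are not spoiled, which carries the induction. -/
theorem run_buildAll {l : List (Fin 4 × Fin 4)} (hl : ∀ e ∈ l, e.1 ≠ e.2) {s : Memory}
    (hT : TablesCorrect G s) (hm : ∀ e ∈ l, s.reg (40 + idx e.1 e.2) < n) :
    AgreeOff workRegs workArrs s ((buildAll l).run G s) ∧
    (∀ e ∉ l, IsBuilt s e.1 e.2 → IsBuilt ((buildAll l).run G s) e.1 e.2) ∧
    (((buildAll l).run G s).reg 5 = 0 ↔ s.reg 5 = 0 ∧ ∀ e ∈ l, IsReached n s e.1 e.2) ∧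
    ∀ e ∈ l, IsReached n s e.1 e.2 → IsBuilt ((buildAll l).run G s) e.1 e.2 := by
  induction l generalizing s with
  | nil =>
    have h : AgreeOff {4} ∅ s ((buildAll []).run G s) := AgreeOff.setReg (by simp) _ _
    have h' : AgreeOff workRegs workArrs s ((buildAll []).run G s) :=
      h.mono (by simp [workRegs]) (by simp)
    refine ⟨h', fun e _ he => ⟨?_, fun i hi => ?_⟩, ?_, by simp⟩
    · rw [h.1 _ (by simp; omega), h'.tableLen_eq]; exact he.1
    · rw [h'.tableLen_eq] at hi
      rw [h.2 _ (by simp), h'.tableRung_eq]; exact he.2 i hi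
    · rw [h.1 5 (by simp)]; simp
  | cons e l ih =>
    have h1 := agree_build (G := G) e.1 e.2 (idx e.2 e.1) s
    obtain ⟨h2, h3⟩ := run_build (hl e List.mem_cons_self) hT (hm e List.mem_cons_self)
    obtain ⟨h4, h5, h6, h7⟩ := ih (fun e he => hl e (List.mem_cons_of_mem _ he)) (hT.agree h1)
      (fun e' he' => by rw [h1.mid_eq]; exact hm e' (List.mem_cons_of_mem _ he'))
    have hrun : (buildAll (e :: l)).run G s =
      (buildAll l).run G ((build (idx e.1 e.2) (idx e.2 e.1)).run G s) := rfl
    rw [hrun]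
    refine ⟨h1.trans h4, fun e' he' hb => h5 e' (fun h => he' (List.mem_cons_of_mem _ h)) ?_, ?_,
      fun e' he' hr => ?_⟩
    · have hne : idx e'.1 e'.2 ≠ idx e.1 e.2 := by
        rw [Ne, idx_inj]
        intro h
        exact he' (List.mem_cons.mpr (Or.inl (Prod.ext h.1 h.2)))
      have := idx_lt e'.1 e'.2
      refine ⟨?_, fun i hi => ?_⟩
      · rw [run_reg (by rw [regs_build]; simp; omega), h1.tableLen_eq]
        exact hb.1
      · rw [h1.tableLen_eq] at hi
        rw [run_arr (by rw [arrs_build]; simp; omega), h1.tableRung_eq]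
        exact hb.2 i hi
    · simp only [h6, h2, h1.isReached_iff, List.forall_mem_cons, and_assoc]
    · by_cases hel : e' ∈ l
      · exact h7 e' hel ((h1.isReached_iff _ _).mpr hr)
      · rcases List.mem_cons.mp he' with rfl | h
        · exact h5 e' hel (h3 hr)
        · exact absurd h hel

/-- The pattern of two rungs. -/
def pattern (e e' : Fin 4 × Fin 4) : LoopProg :=
  if e = e' then samePattern else crossPattern e e'

theorem isPattern_pattern (e e' : Fin 4 × Fin 4) :
    IsPattern G (idx e.1 e.2) (idx e'.1 e'.2) (pattern e e') (RungAdj e e')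
      (fun i j _ _ => e = e' ∧ i = j) := by
  by_cases h : e = e'
  · subst h
    have : RungAdj e e = fun i j _ _ => i + 1 = j ∨ j + 1 = i := by
      funext i j L L'; simp [RungAdj]
    simp only [pattern, if_true, this, true_and]
    exact isPattern_same _
  · have : RungAdj e e' = fun i j L L' => ∃ z, IsEndOf e i L z ∧ IsEndOf e' j L' z := by
      funext i j L L'; simp [RungAdj, h]
    simp only [pattern, this, h, false_and]
    exact isPattern_cross e e'

/-- Test all pairs of rungs. -/
def checkAll : LoopProg :=
  seqList ((rungList.product rungList).map fun a =>
    pairCheck (idx a.1.1 a.1.2) (idx a.2.1 a.2.2) (pattern a.1 a.2))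

theorem isCheck_checkAll : IsCheck G checkAll fun s => ∀ a ∈ rungList.product rungList,
    ∀ i < n, ∀ j < n, Fits G (idx a.1.1 a.1.2) (idx a.2.1 a.2.2) (RungAdj a.1 a.2)
      (fun i j _ _ => a.1 = a.2 ∧ i = j) s i j :=
  isCheck_seqList (fun a _ => isCheck_pairCheck (isPattern_pattern a.1 a.2)) fun a s s' h => by
    simp only [h.fits_iff]

/-- Search for a rung with at least two vertices. -/
def longRung (l : List (Fin 4 × Fin 4)) : LoopProg :=
  l.foldr (fun e p => .ite (.lt 3 (60 + idx e.1 e.2)) skip p) fail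

/-- Test whether some rung has at least two vertices. -/
def properCheck : LoopProg := .seq (.set 3 (.const 1)) (longRung rungList)

theorem run_longRung (l : List (Fin 4 × Fin 4)) (s : Memory) :
    AgreeOff tempRegs ∅ s ((longRung l).run G s) ∧ (((longRung l).run G s).reg 5 = 0 ↔
      s.reg 5 = 0 ∧ ∃ e ∈ l, s.reg 3 < s.reg (60 + idx e.1 e.2)) := by
  induction l with
  | nil => exact ⟨AgreeOff.setReg (by simp [tempRegs]) _ _, by simp [longRung, fail, run, Expr.eval]⟩
  | cons e l ih =>
    have hrun : (longRung (e :: l)).run G s =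
      if (Test.lt 3 (60 + idx e.1 e.2)).holds s then skip.run G s else (longRung l).run G s := rfl
    by_cases c : s.reg 3 < s.reg (60 + idx e.1 e.2)
    · rw [hrun, if_pos (by simp [Test.holds, c])]
      exact ⟨AgreeOff.setReg (by simp [tempRegs]) _ _, by simp [skip, run, c]⟩
    · rw [hrun, if_neg (by simp [Test.holds]; omega)]
      exact ⟨ih.1, by simp [ih.2, c]⟩

theorem isCheck_properCheck :
    IsCheck G properCheck fun s => ∃ e ∈ rungList, 1 < s.reg (60 + idx e.1 e.2) := by
  intro s
  have h1 : AgreeOff tempRegs ∅ s (setReg s 3 1) := AgreeOff.setReg (by simp [tempRegs]) _ _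
  obtain ⟨h2, h3⟩ := run_longRung (G := G) rungList (setReg s 3 1)
  have h4 : ∀ k, (setReg s 3 1).reg (60 + k) = s.reg (60 + k) := fun k => by
    rw [setReg_reg, if_neg (by omega)]
  simp only [h4] at h3
  exact ⟨h1.trans h2, h3⟩

/-- Build the rungs for the chosen middle vertices, and test them. -/
def choose : LoopProg :=
  .seq (.set 5 (.const 0)) <| .seq (buildAll rungList) <| .seq checkAll properCheck

/-- The arrays are meaningful only if all middle vertices were reached; otherwise building has
already set register 5, and no check clears it. -/
theorem run_choose {s : Memory} (hT : TablesCorrect G s)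
    (hm : ∀ e ∈ rungList, s.reg (40 + idx e.1 e.2) < n) :
    AgreeOff workRegs workArrs s (choose.run G s) ∧
    ((choose.run G s).reg 5 = 0 ↔ IsCandidate G s) ∧
    (IsCandidate G s → ∀ e ∈ rungList, IsBuilt (choose.run G s) e.1 e.2) := by
  have h0 : AgreeOff {5} ∅ s (setReg s 5 0) := AgreeOff.setReg (by simp) _ _
  have h0' : AgreeOff workRegs workArrs s (setReg s 5 0) := h0.mono (by simp [workRegs]) (by simp)
  obtain ⟨b1, -, b2, b3⟩ := run_buildAll (G := G) (l := rungList) (s := setReg s 5 0)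
    (fun e he => ((mem_rungList e).mp he).ne) (hT.agree h0')
    (fun e he => by rw [h0'.mid_eq]; exact hm e he)
  set s₁ := (buildAll rungList).run G (setReg s 5 0) with hs₁
  obtain ⟨c1, c2⟩ := isCheck_checkAll (G := G) s₁
  set s₂ := checkAll.run G s₁ with hs₂
  obtain ⟨d1, d2⟩ := isCheck_properCheck (G := G) s₂
  have hrun : choose.run G s = properCheck.run G s₂ := rfl
  rw [hrun]
  have hag1 := h0'.trans b1
  have hag := hag1.trans ((c1.trans d1).mono tempRegs_subset (by simp))
  have r5 : (setReg s 5 0).reg 5 = 0 := by simp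
  have hlen2 : ∀ e : Fin 4 × Fin 4, s₂.reg (60 + idx e.1 e.2) = s₁.reg (60 + idx e.1 e.2) :=
    fun e => c1.1 _ (by simp [tempRegs]; omega)
  have hbuilt : (∀ e ∈ rungList, IsReached n s e.1 e.2) → ∀ e ∈ rungList,
      s₁.reg (60 + idx e.1 e.2) = tableLen s e.1 e.2 ∧
      ∀ i < tableLen s e.1 e.2, s₁.arr (80 + idx e.1 e.2) i = tableRung s e.1 e.2 i := by
    intro h e he
    have h3 := b3 e he ((h0'.isReached_iff _ _).mpr (h e he))
    simp only [IsBuilt, hag1.tableLen_eq, hag1.tableRung_eq] at h3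
    exact h3
  have b2' : s₁.reg 5 = 0 ↔ ∀ e ∈ rungList, IsReached n s e.1 e.2 := by
    rw [b2]
    simp only [r5, true_and, h0'.isReached_iff]
  refine ⟨hag, ?_, fun hC e he => ?_⟩
  · rw [d2, c2, b2']
    constructor
    · rintro ⟨⟨h1, h2⟩, e, he, h3⟩
      refine ⟨h1, fun e he e' he' i hi j hj => ?_, e, he, ?_⟩
      · obtain ⟨l1, p1⟩ := hbuilt h1 e he
        obtain ⟨l2, p2⟩ := hbuilt h1 e' he'
        have := h2 (e, e') (List.pair_mem_product.mpr ⟨he, he'⟩) i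
          (hi.trans_le (h1 e he).2.2) j (hj.trans_le (h1 e' he').2.2)
        simp only [Fits, l1, l2] at this
        have := this hi hj
        rwa [p1 i hi, p2 j hj] at this
      · rwa [hlen2, (hbuilt h1 e he).1] at h3
    · intro hC
      refine ⟨⟨hC.reached, ?_⟩, ?_⟩
      · rintro ⟨e, e'⟩ ha i _ j _
        obtain ⟨he, he'⟩ := List.pair_mem_product.mp ha
        obtain ⟨l1, p1⟩ := hbuilt hC.reached e he
        obtain ⟨l2, p2⟩ := hbuilt hC.reached e' he'
        simp only [Fits, l1, l2]
        intro hi hj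
        rw [p1 i hi, p2 j hj]
        exact hC.fits e he e' he' i hi j hj
      · obtain ⟨e, he, h⟩ := hC.proper
        exact ⟨e, he, by rwa [hlen2, (hbuilt hC.reached e he).1]⟩
  · obtain ⟨l1, p1⟩ := hbuilt hC.reached e he
    refine ⟨?_, fun i hi => ?_⟩
    · rw [hag.tableLen_eq, (c1.trans d1).1 _ (by simp [tempRegs]; omega), l1]
    · rw [hag.tableLen_eq] at hi
      rw [hag.tableRung_eq, (c1.trans d1).2 _ (by simp), p1 i hi]

/-- Mark the vertices of the rung `k` in array `0`. -/
def mark (k : ℕ) : LoopProg :=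
  .loop 6 <| .ite (.lt 6 (60 + k)) (.seq (.set 3 (.const 1)) <| .seq (.set 10 (.load (80 + k) 6))
    (.store 0 10 3)) skip

theorem run_mark_rung (k : ℕ) (s : Memory) :
    AgreeOff {3, 4, 6, 10} {0} s ((mark k).run G s) ∧ ∀ v, ((mark k).run G s).arr 0 v = 1 ↔
      s.arr 0 v = 1 ∨ ∃ i < n, i < s.reg (60 + k) ∧ s.arr (80 + k) i = v := by
  refine ⟨AgreeOff.run (by simp [mark, regs, skip]) (by simp [mark, arrs, skip]) s, ?_⟩
  refine (run_loop_inv (by simp [regs, skip]) (fun m s' => AgreeOff {3, 4, 6, 10} {0} s s' ∧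
    ∀ v, s'.arr 0 v = 1 ↔ s.arr 0 v = 1 ∨ ∃ i < m, i < s.reg (60 + k) ∧ s.arr (80 + k) i = v)
    ⟨AgreeOff.setReg (by simp) _ _, by simp⟩ ?_).2
  rintro m hm s' h6 ⟨h1, h2⟩
  have h3 : s'.reg (60 + k) = s.reg (60 + k) := h1.1 _ (by simp; omega)
  have h4 : s'.arr (80 + k) = s.arr (80 + k) := h1.2 _ (by simp)
  refine ⟨(h1.trans (AgreeOff.run (by simp [regs, skip]) (by simp [arrs, skip]) s')).trans
    (AgreeOff.setReg (by simp) _ _), fun v => ?_⟩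
  simp only [Nat.lt_succ_iff_lt_or_eq, or_and_right, exists_or, exists_eq_left, ← or_assoc, ← h2]
  by_cases c : m < s.reg (60 + k)
  · simp only [run, Test.holds, h6, h3, c, decide_true, if_true, Expr.eval, setReg_arr, setReg_reg,
      setArr_arr, h4, true_and]
    simp only [show (3 : ℕ) ≠ 10 by omega, show (6 : ℕ) ≠ 3 by omega, if_false, eq_comm (a := v)]
    by_cases c' : s.arr (80 + k) m = v <;> simp [c']
  · simp [run, Test.holds, h6, h3, c, skip]

/-- Write the answer. -/
def output (l : List (Fin 4 × Fin 4)) : LoopProg :=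
  .seq (seqList (l.map fun e => mark (idx e.1 e.2))) (.set 0 (.const 1))

theorem run_mark_list (l : List (Fin 4 × Fin 4)) (s : Memory) (v : ℕ) :
    ((seqList (l.map fun e => mark (idx e.1 e.2))).run G s).arr 0 v = 1 ↔ s.arr 0 v = 1 ∨
      ∃ e ∈ l, ∃ i < n, i < s.reg (60 + idx e.1 e.2) ∧ s.arr (80 + idx e.1 e.2) i = v := by
  induction l generalizing s with
  | nil => simp [seqList, skip, run]
  | cons e l ih =>
    obtain ⟨h1, h2⟩ := run_mark_rung (G := G) (idx e.1 e.2) s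
    have h3 : ∀ k, ((mark (idx e.1 e.2)).run G s).reg (60 + k) = s.reg (60 + k) :=
      fun k => h1.1 _ (by simp; omega)
    have h4 : ∀ k, ((mark (idx e.1 e.2)).run G s).arr (80 + k) = s.arr (80 + k) :=
      fun k => h1.2 _ (by simp)
    rw [List.map_cons, run_seqList_cons, ih, h2]
    simp only [h3, h4, List.exists_mem_cons_iff, or_assoc]

/-- Try the chosen corners and middle vertices, unless an answer has been found. -/
def attempt : LoopProg :=
  .seq (.set 2 (.const 0)) <| .ite (.eq 0 2)
    (.seq choose <| .seq (.set 2 (.const 0)) (.ite (.eq 5 2) (output rungList) skip)) skip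

theorem regs_choose : 0 ∉ choose.regs := by decide +kernel

theorem arrs_choose : 0 ∉ choose.arrs := by decide +kernel

/-- Once register 0 holds 1, nothing is tried any more, so the answer is kept. Before that array 0
is zero, so the marks of a single candidate make up a characteristic vector. -/
theorem isSearch_attempt {Ans : (ℕ → ℕ) → Prop}
    (hAns : ∀ s A, TablesCorrect G s → (∀ e ∈ rungList, s.reg (40 + idx e.1 e.2) < n) →
      IsCandidate G s → (∀ v, A v = 1 ↔ ∃ e ∈ rungList, ∃ i < tableLen s e.1 e.2,
        tableRung s e.1 e.2 i = v) → Ans A) :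
    IsSearch G Ans (fun s => TablesCorrect G s ∧ ∀ e ∈ rungList, s.reg (40 + idx e.1 e.2) < n)
      attempt (IsCandidate G) := by
  rintro s ⟨hT, hm⟩
  have hrun : attempt.run G s = if (setReg s 2 0).reg 0 = (setReg s 2 0).reg 2 then
      (if (setReg (choose.run G (setReg s 2 0)) 2 0).reg 5 =
          (setReg (choose.run G (setReg s 2 0)) 2 0).reg 2 then
        (output rungList).run G (setReg (choose.run G (setReg s 2 0)) 2 0)
      else skip.run G (setReg (choose.run G (setReg s 2 0)) 2 0)) else skip.run G (setReg s 2 0) := by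
    simp [attempt, run, Test.holds, Expr.eval]
  have h0 : AgreeOff workRegs workArrs s (setReg s 2 0) := AgreeOff.setReg (by simp [workRegs]) _ _
  have hm' : ∀ e ∈ rungList, (setReg s 2 0).reg (40 + idx e.1 e.2) < n := fun e he => by
    rw [h0.mid_eq]; exact hm e he
  obtain ⟨h1, h2, h3⟩ := run_choose (hT.agree h0) hm'
  have hc0 : (choose.run G (setReg s 2 0)).reg 0 = s.reg 0 := by
    rw [run_reg regs_choose]; simp
  have ha0 : (choose.run G (setReg s 2 0)).arr 0 = s.arr 0 := by
    rw [run_arr arrs_choose]; simp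
  set s₁ := choose.run G (setReg s 2 0)
  simp only [setReg_reg, if_true, show (0 : ℕ) ≠ 2 by omega, show (5 : ℕ) ≠ 2 by omega,
    if_false] at hrun
  constructor
  · rintro ⟨g1, g2⟩
    rw [hrun, if_neg (by omega)]
    exact ⟨by simpa [skip, run] using g1, by simpa [skip, run] using g2⟩
  · rintro ⟨g1, g2⟩
    rw [hrun, if_pos g1]
    by_cases c : s₁.reg 5 = 0
    · rw [if_pos c]
      left
      have hC := h2.mp c
      refine ⟨by simp [output, run, Expr.eval], hAns (setReg s 2 0) _ (hT.agree h0) hm' hC fun v => ?_⟩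
      change ((seqList (rungList.map fun e => mark (idx e.1 e.2))).run G (setReg s₁ 2 0)).arr 0 v = 1 ↔ _
      rw [run_mark_list, setReg_arr, ha0, g2]
      simp only [zero_ne_one, false_or]
      refine exists_congr fun e => and_congr_right fun he => ?_
      obtain ⟨l1, p1⟩ := h3 hC e he
      rw [h1.tableLen_eq] at l1 p1
      rw [setReg_reg, if_neg (by omega), l1]
      have hle := (hC.reached e he).2.2
      constructor
      · rintro ⟨i, -, hi, rfl⟩
        exact ⟨i, hi, by rw [p1 i hi, h1.tableRung_eq]⟩
      · rintro ⟨i, hi, rfl⟩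
        exact ⟨i, by omega, hi, by rw [p1 i hi, h1.tableRung_eq]⟩
    · rw [if_neg c]
      right
      refine ⟨⟨?_, ?_⟩, fun hC => c (h2.mpr (hC.agree h0))⟩
      · simp [skip, run, hc0, g1]
      · simpa [skip, run, ha0] using g2

end LoopProg

end Candidate

end LGK4

/-! ### Soundness and completeness of the test. -/

namespace LGK4

open RAM

section Tuples

variable {n : ℕ} {G : SimpleGraph (Fin n)}

/-- The registers hold the tuple `t`, and the tables are the right ones. -/
structure Represents (G : SimpleGraph (Fin n)) (s : Memory) (t : Tuple18 (Fin n)) : Prop where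
  corner : ∀ d : K4.Dart, s.reg (20 + idx d.fst d.snd) = t.corner d
  mid : ∀ d : K4.Dart, d.fst < d.snd → s.reg (40 + idx d.fst d.snd) = t.mid d
  tables : TablesCorrect G s

variable {s : Memory} {t : Tuple18 (Fin n)}

theorem Represents.isTable (h : Represents G s t) (d : K4.Dart) :
    IsTable G (expandSet G (fun k => s.reg (20 + k)) d.fst d.snd) (t.corner d)
      (s.arr (20 + idx d.fst d.snd)) (s.arr (40 + idx d.fst d.snd)) := by
  rw [← h.corner]
  exact h.tables d.fst d.snd (dart_ne d)

theorem Represents.mem_admissibleSet (h : Represents G s t) (d : K4.Dart) (v : Fin n) :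
    v ∈ admissibleSet G t d ↔
      v = t.mid d ∨ (v : ℕ) ∈ expandSet G (fun k => s.reg (20 + k)) d.fst d.snd := by
  have h1 : ((v : ℕ) ∈ expandSet G (fun k => s.reg (20 + k)) d.fst d.snd) ↔
      v = t.corner d ∨ ∀ d', t.corner d' ≠ t.corner d → ¬ G.Adj v (t.corner d') := by
    simp only [expandSet, Set.mem_ofPred_eq, h.corner d, Fin.ext_iff]
    refine or_congr_right ⟨fun g d' hd' => ?_, fun g x y hxy hne => ?_⟩
    · have := g d'.fst d'.snd (dart_ne d')
      rw [h.corner d', Ne, ← adjEntry_fin] at *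
      exact this (fun h' => hd' (Fin.ext h'))
    · have := h.corner (dart hxy)
      change s.reg (20 + idx x y) = _ at this
      rw [this] at hne ⊢
      rw [Ne, adjEntry_fin]
      exact g _ fun h' => hne (congrArg Fin.val h')
  rw [h1, admissibleSet, Set.mem_ofPred_eq]
  tauto

/-- The path `P` is the one that is stored in the tables. -/
structure IsStored (s : Memory) (d : K4.Dart) (P : G.Walk (t.corner d) (t.mid d)) : Prop where
  shortest : IsShortestAdmissible t d P
  length : P.length + 1 = s.arr (20 + idx d.fst d.snd) (t.mid d)
  getVert : ∀ i ≤ P.length, (P.getVert i : ℕ) =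
    (s.arr (40 + idx d.fst d.snd))^[P.length - i] (t.mid d)

theorem Represents.exists_isStored (h : Represents G s t) (d : K4.Dart)
    (hd : s.arr (20 + idx d.fst d.snd) (t.mid d) ≠ 0) :
    ∃ P : G.Walk (t.corner d) (t.mid d), IsStored s d P := by
  obtain ⟨P, h1, h2, h3⟩ := (h.isTable d).exists_isShortestIn hd
  refine ⟨P, isShortestAdmissible_iff.mpr ?_, h1, h2⟩
  have : admissibleSet G t d = {v | v = t.mid d ∨
      (v : ℕ) ∈ expandSet G (fun k => s.reg (20 + k)) d.fst d.snd} :=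
    Set.ext fun v => h.mem_admissibleSet d v
  rwa [this]

theorem Represents.dist_ne_zero (h : Represents G s t) (d : K4.Dart)
    {P : G.Walk (t.corner d) (t.mid d)} (hP : IsShortestAdmissible t d P) :
    s.arr (20 + idx d.fst d.snd) (t.mid d) ≠ 0 :=
  ((h.isTable d).le_length P fun v hv =>
    (h.mem_admissibleSet d v).mp ((isShortestAdmissible_iff.mp hP).subset v hv)).1

theorem Represents.rung_eq (h : Represents G s t)
    {P : ∀ d : K4.Dart, G.Walk (t.corner d) (t.mid d)} (hP : ∀ d, IsStored s d (P d)) {x y : Fin 4}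
    (hxy : x < y) :
    tableLen s x y = (P (dart hxy.ne)).length + (P (dart hxy.ne')).length + 1 ∧
    (∀ i ≤ (P (dart hxy.ne)).length, tableRung s x y i = (P (dart hxy.ne)).getVert i) ∧
    ∀ i ≤ (P (dart hxy.ne')).length,
      tableRung s x y (tableLen s x y - 1 - i) = (P (dart hxy.ne')).getVert i := by
  have hm : s.reg (40 + idx x y) = t.mid (dart hxy.ne) := h.mid (dart hxy.ne) hxy
  have hm' : t.mid (dart hxy.ne') = t.mid (dart hxy.ne) := mid_symm t hxy.ne
  obtain ⟨-, l1, g1⟩ := hP (dart hxy.ne)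
  obtain ⟨-, l2, g2⟩ := hP (dart hxy.ne')
  have hm'' : ((t.mid (dart hxy.ne') : Fin n) : ℕ) = s.reg (40 + idx x y) := by rw [hm', hm]
  rw [hm''] at l2 g2
  rw [← hm] at l1 g1
  change _ = s.arr (20 + idx x y) _ at l1
  change _ = s.arr (20 + idx y x) _ at l2
  change ∀ i ≤ _, _ = (s.arr (40 + idx x y))^[_] _ at g1
  change ∀ i ≤ _, _ = (s.arr (40 + idx y x))^[_] _ at g2
  have a1 : halfLen s x y (s.reg (40 + idx x y)) = (P (dart hxy.ne)).length := by
    rw [halfLen, ← l1]; rfl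
  have a2 : halfLen s y x (s.reg (40 + idx x y)) = (P (dart hxy.ne')).length := by
    rw [halfLen, ← l2]; rfl
  have hL : tableLen s x y = (P (dart hxy.ne)).length + (P (dart hxy.ne')).length + 1 := by
    rw [tableLen, a1, a2]
  refine ⟨hL, fun i hi => ?_, fun i hi => ?_⟩
  · rw [tableRung, a1, if_pos hi, g1 i hi]
  · rw [hL, tableRung, a1, g2 i hi]
    by_cases c : i = (P (dart hxy.ne')).length
    · rw [if_pos (by omega), show (P (dart hxy.ne)).length - ((P (dart hxy.ne)).length +
        (P (dart hxy.ne')).length + 1 - 1 - i) = 0 by omega, c, Nat.sub_self]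
      rfl
    · rw [if_neg (by omega), show (P (dart hxy.ne)).length + (P (dart hxy.ne')).length + 1 - 1 - i -
        (P (dart hxy.ne)).length = (P (dart hxy.ne')).length - i by omega]

/-- What an answer has to satisfy. -/
def IsAnswer (G : SimpleGraph (Fin n)) (A : ℕ → ℕ) : Prop :=
  IsLGPSK4 G {v : Fin n | A v = 1} ∧
    ∃ (t : Tuple18 (Fin n)) (P : ∀ d : K4.Dart, G.Walk (t.corner d) (t.mid d)),
      (∀ d, IsShortestAdmissible t d (P d)) ∧
        {v : Fin n | A v = 1} = ⋃ d, {x | x ∈ (P d).support}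

/-- The conditions that have been tested are those of a half rung system, and the rungs consist of
the stored shortest paths. Neither minimality nor the absence of pyramids enters. -/
theorem Represents.isAnswer (h : Represents G s t) (hC : IsCandidate G s) {A : ℕ → ℕ}
    (hA : ∀ v, A v = 1 ↔ ∃ e ∈ rungList, ∃ i < tableLen s e.1 e.2, tableRung s e.1 e.2 i = v) :
    IsAnswer G A := by
  have hdist : ∀ d : K4.Dart, s.arr (20 + idx d.fst d.snd) (t.mid d) ≠ 0 := by
    intro d
    rcases lt_or_gt_of_ne (dart_ne d) with hd | hd
    · rw [← h.mid d hd]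
      exact (hC.reached _ ((mem_rungList (d.fst, d.snd)).mpr hd)).1
    · have h1 : t.mid d = t.mid (dart hd.ne) := mid_symm t hd.ne
      have h2 := h.mid (dart hd.ne) hd
      change s.reg (40 + idx d.snd d.fst) = _ at h2
      rw [h1, ← h2]
      exact (hC.reached _ ((mem_rungList (d.snd, d.fst)).mpr hd)).2.1
  choose P hP using fun d => h.exists_isStored d (hdist d)
  have hval : ∀ x y : Fin 4, x < y → ∀ i < tableLen s x y, ∃ v : Fin n, tableRung s x y i = v ∧
      ∃ d, v ∈ (P d).support := by
    intro x y hxy i hi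
    obtain ⟨h1, h2, h3⟩ := h.rung_eq hP hxy
    by_cases c : i ≤ (P (dart hxy.ne)).length
    · exact ⟨_, h2 i c, _, (P _).getVert_mem_support i⟩
    · have := h3 (tableLen s x y - 1 - i) (by omega)
      rw [show tableLen s x y - 1 - (tableLen s x y - 1 - i) = i by omega] at this
      exact ⟨_, this, _, (P _).getVert_mem_support _⟩
  have hpos : 0 < n := (t.corner (dart (show (0 : Fin 4) ≠ 1 by decide))).pos
  let g : Fin 4 → Fin 4 → ℕ → Fin n := fun x y i =>
    if hv : tableRung s x y i < n then ⟨_, hv⟩ else ⟨0, hpos⟩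
  have hg : ∀ x y : Fin 4, x < y → ∀ i < tableLen s x y, (g x y i : ℕ) = tableRung s x y i := by
    intro x y hxy i hi
    obtain ⟨v, hv, -⟩ := hval x y hxy i hi
    have : tableRung s x y i < n := by rw [hv]; exact v.2
    simp only [g, dif_pos this]
  have hfit : ∀ x y x' y' : Fin 4, x < y → x' < y' → ∀ i < tableLen s x y, ∀ j < tableLen s x' y',
      (G.Adj (g x y i) (g x' y' j) ↔
        RungAdj (x, y) (x', y') i j (tableLen s x y) (tableLen s x' y')) ∧
      (g x y i = g x' y' j ↔ (x, y) = (x', y') ∧ i = j) := by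
    intro x y x' y' hxy hxy' i hi j hj
    rw [← adjEntry_fin, Fin.ext_iff, hg x y hxy i hi, hg x' y' hxy' j hj]
    exact hC.fits _ ((mem_rungList (x, y)).mpr hxy) _ ((mem_rungList (x', y')).mpr hxy') i hi j hj
  have hH : IsHalfRungSystem G (tableLen s) g := by
    refine ⟨fun x y _ => Nat.le_add_left .., fun x y i j hxy hi hj he => ?_,
      fun x y i j hxy hi hj => ?_, fun x y x' y' i j hxy hxy' hlt hi hj => ?_, ?_⟩
    · exact ((hfit x y x y hxy hxy i hi j hj).2.mp he).2
    · rw [(hfit x y x y hxy hxy i hi j hj).1, RungAdj, if_pos rfl]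
    · have hne : (x, y) ≠ (x', y') := by
        rintro h'
        rw [Prod.mk.injEq] at h'
        omega
      obtain ⟨h1, h2⟩ := hfit x y x' y' hxy hxy' i hi j hj
      exact ⟨fun h' => hne (h2.mp h').1, by rw [h1, RungAdj, if_neg hne]; rfl⟩
    · obtain ⟨e, he, hl⟩ := hC.proper
      exact ⟨e.1, e.2, (mem_rungList e).mp he, hl⟩
  have hset : {v : Fin n | A v = 1} = {v | ∃ x y i, x < y ∧ i < tableLen s x y ∧ g x y i = v} := by
    ext v
    rw [Set.mem_ofPred_eq, hA]
    constructor
    · rintro ⟨⟨x, y⟩, he, i, hi, hv⟩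
      have hxy := (mem_rungList (x, y)).mp he
      exact ⟨x, y, i, hxy, hi, Fin.ext ((hg x y hxy i hi).trans hv)⟩
    · rintro ⟨x, y, i, hxy, hi, rfl⟩
      exact ⟨(x, y), (mem_rungList (x, y)).mpr hxy, i, hi, (hg x y hxy i hi).symm⟩
  refine ⟨?_, t, P, fun d => (hP d).shortest, ?_⟩
  · rw [hset, ← rungSet_orient]
    exact hH.isRungSystem.isLGPSK4
  · rw [hset]
    ext v
    rw [Set.mem_iUnion]
    constructor
    · rintro ⟨x, y, i, hxy, hi, rfl⟩
      obtain ⟨v, hv, d, hd⟩ := hval x y hxy i hi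
      have : g x y i = v := Fin.ext ((hg x y hxy i hi).trans hv)
      exact ⟨d, this ▸ hd⟩
    · rintro ⟨d, hd⟩
      obtain ⟨i, rfl, hi⟩ := Walk.mem_support_iff_exists_getVert.mp hd
      rcases lt_or_gt_of_ne (dart_ne d) with hlt | hlt
      · obtain ⟨h1, h2, -⟩ := h.rung_eq hP hlt
        rw [dart_fst_snd] at h1 h2
        have hi' : i < tableLen s d.fst d.snd := by omega
        exact ⟨d.fst, d.snd, i, hlt, hi', Fin.ext ((hg _ _ hlt i hi').trans (h2 i hi))⟩
      · obtain ⟨h1, -, h3⟩ := h.rung_eq hP hlt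
        rw [dart_fst_snd] at h1 h3
        have hi' : tableLen s d.snd d.fst - 1 - i < tableLen s d.snd d.fst := by omega
        exact ⟨d.snd, d.fst, _, hlt, hi', Fin.ext ((hg _ _ hlt _ hi').trans (h3 i hi))⟩

/-- Every candidate gives an answer. -/
theorem isAnswer_of_isCandidate (hT : TablesCorrect G s)
    (hm : ∀ e ∈ rungList, s.reg (40 + idx e.1 e.2) < n) (hC : IsCandidate G s) {A : ℕ → ℕ}
    (hA : ∀ v, A v = 1 ↔ ∃ e ∈ rungList, ∃ i < tableLen s e.1 e.2, tableRung s e.1 e.2 i = v) :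
    IsAnswer G A := by
  have hm' : ∀ x y : Fin 4, x < y → s.reg (40 + idx x y) < n := fun x y hxy =>
    hm (x, y) ((mem_rungList (x, y)).mpr hxy)
  -- The corner is the end of a chain of predecessors that starts at a reached vertex, so its
  -- register holds the number of a vertex.
  have key : ∀ x y : Fin 4, x ≠ y → ∀ m < n, s.arr (20 + idx x y) m ≠ 0 →
      s.reg (20 + idx x y) < n := by
    intro x y hxy m hm h0
    obtain ⟨D, hD⟩ := Nat.exists_eq_succ_of_ne_zero h0
    rw [← (hT x y hxy).chain_end hm hD]
    exact ((hT x y hxy).chain hm hD D le_rfl).1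
  have hc : ∀ x y : Fin 4, x ≠ y → s.reg (20 + idx x y) < n := by
    intro x y hxy
    rcases lt_or_gt_of_ne hxy with h | h
    · exact key x y hxy _ (hm' x y h) (hC.reached _ ((mem_rungList (x, y)).mpr h)).1
    · exact key x y hxy _ (hm' y x h) (hC.reached _ ((mem_rungList (y, x)).mpr h)).2.1
  have hpos : 0 < n := by
    have := hc 0 1 (by decide)
    omega
  let f : Fin 4 → Fin 4 → Fin n := fun x y =>
    if h : s.reg (40 + idx (min x y) (max x y)) < n then ⟨_, h⟩ else ⟨0, hpos⟩
  let t : Tuple18 (Fin n) :=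
    { corner := fun d => ⟨_, hc d.fst d.snd (dart_ne d)⟩
      middle := fun e => Sym2.lift ⟨f, fun x y => by simp only [f, min_comm x y, max_comm x y]⟩ e.1 }
  refine Represents.isAnswer (t := t) ⟨fun d => rfl, fun d hd => ?_, hT⟩ hC hA
  change _ = ((f d.fst d.snd : Fin n) : ℕ)
  have := hm' _ _ hd
  simp only [f, min_eq_left hd.le, max_eq_right hd.le, dif_pos this]

/-- If there is anything to be found, then there is a tuple for which it is found. -/
theorem exists_isCandidate (hG : ¬ ContainsPyramid G) {S : Set (Fin n)} (hS : IsLGPSK4 G S) :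
    ∃ t : Tuple18 (Fin n), ∀ s, Represents G s t → IsCandidate G s := by
  -- A smallest subgraph is taken, since the exchange of halves is available for those only.
  obtain ⟨S, ⟨⟨M⟩, hmin⟩⟩ : ∃ S, IsSmallestLGPSK4 G S := by
    obtain ⟨S, h1, h2⟩ := Set.exists_min_image {S | IsLGPSK4 G S} Set.ncard (Set.toFinite _) ⟨S, hS⟩
    exact ⟨S, h1, h2⟩
  obtain ⟨len, r, R, rfl, -⟩ := exists_isRungSystem M
  obtain ⟨t, α, F⟩ := R.exists_frame
  refine ⟨t, fun s h => ?_⟩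
  have hst : ∀ d : K4.Dart, ∃ P : G.Walk (t.corner d) (t.mid d), IsStored s d P := by
    intro d
    obtain ⟨p, hp⟩ := F.exists_isShortestAdmissible R (dart_ne d)
    exact h.exists_isStored d (h.dist_ne_zero d hp)
  choose P hP using hst
  -- Whichever shortest paths the tables happen to store, the exchange argument turns them into the
  -- rungs of a smallest subgraph, so all tests succeed.
  obtain ⟨hl, r', R', F', -, hr⟩ := F.replace_all hG R hmin fun d => (hP d).shortest
  have hlen : ∀ x y : Fin 4, x < y → tableLen s x y = len x y := by
    intro x y hxy
    rw [(h.rung_eq hP hxy).1, hl, hl]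
    exact F.add x y hxy.ne
  have hrung : ∀ x y : Fin 4, x < y → ∀ i < len x y, tableRung s x y i = r' x y i := by
    intro x y hxy i hi
    obtain ⟨-, h2, h3⟩ := h.rung_eq hP hxy
    rw [hl, hlen x y hxy] at h3
    rw [hl] at h2
    change ∀ i ≤ α x y, _ at h2
    change ∀ i ≤ α y x, _ at h3
    by_cases c : i ≤ α x y
    · rw [h2 i c]
      exact congrArg Fin.val (hr (dart hxy.ne) i c).symm
    · have hadd := F.add x y hxy.ne
      have hs := R'.len_symm x y
      have h4 := h3 (len x y - 1 - i) (by omega)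
      rw [show len x y - 1 - (len x y - 1 - i) = i by omega] at h4
      rw [h4, ← hr (dart hxy.ne') _ (show len x y - 1 - i ≤ α y x by omega)]
      change ((r' y x (len x y - 1 - i) : Fin n) : ℕ) = _
      rw [R'.rev x y _ hxy.ne (by omega)]
      congr 2; omega
  have hH := R'.isHalfRungSystem
  constructor
  · intro e he
    have hlt := (mem_rungList e).mp he
    have hm := h.mid (dart hlt.ne) hlt
    change s.reg (40 + idx e.1 e.2) = _ at hm
    refine ⟨?_, ?_, ?_⟩
    · rw [hm]
      exact h.dist_ne_zero _ (hP (dart hlt.ne)).shortest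
    · rw [hm, ← mid_symm t hlt.ne]
      exact h.dist_ne_zero _ (hP (dart hlt.ne')).shortest
    · rw [hlen _ _ hlt]
      -- The vertices of a rung are distinct, so the bound on the length does not reject it.
      have : Function.Injective fun i : Fin (len e.1 e.2) => r' e.1 e.2 i := fun i j hij =>
        Fin.ext (R'.inj e.1 e.2 i j hlt.ne i.2 j.2 hij)
      simpa using Fintype.card_le_of_injective _ this
  · intro e he e' he' i hi j hj
    have hlt := (mem_rungList e).mp he
    have hlt' := (mem_rungList e').mp he'
    rw [hlen _ _ hlt] at hi ⊢
    rw [hlen _ _ hlt'] at hj ⊢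
    rw [hrung _ _ hlt i hi, hrung _ _ hlt' j hj, adjEntry_fin, ← Fin.ext_iff]
    by_cases c : e = e'
    · subst c
      refine ⟨?_, fun h' => ⟨rfl, R'.inj _ _ _ _ hlt.ne hi hj h'⟩, fun h' => by rw [h'.2]⟩
      rw [RungAdj, if_pos rfl]
      exact R'.adj _ _ _ _ hlt.ne hi hj
    · obtain ⟨h1, h2⟩ := hH.cross' e.1 e.2 e'.1 e'.2 i j hlt hlt'
        (fun h' => c (Prod.ext h'.1 h'.2)) hi hj
      refine ⟨?_, fun h' => absurd h' h1, fun h' => absurd h'.1 c⟩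
      rw [RungAdj, if_neg c, h2]
      rfl
  · obtain ⟨x, y, hxy, h2⟩ := hH.proper
    exact ⟨(x, y), (mem_rungList (x, y)).mpr hxy, by rw [hlen x y hxy]; exact h2⟩

end Tuples

end LGK4

/-! ### The complete algorithm. -/

namespace LGK4

open RAM

section Algorithm

variable {n : ℕ} {G : SimpleGraph (Fin n)}

namespace LoopProg

/-- Compute the tables for the corners in the registers. -/
def prepare (l : List (Fin 4 × Fin 4)) : LoopProg :=
  seqList (l.map fun e => .seq (expand (idx e.1 e.2)) (distances (idx e.1 e.2)))

theorem regs_expand (x y : Fin 4) : ∀ k ∈ (expand (idx x y)).regs, k < 20 ∧ k ≠ 0 := by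
  revert x y
  decide +kernel

theorem arrs_expand (x y : Fin 4) : ∀ a ∈ (expand (idx x y)).arrs, a = 60 + idx x y := by
  revert x y
  decide +kernel

theorem regs_distances (k : ℕ) : (distances k).regs =
    [6, 2, 3, 7, 8, 9, 2, 3, 10, 11, 12, 13, 14, 12, 4, 4, 4, 4] := rfl

theorem arrs_distances (k : ℕ) : (distances k).arrs = [20 + k, 20 + k, 20 + k, 40 + k] := rfl

theorem run_prepare (l : List (Fin 4 × Fin 4)) (s : Memory) :
    AgreeOff {y | y < 20 ∧ y ≠ 0} {a | a ≠ 0} s ((prepare l).run G s) ∧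
    (∀ e ∉ l, ∀ a, a = 20 + idx e.1 e.2 ∨ a = 40 + idx e.1 e.2 →
      ((prepare l).run G s).arr a = s.arr a) ∧
    ∀ e ∈ l, IsTable G (expandSet G (fun k => s.reg (20 + k)) e.1 e.2) (s.reg (20 + idx e.1 e.2))
      (((prepare l).run G s).arr (20 + idx e.1 e.2)) (((prepare l).run G s).arr (40 + idx e.1 e.2)) := by
  induction l generalizing s with
  | nil =>
    have h : AgreeOff {4} ∅ s ((prepare []).run G s) := AgreeOff.setReg (by simp) _ _
    exact ⟨h.mono (by simp) (by simp), fun e _ a _ => h.2 a (by simp), by simp⟩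
  | cons e l ih =>
    have hk := idx_lt e.1 e.2
    set s₁ := (expand (idx e.1 e.2)).run G s with hs₁
    set s₂ := (distances (idx e.1 e.2)).run G s₁ with hs₂
    have hrun : (prepare (e :: l)).run G s = (prepare l).run G s₂ := rfl
    have h1 : AgreeOff {y | y < 20 ∧ y ≠ 0} {60 + idx e.1 e.2} s s₁ :=
      AgreeOff.run (regs_expand e.1 e.2) (arrs_expand e.1 e.2) s
    have h2 : AgreeOff {y | y < 20 ∧ y ≠ 0} {20 + idx e.1 e.2, 40 + idx e.1 e.2} s₁ s₂ :=
      AgreeOff.run (by simp [regs_distances]) (by simp [arrs_distances]) s₁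
    have h3 : AgreeOff {y | y < 20 ∧ y ≠ 0} {a | a ≠ 0} s s₂ :=
      (h1.mono subset_rfl (by simp)).trans (h2.mono subset_rfl (by
        intro a; simp only [Set.mem_insert_iff, Set.mem_singleton_iff, Set.mem_ofPred_eq]; omega))
    have hc : ∀ k, s₂.reg (20 + k) = s.reg (20 + k) := fun k => h3.1 _ (by simp)
    have hc1 : ∀ k, s₁.reg (20 + k) = s.reg (20 + k) := fun k => h1.1 _ (by simp)
    obtain ⟨h4, h5, h6⟩ := ih s₂
    rw [hrun]
    refine ⟨h3.trans h4, fun e' he' a ha => ?_, fun e' he' => ?_⟩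
    · have hne : idx e'.1 e'.2 ≠ idx e.1 e.2 := by
        rw [Ne, idx_inj]
        intro h
        exact he' (List.mem_cons.mpr (Or.inl (Prod.ext h.1 h.2)))
      have := idx_lt e'.1 e'.2
      rw [h5 e' (fun h => he' (List.mem_cons_of_mem _ h)) a ha, h2.2 a (by simp; omega),
        h1.2 a (by simp; omega)]
    · by_cases hel : e' ∈ l
      · have := h6 e' hel
        simp only [hc] at this
        exact this
      · rcases List.mem_cons.mp he' with rfl | h
        · rw [h5 e' hel _ (Or.inl rfl), h5 e' hel _ (Or.inr rfl)]
          have hT := isTable_distances (G := G) (idx e'.1 e'.2) s₁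
          rw [hc1] at hT
          exact hT.congr (run_expand e'.1 e'.2 s)
        · exact absurd h hel

/-- The registers for the corners. -/
def cornerRegs : List ℕ := dartList.map fun e => 20 + idx e.1 e.2

/-- The registers for the middle vertices. -/
def midRegs : List ℕ := rungList.map fun e => 40 + idx e.1 e.2

/-- Try all middle vertices for the given corners. -/
def trial : LoopProg := .seq (prepare dartList) (nest midRegs attempt)

/-- Try all corners. -/
def search : LoopProg := nest cornerRegs trial

end LoopProg

open LoopProg

/-- Given the corners in the registers, there are middle vertices such that every memory with
these vertices and correct tables holds a candidate. -/
def IsPromising (G : SimpleGraph (Fin n)) (s : Memory) : Prop :=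
  ∃ t : Tuple18 (Fin n), (∀ d : K4.Dart, s.reg (20 + idx d.fst d.snd) = t.corner d) ∧
    ∀ s', Represents G s' t → IsCandidate G s'

/-- It supplies the memories in which the registers hold the corners or the middle vertices of a
given tuple, as witnesses that a search can succeed. -/
theorem exists_setRegs (s : Memory) (b : ℕ) (p : K4.Dart → Prop) (f : K4.Dart → ℕ) :
    ∃ s' : Memory, s'.arr = s.arr ∧ (∀ d, p d → s'.reg (b + idx d.fst d.snd) = f d) ∧
      ∀ y, (∀ d, p d → y ≠ b + idx d.fst d.snd) → s'.reg y = s.reg y := by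
  classical
  refine ⟨⟨fun y => if h : ∃ d, p d ∧ y = b + idx d.fst d.snd then f h.choose else s.reg y, s.arr⟩,
    rfl, fun d hd => ?_, fun y hy => ?_⟩
  · have h : ∃ d', p d' ∧ b + idx d.fst d.snd = b + idx d'.fst d'.snd := ⟨d, hd, rfl⟩
    refine (dif_pos h).trans ?_
    have h1 := idx_inj.mp (Nat.add_left_cancel h.choose_spec.2)
    congr 1
    exact (Dart.ext _ _ (Prod.ext h1.1 h1.2)).symm
  · refine dif_neg ?_
    rintro ⟨d, hd, h⟩
    exact hy d hd h

theorem mem_midRegs {y : ℕ} : y ∈ midRegs ↔ ∃ d : K4.Dart, d.fst < d.snd ∧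
    y = 40 + idx d.fst d.snd := by
  simp only [midRegs, List.mem_map, mem_rungList]
  constructor
  · rintro ⟨e, he, rfl⟩
    exact ⟨dart he.ne, he, rfl⟩
  · rintro ⟨d, hd, rfl⟩
    exact ⟨(d.fst, d.snd), hd, rfl⟩

theorem mem_cornerRegs {y : ℕ} : y ∈ cornerRegs ↔ ∃ d : K4.Dart, y = 20 + idx d.fst d.snd := by
  simp only [cornerRegs, List.mem_map, mem_dartList]
  constructor
  · rintro ⟨e, he, rfl⟩
    exact ⟨dart he, rfl⟩
  · rintro ⟨d, rfl⟩
    exact ⟨(d.fst, d.snd), dart_ne d, rfl⟩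

/-- Tables depend on the corners only and lie outside of the memory written by the loops over the
middle vertices, so they stay correct throughout. -/
theorem isSearch_mids : IsSearch G (IsAnswer G) (TablesCorrect G) (nest midRegs attempt) fun s =>
    ∃ s', AgreeOff (workRegs ∪ {y | y ∈ midRegs}) workArrs s s' ∧ (∀ y ∈ midRegs, s'.reg y < n) ∧
      IsCandidate G s' := by
  refine IsSearch.nest (by decide +kernel) (by decide +kernel) ?_ ?_ ?_
    (fun s s' h hs => hs.agree h) (fun s s' h hs => ?_) fun s hs => ?_
  · have : ∀ x ∈ midRegs, ¬ (x < 20 ∨ 60 ≤ x) := by decide +kernel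
    exact this
  · have : ∀ x ∈ attempt.regs, x < 20 ∨ 60 ≤ x := by decide +kernel
    exact this
  · have : ∀ x ∈ attempt.arrs, x < 20 ∨ 80 ≤ x := by decide +kernel
    exact this
  · have hreg : ∀ x y : Fin 4, s'.reg (20 + idx x y) = s.reg (20 + idx x y) := fun x y => by
      have h0 := idx_lt x y
      refine h.1 _ ?_
      rintro (h' | h')
      · rcases h' with h' | h' <;> omega
      · obtain ⟨d, -, h'⟩ := mem_midRegs.mp h'
        omega
    have harr : ∀ a, 20 ≤ a → a < 80 → s'.arr a = s.arr a := fun a h1 h2 =>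
      h.2 a (by simp [workArrs]; omega)
    intro x y hxy
    have h0 := idx_lt x y
    rw [hreg, harr _ (by omega) (by omega), harr _ (by omega) (by omega),
      expandSet_congr (c' := fun k => s.reg (20 + k)) hreg]
    exact hs x y hxy
  · exact isSearch_attempt (fun s A h1 h2 h3 h4 => isAnswer_of_isCandidate h1 h2 h3 h4) s
      ⟨hs.1, fun e he => hs.2 _ (List.mem_map.mpr ⟨e, he, rfl⟩)⟩

theorem isSearch_trial : IsSearch G (IsAnswer G) (fun _ => True) trial (IsPromising G) := by
  intro s _
  obtain ⟨h1, -, h3⟩ := run_prepare (G := G) dartList s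
  have hc : ∀ k, ((prepare dartList).run G s).reg (20 + k) = s.reg (20 + k) :=
    fun k => h1.1 _ (by simp)
  have hT : TablesCorrect G ((prepare dartList).run G s) := by
    intro x y hxy
    simp only [hc]
    exact h3 (x, y) ((mem_dartList (x, y)).mpr hxy)
  have hrun : trial.run G s = (nest midRegs attempt).run G ((prepare dartList).run G s) := rfl
  have h0 : ((prepare dartList).run G s).reg 0 = s.reg 0 := h1.1 0 (by simp)
  have h0' : ((prepare dartList).run G s).arr 0 = s.arr 0 := h1.2 0 (by simp)
  obtain ⟨g1, g2⟩ := isSearch_mids ((prepare dartList).run G s) hT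
  rw [hrun]
  refine ⟨fun h => g1 (by rwa [Hit, h0, h0']), fun h => (g2 (by rwa [Fresh, h0, h0'])).imp_right
    fun g => ⟨g.1, ?_⟩⟩
  rintro ⟨t, ht, hC⟩
  -- The witness is the prepared memory with the middle vertices of `t` written into their
  -- registers; corners and tables are unaffected.
  obtain ⟨s', e1, e2, e3⟩ := exists_setRegs ((prepare dartList).run G s) 40
    (fun d => d.fst < d.snd) fun d => t.mid d
  have hcor : ∀ x y : Fin 4, s'.reg (20 + idx x y) = s.reg (20 + idx x y) := fun x y => by
    have h0 := idx_lt x y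
    rw [e3 _ fun d _ => by omega, hc]
  refine g.2 ⟨s', ⟨fun y hy => e3 y fun d hd hyd => hy (Or.inr (mem_midRegs.mpr ⟨d, hd, hyd⟩)),
    fun a _ => by rw [e1]⟩, fun y hy => ?_, hC s' ⟨fun d => ?_, e2, ?_⟩⟩
  · obtain ⟨d, hd, rfl⟩ := mem_midRegs.mp hy
    rw [e2 d hd]
    exact (t.mid d).2
  · rw [hcor, ht]
  · intro x y hxy
    have := hT x y hxy
    rw [hcor, e1, expandSet_congr (c' := fun k => s.reg (20 + k)) hcor]
    simpa only [hc] using this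

theorem isSearch_search : IsSearch G (IsAnswer G) (fun _ => True) search fun _ =>
    ∃ s, (∀ y ∈ cornerRegs, s.reg y < n) ∧ IsPromising G s := by
  have key := IsSearch.nest (G := G) (Ans := IsAnswer G) (l := cornerRegs) (p := trial)
    (W := {y | y < 20 ∨ 40 ≤ y}) (A := Set.univ) (Ψ := IsPromising G) (Pre := fun _ => True)
    (by decide +kernel) (by decide +kernel)
    (by
      have : ∀ x ∈ cornerRegs, ¬ (x < 20 ∨ 40 ≤ x) := by decide +kernel
      exact this)
    (by
      have : ∀ x ∈ trial.regs, x < 20 ∨ 40 ≤ x := by decide +kernel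
      exact this)
    (by simp)
    (fun s s' h ⟨t, ht, hC⟩ => ⟨t, fun d => by
      have := idx_lt d.fst d.snd
      rw [h.1 _ (by simp; omega), ht], hC⟩)
    (fun _ _ _ h => h) (fun s _ => isSearch_trial s trivial)
  intro s hs
  obtain ⟨h1, h2⟩ := key s hs
  refine ⟨h1, fun h => (h2 h).imp_right fun g => ⟨g.1, ?_⟩⟩
  rintro ⟨s₁, h3, t, ht, hC⟩
  obtain ⟨s', e1, e2, e3⟩ := exists_setRegs s 20 (fun _ => True) fun d => t.corner d
  refine g.2 ⟨s', ⟨fun y hy => e3 y fun d hd hyd => hy (Or.inr (mem_cornerRegs.mpr ⟨d, hyd⟩)),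
    fun a ha => absurd (Set.mem_univ a) ha⟩, fun y hy => ?_, t, fun d => e2 d trivial, hC⟩
  obtain ⟨d, rfl⟩ := mem_cornerRegs.mp hy
  rw [e2 d trivial]
  exact (t.corner d).2

theorem correctAnswer_search (hG : ¬ ContainsPyramid G) :
    CorrectAnswer G (search.run G (setReg ⟨fun _ => 0, fun _ _ => 0⟩ 1 n)) := by
  rcases (isSearch_search (G := G) (setReg ⟨fun _ => 0, fun _ _ => 0⟩ 1 n) trivial).2
    ⟨by simp, by simp⟩ with ⟨h1, h2, h3⟩ | ⟨h1, h2⟩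
  · exact Or.inl ⟨h1, h2, h3⟩
  · refine Or.inr ⟨h1.1, fun S hS => h2 ?_⟩
    obtain ⟨t, ht⟩ := exists_isCandidate hG hS
    obtain ⟨s', -, e2, -⟩ := exists_setRegs ⟨fun _ => 0, fun _ _ => 0⟩ 20 (fun _ => True)
      fun d => t.corner d
    refine ⟨s', fun y hy => ?_, t, fun d => e2 d trivial, ht⟩
    obtain ⟨d, rfl⟩ := mem_cornerRegs.mp hy
    rw [e2 d trivial]
    exact (t.corner d).2

/-- The algorithm for detecting line graphs of proper subdivisions of `K4`. -/
theorem exists_algorithm : ∃ (p : RAM.Prog) (C : ℕ), ∀ (n : ℕ) (G : SimpleGraph (Fin n)),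
    ¬ ContainsPyramid G → ∃ s : RAM.Memory,
      RAM.HaltsWithin G p (C * n ^ 20 + C) s ∧ RAM.CorrectAnswer G s := by
  -- The depth is 12 for the corners, plus 6 for the middle vertices and 2 for the pairs of
  -- positions. The tables need depth 3 below the corners only.
  obtain ⟨p, C, h⟩ := exists_haltsWithin (p := search) (by decide +kernel) (by decide +kernel)
    (by decide +kernel)
  exact ⟨p, C, fun n G hG => ⟨_, h n G, correctAnswer_search hG⟩⟩

end Algorithm

end LGK4

theorem mainTheorem5 :
    -- replacing half of a rung by a shortest path
    (∀ {V : Type*} [Finite V] (G : SimpleGraph V), ¬ ContainsPyramid G →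
      ∀ (S : Set V), IsSmallestLGPSK4 G S →
      ∀ (M : LineGraphModel G S) (t : Tuple18 V), M.IsFrame t →
      ∀ (d : K4.Dart) (P : G.Walk (t.corner d) (t.mid d)), IsShortestAdmissible t d P →
        IsSmallestLGPSK4 G ((S \ M.initialSegment d (t.mid d)) ∪ {x | x ∈ P.support})) ∧
    -- the method: from a frame of a smallest subgraph, twelve shortest paths exist, and any
    -- twelve of them rebuild a smallest subgraph
    (∀ {V : Type*} [Finite V] (G : SimpleGraph V), ¬ ContainsPyramid G →
      ∀ (S : Set V), IsSmallestLGPSK4 G S →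
      ∀ (M : LineGraphModel G S) (t : Tuple18 V), M.IsFrame t →
        (∀ d : K4.Dart, ∃ P : G.Walk (t.corner d) (t.mid d), IsShortestAdmissible t d P) ∧
        ∀ P : ∀ d : K4.Dart, G.Walk (t.corner d) (t.mid d),
          (∀ d, IsShortestAdmissible t d (P d)) →
          IsSmallestLGPSK4 G (⋃ d, {x | x ∈ (P d).support})) ∧
    -- the running time
    (∃ (p : RAM.Prog) (C : ℕ), ∀ (n : ℕ) (G : SimpleGraph (Fin n)), ¬ ContainsPyramid G →
      ∃ s : RAM.Memory, RAM.HaltsWithin G p (C * n ^ 20 + C) s ∧ RAM.CorrectAnswer G s) := by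
  exact ⟨fun G hG S hS M t ht d P hP => LGK4.isSmallest_replace_half hG hS M ht d P hP,
    fun G hG S hS M t ht => LGK4.isSmallest_iUnion hG hS M ht, LGK4.exists_algorithm⟩
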